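/- Let $X$ be a complex manifold (Hausdorff, second countable) of complex dimension $n$ with a Kähler metric $\omega$, and let $(L,h)$ be a $C^\infty$ Hermitian complex line bundle on $X$ with a $C^\infty$ Hermitian connection $D=\partial_D+\bar\partial_D$, split into its parts of type $(1,0)$ and $(0,1)$; it is not assumed that $\bar\partial_D^2=0$. Let $\Theta(D)$ be the curvature form, $D^2=\Theta(D)\wedge\cdot$. Let $\Lambda$ be the pointwise adjoint of $\omega\wedge\cdot$, let $\langle\langle\cdot,\cdot\rangle\rangle$ be the $L^2$ inner product of $L$-valued forms given by $\omega$ and $h$, and let $^\star$ denote the formal adjoint of a differential operator with respect to $\langle\langle\cdot,\cdot\rangle\rangle$ (the pointwise adjoint for an operator of order zero). For a $C^\infty$ function $\eta:X\to(0,+\infty)$ put $$\Delta''_{(\eta)}=\big(\bar\partial_D\sqrt\eta\big)\big(\bar\partial_D\sqrt\eta\big)^\star+\big(\sqrt\eta\,\bar\partial_D\big)^\star\big(\sqrt\eta\,\bar\partial_D\big),\qquad \Delta'_{(\eta)}=\big(\partial_D\sqrt\eta\big)\big(\partial_D\sqrt\eta\big)^\star+\big(\sqrt\eta\,\partial_D\big)^\star\big(\sqrt\eta\,\partial_D\big),$$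 where $\sqrt\eta$ stands for multiplication by this function. 1. For every $C^\infty$ function $\eta:X\to(0,+\infty)$ the formal adjoints of $\bar\partial_D$, $\bar\partial_D\sqrt\eta$, $\sqrt\eta\,\bar\partial_D$, $\partial_D\sqrt\eta$ and $\sqrt\eta\,\partial_D$ exist as operators on smooth $L$-valued forms, and for every $q\ge0$ and every smooth $L$-valued $(n,q)$-form $v$, $$\Delta''_{(\eta)}v=\Delta'_{(\eta)}v+\big[\eta\,i\Theta(D)^{1,1}-i\partial\bar\partial\eta,\ \Lambda\big]v+\bar\partial\eta\wedge\bar\partial_D^\star v+\bar\partial_D\big((\bar\partial\eta\wedge\cdot)^\star v\big).$$ 2. For all $C^\infty$ functions $\eta,\lambda:X\to(0,+\infty)$, every $q\ge0$ and every compactly supported smooth $L$-valued $(n,q)$-form $v$, the two $L^2$ products below are given by convergent integrals, are real, and satisfy $$\big\langle\big\langle\Delta''_{(\eta+\lambda)}v,v\big\rangle\big\rangle\ \ge\ \Big\langle\Big\langle\Big[\eta\,i\Theta(D)^{1,1}-i\partial\bar\partial\eta-\tfrac1\lambda\,i\partial\eta\wedge\bar\partial\eta,\ \Lambda\Big]v,v\Big\rangle\Big\rangle.$$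 -/

import Mathlib

open scoped Manifold ContDiff Bundle
open MeasureTheory

namespace TwistedBKN

/-! ### Real structures underlying complex ones -/

section Instances

variable {E : Type*} [NormedAddCommGroup E] [NormedSpace ℂ E]
  {X : Type*} [TopologicalSpace X]

/-- A complex manifold is in particular a smooth real manifold. -/
instance isManifold_real [ChartedSpace E X] [IsManifold 𝓘(ℂ, E) ω X] :
    IsManifold 𝓘(ℝ, E) ∞ X := by
  refine isManifold_of_contDiffOn 𝓘(ℝ, E) ∞ X fun e e' he he' => ?_
  have h := (contDiffGroupoid ω 𝓘(ℂ, E)).compatible he he'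
  rw [contDiffGroupoid, mem_groupoid_of_pregroupoid] at h
  have h1 : ContDiffOn ℂ ω (e.symm ≫ₕ e') (e.symm ≫ₕ e').source := by
    simpa [contDiffPregroupoid] using h.1
  simpa using (h1.restrict_scalars ℝ).of_le le_top

/-- A complex vector bundle is in particular a real vector bundle. -/
instance vectorBundle_real {L : X → Type*} [∀ x, NormedAddCommGroup (L x)]
    [∀ x, InnerProductSpace ℂ (L x)] [TopologicalSpace (Bundle.TotalSpace ℂ L)]
    [FiberBundle ℂ L] [VectorBundle ℂ ℂ L] : VectorBundle ℝ ℂ L where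
  trivialization_linear' e he := by
    have h : e.IsLinear ℂ := VectorBundle.trivialization_linear' e
    refine ⟨fun b hb => ⟨(h.linear b hb).map_add, fun c v => ?_⟩⟩
    simpa using (h.linear b hb).map_smul (c : ℂ) v
  continuousOn_coordChange' e e' he he' := by
    have h := continuousOn_coordChange ℂ e e'
    refine ((ContinuousLinearMap.continuous_restrictScalars (𝕜 := ℂ) (𝕜' := ℝ)).comp_continuousOn
      h).congr fun b hb => ?_
    ext v
    have hc : e.IsLinear ℂ := VectorBundle.trivialization_linear' e
    have hc' : e'.IsLinear ℂ := VectorBundle.trivialization_linear' e'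
    simp [Bundle.Trivialization.coordChangeL_apply e e' hb]

end Instances

/-! ### Pointwise exterior algebra

`E` is a complex vector space regarded as a real one; `F` is a complex space of values. -/

noncomputable section Algebra

variable {E : Type*} [NormedAddCommGroup E] [NormedSpace ℂ E]
  {F : Type*} [NormedAddCommGroup F] [NormedSpace ℂ F] {k : ℕ}

/-- The complex structure `v ↦ i v`. -/
def cplxJ (E : Type*) [NormedAddCommGroup E] [NormedSpace ℂ E] : E →L[ℝ] E :=
  (Complex.I • ContinuousLinearMap.id ℂ E).restrictScalars ℝ

/-- The complex linear (type `(1, 0)`) part of a real linear map. -/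
def part10 (T : E →L[ℝ] F) : E →L[ℝ] F :=
  (1 / 2 : ℂ) • (T - Complex.I • T ∘L cplxJ E)

/-- The conjugate linear (type `(0, 1)`) part of a real linear map. -/
def part01 (T : E →L[ℝ] F) : E →L[ℝ] F :=
  (1 / 2 : ℂ) • (T + Complex.I • T ∘L cplxJ E)

/-- The `(1, 1)`-part of a `2`-form: `(2, 0)`- and `(0, 2)`-forms change sign when both arguments
are multiplied by `i`, and `(1, 1)`-forms are invariant. -/
def part11 (β : E [⋀^Fin 2]→L[ℝ] ℂ) : E [⋀^Fin 2]→L[ℝ] ℂ :=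
  (1 / 2 : ℂ) • (β + β.compContinuousLinearMap (cplxJ E))

/-- `u` is of type `(p, q)`. Since `c ↦ c ^ p * conj c ^ q`, `p + q = k`, are pairwise distinct
characters, this singles out the `(p, q)`-summand of the type decomposition of `k`-forms. -/
def IsOfType (p q : ℕ) (u : E [⋀^Fin k]→L[ℝ] F) : Prop :=
  p + q = k ∧ ∀ (c : ℂ) (v : Fin k → E),
    u (fun i => c • v i) = (c ^ p * (starRingEnd ℂ c) ^ q) • u v

lemma part10_apply_smul (T : E →L[ℝ] F) (c : ℂ) (v : E) : part10 T (c • v) = c • part10 T v := by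
  have h : ∀ w : E, T (c • w) = c.re • T w + c.im • T (Complex.I • w) := fun w => by
    rw [← T.map_smul, ← T.map_smul, ← T.map_add]
    congr 1
    conv_lhs => rw [← Complex.re_add_im c]
    rw [add_smul, mul_smul]
    simp
  have h2 : T (Complex.I • Complex.I • v) = - T v := by
    rw [smul_smul, Complex.I_mul_I, neg_one_smul, map_neg]
  have e : part10 T = fun v => (1 / 2 : ℂ) • (T v - Complex.I • T (Complex.I • v)) := rfl
  simp only [e, smul_comm Complex.I c v, h, h2, ← Complex.coe_smul]
  conv_rhs => rw [← Complex.re_add_im c]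
  match_scalars <;> first | ring1 | linear_combination (-1 / 2 : ℂ) * c.im * Complex.I_sq |
    linear_combination (1 / 2 : ℂ) * c.im * Complex.I_sq

lemma part01_apply_smul (T : E →L[ℝ] F) (c : ℂ) (v : E) :
    part01 T (c • v) = (starRingEnd ℂ c) • part01 T v := by
  have h : ∀ w : E, T (c • w) = c.re • T w + c.im • T (Complex.I • w) := fun w => by
    rw [← T.map_smul, ← T.map_smul, ← T.map_add]
    congr 1
    conv_lhs => rw [← Complex.re_add_im c]
    rw [add_smul, mul_smul]
    simp
  have h2 : T (Complex.I • Complex.I • v) = - T v := by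
    rw [smul_smul, Complex.I_mul_I, neg_one_smul, map_neg]
  have e : part01 T = fun v => (1 / 2 : ℂ) • (T v + Complex.I • T (Complex.I • v)) := rfl
  simp only [e, smul_comm Complex.I c v, h, h2, ← Complex.coe_smul]
  conv_rhs => rw [← Complex.re_add_im c]
  simp only [map_add, map_mul, Complex.conj_ofReal, Complex.conj_I]
  match_scalars <;> first | ring1 | linear_combination (-1 / 2 : ℂ) * c.im * Complex.I_sq |
    linear_combination (1 / 2 : ℂ) * c.im * Complex.I_sq

/-- `dz_j ∧ ·` maps forms of type `(p, q)` to forms of type `(p + 1, q)`. -/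
lemma isOfType_alternatize_part10 {p q : ℕ} (T : E →L[ℝ] E [⋀^Fin k]→L[ℝ] F)
    (hT : ∀ v, IsOfType p q (T v)) :
    IsOfType (p + 1) q (ContinuousAlternatingMap.alternatizeUncurryFin (part10 T)) := by
  refine ⟨by have := (hT 0).1; omega, fun c v => ?_⟩
  have h : ∀ (w : E) (m : Fin k → E), part10 T w (fun i => c • m i) =
      (c ^ p * (starRingEnd ℂ c) ^ q) • part10 T w m := fun w m => by
    have e : ∀ m, part10 T w m = (1 / 2 : ℂ) • (T w m - Complex.I • T (Complex.I • w) m) :=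
      fun _ => rfl
    rw [e, e, (hT _).2, (hT _).2]
    module
  simp only [ContinuousAlternatingMap.alternatizeUncurryFin_apply, Finset.smul_sum]
  refine Finset.sum_congr rfl fun i _ => ?_
  rw [part10_apply_smul, ContinuousAlternatingMap.smul_apply]
  have h' := h (v i) (i.removeNth v)
  rw [show i.removeNth (fun j => c • v j) = fun j => c • i.removeNth v j from rfl, h',
    smul_comm (c ^ (p + 1) * (starRingEnd ℂ c) ^ q) ((-1 : ℤ) ^ (i : ℕ)), smul_smul]
  congr 2
  ring

/-- `dz̄_j ∧ ·` maps forms of type `(p, q)` to forms of type `(p, q + 1)`. -/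
lemma isOfType_alternatize_part01 {p q : ℕ} (T : E →L[ℝ] E [⋀^Fin k]→L[ℝ] F)
    (hT : ∀ v, IsOfType p q (T v)) :
    IsOfType p (q + 1) (ContinuousAlternatingMap.alternatizeUncurryFin (part01 T)) := by
  refine ⟨by have := (hT 0).1; omega, fun c v => ?_⟩
  have h : ∀ (w : E) (m : Fin k → E), part01 T w (fun i => c • m i) =
      (c ^ p * (starRingEnd ℂ c) ^ q) • part01 T w m := fun w m => by
    have e : ∀ m, part01 T w m = (1 / 2 : ℂ) • (T w m + Complex.I • T (Complex.I • w) m) :=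
      fun _ => rfl
    rw [e, e, (hT _).2, (hT _).2]
    module
  simp only [ContinuousAlternatingMap.alternatizeUncurryFin_apply, Finset.smul_sum]
  refine Finset.sum_congr rfl fun i _ => ?_
  rw [part01_apply_smul, ContinuousAlternatingMap.smul_apply]
  have h' := h (v i) (i.removeNth v)
  rw [show i.removeNth (fun j => c • v j) = fun j => c • i.removeNth v j from rfl, h',
    smul_comm (c ^ p * (starRingEnd ℂ c) ^ (q + 1)) ((-1 : ℤ) ^ (i : ℕ)), smul_smul]
  congr 2
  ring

/-- A real linear map viewed as a `1`-form. -/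
def oneForm (θ : E →L[ℝ] ℂ) : E [⋀^Fin 1]→L[ℝ] ℂ :=
  ContinuousAlternatingMap.ofSubsingleton ℝ E ℂ (0 : Fin 1) θ

/-- The exterior product `θ ∧ u` of a scalar `1`-form and a `k`-form:
`(θ ∧ u) (v₀, …, v_k) = ∑ i, (-1) ^ i θ (v_i) u (v₀, …, v̂_i, …, v_k)`. -/
def wedge1 (θ : E →L[ℝ] ℂ) (u : E [⋀^Fin k]→L[ℝ] F) : E [⋀^Fin (k + 1)]→L[ℝ] F :=
  ContinuousAlternatingMap.alternatizeUncurryFin (θ.smulRight u)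

/-- Interior product of a `2`-form with a vector, as a linear map. -/
def slot (β : E [⋀^Fin 2]→L[ℝ] ℂ) (v : E) : E →L[ℝ] ℂ :=
  (ContinuousAlternatingMap.ofSubsingleton ℝ E ℂ (0 : Fin 1)).symm (β.curryLeft v)

lemma slot_apply (β : E [⋀^Fin 2]→L[ℝ] ℂ) (v w : E) : slot β v w = β ![v, w] := by
  change β (Matrix.vecCons v fun _ => w) = _
  congr 1
  funext i
  fin_cases i <;> rfl

variable [FiniteDimensional ℂ E]

/-- The exterior product `β ∧ u` of a scalar `2`-form and a `k`-form, normalized so that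
`(θ₁ ∧ θ₂) ∧ u = θ₁ ∧ (θ₂ ∧ u)`. -/
def wedge2 (β : E [⋀^Fin 2]→L[ℝ] ℂ) (u : E [⋀^Fin k]→L[ℝ] F) : E [⋀^Fin (k + 2)]→L[ℝ] F :=
  (1 / 2 : ℂ) • ContinuousAlternatingMap.alternatizeUncurryFin
    (LinearMap.toContinuousLinearMap
      { toFun := fun v => wedge1 (slot β v) u
        map_add' := fun v w => by
          ext m
          simp [wedge1, slot, ContinuousAlternatingMap.alternatizeUncurryFin_apply, add_smul,
            Finset.sum_add_distrib]
        map_smul' := fun c v => by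
          ext m
          simp only [wedge1, slot, ContinuousAlternatingMap.alternatizeUncurryFin_apply,
            ContinuousLinearMap.smulRight_apply, ContinuousAlternatingMap.smul_apply,
            Finset.smul_sum, RingHom.id_apply]
          refine Finset.sum_congr rfl fun i _ => ?_
          rw [smul_comm c]
          congr 1
          rw [← smul_assoc]
          simp } : E →L[ℝ] E [⋀^Fin (k + 1)]→L[ℝ] F)

end Algebra

/-! ### Hermitian and Kähler metrics -/

section Frame

/-- Every finite-dimensional real vector space with a scalar product has an orthonormal basis. -/
lemma exists_orthonormal_basis {V : Type*} [AddCommGroup V] [Module ℝ V] [FiniteDimensional ℝ V]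
    (B : V → V → ℝ) (hadd : ∀ u v w, B (u + v) w = B u w + B v w)
    (hsmul : ∀ (c : ℝ) u v, B (c • u) v = c * B u v) (hsymm : ∀ u v, B u v = B v u)
    (hpos : ∀ v, v ≠ 0 → 0 < B v v) :
    ∃ b : Module.Basis (Fin (Module.finrank ℝ V)) ℝ V,
      ∀ i j, B (b i) (b j) = if i = j then 1 else 0 := by
  have h0 : ∀ w, B 0 w = 0 := fun w => by simpa using hsmul 0 0 w
  let c : InnerProductSpace.Core ℝ V :=
    { inner := B
      conj_inner_symm := fun u v => by simp [hsymm u v]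
      re_inner_nonneg := fun v => by
        rcases eq_or_ne v 0 with rfl | hv
        · simp [h0]
        · simpa using (hpos v hv).le
      add_left := hadd
      smul_left := fun u v r => by simp [hsmul]
      definite := fun v hv => by
        by_contra hne
        exact (hpos v hne).ne' hv }
  let : NormedAddCommGroup V := c.toNormedAddCommGroup
  let : InnerProductSpace ℝ V := InnerProductSpace.ofCore c.toCore
  refine ⟨(stdOrthonormalBasis ℝ V).toBasis, fun i j => ?_⟩
  have h := orthonormal_iff_ite.mp (stdOrthonormalBasis ℝ V).orthonormal i j
  rw [OrthonormalBasis.coe_toBasis]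
  exact h

end Frame

noncomputable section Metric

variable {E : Type*} [NormedAddCommGroup E] [NormedSpace ℂ E] [FiniteDimensional ℂ E]
  {X : Type*} [TopologicalSpace X] [ChartedSpace E X] [IsManifold 𝓘(ℂ, E) ω X]

variable (E X) in
/-- Smooth Riemannian metrics on the real manifold underlying `X`. The tangent space of `X` at `x`
is identified with the model space `E` through the preferred holomorphic chart at `x`. -/
abbrev TangentMetric :=
  Bundle.ContMDiffRiemannianMetric 𝓘(ℝ, E) ∞ E (fun x : X => TangentSpace 𝓘(ℝ, E) x)

/-- The scalar product on the tangent space at `x`. -/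
def metricAt (g : TangentMetric E X) (x : X) : E →L[ℝ] E →L[ℝ] ℝ := g.inner x

lemma exists_frame (g : TangentMetric E X) (x : X) :
    ∃ b : Module.Basis (Fin (Module.finrank ℝ E)) ℝ E,
      ∀ i j, metricAt g x (b i) (b j) = if i = j then 1 else 0 :=
  exists_orthonormal_basis (fun v w : E => metricAt g x v w) (fun u v w => by simp)
    (fun c u v => by simp) (g.symm x) (g.pos x)

/-- A `g`-orthonormal real basis of the tangent space at `x`. -/
def frame (g : TangentMetric E X) (x : X) : Module.Basis (Fin (Module.finrank ℝ E)) ℝ E :=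
  (exists_frame g x).choose

lemma frame_orthonormal (g : TangentMetric E X) (x : X) (i j : Fin (Module.finrank ℝ E)) :
    metricAt g x (frame g x i) (frame g x j) = if i = j then 1 else 0 :=
  (exists_frame g x).choose_spec i j

/-- Scalar differential forms of degree `k` with complex values, not assumed to be regular. -/
abbrev ScalarForm (E X : Type*) [NormedAddCommGroup E] [NormedSpace ℂ E] (k : ℕ) :=
  X → E [⋀^Fin k]→L[ℝ] ℂ

/-- The fundamental form `ω (v, w) = g (i v, w)` (antisymmetrized, which changes nothing when `g` is
Hermitian). -/
def fundamentalForm (g : TangentMetric E X) : ScalarForm E X 2 := fun x =>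
  (1 / 2 : ℂ) • ContinuousAlternatingMap.alternatizeUncurryFin
    (LinearMap.toContinuousLinearMap
      { toFun := fun v => oneForm (Complex.ofRealCLM ∘L metricAt g x (cplxJ E v))
        map_add' := fun v w => by ext m; simp [oneForm]
        map_smul' := fun c v => by ext m; simp [oneForm] } : E →L[ℝ] E [⋀^Fin 1]→L[ℝ] ℂ)

/-! ### Calculus of scalar forms -/

/-- The tangent map at `x`, into the tangent space `E` of `X` at `x`, of the inverse of the
preferred chart at `x₀`. -/
def fromChart (x₀ x : X) : E →L[ℝ] E :=
  (trivializationAt E (TangentSpace 𝓘(ℝ, E) : X → Type _) x₀).symmL ℝ x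

/-- The expression of a scalar form in the preferred chart at `x₀`. -/
def ScalarForm.inChart {k : ℕ} (β : ScalarForm E X k) (x₀ : X) (y : E) : E [⋀^Fin k]→L[ℝ] ℂ :=
  (β ((chartAt E x₀).symm y)).compContinuousLinearMap (fromChart x₀ ((chartAt E x₀).symm y))

/-- The exterior derivative, computed at each point in the preferred chart. -/
def ScalarForm.d {k : ℕ} (β : ScalarForm E X k) : ScalarForm E X (k + 1) := fun x =>
  extDeriv (β.inChart x) (chartAt E x x)

/-- `∂ β = ∑ j, dz_j ∧ ∂β / ∂z_j` in holomorphic coordinates. -/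
def ScalarForm.del {k : ℕ} (β : ScalarForm E X k) : ScalarForm E X (k + 1) := fun x =>
  ContinuousAlternatingMap.alternatizeUncurryFin
    (part10 (fderiv ℝ (β.inChart x) (chartAt E x x)))

/-- `g` is Hermitian: the complex structure is an isometry. -/
def IsHermitian (g : TangentMetric E X) : Prop :=
  ∀ x v w, metricAt g x (cplxJ E v) (cplxJ E w) = metricAt g x v w

/-- `g` is Kähler: it is Hermitian and its fundamental form is closed. -/
def IsKaehler (g : TangentMetric E X) : Prop :=
  IsHermitian g ∧ (fundamentalForm g).d = 0

/-- The differential of a real function, as a complex-valued real linear map on tangent spaces. -/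
def dFun (f : X → ℝ) (x : X) : E →L[ℝ] ℂ :=
  Complex.ofRealCLM ∘L (mfderiv 𝓘(ℝ, E) 𝓘(ℝ, ℝ) f x : E →L[ℝ] ℝ)

/-- `∂ f`. -/
def delFun (f : X → ℝ) (x : X) : E →L[ℝ] ℂ := part10 (dFun f x)

/-- `∂̄ f`. -/
def dbarFun (f : X → ℝ) (x : X) : E →L[ℝ] ℂ := part01 (dFun f x)

/-- `∂ ∂̄ f`. -/
def delDbar (f : X → ℝ) : ScalarForm E X 2 :=
  ScalarForm.del (fun x => oneForm (dbarFun f x))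

/-- `∂ f ∧ ∂̄ f`. -/
def delWedgeDbar (f : X → ℝ) : ScalarForm E X 2 := fun x =>
  wedge1 (delFun f x) (oneForm (dbarFun f x))

end Metric

/-! ### The Riemannian volume measure -/

noncomputable section Volume

variable {E : Type*} [NormedAddCommGroup E] [NormedSpace ℂ E] [FiniteDimensional ℂ E]
  [MeasurableSpace E] [BorelSpace E]
  {X : Type*} [TopologicalSpace X] [ChartedSpace E X] [IsManifold 𝓘(ℂ, E) ω X]
  [MeasurableSpace X] [BorelSpace X]

/-- The volume density `√ det (g_ij)` in the preferred chart at `x₀`, with respect to the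
coordinates given by a fixed real basis of `E`. -/
def volumeDensity (g : TangentMetric E X) (x₀ : X) (y : E) : ℝ :=
  let x := (chartAt E x₀).symm y
  let b := Module.finBasis ℝ E
  √(Matrix.det (Matrix.of fun i j => metricAt g x (fromChart x₀ x (b i)) (fromChart x₀ x (b j))))

/-- The Riemannian volume of the domain of the preferred chart at `x₀`, as a measure on `X`. -/
def chartVolume (g : TangentMetric E X) (x₀ : X) : Measure X :=
  (((Module.finBasis ℝ E).addHaar.restrict (chartAt E x₀).target).withDensity
    fun y => ENNReal.ofReal (volumeDensity g x₀ y)).map (chartAt E x₀).symm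

open Classical in
/-- The Riemannian volume measure of `X`: the volumes of countably many chart domains
covering `X` are glued along the associated disjoint pieces. -/
def volumeMeasure (g : TangentMetric E X) : Measure X :=
  if h : ∃ s : ℕ → X, ⋃ m, (chartAt E (s m)).source = Set.univ then
    Measure.sum fun m => (chartVolume g (h.choose m)).restrict
      (disjointed (fun m => (chartAt E (h.choose m)).source) m)
  else 0

end Volume

/-! ### Forms with values in a Hermitian line bundle with connection -/

noncomputable section BundleForms

variable {E : Type*} [NormedAddCommGroup E] [NormedSpace ℂ E] [FiniteDimensional ℂ E]
  {X : Type*} [TopologicalSpace X] [ChartedSpace E X] [IsManifold 𝓘(ℂ, E) ω X]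
  {L : X → Type*} [∀ x, NormedAddCommGroup (L x)] [∀ x, InnerProductSpace ℂ (L x)]

/-- `L`-valued differential forms, of all degrees at once and not assumed to be regular: `u k` is
the component of degree `k`. -/
abbrev Form (E : Type*) [NormedAddCommGroup E] [NormedSpace ℂ E] {X : Type*} (L : X → Type*)
    [∀ x, NormedAddCommGroup (L x)] [∀ x, InnerProductSpace ℂ (L x)] :=
  ∀ (k : ℕ) (x : X), E [⋀^Fin k]→L[ℝ] L x

namespace Form

/-- `u` is purely of bidegree `(p, q)`. -/
def IsBidegree (p q : ℕ) (u : Form E L) : Prop :=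
  (∀ k, k ≠ p + q → u k = 0) ∧ ∀ x, IsOfType p q (u (p + q) x)

/-- Multiplication by a real function. -/
def mulFun (f : X → ℝ) (u : Form E L) : Form E L := fun k x => (f x : ℂ) • u k x

/-- `θ ∧ u` for a scalar `1`-form `θ`. -/
def wedge1 (θ : X → E →L[ℝ] ℂ) (u : Form E L) : Form E L
  | 0, _ => 0
  | k + 1, x => TwistedBKN.wedge1 (θ x) (u k x)

/-- `β ∧ u` for a scalar `2`-form `β`. -/
def wedge2 (β : ScalarForm E X 2) (u : Form E L) : Form E L
  | 0, _ => 0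
  | 1, _ => 0
  | k + 2, x => TwistedBKN.wedge2 (β x) (u k x)

/-- The pointwise Hermitian inner product of `k`-forms induced by the metrics of `X` and `L`:
`⟨u, v⟩ = ∑_{i₁ < … < i_k} h (u (e_{i₁}, …, e_{i_k}), v (e_{i₁}, …, e_{i_k}))` for any
orthonormal frame, written as a sum over all multi-indices. It is linear in `u`. -/
def pointwiseInner (g : TangentMetric E X) (x : X) {k : ℕ} (u v : E [⋀^Fin k]→L[ℝ] L x) : ℂ :=
  ((k.factorial : ℂ))⁻¹ * ∑ a : Fin k → Fin (Module.finrank ℝ E),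
    inner ℂ (v (fun i => frame g x (a i))) (u (fun i => frame g x (a i)))

/-- The pointwise adjoint of `θ ∧ ·`, see `pointwiseInner_wedge1`. -/
def wedge1Adjoint (g : TangentMetric E X) (θ : X → E →L[ℝ] ℂ) (u : Form E L) : Form E L :=
  fun k x => ∑ a, (starRingEnd ℂ) (θ x (frame g x a)) • (u (k + 1) x).curryLeft (frame g x a)

/-- The pointwise adjoint of `β ∧ ·`, see `pointwiseInner_wedge2`. -/
def wedge2Adjoint (g : TangentMetric E X) (β : ScalarForm E X 2) (u : Form E L) : Form E L :=
  fun k x => (1 / 2 : ℂ) • ∑ a, ∑ b, (starRingEnd ℂ) (β x ![frame g x a, frame g x b]) •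
    ((u (k + 2) x).curryLeft (frame g x a)).curryLeft (frame g x b)

/-- The operator `Λ`, adjoint of the multiplication by the fundamental form. -/
def Lambda (g : TangentMetric E X) (u : Form E L) : Form E L :=
  wedge2Adjoint g (fundamentalForm g) u

/-- The commutator `[β ∧ ·, Λ]` for a scalar `2`-form `β`. -/
def commLambda (g : TangentMetric E X) (β : ScalarForm E X 2) (u : Form E L) : Form E L :=
  wedge2 β (Lambda g u) - Lambda g (wedge2 β u)

lemma pointwiseInner_alternatize (g : TangentMetric E X) (x : X) {k : ℕ}
    (T : E →L[ℝ] E [⋀^Fin k]→L[ℝ] L x) (w : E [⋀^Fin (k + 1)]→L[ℝ] L x) :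
    pointwiseInner g x (ContinuousAlternatingMap.alternatizeUncurryFin T) w =
      ∑ a, pointwiseInner g x (T (frame g x a)) (w.curryLeft (frame g x a)) := by
  have key : ∀ i : Fin (k + 1), ∑ a : Fin (k + 1) → Fin (Module.finrank ℝ E),
      inner ℂ (w fun j => frame g x (a j)) ((-1 : ℤ) ^ (i : ℕ) •
        T (frame g x (a i)) (i.removeNth fun j => frame g x (a j))) =
      ∑ c, ∑ b : Fin k → Fin (Module.finrank ℝ E),
        inner ℂ (w.curryLeft (frame g x c) fun j => frame g x (b j))
          (T (frame g x c) fun j => frame g x (b j)) := by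
    intro i
    rw [← Fintype.sum_prod_type', 
      ← (Fin.insertNthEquiv (fun _ => Fin (Module.finrank ℝ E)) i).sum_comp]
    refine Finset.sum_congr rfl fun p _ => ?_
    obtain ⟨c, b⟩ := p
    have h1 : (fun j => frame g x (Fin.insertNthEquiv (fun _ => Fin (Module.finrank ℝ E)) i (c, b) j))
        = i.insertNth (frame g x c) (fun j => frame g x (b j)) := by
      funext j
      refine Fin.succAboveCases i ?_ (fun j => ?_) j <;> simp
    rw [h1, ContinuousAlternatingMap.map_insertNth]
    rcases neg_one_pow_eq_or ℤ (i : ℕ) with h | h <;> simp [h]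
  simp only [pointwiseInner, ContinuousAlternatingMap.alternatizeUncurryFin_apply, inner_sum]
  rw [Finset.sum_comm]
  simp only [key]
  rw [← Finset.mul_sum]
  simp [Nat.factorial_succ]
  have : ((k : ℂ) + 1) ≠ 0 := by exact_mod_cast Nat.succ_ne_zero k
  field_simp

lemma pointwiseInner_smul_left (g : TangentMetric E X) (x : X) {k : ℕ} (c : ℂ)
    (u v : E [⋀^Fin k]→L[ℝ] L x) : pointwiseInner g x (c • u) v = c * pointwiseInner g x u v := by
  simp only [pointwiseInner, ContinuousAlternatingMap.smul_apply, inner_smul_right,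
    ← Finset.mul_sum]
  ring

lemma pointwiseInner_smul_right (g : TangentMetric E X) (x : X) {k : ℕ} (c : ℂ)
    (u v : E [⋀^Fin k]→L[ℝ] L x) :
    pointwiseInner g x u (c • v) = (starRingEnd ℂ) c * pointwiseInner g x u v := by
  simp only [pointwiseInner, ContinuousAlternatingMap.smul_apply, inner_smul_left,
    ← Finset.mul_sum]
  ring

lemma pointwiseInner_sum_right (g : TangentMetric E X) (x : X) {k : ℕ} {ι : Type*} (s : Finset ι)
    (u : E [⋀^Fin k]→L[ℝ] L x) (v : ι → E [⋀^Fin k]→L[ℝ] L x) :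
    pointwiseInner g x u (∑ i ∈ s, v i) = ∑ i ∈ s, pointwiseInner g x u (v i) := by
  simp only [pointwiseInner, ContinuousAlternatingMap.sum_apply, sum_inner, ← Finset.mul_sum]
  rw [Finset.sum_comm]

lemma pointwiseInner_wedge1 (g : TangentMetric E X) (θ : X → E →L[ℝ] ℂ) (u v : Form E L) (k : ℕ)
    (x : X) : pointwiseInner g x (wedge1 θ u (k + 1) x) (v (k + 1) x) =
      pointwiseInner g x (u k x) (wedge1Adjoint g θ v k x) := by
  simp [wedge1, TwistedBKN.wedge1, pointwiseInner_alternatize, wedge1Adjoint,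
    pointwiseInner_smul_left, pointwiseInner_smul_right, pointwiseInner_sum_right]

lemma pointwiseInner_wedge2 (g : TangentMetric E X) (β : ScalarForm E X 2) (u v : Form E L) (k : ℕ)
    (x : X) : pointwiseInner g x (wedge2 β u (k + 2) x) (v (k + 2) x) =
      pointwiseInner g x (u k x) (wedge2Adjoint g β v k x) := by
  simp [wedge2, TwistedBKN.wedge2, TwistedBKN.wedge1, pointwiseInner_alternatize, wedge2Adjoint,
    pointwiseInner_smul_left, pointwiseInner_smul_right, pointwiseInner_sum_right, slot_apply, Complex.conj_ofNat]

/-- The form has compact support. -/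
def HasCompactSupport (u : Form E L) : Prop :=
  IsCompact (closure {x | ∃ k, u k x ≠ 0})

/-- The pointwise inner product of forms of mixed degrees; different degrees are orthogonal, and
there are no nonzero forms of degree larger than the real dimension. -/
def innerAt (g : TangentMetric E X) (u v : Form E L) (x : X) : ℂ :=
  ∑ k ∈ Finset.range (Module.finrank ℝ E + 1), pointwiseInner g x (u k x) (v k x)

/-- The `L²` inner product. -/
def l2Inner [MeasurableSpace E] [BorelSpace E] [MeasurableSpace X] [BorelSpace X]
    (g : TangentMetric E X) (u v : Form E L) : ℂ :=
  ∫ x, innerAt g u v x ∂(volumeMeasure g)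

variable [TopologicalSpace (Bundle.TotalSpace ℂ L)] [FiberBundle ℂ L] [VectorBundle ℂ ℂ L]

/-- The expression of the degree `k` component of an `L`-valued form in the preferred chart of `X`
and the preferred trivialization of `L` at `x₀`. -/
def inChart (u : Form E L) (k : ℕ) (x₀ : X) (y : E) : E [⋀^Fin k]→L[ℝ] ℂ :=
  let x := (chartAt E x₀).symm y
  ((trivializationAt ℂ L x₀).continuousLinearMapAt ℝ x).compContinuousAlternatingMap
    ((u k x).compContinuousLinearMap (fromChart x₀ x))

/-- The form is smooth: so are all its local expressions. -/
def IsSmooth (u : Form E L) : Prop :=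
  ∀ (k : ℕ) (x₀ : X), ContDiffOn ℝ ∞ (u.inChart k x₀)
    ((chartAt E x₀).target ∩ (chartAt E x₀).symm ⁻¹' (trivializationAt ℂ L x₀).baseSet)

end Form

variable (E) in
/-- The Hermitian metric of the complex line bundle `L`, given by the inner products of its fibres,
is smooth: so is the squared length of the local frame given by any preferred trivialization. -/
def HasSmoothMetric (L : X → Type*) [∀ x, NormedAddCommGroup (L x)]
    [∀ x, InnerProductSpace ℂ (L x)] [TopologicalSpace (Bundle.TotalSpace ℂ L)] [FiberBundle ℂ L]
    [VectorBundle ℂ ℂ L] : Prop :=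
  ∀ x₀ : X, ContMDiffOn 𝓘(ℝ, E) 𝓘(ℝ, ℝ) ∞
    (fun x => ‖(trivializationAt ℂ L x₀).symmL ℝ x 1‖ ^ 2) (trivializationAt ℂ L x₀).baseSet

variable (E) in
/-- The section `σ` of `L` is differentiable (in the real sense) at `x`. -/
def IsDiffSection [TopologicalSpace (Bundle.TotalSpace ℂ L)] [FiberBundle ℂ L]
    (σ : ∀ x, L x) (x : X) : Prop :=
  MDifferentiableAt 𝓘(ℝ, E) (𝓘(ℝ, E).prod 𝓘(ℝ, ℂ)) (fun y => Bundle.TotalSpace.mk' ℂ y (σ y)) x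

/-- `D` is a smooth complex linear connection on the complex line bundle `L`, compatible with the
Hermitian metric `h` of `L`: `d h (σ, τ) = h (D σ, τ) + h (σ, D τ)`. -/
structure IsHermitianConnection [TopologicalSpace (Bundle.TotalSpace ℂ L)] [FiberBundle ℂ L]
    [VectorBundle ℂ ℂ L] (D : CovariantDerivative 𝓘(ℝ, E) ℂ L) : Prop where
  smooth : CovariantDerivative.ContMDiffCovariantDerivative D ∞
  map_smul : ∀ (c : ℂ) (σ : ∀ x, L x) (x : X), IsDiffSection E σ x →
    ∀ v : TangentSpace 𝓘(ℝ, E) x, D (c • σ) x v = c • D σ x v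
  metric : ∀ (σ τ : ∀ x, L x) (x : X), IsDiffSection E σ x → IsDiffSection E τ x →
    ∀ v : TangentSpace 𝓘(ℝ, E) x,
      (mfderiv 𝓘(ℝ, E) 𝓘(ℝ, ℂ) (fun y => (inner ℂ (τ y) (σ y) : ℂ)) x v : ℂ) =
        inner ℂ (τ x) (D σ x v) + inner ℂ (D τ x v) (σ x)

section Connection

variable [TopologicalSpace (Bundle.TotalSpace ℂ L)] [FiberBundle ℂ L] [VectorBundle ℂ ℂ L]
  (D : CovariantDerivative 𝓘(ℝ, E) ℂ L)

/-- The connection form `A` of `D` with respect to the local frame `e` of `L` given by the preferred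
trivialization at `x₀`, expressed in the preferred chart at `x₀`: `D e = A ⊗ e`. -/
def connectionForm (x₀ : X) (y : E) : E →L[ℝ] ℂ :=
  let x := (chartAt E x₀).symm y
  let e := trivializationAt ℂ L x₀
  e.continuousLinearMapAt ℝ x ∘L
    ((D (fun z => e.symmL ℝ z 1) x : E →L[ℝ] L x) ∘L fromChart x₀ x)

/-- The curvature `Θ (D)`, the scalar `2`-form with `D² = Θ (D) ∧ ·`. For a line bundle it is the
exterior derivative of any local connection form. -/
def curvature : ScalarForm E X 2 := fun x =>
  extDeriv (fun y => oneForm (connectionForm D x y)) (chartAt E x x)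

/-- The derivative `d u + A ⊗ u` of the coefficients of the local expression of `u` at `x`. -/
def localDeriv (u : Form E L) (k : ℕ) (x : X) : E →L[ℝ] E [⋀^Fin k]→L[ℝ] ℂ :=
  fderiv ℝ (u.inChart k x) (chartAt E x x) +
    (connectionForm D x (chartAt E x x)).smulRight (u.inChart k x (chartAt E x x))

/-- Back from a local expression at `x` to the fibre of `L` at `x`. -/
def toFiber (x : X) {k : ℕ} (w : E [⋀^Fin k]→L[ℝ] ℂ) : E [⋀^Fin k]→L[ℝ] L x :=
  ((trivializationAt ℂ L x).symmL ℝ x).compContinuousAlternatingMap w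

/-- The exterior covariant derivative on `L`-valued forms: `d u + A ∧ u` in a local frame. -/
def extD (u : Form E L) : Form E L
  | 0, _ => 0
  | k + 1, x => toFiber x (ContinuousAlternatingMap.alternatizeUncurryFin (localDeriv D u k x))

/-- The `(1, 0)`-part `∂_D` of the connection on forms: `∑ j, dz_j ∧ (∂ / ∂z_j + A (∂ / ∂z_j)) u` in
a local frame and local holomorphic coordinates. -/
def del (u : Form E L) : Form E L
  | 0, _ => 0
  | k + 1, x =>
    toFiber x (ContinuousAlternatingMap.alternatizeUncurryFin (part10 (localDeriv D u k x)))

/-- The `(0, 1)`-part `∂̄_D` of the connection on forms: `∑ j, dz̄_j ∧ (∂ / ∂z̄_j + A (∂ / ∂z̄_j)) u`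
in a local frame and local holomorphic coordinates. It raises the type `(p, q)` to `(p, q + 1)`, as
`∂_D` raises it to `(p + 1, q)`. Its square is not assumed to vanish. -/
def dbar (u : Form E L) : Form E L
  | 0, _ => 0
  | k + 1, x =>
    toFiber x (ContinuousAlternatingMap.alternatizeUncurryFin (part01 (localDeriv D u k x)))

lemma del_add_dbar (u : Form E L) : del D u + dbar D u = extD D u := by
  funext k x
  cases k with
  | zero => simp [del, dbar, extD]
  | succ k =>
    have h : part10 (localDeriv D u k x) + part01 (localDeriv D u k x) = localDeriv D u k x := by
      simp only [part10, part01, ← smul_add]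
      rw [sub_add_add_cancel, ← two_smul ℂ, smul_smul]
      norm_num
    ext m
    simp only [Pi.add_apply, del, dbar, extD]
    rw [← h, ContinuousAlternatingMap.alternatizeUncurryFin_add]
    simp [toFiber, h]


/-! ### Twisted operators, formal adjoints, twisted Laplacians -/

/-- The right twisting `∂̄ (√η ·)`. -/
def dbarRight (η : X → ℝ) (u : Form E L) : Form E L := dbar D (u.mulFun fun x => √(η x))

/-- The left twisting `√η ∂̄`. -/
def dbarLeft (η : X → ℝ) (u : Form E L) : Form E L := (dbar D u).mulFun fun x => √(η x)

/-- The right twisting `∂ (√η ·)`. -/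
def delRight (η : X → ℝ) (u : Form E L) : Form E L := del D (u.mulFun fun x => √(η x))

/-- The left twisting `√η ∂`. -/
def delLeft (η : X → ℝ) (u : Form E L) : Form E L := (del D u).mulFun fun x => √(η x)

variable [MeasurableSpace E] [BorelSpace E] [MeasurableSpace X] [BorelSpace X]

/-- `P` and `Q` are operators on smooth `L`-valued forms, and `Q` is the formal adjoint of `P`:
`⟪P u, v⟫ = ⟪u, Q v⟫` for all smooth `u`, `v` with `u` compactly supported. This determines `Q v`
for smooth `v`. -/
structure IsFormalAdjoint (g : TangentMetric E X) (P Q : Form E L → Form E L) : Prop where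
  smooth_left : ∀ u, u.IsSmooth → (P u).IsSmooth
  smooth_right : ∀ v, v.IsSmooth → (Q v).IsSmooth
  adjoint : ∀ u v, u.IsSmooth → v.IsSmooth → u.HasCompactSupport →
    Form.l2Inner g (P u) v = Form.l2Inner g u (Q v)

open Classical in
/-- The formal adjoint of an operator on smooth forms (with junk value `0` if there is none). -/
def formalAdjoint (g : TangentMetric E X) (P : Form E L → Form E L) : Form E L → Form E L :=
  if h : ∃ Q, IsFormalAdjoint g P Q then h.choose else 0

/-- The twisted Laplacian `Δ''_(η) = (∂̄ √η) (∂̄ √η)^⋆ + (√η ∂̄)^⋆ (√η ∂̄)`. -/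
def laplaceDbar (g : TangentMetric E X) (η : X → ℝ) (u : Form E L) : Form E L :=
  dbarRight D η (formalAdjoint g (dbarRight D η) u) +
    formalAdjoint g (dbarLeft D η) (dbarLeft D η u)

/-- The twisted Laplacian `Δ'_(η) = (∂ √η) (∂ √η)^⋆ + (√η ∂)^⋆ (√η ∂)`. -/
def laplaceDel (g : TangentMetric E X) (η : X → ℝ) (u : Form E L) : Form E L :=
  delRight D η (formalAdjoint g (delRight D η) u) +
    formalAdjoint g (delLeft D η) (delLeft D η u)

end Connection

/-- The twisted curvature form `η i Θ(D)^{1,1} - i ∂∂̄η`. -/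
def twistedCurvature [TopologicalSpace (Bundle.TotalSpace ℂ L)] [FiberBundle ℂ L]
    [VectorBundle ℂ ℂ L] (D : CovariantDerivative 𝓘(ℝ, E) ℂ L) (η : X → ℝ) : ScalarForm E X 2 :=
  fun x => (η x : ℂ) • Complex.I • part11 (curvature D x) - Complex.I • delDbar η x

/-- The twisted curvature form `η i Θ(D)^{1,1} - i ∂∂̄η - λ⁻¹ i ∂η ∧ ∂̄η`. -/
def twistedCurvature₂ [TopologicalSpace (Bundle.TotalSpace ℂ L)] [FiberBundle ℂ L]
    [VectorBundle ℂ ℂ L] (D : CovariantDerivative 𝓘(ℝ, E) ℂ L) (η lam : X → ℝ) :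
    ScalarForm E X 2 := fun x =>
  twistedCurvature D η x - ((lam x : ℂ))⁻¹ • Complex.I • delWedgeDbar η x

end BundleForms

end TwistedBKN

/-! The identity is an algebraic consequence of four facts. (a) The Kähler identities: the formal
adjoint of `∂̄_D` is `-i [Λ, ∂_D]`, that of `∂_D` is `i [Λ, ∂̄_D]`. (b) `∂_D ∂̄_D + ∂̄_D ∂_D` is the
product with `Θ(D)^{1,1}` (`typedD_anticommutator`). (c) The Leibniz rules for multiplication by `η`
and for `∂̄_D (∂η ∧ ·)` (`typedD_mulFun`, `typedD_wedge1`). (d) The pointwise adjoint of `∂̄η ∧ ·`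
is `i [Λ, ∂η ∧ ·]` (`Form.wedge1Adjoint_dbarFun`). A form of type `(n, q)` is killed by `∂_D` and by
`∂η ∧ ·`, since the result would have type `(n + 1, q)`. After substitution both sides are the same
linear combination of terms (`twistedBochnerKodairaNakano`). Neither `∂_D²` nor `∂̄_D²` occurs, so
integrability of `∂̄_D` plays no role.

The inequality comes from pairing the identity with `v`. Write `P = ∂̄_D^⋆ v` and `a = (∂̄η ∧ ·)^⋆
v`. The last two terms of the identity contribute `⟪P, a⟫ + ⟪a, P⟫`, and `[i ∂η ∧ ∂̄η, Λ] v = ∂̄η ∧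
a`. Adding the energy of weight `λ` completes a square: the left side exceeds the right side by
`⟪Δ'_(η) v, v⟫ + ‖√λ ∂̄_D v‖² + ‖√λ P + a / √λ‖²`, which is real and nonnegative.

The analytic core is (a). The operator `codiff` is defined as the commutator with `Λ` and then shown
to be the formal adjoint. At a point of a chart, closedness of the fundamental form provides
Christoffel symbols that are symmetric, complex bilinear and compatible with the metric
(`exists_isChristoffel`). Corrections of this kind disappear after alternation, also after splitting
into types, so `∂_D` and `∂̄_D` can be computed from the covariant derivative. Since `Λ` is
parallel, its commutator with them reduces to linear algebra over an orthonormal frame and equals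
minus a contracted covariant derivative (`IsLocalKaehler.localCodiff_eq`). The same contraction
appears in the divergence of the vector field dual to `a ↦ ⟨u, ι_a v⟩` (`hasFDerivAt_divergence`),
and integration by parts gives adjointness (`IsLocalKaehler.integral_formInner_localD`).

The global operators are defined at each point in the chart and the frame attached to that very
point. Naturality (`localD_pullback`) shows that they have the same expression throughout any one
chart (`typedD_inChart`), and a partition of unity then globalizes the adjointness
(`l2Inner_typedD`). Finally, formal adjoints are unique on smooth forms (`IsFormalAdjoint.unique`),
so the adjoints chosen in the definition of the Laplacians are given by `codiff`. -/

namespace TwistedBKN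

set_option synthInstance.maxHeartbeats 400000
set_option maxSynthPendingDepth 3
set_option linter.unusedSectionVars false

/-! ### Pointwise exterior algebra -/

noncomputable section PointwiseAlgebra

open ContinuousAlternatingMap (alternatizeUncurryFin alternatizeUncurryFinCLM alternatizeUncurryFin_apply
  alternatizeUncurryFin_add alternatizeUncurryFin_smul curryLeftLI curryLeft_same
  alternatizeUncurryFin_alternatizeUncurryFinCLM_comp_of_symmetric compContinuousLinearMapCLM)

variable {E : Type*} [NormedAddCommGroup E] [NormedSpace ℂ E]
  {F : Type*} [NormedAddCommGroup F] [NormedSpace ℂ F] {k : ℕ}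

/-- The part of type `(1, 0)` (for `s = 1`) or `(0, 1)` (for `s = -1`) of a real linear map. -/
def typePart (s : ℝ) (T : E →L[ℝ] F) : E →L[ℝ] F :=
  (1 / 2 : ℂ) • (T - ((s : ℂ) * Complex.I) • T ∘L cplxJ E)

lemma typePart_one (T : E →L[ℝ] F) : typePart 1 T = part10 T := by simp [typePart, part10]

lemma typePart_neg_one (T : E →L[ℝ] F) : typePart (-1) T = part01 T := by
  simp [typePart, part01, sub_neg_eq_add]

lemma typePart_apply (s : ℝ) (T : E →L[ℝ] F) (a : E) :
    typePart s T a = (1 / 2 : ℂ) • (T a - ((s : ℂ) * Complex.I) • T (Complex.I • a)) := rfl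

lemma typePart_add (s : ℝ) (T T' : E →L[ℝ] F) :
    typePart s (T + T') = typePart s T + typePart s T' := by
  ext a; simp only [typePart_apply, add_apply]; module

lemma typePart_smul (s : ℝ) (c : ℂ) (T : E →L[ℝ] F) :
    typePart s (c • T) = c • typePart s T := by
  ext a
  simp only [typePart_apply, smul_apply]
  module

lemma cplxJ_apply (v : E) : cplxJ E v = Complex.I • v := rfl

lemma cplxJ_cplxJ (v : E) : cplxJ E (cplxJ E v) = -v := by
  simp [cplxJ_apply, smul_smul]

/-- `alternatizeUncurryFin` as an additive map. -/
def alternatizeHom : (E →L[ℝ] E [⋀^Fin k]→L[ℝ] F) →+ E [⋀^Fin (k + 1)]→L[ℝ] F :=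
  AddMonoidHom.mk' alternatizeUncurryFin alternatizeUncurryFin_add

lemma alternatize_sub (S T : E →L[ℝ] E [⋀^Fin k]→L[ℝ] F) :
    alternatizeUncurryFin (S - T) = alternatizeUncurryFin S - alternatizeUncurryFin T :=
  map_sub alternatizeHom S T

lemma alternatize_sum {ι : Type*} (s : Finset ι) (T : ι → E →L[ℝ] E [⋀^Fin k]→L[ℝ] F) :
    alternatizeUncurryFin (∑ i ∈ s, T i) = ∑ i ∈ s, alternatizeUncurryFin (T i) :=
  map_sum alternatizeHom T s

/-- Interior product with a vector. -/
def contr (a : E) : (E [⋀^Fin (k + 1)]→L[ℝ] F) →L[ℝ] E [⋀^Fin k]→L[ℝ] F :=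
  ContinuousLinearMap.apply ℝ _ a ∘L (curryLeftLI (𝕜 := ℝ)).toContinuousLinearMap

lemma contr_apply (a : E) (u : E [⋀^Fin (k + 1)]→L[ℝ] F) : contr a u = u.curryLeft a := rfl

lemma contr_apply_apply (a : E) (u : E [⋀^Fin (k + 1)]→L[ℝ] F) (m : Fin k → E) :
    contr a u m = u (Matrix.vecCons a m) := rfl

lemma contr_smul (a : E) (c : ℂ) (u : E [⋀^Fin (k + 1)]→L[ℝ] F) :
    contr a (c • u) = c • contr a u := rfl

lemma contr_add_left (a b : E) (u : E [⋀^Fin (k + 1)]→L[ℝ] F) :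
    contr (a + b) u = contr a u + contr b u := map_add u.curryLeft a b

lemma contr_smul_left (c : ℝ) (a : E) (u : E [⋀^Fin (k + 1)]→L[ℝ] F) :
    contr (c • a) u = c • contr a u := map_smul u.curryLeft c a

lemma contr_neg_left (a : E) (u : E [⋀^Fin (k + 1)]→L[ℝ] F) :
    contr (-a) u = -contr a u := map_neg u.curryLeft a

lemma contr_self (a : E) (u : E [⋀^Fin (k + 2)]→L[ℝ] F) : contr a (contr a u) = 0 :=
  curryLeft_same u a

lemma contr_swap (a b : E) (u : E [⋀^Fin (k + 2)]→L[ℝ] F) :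
    contr a (contr b u) = -contr b (contr a u) := by
  have h := contr_self (a + b) u
  simp only [contr_add_left, map_add, contr_self] at h
  rw [zero_add, add_zero] at h
  first | exact eq_neg_of_add_eq_zero_left h | exact eq_neg_of_add_eq_zero_right h

/-- The two-fold alternatization of a bilinear map is antisymmetric in its arguments. -/
lemma alternatize_flip (B : E →L[ℝ] E →L[ℝ] E [⋀^Fin k]→L[ℝ] F) :
    alternatizeUncurryFin (alternatizeUncurryFinCLM ℝ E F ∘L B.flip) =
      -alternatizeUncurryFin (alternatizeUncurryFinCLM ℝ E F ∘L B) := by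
  have h := alternatizeUncurryFin_alternatizeUncurryFinCLM_comp_of_symmetric (f := B.flip + B)
    (fun x y => by simp [add_comm])
  rw [ContinuousLinearMap.comp_add, alternatizeUncurryFin_add] at h
  exact eq_neg_of_add_eq_zero_left h

/-- The degree zero case of the formula `ι_a (alt T) = T a - alt (ι_a ∘ T)`. It is separate because
the values of `T` are then functions, which have no interior product, and the correction term is
absent. -/
lemma contr_alternatize_zero (a : E) (T : E →L[ℝ] E [⋀^Fin 0]→L[ℝ] F) :
    contr a (alternatizeUncurryFin T) = T a := by
  ext m
  rw [contr_apply_apply, alternatizeUncurryFin_apply]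
  rw [Fin.sum_univ_succ, Finset.univ_eq_empty, Finset.sum_empty, add_zero, Fin.val_zero, pow_zero,
    one_smul]
  exact congrArg (T a) (Subsingleton.elim _ _)

/-- `ι_a (alt T) = T a - alt (ι_a ∘ T)`. -/
lemma contr_alternatize (a : E) (T : E →L[ℝ] E [⋀^Fin (k + 1)]→L[ℝ] F) :
    contr a (alternatizeUncurryFin T) = T a - alternatizeUncurryFin (contr a ∘L T) := by
  ext m
  rw [contr_apply_apply, alternatizeUncurryFin_apply, Fin.sum_univ_succ,
    ContinuousAlternatingMap.sub_apply, alternatizeUncurryFin_apply, sub_eq_add_neg, ← Finset.sum_neg_distrib]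
  congr 1
  · simp only [Fin.val_zero, pow_zero, one_smul, Matrix.cons_val_zero]
    rfl
  · refine Finset.sum_congr rfl fun i _ => ?_
    rw [Fin.val_succ, pow_succ, mul_neg_one, neg_smul, Matrix.cons_val_succ,
      ContinuousLinearMap.comp_apply, contr_apply_apply]
    congr 3
    funext j
    refine Fin.cases ?_ (fun j => ?_) j <;> simp [Fin.removeNth]

lemma alternatize_compContinuousLinearMap (T : E →L[ℝ] E [⋀^Fin k]→L[ℝ] F) (A : E →L[ℝ] E) :
    (alternatizeUncurryFin T).compContinuousLinearMap A =
      alternatizeUncurryFin (compContinuousLinearMapCLM A ∘L T ∘L A) := by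
  ext v
  simp [alternatizeUncurryFin_apply, Fin.removeNth, Function.comp_def]
  rfl

/-! ### Traces over orthonormal frames -/

/-- `f` is orthonormal for the bilinear form `G`. -/
def IsOrthonormalFrame {ι : Type*} (G : E →L[ℝ] E →L[ℝ] ℝ) (f : Module.Basis ι ℝ E) : Prop :=
  ∀ a b, G (f a) (f b) = open Classical in if a = b then 1 else 0

section Trace

variable {ι : Type*} [Fintype ι] {G : E →L[ℝ] E →L[ℝ] ℝ} {f : Module.Basis ι ℝ E}

lemma IsOrthonormalFrame.sum_apply_smul (hf : IsOrthonormalFrame G f) (v : E) :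
    ∑ a, G v (f a) • f a = v := by
  classical
  conv_rhs => rw [← f.sum_repr v]
  refine Finset.sum_congr rfl fun a _ => ?_
  congr 1
  conv_lhs => rw [← f.sum_repr v]
  simp only [map_sum, map_smul, FunLike.coe_sum, FunLike.coe_smul, Finset.sum_apply, Pi.smul_apply,
    hf _ a, smul_eq_mul, mul_ite, mul_one, mul_zero]
  simp

variable {W : Type*} [AddCommGroup W] [Module ℝ W]

/-- A trace over an orthonormal frame, after moving an endomorphism to the other argument. -/
lemma IsOrthonormalFrame.sum_adjoint (hf : IsOrthonormalFrame G f) (hG : ∀ v w, G v w = G w v)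
    {K K' : E →L[ℝ] E} (hK : ∀ v w, G (K v) w = G v (K' w)) (B : E →ₗ[ℝ] E →ₗ[ℝ] W) :
    ∑ a, B (K (f a)) (f a) = ∑ a, B (f a) (K' (f a)) := by
  have h1 : ∀ a, B (K (f a)) (f a) = ∑ b, G (K (f a)) (f b) • B (f b) (f a) := fun a => by
    conv_lhs => rw [← hf.sum_apply_smul (K (f a))]
    simp
  have h2 : ∀ a, B (f a) (K' (f a)) = ∑ b, G (K' (f a)) (f b) • B (f a) (f b) := fun a => by
    conv_lhs => rw [← hf.sum_apply_smul (K' (f a))]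
    simp
  simp only [h1, h2]
  rw [Finset.sum_comm]
  refine Finset.sum_congr rfl fun a _ => Finset.sum_congr rfl fun b _ => ?_
  rw [hK, hG]

variable (hf : IsOrthonormalFrame G f) (hG : ∀ v w, G v w = G w v)
  (hJ : ∀ v w, G (cplxJ E v) (cplxJ E w) = G v w)

include hJ in
-- An isometry whose square is `-1` is skew. Over an orthonormal frame this lets `J` move between
-- the two arguments of a trace at the cost of a sign.
lemma metric_cplxJ_left (v w : E) : G (cplxJ E v) w = -G v (cplxJ E w) := by
  rw [← hJ v, cplxJ_cplxJ]
  simp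

include hf hG hJ in
lemma IsOrthonormalFrame.sum_cplxJ_left (B : E →ₗ[ℝ] E →ₗ[ℝ] W) :
    ∑ a, B (cplxJ E (f a)) (f a) = -∑ a, B (f a) (cplxJ E (f a)) := by
  rw [hf.sum_adjoint hG (K' := -cplxJ E) (fun v w => by simp [metric_cplxJ_left hJ])]
  simp

include hf hG hJ in
-- The vectors `J f_a` form an orthonormal frame too, and a trace does not depend on the frame.
lemma IsOrthonormalFrame.sum_cplxJ_both (B : E →ₗ[ℝ] E →ₗ[ℝ] W) :
    ∑ a, B (cplxJ E (f a)) (cplxJ E (f a)) = ∑ a, B (f a) (f a) := by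
  have h := hf.sum_cplxJ_left hG hJ (B.compl₂ (cplxJ E : E →ₗ[ℝ] E))
  simp only [LinearMap.compl₂_apply, ContinuousLinearMap.coe_coe, cplxJ_cplxJ, map_neg,
    Finset.sum_neg_distrib, neg_neg] at h
  exact h

/-! ### The operator `Λ` in a frame -/

/-- The operator `Λ` computed in an orthonormal frame. -/
def lamFrame (f : Module.Basis ι ℝ E) : (E [⋀^Fin (k + 2)]→L[ℝ] F) →L[ℝ] E [⋀^Fin k]→L[ℝ] F :=
  (1 / 2 : ℝ) • ∑ a, contr (cplxJ E (f a)) ∘L contr (f a)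

/-- Interior product with the part of type `(1, 0)` (for `s = 1`) of a vector. -/
def contrPart (s : ℝ) (a : E) (u : E [⋀^Fin (k + 1)]→L[ℝ] F) : E [⋀^Fin k]→L[ℝ] F :=
  typePart s u.curryLeft a

lemma contrPart_eq (s : ℝ) (a : E) (u : E [⋀^Fin (k + 1)]→L[ℝ] F) :
    contrPart s a u = (1 / 2 : ℂ) • (contr a u - ((s : ℂ) * Complex.I) • contr (cplxJ E a) u) := rfl

/-- The bilinear map `(x, y) ↦ ι_y (T x)`. -/
def contrBilin (T : E →L[ℝ] E [⋀^Fin (k + 1)]→L[ℝ] F) : E →ₗ[ℝ] E →ₗ[ℝ] E [⋀^Fin k]→L[ℝ] F :=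
  LinearMap.mk₂ ℝ (fun x y => contr y (T x)) (fun x x' y => by simp) (fun c x y => by simp)
    (fun x y y' => contr_add_left _ _ _) (fun c x y => contr_smul_left _ _ _)

include hf hG hJ in
-- Commuting the two interior products of `Λ` past an alternatization leaves one term for each of
-- them. The two terms have the same trace because `J` is skew, and the factor `1 / 2` in `Λ` makes
-- up for the repetition.
lemma IsOrthonormalFrame.half_sum_contr (T : E →L[ℝ] E [⋀^Fin (k + 1)]→L[ℝ] F) :
    (1 / 2 : ℝ) • ∑ a, (contr (cplxJ E (f a)) (T (f a)) - contr (f a) (T (cplxJ E (f a)))) =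
      ∑ a, contr (cplxJ E (f a)) (T (f a)) := by
  have h := hf.sum_cplxJ_left hG hJ (contrBilin T)
  simp only [contrBilin, LinearMap.mk₂_apply] at h
  rw [Finset.sum_sub_distrib, h, sub_neg_eq_add, ← two_smul ℝ, smul_smul]
  norm_num

include hf hG hJ in
/-- The commutator of `Λ` with an alternatization, in degree one. -/
lemma IsOrthonormalFrame.lamFrame_alternatize_one (T : E →L[ℝ] E [⋀^Fin 1]→L[ℝ] F) :
    lamFrame f (alternatizeUncurryFin T) = ∑ a, contr (cplxJ E (f a)) (T (f a)) := by
  rw [← hf.half_sum_contr hG hJ, lamFrame]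
  simp only [FunLike.coe_smul, FunLike.coe_sum, Pi.smul_apply, Finset.sum_apply,
    ContinuousLinearMap.comp_apply]
  congr 1
  refine Finset.sum_congr rfl fun a _ => ?_
  -- The values of `T` are `1`-forms, on which `Λ` is zero, so no second term of a commutator
  -- remains.
  rw [contr_alternatize, map_sub, contr_alternatize_zero]
  rfl

include hf hG hJ in
/-- The commutator of `Λ` with an alternatization. -/
lemma IsOrthonormalFrame.lamFrame_alternatize (T : E →L[ℝ] E [⋀^Fin (k + 2)]→L[ℝ] F) :
    lamFrame f (alternatizeUncurryFin T) - alternatizeUncurryFin (lamFrame f ∘L T) =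
      ∑ a, contr (cplxJ E (f a)) (T (f a)) := by
  rw [← hf.half_sum_contr hG hJ]
  have e : lamFrame f ∘L T = (1 / 2 : ℝ) •
      ∑ a, contr (cplxJ E (f a)) ∘L contr (f a) ∘L T := by
    ext v m
    simp [lamFrame]
  rw [e, alternatizeUncurryFin_smul, alternatize_sum, lamFrame]
  simp only [FunLike.coe_smul, FunLike.coe_sum, Pi.smul_apply, Finset.sum_apply,
    ContinuousLinearMap.comp_apply]
  rw [← smul_sub, ← Finset.sum_sub_distrib]
  congr 1
  refine Finset.sum_congr rfl fun a _ => ?_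
  -- Applied twice, the contraction formula leaves `ι_{Jf} (T f) - ι_f (T (J f))` besides the
  -- alternatization of `ι_{Jf} ι_f ∘ T`, which is subtracted.
  rw [contr_alternatize, map_sub, contr_alternatize, ContinuousLinearMap.comp_apply]
  abel

include hf hG hJ in
-- The algebraic heart of the Kähler identities: moving `J` from the contracting vector to the
-- differentiating one exchanges the type `-s` of the derivative for the type `s` of the
-- contraction. With `T` a covariant derivative, the right side is a typed divergence.
lemma IsOrthonormalFrame.sum_contr_typePart {s : ℝ} (hs : s * s = 1)
    (T : E →L[ℝ] E [⋀^Fin (k + 1)]→L[ℝ] F) :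
    ∑ a, contr (cplxJ E (f a)) (typePart (-s) T (f a)) =
      ((s : ℂ) * Complex.I) • ∑ a, contrPart s (f a) (T (f a)) := by
  have h := hf.sum_cplxJ_both hG hJ (contrBilin T)
  simp only [contrBilin, LinearMap.mk₂_apply] at h
  have hs' : ((s : ℂ) * Complex.I) * ((s : ℂ) * Complex.I) = -1 := by
    have : (s : ℂ) * s = 1 := by exact_mod_cast hs
    linear_combination (Complex.I * Complex.I) * this + Complex.I_mul_I
  have h1 : ∀ a, contr (cplxJ E (f a)) (typePart (-s) T (f a)) = (1 / 2 : ℂ) •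
      contr (cplxJ E (f a)) (T (f a)) + ((1 / 2 : ℂ) * ((s : ℂ) * Complex.I)) •
        contr (cplxJ E (f a)) (T (cplxJ E (f a))) := fun a => by
    rw [typePart_apply, contr_smul, map_sub, contr_smul]
    push_cast
    rw [← cplxJ_apply]
    module
  simp only [h1, contrPart_eq, Finset.sum_add_distrib, ← Finset.smul_sum, Finset.sum_sub_distrib, h]
  rw [smul_comm, smul_sub, smul_smul _ _ (∑ a, contr (cplxJ E (f a)) (T (f a))), hs']
  module

end Trace

end PointwiseAlgebra

/-! ### Forms of type `(p, q)` with `p` larger than the dimension -/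

noncomputable section Types

variable {E : Type*} [NormedAddCommGroup E] [NormedSpace ℂ E]
  {F : Type*} [NormedAddCommGroup F] [NormedSpace ℂ F] {k : ℕ}

/-- Under multiplication of all arguments by `c` of absolute value one, `u` is multiplied by
`c ^ m`. -/
def HasWeight (m : ℤ) (u : E [⋀^Fin k]→L[ℝ] F) : Prop :=
  ∀ (c : ℂ) (v : Fin k → E), ‖c‖ = 1 → u (fun i => c • v i) = c ^ m • u v

/-- On the unit circle `conj c = c⁻¹`, so only `p - q` survives. The weight is easier to follow than
the bidegree: a `(1, 0)`-contraction lowers it by one and a `(0, 1)`-contraction raises it by one,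
without natural subtraction. -/
lemma IsOfType.hasWeight {p q : ℕ} {u : E [⋀^Fin k]→L[ℝ] F} (h : IsOfType p q u) :
    HasWeight ((p : ℤ) - q) u := fun c v hc => by
  have h0 : c ≠ 0 := by rintro rfl; simp at hc
  rw [h.2, ← Complex.inv_eq_conj hc, zpow_sub₀ h0, zpow_natCast, zpow_natCast, inv_pow,
    div_eq_mul_inv]

/-- `u` is annihilated by interior products with `(1, 0)`-parts of vectors of `W`. -/
def AnnihilatedBy (W : Submodule ℂ E) : ∀ {k : ℕ}, (E [⋀^Fin k]→L[ℝ] F) → Prop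
  | 0, _ => True
  | _ + 1, u => ∀ w ∈ W, contrPart 1 w u = 0

lemma contrPart_add_left (s : ℝ) (a b : E) (u : E [⋀^Fin (k + 1)]→L[ℝ] F) :
    contrPart s (a + b) u = contrPart s a u + contrPart s b u := map_add (typePart s _) a b

lemma contrPart_one_smul (c : ℂ) (b : E) (u : E [⋀^Fin (k + 1)]→L[ℝ] F) :
    contrPart 1 (c • b) u = c • contrPart 1 b u := by
  rw [contrPart, typePart_one, part10_apply_smul, ← typePart_one, ← contrPart]

lemma contrPart_neg_one_smul (c : ℂ) (b : E) (u : E [⋀^Fin (k + 1)]→L[ℝ] F) :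
    contrPart (-1) (c • b) u = (starRingEnd ℂ c) • contrPart (-1) b u := by
  rw [contrPart, typePart_neg_one, part01_apply_smul, ← typePart_neg_one, ← contrPart]

lemma contrPart_swap (s t : ℝ) (a b : E) (u : E [⋀^Fin (k + 2)]→L[ℝ] F) :
    contrPart s a (contrPart t b u) = -contrPart t b (contrPart s a u) := by
  simp only [contrPart_eq, map_sub, contr_smul, smul_sub]
  rw [contr_swap a b, contr_swap a (cplxJ E b), contr_swap (cplxJ E a) b,
    contr_swap (cplxJ E a) (cplxJ E b)]
  module

lemma contrPart_apply_smul (s : ℝ) {m : ℤ} {u : E [⋀^Fin (k + 1)]→L[ℝ] F} (hu : HasWeight m u)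
    (b : E) (c : ℂ) (v : Fin k → E) (hc : ‖c‖ = 1) :
    contrPart s (c • b) u (fun i => c • v i) = c ^ m • contrPart s b u v := by
  have h : ∀ b : E, contr (c • b) u (fun i => c • v i) = c ^ m • contr b u v := fun b => by
    rw [contr_apply_apply, contr_apply_apply, ← hu c _ hc]
    congr 1
    funext i
    refine Fin.cases ?_ (fun i => ?_) i <;> simp
  simp only [contrPart_eq, ContinuousAlternatingMap.smul_apply, ContinuousAlternatingMap.sub_apply,
    cplxJ_apply, smul_comm Complex.I c b, h]
  module

lemma HasWeight.contrPart_one {m : ℤ} {u : E [⋀^Fin (k + 1)]→L[ℝ] F} (hu : HasWeight m u) (b : E) :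
    HasWeight (m - 1) (contrPart 1 b u) := fun c v hc => by
  have h0 : c ≠ 0 := by rintro rfl; simp at hc
  have h := contrPart_apply_smul 1 hu b c v hc
  rw [contrPart_one_smul, ContinuousAlternatingMap.smul_apply] at h
  rw [zpow_sub_one₀ h0, mul_comm, mul_smul, ← h, smul_smul, inv_mul_cancel₀ h0, one_smul]

lemma HasWeight.contrPart_neg_one {m : ℤ} {u : E [⋀^Fin (k + 1)]→L[ℝ] F} (hu : HasWeight m u)
    (b : E) : HasWeight (m + 1) (contrPart (-1) b u) := fun c v hc => by
  have h0 : c ≠ 0 := by rintro rfl; simp at hc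
  have h := contrPart_apply_smul (-1) hu b c v hc
  rw [contrPart_neg_one_smul, ContinuousAlternatingMap.smul_apply, ← Complex.inv_eq_conj hc] at h
  rw [zpow_add_one₀ h0, mul_comm, mul_smul, ← h, smul_smul, mul_inv_cancel₀ h0, one_smul]

lemma AnnihilatedBy.contrPart {W : Submodule ℂ E} {u : E [⋀^Fin (k + 1)]→L[ℝ] F}
    (hu : AnnihilatedBy W u) (s : ℝ) (b : E) : AnnihilatedBy W (contrPart s b u) := by
  cases k with
  | zero => trivial
  | succ k =>
    intro w hw
    have h : TwistedBKN.contrPart s b (TwistedBKN.contrPart 1 w u) = 0 := by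
      rw [hu w hw]; simp [contrPart_eq]
    rw [contrPart_swap, h, neg_zero]

lemma contrPart_one_add_neg_one (b : E) (u : E [⋀^Fin (k + 1)]→L[ℝ] F) :
    contrPart 1 b u + contrPart (-1) b u = contr b u := by
  rw [contrPart_eq, contrPart_eq]
  push_cast
  module

/-- For type `(p, q)` one has `k + m = 2 p`, so the bound says that `p` exceeds the codimension of
`W`. Induction on the degree shows that every contraction `ι_b u` vanishes. Its `(0, 1)`-part keeps
`k + m`. Its `(1, 0)`-part lowers `k + m` by two, but it vanishes if `b ∈ W`, and otherwise it is
annihilated by the larger space `W + ℂ b`, so the bound persists. In degree zero the bound forces a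
positive weight, which a nonzero constant cannot have. -/
lemma eq_zero_of_hasWeight [FiniteDimensional ℂ E] : ∀ {k : ℕ} (u : E [⋀^Fin k]→L[ℝ] F) (m : ℤ)
    (W : Submodule ℂ E), HasWeight m u → AnnihilatedBy W u →
    2 * ((Module.finrank ℂ E : ℤ) - Module.finrank ℂ W) < k + m → u = 0 := by
  intro k
  induction k with
  | zero =>
    intro u m W hu _ hlt
    have hW := Submodule.finrank_le W
    have hm : 0 < m := by push_cast at hlt; omega
    ext v
    obtain ⟨m, rfl⟩ := Int.eq_ofNat_of_zero_le hm.le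
    have hm : m ≠ 0 := by omega
    -- The choice `c = exp (i π / m)` gives `c ^ m = -1`.
    obtain ⟨c, hc, hne⟩ : ∃ c : ℂ, ‖c‖ = 1 ∧ c ^ m ≠ 1 := by
      refine ⟨Complex.exp ((Real.pi / m : ℝ) * Complex.I), Complex.norm_exp_ofReal_mul_I _, ?_⟩
      rw [← Complex.exp_nat_mul]
      have : (m : ℂ) * ((Real.pi / m : ℝ) * Complex.I) = Real.pi * Complex.I := by
        push_cast
        field_simp
      rw [this, Complex.exp_pi_mul_I]
      norm_num
    have h := hu c v hc
    rw [Subsingleton.elim (fun i => c • v i) v, zpow_natCast] at h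
    have h2 : (c ^ m - 1) • u v = 0 := by rw [sub_smul, one_smul, ← h, sub_self]
    rcases smul_eq_zero.mp h2 with h3 | h3
    · exact absurd (sub_eq_zero.mp h3) hne
    · simpa using h3
  | succ k ih =>
    intro u m W hu hW hlt
    have key : ∀ b, contr b u = 0 := fun b => by
      have h1 : contrPart (-1) b u = 0 :=
        ih _ (m + 1) W (hu.contrPart_neg_one b) (hW.contrPart _ b) (by push_cast at hlt; omega)
      have h2 : contrPart 1 b u = 0 := by
        by_cases hb : b ∈ W
        · exact hW b hb
        refine ih _ (m - 1) (W ⊔ Submodule.span ℂ {b}) (hu.contrPart_one b) ?_ ?_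
        · cases k with
          | zero => trivial
          | succ k =>
            -- Contractions anticommute, so contracting twice with the same vector gives zero. This
            -- is what allows `b` to be added to the annihilating subspace.
            have hbb : contrPart 1 b (contrPart 1 b u) = 0 := by
              have h := contrPart_swap 1 1 b b u
              rw [eq_neg_iff_add_eq_zero, ← two_smul ℝ] at h
              exact (smul_eq_zero.mp h).resolve_left two_ne_zero
            intro w hw
            obtain ⟨w', hw', z, hz, rfl⟩ := Submodule.mem_sup.mp hw
            obtain ⟨c, rfl⟩ := Submodule.mem_span_singleton.mp hz
            rw [contrPart_add_left, contrPart_one_smul, hbb, smul_zero, add_zero]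
            exact hW.contrPart 1 b w' hw'
        · have hlt' : W < W ⊔ Submodule.span ℂ {b} := by
            refine lt_of_le_of_ne le_sup_left fun h => hb ?_
            rw [h]
            exact Submodule.mem_sup_right (Submodule.mem_span_singleton_self b)
          have := Submodule.finrank_lt_finrank_of_lt hlt'
          push_cast at hlt
          omega
      rw [← contrPart_one_add_neg_one, h1, h2, add_zero]
    ext v
    have h := congrArg (fun w => w (Fin.tail v)) (key (v 0))
    simp only [contr_apply_apply] at h
    have e : Matrix.vecCons (v 0) (Fin.tail v) = v := Fin.cons_self_tail v
    rw [e] at h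
    simpa using h

/-- There are no nonzero forms of type `(p, q)` with `p` larger than the dimension. -/
lemma IsOfType.eq_zero [FiniteDimensional ℂ E] {p q : ℕ} {u : E [⋀^Fin k]→L[ℝ] F}
    (h : IsOfType p q u) (hp : Module.finrank ℂ E < p) : u = 0 := by
  refine eq_zero_of_hasWeight u _ ⊥ h.hasWeight ?_ ?_
  · cases k with
    | zero => trivial
    | succ k =>
      intro w hw
      rw [(Submodule.mem_bot ℂ).mp hw]
      exact map_zero (typePart 1 u.curryLeft)
  · rw [finrank_bot, ← h.1]
    push_cast
    omega

end Types

noncomputable section LocalMetric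

open ContinuousAlternatingMap (alternatizeUncurryFin alternatizeUncurryFinCLM
  alternatizeUncurryFin_apply alternatizeUncurryFin_add alternatizeUncurryFin_smul curryLeftLI
  alternatizeUncurryFin_fderivCompContinuousLinearMap_eq_zero
  fderivCompContinuousLinearMap_apply fderivCompContinuousLinearMap_of_isEmpty)

variable {E : Type*} [NormedAddCommGroup E] [NormedSpace ℂ E]
  {F : Type*} [NormedAddCommGroup F] [NormedSpace ℂ F] {k : ℕ}

/-! ### The action of endomorphisms on forms by derivations -/

/-- The action of an endomorphism on forms by derivations:
`(act K u) (v₁, …, v_k) = ∑ i, u (v₁, …, K v_i, …, v_k)`. -/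
def act (K : E →L[ℝ] E) (u : E [⋀^Fin k]→L[ℝ] F) : E [⋀^Fin k]→L[ℝ] F :=
  u.fderivCompContinuousLinearMap (ContinuousLinearMap.id ℝ E) K

lemma act_apply (K : E →L[ℝ] E) (u : E [⋀^Fin k]→L[ℝ] F) (v : Fin k → E) :
    act K u v = ∑ i, u (Function.update v i (K (v i))) := by
  rw [act, fderivCompContinuousLinearMap_apply]
  refine Finset.sum_congr rfl fun i _ => ?_
  congr 1
  funext j
  rcases eq_or_ne j i with rfl | h <;> simp [*]

lemma act_zero_form (K : E →L[ℝ] E) (u : E [⋀^Fin 0]→L[ℝ] F) : act K u = 0 := by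
  ext v; simp [act_apply]

lemma act_add (K : E →L[ℝ] E) (u v : E [⋀^Fin k]→L[ℝ] F) : act K (u + v) = act K u + act K v := by
  ext m; simp [act_apply, Finset.sum_add_distrib]

lemma act_smul (K : E →L[ℝ] E) (c : ℂ) (u : E [⋀^Fin k]→L[ℝ] F) :
    act K (c • u) = c • act K u := by
  ext m; simp [act_apply, Finset.smul_sum]

lemma act_sub (K : E →L[ℝ] E) (u v : E [⋀^Fin k]→L[ℝ] F) : act K (u - v) = act K u - act K v := by
  ext m; simp [act_apply, Finset.sum_sub_distrib]

lemma act_sum {ι : Type*} (s : Finset ι) (K : E →L[ℝ] E) (u : ι → E [⋀^Fin k]→L[ℝ] F) :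
    act K (∑ i ∈ s, u i) = ∑ i ∈ s, act K (u i) :=
  map_sum (AddMonoidHom.mk' (act (F := F) (k := k) K) (act_add K)) u s

lemma contr_act (a : E) (K : E →L[ℝ] E) (u : E [⋀^Fin (k + 1)]→L[ℝ] F) :
    contr a (act K u) = contr (K a) u + act K (contr a u) := by
  ext m
  rw [contr_apply_apply, act_apply, Fin.sum_univ_succ, ContinuousAlternatingMap.add_apply, act_apply,
    contr_apply_apply]
  congr 1
  · congr 1
    funext j
    refine Fin.cases ?_ (fun j => ?_) j <;> simp
  · refine Finset.sum_congr rfl fun i _ => ?_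
    rw [contr_apply_apply]
    congr 1
    funext j
    refine Fin.cases ?_ (fun j => ?_) j
    · simp [Function.update_of_ne (Fin.succ_ne_zero i).symm]
    · rcases eq_or_ne j i with rfl | h
      · simp
      · rw [Function.update_of_ne (by simpa using h)]
        simp [h]

/-- Symmetric Christoffel symbols, that is a torsion free connection, contribute nothing to an
exterior derivative. -/
lemma alternatize_act (u : E [⋀^Fin k]→L[ℝ] F) (Gam : E →L[ℝ] E →L[ℝ] E)
    (h : ∀ v w, Gam v w = Gam w v) :
    alternatizeUncurryFin (u.fderivCompContinuousLinearMap (ContinuousLinearMap.id ℝ E) ∘L Gam) =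
      0 :=
  alternatizeUncurryFin_fderivCompContinuousLinearMap_eq_zero u _ h

/-- If `Gam` is symmetric and complex linear in one argument, then it is complex bilinear and `Gam ∘
J` is symmetric again. Hence both halves of the type decomposition vanish after alternation. This is
where the Kähler condition, rather than mere absence of torsion, is needed. -/
lemma alternatize_typePart_act (s : ℝ) (u : E [⋀^Fin k]→L[ℝ] F) (Gam : E →L[ℝ] E →L[ℝ] E)
    (h : ∀ v w, Gam v w = Gam w v) (hJ : ∀ v w, Gam v (cplxJ E w) = cplxJ E (Gam v w)) :
    alternatizeUncurryFin (typePart s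
      (u.fderivCompContinuousLinearMap (ContinuousLinearMap.id ℝ E) ∘L Gam)) = 0 := by
  rw [typePart, alternatizeUncurryFin_smul, alternatize_sub, alternatizeUncurryFin_smul,
    ContinuousLinearMap.comp_assoc, alternatize_act u Gam h, alternatize_act u (Gam ∘L cplxJ E)]
  · simp
  · intro v w
    simp only [ContinuousLinearMap.comp_apply]
    rw [h, hJ, h, ← hJ, h]

/-- The covariant derivative of a form with value `u` and derivative `u'` at a point, for the
connection form `A` and the Christoffel symbols `Gam`. -/
def nabla (Gam : E →L[ℝ] E →L[ℝ] E) (A : E →L[ℝ] ℂ) (u : E [⋀^Fin k]→L[ℝ] F)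
    (u' : E →L[ℝ] E [⋀^Fin k]→L[ℝ] F) : E →L[ℝ] E [⋀^Fin k]→L[ℝ] F :=
  u' + A.smulRight u - u.fderivCompContinuousLinearMap (ContinuousLinearMap.id ℝ E) ∘L Gam

lemma nabla_apply (Gam : E →L[ℝ] E →L[ℝ] E) (A : E →L[ℝ] ℂ) (u : E [⋀^Fin k]→L[ℝ] F)
    (u' : E →L[ℝ] E [⋀^Fin k]→L[ℝ] F) (w : E) :
    nabla Gam A u u' w = u' w + A w • u - act (Gam w) u := rfl

/-- Consequently `∂` and `∂̄` may be computed from the covariant derivative, which is compatible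
with the metric, instead of from `d + A`. -/
lemma alternatize_typePart_nabla (s : ℝ) {Gam : E →L[ℝ] E →L[ℝ] E}
    (h : ∀ v w, Gam v w = Gam w v) (hJ : ∀ v w, Gam v (cplxJ E w) = cplxJ E (Gam v w))
    (A : E →L[ℝ] ℂ) (u : E [⋀^Fin k]→L[ℝ] F) (u' : E →L[ℝ] E [⋀^Fin k]→L[ℝ] F) :
    alternatizeUncurryFin (typePart s (nabla Gam A u u')) =
      alternatizeUncurryFin (typePart s (u' + A.smulRight u)) := by
  have e : typePart s (u' + A.smulRight u) = typePart s (nabla Gam A u u') + typePart s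
      (u.fderivCompContinuousLinearMap (ContinuousLinearMap.id ℝ E) ∘L Gam) := by
    rw [← typePart_add, nabla, sub_add_cancel]
  rw [e, alternatizeUncurryFin_add, alternatize_typePart_act s u Gam h hJ, add_zero]

lemma contrPart_act (s : ℝ) (a : E) {K : E →L[ℝ] E} (hK : ∀ v, K (cplxJ E v) = cplxJ E (K v))
    (u : E [⋀^Fin (k + 1)]→L[ℝ] F) :
    contrPart s a (act K u) = contrPart s (K a) u + act K (contrPart s a u) := by
  simp only [contrPart_eq, contr_act, act_smul, act_sub, hK]
  module

/-! ### Traces and inverse metrics -/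

variable [FiniteDimensional ℂ E]

variable (E) in
/-- A fixed real basis. -/
def realBasis : Module.Basis (Fin (Module.finrank ℝ E)) ℝ E := Module.finBasis ℝ E

/-- The coordinate functionals of the fixed real basis. -/
def dualVec (i : Fin (Module.finrank ℝ E)) : E →L[ℝ] ℝ :=
  LinearMap.toContinuousLinearMap ((realBasis E).coord i)

lemma sum_dualVec_smul (v : E) : ∑ i, dualVec i v • realBasis E i = v :=
  (realBasis E).sum_repr v

lemma sum_apply_dualVec (φ : E →L[ℝ] ℝ) : ∑ i, φ (realBasis E i) • dualVec i = φ := by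
  ext v
  conv_rhs => rw [← sum_dualVec_smul v, map_sum]
  simp [mul_comm]

/-- The canonical element `∑ e_i ⊗ e^i` is invariant under endomorphisms. This cancels the
Christoffel terms that arise when an expression contracted over a fixed basis and its dual is
differentiated. -/
lemma sum_dual_comp {W : Type*} [AddCommGroup W] [Module ℝ W] (K : E →L[ℝ] E)
    (B : E →ₗ[ℝ] (E →L[ℝ] ℝ) →ₗ[ℝ] W) :
    ∑ i, B (K (realBasis E i)) (dualVec i) = ∑ i, B (realBasis E i) (dualVec i ∘L K) := by
  have h1 : ∀ i, B (K (realBasis E i)) (dualVec i) =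
      ∑ j, dualVec j (K (realBasis E i)) • B (realBasis E j) (dualVec i) := fun i => by
    conv_lhs => rw [← sum_dualVec_smul (K (realBasis E i))]
    simp
  have h2 : ∀ i, B (realBasis E i) (dualVec i ∘L K) =
      ∑ j, dualVec i (K (realBasis E j)) • B (realBasis E i) (dualVec j) := fun i => by
    conv_lhs => rw [← sum_apply_dualVec (dualVec i ∘L K)]
    simp
  simp only [h1, h2]
  exact Finset.sum_comm

/-- The trace of an endomorphism. -/
def realTrace (K : E →L[ℝ] E) : ℝ := ∑ i, dualVec i (K (realBasis E i))

/-- The inverse of a metric, as a map from covectors to vectors. -/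
def sharp (G : E →L[ℝ] E →L[ℝ] ℝ) : (E →L[ℝ] ℝ) →L[ℝ] E := ContinuousLinearMap.inverse G

section Frame

variable {G : E →L[ℝ] E →L[ℝ] ℝ} {f : Module.Basis (Fin (Module.finrank ℝ E)) ℝ E}
  (hf : IsOrthonormalFrame G f) (hG : ∀ v w, G v w = G w v)

include hf hG

lemma IsOrthonormalFrame.apply_sum (φ : E →L[ℝ] ℝ) : G (∑ a, φ (f a) • f a) = φ := by
  refine ContinuousLinearMap.coe_injective (f.ext fun b => ?_)
  have h := fun a => hf a b
  classical
  simp [h]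

lemma IsOrthonormalFrame.isInvertible : G.IsInvertible := by
  refine ⟨ContinuousLinearEquiv.equivOfInverse G
    (∑ a, (ContinuousLinearMap.apply ℝ ℝ (f a)).smulRight (f a)) (fun v => ?_) (fun φ => ?_), rfl⟩
  · simpa using hf.sum_apply_smul v
  · simpa using hf.apply_sum hG φ

lemma IsOrthonormalFrame.sharp_apply (φ : E →L[ℝ] ℝ) : sharp G φ = ∑ a, φ (f a) • f a := by
  rw [sharp, ← hf.apply_sum hG φ, (hf.isInvertible hG).inverse_apply_self]
  simp only [hf.apply_sum hG φ]

/-- A trace over an orthonormal frame in terms of the inverse metric. -/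
lemma IsOrthonormalFrame.sum_sharp {W : Type*} [AddCommGroup W] [Module ℝ W]
    (B : E →ₗ[ℝ] E →ₗ[ℝ] W) :
    ∑ i, B (realBasis E i) (sharp G (dualVec i)) = ∑ a, B (f a) (f a) := by
  simp only [hf.sharp_apply hG, map_sum, map_smul]
  rw [Finset.sum_comm]
  refine Finset.sum_congr rfl fun a _ => ?_
  conv_rhs => enter [1]; rw [← sum_dualVec_smul (f a)]
  simp

end Frame

lemma exists_isOrthonormalFrame {G : E →L[ℝ] E →L[ℝ] ℝ} (hG : ∀ v w, G v w = G w v)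
    (hpos : ∀ v, v ≠ 0 → 0 < G v v) :
    ∃ f : Module.Basis (Fin (Module.finrank ℝ E)) ℝ E, IsOrthonormalFrame G f := by
  classical
  obtain ⟨f, hf⟩ := exists_orthonormal_basis (fun v w : E => G v w) (fun u v w => by simp)
    (fun c u v => by simp) hG hpos
  exact ⟨f, fun a b => by rw [hf]; congr⟩

/-- The derivative of the inverse metric, when the derivative of the metric is given by Christoffel
symbols. -/
lemma hasFDerivAt_sharp {G : E → E →L[ℝ] E →L[ℝ] ℝ} {G' : E →L[ℝ] E →L[ℝ] E →L[ℝ] ℝ} {y : E}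
    (hG : HasFDerivAt G G' y) (hinv : (G y).IsInvertible) {Gam : E →L[ℝ] E →L[ℝ] E}
    (hGam : ∀ w a b, G' w a b = G y (Gam w a) b + G y a (Gam w b)) :
    ∃ S' : E →L[ℝ] (E →L[ℝ] ℝ) →L[ℝ] E, HasFDerivAt (fun z => sharp (G z)) S' y ∧
      ∀ w φ, S' w φ = -Gam w (sharp (G y) φ) - sharp (G y) (φ ∘L Gam w) := by
  have hd : DifferentiableAt ℝ (fun z => sharp (G z)) y :=
    (hinv.contDiffAt_map_inverse (n := 1)).differentiableAt one_ne_zero |>.comp y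
      hG.differentiableAt
  refine ⟨_, hd.hasFDerivAt, fun w φ => ?_⟩
  have hev : ∀ᶠ z in nhds y, (G z).IsInvertible := by
    obtain ⟨e, he⟩ := hinv
    have h := (ContinuousLinearEquiv.nhds e)
    rw [he] at h
    filter_upwards [hG.continuousAt.eventually h] with z hz
    obtain ⟨e', he'⟩ := hz
    exact ⟨e', he'⟩
  have h1 : HasFDerivAt (fun z => G z (sharp (G z) φ)) _ y :=
    hG.clm_apply (hd.hasFDerivAt.clm_apply (hasFDerivAt_const φ y))
  -- Invertibility is an open condition, so `G z (sharp (G z) φ) = φ` near `y`. Differentiating this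
  -- product determines the derivative of the inverse.
  have h2 : HasFDerivAt (fun z => G z (sharp (G z) φ)) (0 : E →L[ℝ] E →L[ℝ] ℝ) y :=
    (hasFDerivAt_const φ y).congr_of_eventuallyEq
      (hev.mono fun z hz => hz.self_apply_inverse φ)
  have h3 := congrArg (fun T => T w) (h1.unique h2)
  simp at h3
  have h4 : G' w (sharp (G y) φ) = G y (Gam w (sharp (G y) φ)) + φ ∘L Gam w := by
    ext b
    rw [hGam]
    simp [sharp, hinv.self_apply_inverse]
  have h5 := congrArg (sharp (G y)) h3
  rw [h4] at h5
  simp only [map_add, map_zero, sharp, hinv.inverse_apply_self] at h5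
  change (fderiv ℝ (fun z => ContinuousLinearMap.inverse (G z)) y w) φ = _
  rw [sharp]
  rw [← sub_eq_zero, ← h5]; abel

end LocalMetric

noncomputable section LocalKaehler

open ContinuousAlternatingMap (alternatizeUncurryFin alternatizeUncurryFinCLM
  alternatizeUncurryFin_apply alternatizeUncurryFin_add alternatizeUncurryFin_smul curryLeftLI)

variable {E : Type*} [NormedAddCommGroup E] [NormedSpace ℂ E] [FiniteDimensional ℂ E]
  {F : Type*} [NormedAddCommGroup F] [NormedSpace ℂ F] {k : ℕ}

/-! ### Christoffel symbols of a Kähler metric -/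

/-- `Gam` are Christoffel symbols at a point for a Hermitian metric with value `G` and derivative
`G'` at this point: they are symmetric, complex bilinear and compatible with the metric. -/
structure IsChristoffel (G : E →L[ℝ] E →L[ℝ] ℝ) (G' : E →L[ℝ] E →L[ℝ] E →L[ℝ] ℝ)
    (Gam : E →L[ℝ] E →L[ℝ] E) : Prop where
  symm : ∀ v w, Gam v w = Gam w v
  cplxJ : ∀ v w, Gam v (cplxJ E w) = cplxJ E (Gam v w)
  compat : ∀ w a b, G' w a b = G (Gam w a) b + G a (Gam w b)

/-- The closedness of the fundamental form provides complex bilinear Christoffel symbols. -/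
lemma exists_isChristoffel {G : E →L[ℝ] E →L[ℝ] ℝ} {G' : E →L[ℝ] E →L[ℝ] E →L[ℝ] ℝ}
    (hinv : G.IsInvertible) (hG : ∀ v w, G v w = G w v)
    (hJ : ∀ v w, G (cplxJ E v) (cplxJ E w) = G v w)
    (hG' : ∀ w a b, G' w a b = G' w b a)
    (hJ' : ∀ w a b, G' w (cplxJ E a) (cplxJ E b) = G' w a b)
    (hclosed : ∀ a b c, G' a (cplxJ E b) c + G' b (cplxJ E c) a + G' c (cplxJ E a) b = 0) :
    ∃ Gam, IsChristoffel G G' Gam := by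
  have hinj : ∀ v w, (∀ z, G v z = G w z) → v = w := fun v w h => by
    rw [← hinv.inverse_apply_self v, ← hinv.inverse_apply_self w]
    congr 1
    ext z
    exact h z
  have hJl : ∀ w a b, G' w (cplxJ E a) b = -G' w a (cplxJ E b) := fun w a b => by
    rw [← hJ' w (cplxJ E a) b, cplxJ_cplxJ]
    simp
  let G₁ : E →L[ℝ] E →L[ℝ] E →L[ℝ] ℝ := G'.flip
  let G₂ : E →L[ℝ] E →L[ℝ] E →L[ℝ] ℝ :=
    (ContinuousLinearMap.flipₗᵢ ℝ E E ℝ).toContinuousLinearEquiv.toContinuousLinearMap ∘L G'.flip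
  -- The Koszul formula for the Levi-Civita connection in coordinates; `Gam` is obtained by raising
  -- the last index.
  let K : E →L[ℝ] E →L[ℝ] E →L[ℝ] ℝ := (1 / 2 : ℝ) • (G' + G₁ - G₂)
  have hK : ∀ v w z, K v w z = (1 / 2 : ℝ) * (G' v w z + G' w v z - G' z v w) := fun v w z => rfl
  let Gam : E →L[ℝ] E →L[ℝ] E := ContinuousLinearMap.compL ℝ E (E →L[ℝ] ℝ) E G.inverse ∘L K
  have hGam : ∀ v w z, G (Gam v w) z = (1 / 2 : ℝ) * (G' v w z + G' w v z - G' z v w) :=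
    fun v w z => by
      rw [← hK]
      exact congrArg (fun φ => φ z) (hinv.self_apply_inverse (K v w))
  refine ⟨Gam, fun v w => hinj _ _ fun z => ?_, fun v w => hinj _ _ fun z => ?_, fun w a b => ?_⟩
  · rw [hGam, hGam, hG' z]
    ring
  · rw [metric_cplxJ_left hJ, hGam, hGam]
    -- Complex linearity is a linear consequence of these two instances of closedness together with
    -- the symmetries that `G'` inherits from `G`.
    have h1 := hclosed (cplxJ E w) (cplxJ E v) z
    have h2 := hclosed w (cplxJ E v) (cplxJ E z)
    simp only [cplxJ_cplxJ, map_neg, neg_apply] at h1 h2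
    have e1 := hJl v w z
    have e2 := hJl z w v
    have e3 := hJ' (cplxJ E z) w v
    have e4 := hJl (cplxJ E v) z (cplxJ E w)
    have e5 := hJl (cplxJ E v) (cplxJ E z) w
    simp only [cplxJ_cplxJ, map_neg, neg_apply] at e4 e5
    have s1 := hG' (cplxJ E w) v z
    have s2 := hG' z v (cplxJ E w)
    have s3 := hG' w v (cplxJ E z)
    have s4 := hG' (cplxJ E z) v w
    have s5 := hG' (cplxJ E v) z w
    linarith
  · rw [hGam, hG a, hGam, hG' w b a]
    ring

/-! ### The inner product of forms in terms of the inverse metric -/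

/-- The inner product of complex valued forms for the inverse metric `S`. -/
def formInner (S : (E →L[ℝ] ℝ) →L[ℝ] E) :
    ∀ {k : ℕ}, (E [⋀^Fin k]→L[ℝ] ℂ) → (E [⋀^Fin k]→L[ℝ] ℂ) → ℂ
  | 0, u, v => inner ℂ (v 0) (u 0)
  | k + 1, u, v => ((k : ℂ) + 1)⁻¹ * ∑ i, formInner S (contr (realBasis E i) u)
      (contr (S (dualVec i)) v)

lemma coe_smul_form (c : ℝ) (u : E [⋀^Fin k]→L[ℝ] F) : (c : ℂ) • u = c • u := by
  ext m; simp

section FormInner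

variable (S : (E →L[ℝ] ℝ) →L[ℝ] E)

lemma formInner_add_left : ∀ {k : ℕ} (u u' v : E [⋀^Fin k]→L[ℝ] ℂ),
    formInner S (u + u') v = formInner S u v + formInner S u' v := by
  intro k
  induction k with
  | zero => intro u u' v; simp [formInner, add_mul]
  | succ k ih => intro u u' v; simp [formInner, ih, Finset.sum_add_distrib, mul_add]

lemma formInner_add_right : ∀ {k : ℕ} (u v v' : E [⋀^Fin k]→L[ℝ] ℂ),
    formInner S u (v + v') = formInner S u v + formInner S u v' := by
  intro k
  induction k with
  | zero => intro u v v'; simp [formInner, mul_add]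
  | succ k ih => intro u v v'; simp [formInner, ih, Finset.sum_add_distrib, mul_add]

lemma formInner_smul_left : ∀ {k : ℕ} (c : ℂ) (u v : E [⋀^Fin k]→L[ℝ] ℂ),
    formInner S (c • u) v = c * formInner S u v := by
  intro k
  induction k with
  | zero => intro c u v; simp [formInner]; ring
  | succ k ih => intro c u v; simp [formInner, ih, contr_smul, ← Finset.mul_sum]; ring

lemma formInner_smul_right : ∀ {k : ℕ} (c : ℂ) (u v : E [⋀^Fin k]→L[ℝ] ℂ),
    formInner S u (c • v) = (starRingEnd ℂ) c * formInner S u v := by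
  intro k
  induction k with
  | zero => intro c u v; simp [formInner]; ring
  | succ k ih => intro c u v; simp [formInner, ih, contr_smul, ← Finset.mul_sum]; ring

/-- `formInner` as a real bilinear map. -/
def formInnerBilin : (E [⋀^Fin k]→L[ℝ] ℂ) →ₗ[ℝ] (E [⋀^Fin k]→L[ℝ] ℂ) →ₗ[ℝ] ℂ :=
  LinearMap.mk₂ ℝ (formInner S) (formInner_add_left S)
    (fun c u v => by
      have h := formInner_smul_left S (c : ℂ) u v
      rwa [coe_smul_form, ← Complex.real_smul] at h)
    (formInner_add_right S)
    (fun c u v => by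
      have h := formInner_smul_right S (c : ℂ) u v
      rwa [coe_smul_form, Complex.conj_ofReal, ← Complex.real_smul] at h)

lemma formInnerBilin_apply (u v : E [⋀^Fin k]→L[ℝ] ℂ) :
    formInnerBilin S u v = formInner S u v := rfl

lemma formInner_sub_left (u u' v : E [⋀^Fin k]→L[ℝ] ℂ) :
    formInner S (u - u') v = formInner S u v - formInner S u' v := by
  simp [← formInnerBilin_apply]

lemma formInner_sub_right (u v v' : E [⋀^Fin k]→L[ℝ] ℂ) :
    formInner S u (v - v') = formInner S u v - formInner S u v' := by
  simp [← formInnerBilin_apply]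

lemma formInner_neg_right (u v : E [⋀^Fin k]→L[ℝ] ℂ) :
    formInner S u (-v) = -formInner S u v := by
  simp [← formInnerBilin_apply]

lemma formInner_sum_right {ι : Type*} (s : Finset ι) (u : E [⋀^Fin k]→L[ℝ] ℂ)
    (v : ι → E [⋀^Fin k]→L[ℝ] ℂ) : formInner S u (∑ i ∈ s, v i) = ∑ i ∈ s, formInner S u (v i) := by
  simp [← formInnerBilin_apply]

end FormInner

/-- The vector argument of an interior product, as a linear map. -/
def contrLin (u : E [⋀^Fin (k + 1)]→L[ℝ] F) : E →ₗ[ℝ] E [⋀^Fin k]→L[ℝ] F :=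
  (u.curryLeft : E →ₗ[ℝ] E [⋀^Fin k]→L[ℝ] F)

lemma contrLin_apply (u : E [⋀^Fin (k + 1)]→L[ℝ] F) (a : E) : contrLin u a = contr a u := rfl

section Frame

variable {G : E →L[ℝ] E →L[ℝ] ℝ} {f : Module.Basis (Fin (Module.finrank ℝ E)) ℝ E}
  (hf : IsOrthonormalFrame G f) (hG : ∀ v w, G v w = G w v)

include hf hG

/-- The inner product is defined with a fixed basis and the inverse metric because this expression
is smooth in the point, whereas orthonormal frames are chosen pointwise. At a single point one may
still compute in an orthonormal frame. -/
lemma IsOrthonormalFrame.formInner_succ (u v : E [⋀^Fin (k + 1)]→L[ℝ] ℂ) :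
    formInner (sharp G) u v = ((k : ℂ) + 1)⁻¹ *
      ∑ a, formInner (sharp G) (contr (f a) u) (contr (f a) v) := by
  have h := hf.sum_sharp hG ((formInnerBilin (sharp G)).compl₁₂ (contrLin u) (contrLin v))
  simp only [LinearMap.compl₁₂_apply, contrLin_apply, formInnerBilin_apply] at h
  rw [formInner, h]

/-- The inner product of forms, computed in an orthonormal frame. -/
lemma IsOrthonormalFrame.formInner_eq : ∀ {k : ℕ} (u v : E [⋀^Fin k]→L[ℝ] ℂ),
    formInner (sharp G) u v = ((k.factorial : ℂ))⁻¹ *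
      ∑ a : Fin k → Fin (Module.finrank ℝ E), inner ℂ (v fun i => f (a i)) (u fun i => f (a i)) := by
  intro k
  induction k with
  | zero =>
    intro u v
    rw [formInner]
    simp only [Nat.factorial_zero, Nat.cast_one, inv_one, one_mul, Finset.univ_unique,
      Finset.sum_singleton]
    congr 2 <;> exact Subsingleton.elim _ _
  | succ k ih =>
    intro u v
    rw [hf.formInner_succ hG]
    simp only [ih]
    rw [← Finset.mul_sum, ← mul_assoc, ← mul_inv, Nat.factorial_succ]
    push_cast
    congr 1
    rw [← Fintype.sum_prod_type', ← (Fin.consEquiv (fun _ => Fin (Module.finrank ℝ E))).sum_comp]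
    refine Finset.sum_congr rfl fun p _ => ?_
    have h1 : (fun j => f (Fin.consEquiv (fun _ => Fin (Module.finrank ℝ E)) p j)) =
        Matrix.vecCons (f p.1) fun j => f (p.2 j) := by
      funext j
      refine Fin.cases ?_ (fun j => ?_) j <;> simp [Fin.consEquiv]
    rw [contr_apply_apply, contr_apply_apply, h1]

/-- The adjoint of alternatization is given by interior products. -/
lemma IsOrthonormalFrame.formInner_alternatize : ∀ {k : ℕ} (T : E →L[ℝ] E [⋀^Fin k]→L[ℝ] ℂ)
    (v : E [⋀^Fin (k + 1)]→L[ℝ] ℂ), formInner (sharp G) (alternatizeUncurryFin T) v =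
      ∑ a, formInner (sharp G) (T (f a)) (contr (f a) v) := by
  intro k
  induction k with
  | zero =>
    intro T v
    rw [hf.formInner_succ hG]
    simp [contr_alternatize_zero]
  | succ k ih =>
    intro T v
    rw [hf.formInner_succ hG]
    -- By induction and anticommutation, the correction terms `alt (ι_a ∘ T)` sum up to `k + 1`
    -- further copies of the desired trace. The total of `k + 2` copies cancels the normalizing
    -- factor.
    have h1 : ∀ a, formInner (sharp G) (alternatizeUncurryFin (contr (f a) ∘L T)) (contr (f a) v) =
        -∑ c, formInner (sharp G) (contr (f a) (T (f c))) (contr (f a) (contr (f c) v)) :=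
      fun a => by
        rw [ih, ← Finset.sum_neg_distrib]
        refine Finset.sum_congr rfl fun c _ => ?_
        rw [contr_swap (f c), formInner_neg_right]
        rfl
    have h2 : ∀ c, ∑ a, formInner (sharp G) (contr (f a) (T (f c))) (contr (f a) (contr (f c) v)) =
        ((k : ℂ) + 1) * formInner (sharp G) (T (f c)) (contr (f c) v) := fun c => by
      rw [hf.formInner_succ hG (T (f c))]
      have : ((k : ℂ) + 1) ≠ 0 := by exact_mod_cast Nat.succ_ne_zero k
      field_simp
    simp only [contr_alternatize, formInner_sub_left, h1, sub_neg_eq_add, Finset.sum_add_distrib]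
    rw [Finset.sum_comm (f := fun a c => formInner (sharp G) (contr (f a) (T (f c)))
      (contr (f a) (contr (f c) v)))]
    simp only [h2, ← Finset.mul_sum]
    have : ((k : ℂ) + 1 + 1) ≠ 0 := by exact_mod_cast Nat.succ_ne_zero (k + 1)
    push_cast
    field_simp
    ring

/-- The adjoint of the alternatized `(1, 0)`-part. -/
lemma IsOrthonormalFrame.formInner_alternatize_typePart
    (hJ : ∀ v w, G (cplxJ E v) (cplxJ E w) = G v w) (s : ℝ) (T : E →L[ℝ] E [⋀^Fin k]→L[ℝ] ℂ)
    (v : E [⋀^Fin (k + 1)]→L[ℝ] ℂ) :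
    formInner (sharp G) (alternatizeUncurryFin (typePart s T)) v =
      ∑ a, formInner (sharp G) (T (f a)) (contrPart s (f a) v) := by
  rw [hf.formInner_alternatize hG]
  -- Moving `J` from `T` to the contraction changes the sign, and so does conjugating `s i` when it
  -- passes into the second argument; thus the type `s` is the same on both sides.
  have h := hf.sum_cplxJ_left hG hJ
    ((formInnerBilin (sharp G)).compl₁₂ (T : E →ₗ[ℝ] E [⋀^Fin k]→L[ℝ] ℂ) (contrLin v))
  simp only [LinearMap.compl₁₂_apply, contrLin_apply, formInnerBilin_apply,
    ContinuousLinearMap.coe_coe] at h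
  simp only [typePart_apply, contrPart_eq, formInner_smul_left, formInner_smul_right,
    formInner_sub_left, formInner_sub_right, ← cplxJ_apply, mul_sub, Finset.sum_sub_distrib,
    ← Finset.mul_sum, h]
  simp [Complex.conj_ofNat]

end Frame

end LocalKaehler

/-! ### Covariant differentiation of the inner product and of `Λ`. -/

noncomputable section LocalDerivatives

open ContinuousAlternatingMap (alternatizeUncurryFin alternatizeUncurryFinCLM
  alternatizeUncurryFin_apply alternatizeUncurryFin_add alternatizeUncurryFin_smul curryLeftLI)

variable {E : Type*} [NormedAddCommGroup E] [NormedSpace ℂ E] [FiniteDimensional ℂ E]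
  {F : Type*} [NormedAddCommGroup F] [NormedSpace ℂ F] {k : ℕ}

/-- The inverse metric `S` at `y`, with derivative `S'`, is parallel for the Christoffel symbols. -/
def IsParallelAt (S : E → (E →L[ℝ] ℝ) →L[ℝ] E) (Gam : E →L[ℝ] E →L[ℝ] E) (y : E) : Prop :=
  ∃ S' : E →L[ℝ] (E →L[ℝ] ℝ) →L[ℝ] E, HasFDerivAt S S' y ∧
    ∀ w φ, S' w φ = -Gam w (S y φ) - S y (φ ∘L Gam w)

lemma hasFDerivAt_contr {u : E → E [⋀^Fin (k + 1)]→L[ℝ] F} {u' : E →L[ℝ] E [⋀^Fin (k + 1)]→L[ℝ] F}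
    {a : E → E} {a' : E →L[ℝ] E} {y : E} (hu : HasFDerivAt u u' y) (ha : HasFDerivAt a a' y) :
    ∃ D : E →L[ℝ] E [⋀^Fin k]→L[ℝ] F, HasFDerivAt (fun z => contr (a z) (u z)) D y ∧
      ∀ w, D w = contr (a y) (u' w) + contr (a' w) (u y) :=
  ⟨_, ((curryLeftLI (𝕜 := ℝ) (E := E) (F := F) (n := k)).toContinuousLinearMap.hasFDerivAt.comp y
    hu).clm_apply ha, fun _ => add_comm _ _⟩

/-- The covariant derivative of the inner product of forms. -/
lemma hasFDerivAt_formInner {S : E → (E →L[ℝ] ℝ) →L[ℝ] E} {Gam : E →L[ℝ] E →L[ℝ] E} {y : E}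
    (hS : IsParallelAt S Gam y) : ∀ {k : ℕ} {u v : E → E [⋀^Fin k]→L[ℝ] ℂ}
    {u' v' : E →L[ℝ] E [⋀^Fin k]→L[ℝ] ℂ}, HasFDerivAt u u' y → HasFDerivAt v v' y →
    ∃ D : E →L[ℝ] ℂ, HasFDerivAt (fun z => formInner (S z) (u z) (v z)) D y ∧
      ∀ w, D w = formInner (S y) (u' w - act (Gam w) (u y)) (v y) +
        formInner (S y) (u y) (v' w - act (Gam w) (v y)) := by
  intro k
  induction k with
  | zero =>
    intro u v u' v' hu hv
    have hu0 : HasFDerivAt (fun z => u z 0)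
        (ContinuousAlternatingMap.apply ℝ E ℂ (0 : Fin 0 → E) ∘L u') y :=
      (ContinuousAlternatingMap.apply ℝ E ℂ (0 : Fin 0 → E)).hasFDerivAt.comp y hu
    have hv0 : HasFDerivAt (fun z => v z 0)
        (ContinuousAlternatingMap.apply ℝ E ℂ (0 : Fin 0 → E) ∘L v') y :=
      (ContinuousAlternatingMap.apply ℝ E ℂ (0 : Fin 0 → E)).hasFDerivAt.comp y hv
    refine ⟨_, hv0.inner ℂ hu0, fun w => ?_⟩
    simp only [act_zero_form, sub_zero, formInner]
    simp [fderivInnerCLM_apply]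
  | succ k ih =>
    intro u v u' v' hu hv
    obtain ⟨S', hS', hS'e⟩ := hS
    have h1 := fun i => hasFDerivAt_contr hu (hasFDerivAt_const (realBasis E i) y)
    have h2 := fun i => hasFDerivAt_contr hv (hS'.clm_apply (hasFDerivAt_const (dualVec (E := E) i) y))
    choose D1 hD1 hD1e using h1
    choose D2 hD2 hD2e using h2
    have h3 := fun i => ih (hD1 i) (hD2 i)
    choose D3 hD3 hD3e using h3
    refine ⟨_, (HasFDerivAt.fun_sum fun i _ => hD3 i).const_mul (((k : ℂ) + 1)⁻¹), fun w => ?_⟩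
    -- The derivative acts on the contracted forms as a covariant derivative, up to a Christoffel
    -- term on the basis vector and one on the dual covector. Summed over the basis, these two
    -- cancel.
    have hsum := sum_dual_comp (Gam w) (((formInnerBilin (S y)).compl₁₂ (contrLin (u y))
      (contrLin (v y))).compl₂ (S y : (E →L[ℝ] ℝ) →ₗ[ℝ] E))
    simp only [LinearMap.compl₂_apply, LinearMap.compl₁₂_apply, contrLin_apply,
      formInnerBilin_apply, ContinuousLinearMap.coe_coe] at hsum
    simp only [smul_apply, sum_apply, hD3e, hD1e, hD2e, formInner, smul_eq_mul]
    rw [← mul_add]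
    congr 1
    have e1 : ∀ i, formInner (S y) (contr (realBasis E i) (u' w) +
          contr ((0 : E →L[ℝ] E) w) (u y) - act (Gam w) (contr (realBasis E i) (u y)))
          (contr (S y (dualVec i)) (v y)) =
        formInner (S y) (contr (realBasis E i) (u' w - act (Gam w) (u y)))
          (contr (S y (dualVec i)) (v y)) +
        formInner (S y) (contr (Gam w (realBasis E i)) (u y)) (contr (S y (dualVec i)) (v y)) :=
      fun i => by
        rw [← formInner_add_left, map_sub, contr_act, zero_apply]
        congr 1
        rw [show contr (0 : E) (u y) = 0 from map_zero (u y).curryLeft]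
        abel
    have e2 : ∀ i, formInner (S y) (contr (realBasis E i) (u y))
          (contr (S y (dualVec i)) (v' w) +
            contr (((S y) ∘L (0 : E →L[ℝ] E →L[ℝ] ℝ) + S'.flip (dualVec i)) w) (v y) -
            act (Gam w) (contr (S y (dualVec i)) (v y))) =
        formInner (S y) (contr (realBasis E i) (u y))
          (contr (S y (dualVec i)) (v' w - act (Gam w) (v y))) -
        formInner (S y) (contr (realBasis E i) (u y))
          (contr (S y (dualVec i ∘L Gam w)) (v y)) := fun i => by
      rw [← formInner_sub_right, map_sub, contr_act]
      congr 1
      have : ((S y) ∘L (0 : E →L[ℝ] E →L[ℝ] ℝ) + S'.flip (dualVec i)) w =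
          -Gam w (S y (dualVec i)) + -S y (dualVec i ∘L Gam w) := by
        rw [← sub_eq_add_neg, ← hS'e]
        simp
      rw [this, contr_add_left, contr_neg_left, contr_neg_left]
      abel
    simp only [e1, e2]
    rw [Finset.sum_add_distrib, Finset.sum_add_distrib, Finset.sum_sub_distrib, hsum]
    ring

/-- The operator `Λ` for the inverse metric `S`. -/
def lamSharp (S : (E →L[ℝ] ℝ) →L[ℝ] E) (u : E [⋀^Fin (k + 2)]→L[ℝ] F) : E [⋀^Fin k]→L[ℝ] F :=
  (1 / 2 : ℝ) • ∑ i, contr (cplxJ E (S (dualVec i))) (contr (realBasis E i) u)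

/-- The bilinear map `(x, y) ↦ ι_{J y} ι_x u`. -/
def lamBilin (u : E [⋀^Fin (k + 2)]→L[ℝ] F) : E →ₗ[ℝ] E →ₗ[ℝ] E [⋀^Fin k]→L[ℝ] F :=
  LinearMap.mk₂ ℝ (fun x y => contr (cplxJ E y) (contr x u))
    (fun x x' y => by rw [contr_add_left, map_add])
    (fun c x y => by rw [contr_smul_left, map_smul])
    (fun x y y' => by rw [map_add, contr_add_left])
    (fun c x y => by rw [map_smul, contr_smul_left])

lemma lamBilin_apply (u : E [⋀^Fin (k + 2)]→L[ℝ] F) (x y : E) :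
    lamBilin u x y = contr (cplxJ E y) (contr x u) := rfl

lemma IsOrthonormalFrame.lamSharp_eq {G : E →L[ℝ] E →L[ℝ] ℝ}
    {f : Module.Basis (Fin (Module.finrank ℝ E)) ℝ E} (hf : IsOrthonormalFrame G f)
    (hG : ∀ v w, G v w = G w v) (u : E [⋀^Fin (k + 2)]→L[ℝ] F) :
    lamSharp (sharp G) u = lamFrame f u := by
  have h := hf.sum_sharp hG (lamBilin u)
  simp only [lamBilin_apply] at h
  rw [lamSharp, h, lamFrame]
  simp

/-- The operator `Λ` is parallel. -/
lemma hasFDerivAt_lamSharp {S : E → (E →L[ℝ] ℝ) →L[ℝ] E} {Gam : E →L[ℝ] E →L[ℝ] E} {y : E}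
    (hS : IsParallelAt S Gam y) (hJ : ∀ v w, Gam v (cplxJ E w) = cplxJ E (Gam v w))
    {u : E → E [⋀^Fin (k + 2)]→L[ℝ] F} {u' : E →L[ℝ] E [⋀^Fin (k + 2)]→L[ℝ] F}
    (hu : HasFDerivAt u u' y) :
    ∃ D : E →L[ℝ] E [⋀^Fin k]→L[ℝ] F, HasFDerivAt (fun z => lamSharp (S z) (u z)) D y ∧
      ∀ w, D w = act (Gam w) (lamSharp (S y) (u y)) +
        lamSharp (S y) (u' w - act (Gam w) (u y)) := by
  obtain ⟨S', hS', hS'e⟩ := hS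
  have h1 := fun i => hasFDerivAt_contr hu (hasFDerivAt_const (realBasis E i) y)
  choose D1 hD1 hD1e using h1
  have h2 := fun i => hasFDerivAt_contr (hD1 i) ((cplxJ E).hasFDerivAt.comp y
    (hS'.clm_apply (hasFDerivAt_const (dualVec (E := E) i) y)))
  choose D2 hD2 hD2e using h2
  refine ⟨_, (HasFDerivAt.fun_sum fun i _ => hD2 i).const_smul (1 / 2 : ℝ), fun w => ?_⟩
  have hsum := sum_dual_comp (Gam w) ((lamBilin (u y)).compl₂ (S y : (E →L[ℝ] ℝ) →ₗ[ℝ] E))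
  simp only [LinearMap.compl₂_apply, lamBilin_apply, ContinuousLinearMap.coe_coe] at hsum
  have hact : act (Gam w) (lamSharp (S y) (u y)) = (1 / 2 : ℝ) •
      ∑ i, act (Gam w) (contr (cplxJ E (S y (dualVec i))) (contr (realBasis E i) (u y))) := by
    rw [lamSharp, ← act_sum, ← coe_smul_form, act_smul, coe_smul_form]
  rw [hact]
  simp only [smul_apply, sum_apply, hD2e, hD1e, lamSharp]
  rw [← smul_add]
  congr 1
  have e : ∀ i, contr ((cplxJ E ∘ fun z => S z (dualVec i)) y) (contr (realBasis E i) (u' w) +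
        contr ((0 : E →L[ℝ] E) w) (u y)) +
      contr ((cplxJ E ∘L ((S y) ∘L (0 : E →L[ℝ] E →L[ℝ] ℝ) + S'.flip (dualVec i))) w)
        (contr (realBasis E i) (u y)) =
      act (Gam w) (contr (cplxJ E (S y (dualVec i))) (contr (realBasis E i) (u y))) +
      contr (cplxJ E (S y (dualVec i))) (contr (realBasis E i) (u' w - act (Gam w) (u y))) +
      contr (cplxJ E (S y (dualVec i))) (contr (Gam w (realBasis E i)) (u y)) -
      contr (cplxJ E (S y (dualVec i ∘L Gam w))) (contr (realBasis E i) (u y)) := fun i => by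
    -- Here `Gam` has to commute with `J`: the complex structure which enters `Λ` must be parallel
    -- as well as the metric.
    have h0 : (cplxJ E ∘L ((S y) ∘L (0 : E →L[ℝ] E →L[ℝ] ℝ) + S'.flip (dualVec i))) w =
        -Gam w (cplxJ E (S y (dualVec i))) + -cplxJ E (S y (dualVec i ∘L Gam w)) := by
      change cplxJ E (S y 0 + S' w (dualVec i)) = _
      rw [map_zero, zero_add, hS'e, hJ, map_sub, map_neg, sub_eq_add_neg]
    rw [h0, zero_apply, show contr (0 : E) (u y) = 0 from map_zero (u y).curryLeft]
    simp only [contr_act, contr_add_left, contr_neg_left, map_sub, map_add, map_zero,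
      Function.comp_apply]
    abel
  simp only [e]
  rw [Finset.sum_sub_distrib, Finset.sum_add_distrib, Finset.sum_add_distrib, hsum]
  abel

end LocalDerivatives

noncomputable section LocalDivergence

open ContinuousAlternatingMap (alternatizeUncurryFin alternatizeUncurryFinCLM
  alternatizeUncurryFin_apply alternatizeUncurryFin_add alternatizeUncurryFin_smul curryLeftLI)

variable {E : Type*} [NormedAddCommGroup E] [NormedSpace ℂ E] [FiniteDimensional ℂ E]
  {F : Type*} [NormedAddCommGroup F] [NormedSpace ℂ F] {k : ℕ}

/-! ### The derivative of the volume density -/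

/-- The determinant as a continuous multilinear map of the rows. -/
def detRows (ι : Type*) [Fintype ι] [DecidableEq ι] :
    ContinuousMultilinearMap ℝ (fun _ : ι => ι → ℝ) ℝ where
  toMultilinearMap := (Matrix.detRowAlternating (R := ℝ) (n := ι)).toMultilinearMap
  cont := Continuous.matrix_det (A := fun M : ι → ι → ℝ => Matrix.of M) continuous_id

/-- Jacobi's formula: in the determinant with the `i`-th row replaced by `∑ l, N w i l • M y l`, all
terms but `l = i` have a repeated row. -/
lemma hasFDerivAt_det {ι : Type*} [Fintype ι] [DecidableEq ι] {M : E → ι → ι → ℝ}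
    {M' : E →L[ℝ] ι → ι → ℝ} {y : E} (hM : HasFDerivAt M M' y) (N : E → ι → ι → ℝ)
    (hN : ∀ w i, M' w i = ∑ l, N w i l • M y l) :
    ∃ D : E →L[ℝ] ℝ, HasFDerivAt (fun z => (Matrix.of (M z)).det) D y ∧
      ∀ w, D w = (∑ i, N w i i) * (Matrix.of (M y)).det := by
  refine ⟨_, ((detRows ι).hasFDerivAt (M y)).comp y hM, fun w => ?_⟩
  rw [ContinuousLinearMap.comp_apply, ContinuousMultilinearMap.linearDeriv_apply, Finset.sum_mul]
  refine Finset.sum_congr rfl fun i _ => ?_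
  rw [hN]
  exact Matrix.det_updateRow_sum (Matrix.of (M y)) i (N w i)

/-- The square root of the Gram determinant of a metric in the fixed real basis. -/
def metricDensity (G : E →L[ℝ] E →L[ℝ] ℝ) : ℝ :=
  √(Matrix.det (Matrix.of fun i j => G (realBasis E i) (realBasis E j)))

lemma det_gram_pos {G : E →L[ℝ] E →L[ℝ] ℝ} (hG : ∀ v w, G v w = G w v)
    (hpos : ∀ v, v ≠ 0 → 0 < G v v) :
    0 < Matrix.det (Matrix.of fun i j => G (realBasis E i) (realBasis E j)) := by
  refine Matrix.PosDef.det_pos ?_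
  refine Matrix.PosDef.of_dotProduct_mulVec_pos ?_ fun x hx => ?_
  · ext i j
    simp [hG]
  · have h := hpos (∑ i, x i • realBasis E i) fun h0 => hx ?_
    · have hswap : ∀ i j, G (realBasis E i) (realBasis E j) = G (realBasis E j) (realBasis E i) :=
        fun i j => hG _ _
      simp only [map_sum, map_smul, sum_apply, smul_apply, smul_eq_mul] at h
      simp only [Matrix.mulVec, dotProduct, Matrix.of_apply, star_trivial]
      convert! h using 1
      refine Finset.sum_congr rfl fun i _ => ?_
      simp only [Finset.mul_sum]
      refine Finset.sum_congr rfl fun j _ => ?_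
      rw [hswap i j]
      ring
    · funext i
      have := (Fintype.linearIndependent_iff.mp (realBasis E).linearIndependent) x h0 i
      simpa using this

lemma metricDensity_pos {G : E →L[ℝ] E →L[ℝ] ℝ} (hG : ∀ v w, G v w = G w v)
    (hpos : ∀ v, v ≠ 0 → 0 < G v v) : 0 < metricDensity G :=
  Real.sqrt_pos.mpr (det_gram_pos hG hpos)

/-- The logarithmic derivative of `√ det G` is the trace of the Christoffel symbols. This is what
turns a coordinate divergence, weighted by the volume density, into a covariant one. -/
lemma hasFDerivAt_metricDensity {G : E → E →L[ℝ] E →L[ℝ] ℝ} {G' : E →L[ℝ] E →L[ℝ] E →L[ℝ] ℝ}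
    {y : E} (hd : HasFDerivAt G G' y) (hG : ∀ v w, G y v w = G y w v)
    (hpos : ∀ v, v ≠ 0 → 0 < G y v v) {Gam : E →L[ℝ] E →L[ℝ] E}
    (hGam : ∀ w a b, G' w a b = G y (Gam w a) b + G y a (Gam w b)) :
    ∃ D : E →L[ℝ] ℝ, HasFDerivAt (fun z => metricDensity (G z)) D y ∧
      ∀ w, D w = metricDensity (G y) * realTrace (Gam w) := by
  have hM : HasFDerivAt (fun z => fun i j => G z (realBasis E i) (realBasis E j))
      (ContinuousLinearMap.pi fun i => ContinuousLinearMap.pi fun j =>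
        (G'.flip (realBasis E i)).flip (realBasis E j)) y := by
    refine hasFDerivAt_pi.mpr fun i => hasFDerivAt_pi.mpr fun j => ?_
    have h := (hd.clm_apply (hasFDerivAt_const (realBasis E i) y)).clm_apply
      (hasFDerivAt_const (realBasis E j) y)
    convert! h using 1
    ext w
    simp
  -- the endomorphism with `G (K_w a, b) = G' w a b`
  obtain ⟨f, hf⟩ := exists_isOrthonormalFrame hG hpos
  have hinv := hf.isInvertible hG
  let N : E → Fin (Module.finrank ℝ E) → Fin (Module.finrank ℝ E) → ℝ := fun w i l =>
    dualVec l (sharp (G y) (G' w (realBasis E i)))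
  obtain ⟨D, hD, hDe⟩ := hasFDerivAt_det hM N fun w i => by
    funext j
    have h1 : G y (sharp (G y) (G' w (realBasis E i))) (realBasis E j) =
        G' w (realBasis E i) (realBasis E j) := by
      rw [sharp, hinv.self_apply_inverse]
    rw [← sum_dualVec_smul (sharp (G y) (G' w (realBasis E i)))] at h1
    simp only [map_sum, map_smul, sum_apply, smul_apply] at h1
    simp only [ContinuousLinearMap.pi_apply, Finset.sum_apply, Pi.smul_apply, N]
    exact h1.symm
  have hdet := det_gram_pos hG hpos
  refine ⟨_, hD.sqrt hdet.ne', fun w => ?_⟩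
  -- `N` is the matrix of `G⁻¹ G'`. Compatibility writes `G'` as two terms, each with trace `tr
  -- Gam`; the square root will halve the result.
  have htr : ∑ i, N w i i = 2 * realTrace (Gam w) := by
    have e1 : ∀ i, G' w (realBasis E i) =
        G y (Gam w (realBasis E i)) + (G y (realBasis E i)) ∘L Gam w := fun i => by
      ext b; simp [hGam]
    have e2 : ∀ i, N w i i = dualVec i (Gam w (realBasis E i)) +
        dualVec i (sharp (G y) ((G y (realBasis E i)) ∘L Gam w)) := fun i => by
      simp only [N]
      rw [e1, map_add, map_add, sharp, hinv.inverse_apply_self]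
    -- cyclicity of the trace
    have e3 : ∑ i, dualVec i (sharp (G y) ((G y (realBasis E i)) ∘L Gam w)) =
        realTrace (Gam w) := by
      have h : ∀ i, sharp (G y) ((G y (realBasis E i)) ∘L Gam w) = ∑ a,
          G y (realBasis E i) (Gam w (f a)) • f a := fun i => by
        rw [hf.sharp_apply hG]; rfl
      simp only [h, map_sum, map_smul, smul_eq_mul]
      rw [Finset.sum_comm]
      have h2 : ∀ a, ∑ i, G y (realBasis E i) (Gam w (f a)) * dualVec i (f a) =
          G y (f a) (Gam w (f a)) := fun a => by
        conv_rhs => enter [1]; rw [← sum_dualVec_smul (f a)]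
        simp [mul_comm]
      simp only [h2, realTrace]
      have h3 : ∀ i, dualVec i (Gam w (realBasis E i)) = ∑ a, G y (realBasis E i) (f a) *
          dualVec i (Gam w (f a)) := fun i => by
        conv_lhs => rw [← hf.sum_apply_smul (realBasis E i)]
        simp
      simp only [h3]
      rw [Finset.sum_comm]
      refine Finset.sum_congr rfl fun a _ => ?_
      conv_lhs => enter [2]; rw [← sum_dualVec_smul (Gam w (f a))]
      simp [mul_comm, hG (f a)]
    simp only [e2, Finset.sum_add_distrib, e3]
    rw [← realTrace]
    ring
  have hs : √(Matrix.det (Matrix.of fun i j => G y (realBasis E i) (realBasis E j))) ≠ 0 :=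
    (Real.sqrt_pos.mpr hdet).ne'
  rw [smul_apply, hDe, htr, metricDensity, smul_eq_mul]
  have hsq := Real.mul_self_sqrt hdet.le
  field_simp
  rw [sq, hsq]
  ring

/-! ### A divergence formula -/

lemma hasFDerivAt_contrPart {s : ℝ} {u : E → E [⋀^Fin (k + 1)]→L[ℝ] F}
    {u' : E →L[ℝ] E [⋀^Fin (k + 1)]→L[ℝ] F}
    {a : E → E} {a' : E →L[ℝ] E} {y : E} (hu : HasFDerivAt u u' y) (ha : HasFDerivAt a a' y) :
    ∃ D : E →L[ℝ] E [⋀^Fin k]→L[ℝ] F, HasFDerivAt (fun z => contrPart s (a z) (u z)) D y ∧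
      ∀ w, D w = contrPart s (a y) (u' w) + contrPart s (a' w) (u y) := by
  obtain ⟨D1, h1, e1⟩ := hasFDerivAt_contr hu ha
  obtain ⟨D2, h2, e2⟩ := hasFDerivAt_contr hu ((cplxJ E).hasFDerivAt.comp y ha)
  refine ⟨_, (h1.sub (h2.const_smul ((s : ℂ) * Complex.I))).const_smul (1 / 2 : ℂ), fun w => ?_⟩
  simp only [smul_apply, sub_apply, e1, e2, contrPart_eq, Function.comp_apply,
    ContinuousLinearMap.comp_apply]
  module

lemma contrPart_sub_right (s : ℝ) (a : E) (u v : E [⋀^Fin (k + 1)]→L[ℝ] F) :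
    contrPart s a (u - v) = contrPart s a u - contrPart s a v := by
  simp only [contrPart_eq, map_sub]; module

lemma contrPart_add_right (s : ℝ) (a : E) (u v : E [⋀^Fin (k + 1)]→L[ℝ] F) :
    contrPart s a (u + v) = contrPart s a u + contrPart s a v := by
  simp only [contrPart_eq, map_add]; module

lemma contrPart_smul_right (s : ℝ) (a : E) (c : ℂ) (u : E [⋀^Fin (k + 1)]→L[ℝ] F) :
    contrPart s a (c • u) = c • contrPart s a u := by
  simp only [contrPart_eq, contr_smul]; module

/-- The vector argument of `contrPart`, as a linear map. -/
def contrPartLin (s : ℝ) (u : E [⋀^Fin (k + 1)]→L[ℝ] F) : E →ₗ[ℝ] E [⋀^Fin k]→L[ℝ] F :=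
  (typePart s u.curryLeft : E →ₗ[ℝ] E [⋀^Fin k]→L[ℝ] F)

lemma contrPartLin_apply (s : ℝ) (u : E [⋀^Fin (k + 1)]→L[ℝ] F) (a : E) :
    contrPartLin s u a = contrPart s a u := rfl

/-- The divergence of the vector field dual to `a ↦ ⟨u, ι_a v⟩`. -/
lemma hasFDerivAt_divergence (s : ℝ) {S : E → (E →L[ℝ] ℝ) →L[ℝ] E} {Gam : E →L[ℝ] E →L[ℝ] E}
    {y : E} (hS : IsParallelAt S Gam y) (hsymm : ∀ v w, Gam v w = Gam w v)
    (hJ : ∀ v w, Gam v (cplxJ E w) = cplxJ E (Gam v w))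
    {r : E → ℝ} {r' : E →L[ℝ] ℝ} (hr : HasFDerivAt r r' y)
    (hr' : ∀ w, r' w = r y * realTrace (Gam w))
    {h : E → ℝ} {h' : E →L[ℝ] ℝ} (hh : HasFDerivAt h h' y) {A : E →L[ℝ] ℂ}
    (hh' : ∀ w, (h' w : ℂ) = h y * (A w + (starRingEnd ℂ) (A w)))
    {u : E → E [⋀^Fin k]→L[ℝ] ℂ} {u' : E →L[ℝ] E [⋀^Fin k]→L[ℝ] ℂ} (hu : HasFDerivAt u u' y)
    {v : E → E [⋀^Fin (k + 1)]→L[ℝ] ℂ} {v' : E →L[ℝ] E [⋀^Fin (k + 1)]→L[ℝ] ℂ}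
    (hv : HasFDerivAt v v' y) :
    ∃ D : Fin (Module.finrank ℝ E) → E →L[ℝ] ℂ,
      (∀ i, HasFDerivAt (fun z => ((r z : ℂ) * (h z : ℂ)) *
        formInner (S z) (u z) (contrPart s (S z (dualVec i)) (v z))) (D i) y) ∧
      ∑ i, D i (realBasis E i) = (r y : ℂ) * h y *
        ∑ i, (formInner (S y) (nabla Gam A (u y) u' (realBasis E i))
            (contrPart s (S y (dualVec i)) (v y)) +
          formInner (S y) (u y)
            (contrPart s (S y (dualVec i)) (nabla Gam A (v y) v' (realBasis E i)))) := by
  have hS0 := hS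
  obtain ⟨S', hS', hS'e⟩ := hS
  have h2 := fun i => hasFDerivAt_contrPart (s := s) hv
    (hS'.clm_apply (hasFDerivAt_const (dualVec (E := E) i) y))
  choose D2 hD2 hD2e using h2
  have h3 := fun i => hasFDerivAt_formInner hS0 hu (hD2 i)
  choose D3 hD3 hD3e using h3
  have hrc := Complex.ofRealCLM.hasFDerivAt.comp y hr
  have hhc := Complex.ofRealCLM.hasFDerivAt.comp y hh
  refine ⟨_, fun i => (hrc.mul hhc).mul (hD3 i), ?_⟩
  -- Passing from Christoffel corrections to the full covariant derivative costs `A` in the first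
  -- argument and `conj A` in the second, because of sesquilinearity. Their sum is the logarithmic
  -- derivative of the weight `h` and cancels against it.
  have key : ∀ i w, formInner (S y) (u' w - act (Gam w) (u y))
        (contrPart s (S y (dualVec i)) (v y)) +
      formInner (S y) (u y) (D2 i w - act (Gam w) (contrPart s (S y (dualVec i)) (v y))) =
      formInner (S y) (nabla Gam A (u y) u' w) (contrPart s (S y (dualVec i)) (v y)) +
      formInner (S y) (u y) (contrPart s (S y (dualVec i)) (nabla Gam A (v y) v' w)) -
      (A w + (starRingEnd ℂ) (A w)) *
        formInner (S y) (u y) (contrPart s (S y (dualVec i)) (v y)) -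
      formInner (S y) (u y) (contrPart s (S y (dualVec i ∘L Gam w)) (v y)) := fun i w => by
    have e0 : ((S y) ∘L (0 : E →L[ℝ] E →L[ℝ] ℝ) + S'.flip (dualVec i)) w =
          -Gam w (S y (dualVec i)) + -S y (dualVec i ∘L Gam w) := by
        rw [← sub_eq_add_neg, ← hS'e]
        simp
    have eneg : ∀ a, contrPart s (-a) (v y) = -contrPart s a (v y) :=
      fun a => map_neg (typePart s _) a
    have e1 : D2 i w - act (Gam w) (contrPart s (S y (dualVec i)) (v y)) =
        contrPart s (S y (dualVec i)) (nabla Gam A (v y) v' w) -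
          A w • contrPart s (S y (dualVec i)) (v y) -
          contrPart s (S y (dualVec i ∘L Gam w)) (v y) := by
      rw [hD2e, e0, nabla_apply, contrPart_sub_right, contrPart_add_right, contrPart_smul_right,
        contrPart_act s _ (hJ w), contrPart_add_left, eneg, eneg]
      module
    have e2 : u' w - act (Gam w) (u y) = nabla Gam A (u y) u' w - A w • u y := by
      rw [nabla_apply]; module
    rw [e1, e2, formInner_sub_left, formInner_sub_right, formInner_sub_right, formInner_smul_left,
      formInner_smul_right]
    ring
  -- By symmetry of `Gam` the covector `∑ i, e^i ∘ Gam e_i` is `w ↦ tr (Gam w)`. So the remaining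
  -- Christoffel term cancels the derivative of the density `r`.
  have hcancel : ∑ i, formInner (S y) (u y)
        (contrPart s (S y (dualVec i ∘L Gam (realBasis E i))) (v y)) =
      ∑ i, (realTrace (Gam (realBasis E i)) : ℂ) *
        formInner (S y) (u y) (contrPart s (S y (dualVec i)) (v y)) := by
    let Φ : (E →L[ℝ] ℝ) →ₗ[ℝ] ℂ := (formInnerBilin (S y) (u y)) ∘ₗ (contrPartLin s (v y)) ∘ₗ
      (S y : (E →L[ℝ] ℝ) →ₗ[ℝ] E)
    have hΦ : ∀ φ, formInner (S y) (u y) (contrPart s (S y φ) (v y)) = Φ φ := fun φ => rfl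
    simp only [hΦ, ← Complex.real_smul, ← map_smul]
    rw [← map_sum, ← map_sum]
    congr 1
    ext z
    simp only [sum_apply, ContinuousLinearMap.comp_apply, smul_apply, smul_eq_mul]
    have hz : ∑ i, realTrace (Gam (realBasis E i)) * dualVec i z = realTrace (Gam z) := by
      conv_rhs => rw [← sum_dualVec_smul z]
      simp only [realTrace, map_sum, map_smul, sum_apply, smul_apply, smul_eq_mul]
      rw [Finset.sum_comm]
      refine Finset.sum_congr rfl fun i _ => ?_
      rw [← Finset.mul_sum, mul_comm]
    rw [hz, realTrace]
    refine Finset.sum_congr rfl fun i _ => ?_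
    rw [hsymm]
  have hrw : ∀ w, ((Complex.ofRealCLM ∘L r') w : ℂ) = r y * realTrace (Gam w) := fun w => by
    simp [hr']
  have hhw : ∀ w, ((Complex.ofRealCLM ∘L h') w : ℂ) = h y * (A w + (starRingEnd ℂ) (A w)) :=
    fun w => by rw [← hh' w]; simp
  simp only [add_apply, smul_apply, hD3e, key, Function.comp_apply, hrw, hhw, smul_eq_mul,
    Complex.ofRealCLM_apply, Pi.mul_apply]
  rw [Finset.mul_sum]
  have hc := congrArg (fun t => (r y : ℂ) * h y * t) hcancel
  simp only [Finset.mul_sum] at hc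
  have hc' := sub_eq_zero.mpr hc
  rw [← Finset.sum_sub_distrib] at hc'
  rw [← sub_eq_zero, ← Finset.sum_sub_distrib, ← neg_eq_zero, ← Finset.sum_neg_distrib, ← hc']
  refine Finset.sum_congr rfl fun i _ => ?_
  ring

end LocalDivergence

/-! ### Smooth dependence on the point, and the local expressions of the operators. -/

noncomputable section LocalSmoothness

open ContinuousAlternatingMap (alternatizeUncurryFin alternatizeUncurryFinCLM
  alternatizeUncurryFin_apply alternatizeUncurryFin_add alternatizeUncurryFin_smul curryLeftLI)

variable {E : Type*} [NormedAddCommGroup E] [NormedSpace ℂ E] [FiniteDimensional ℂ E]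
  {F : Type*} [NormedAddCommGroup F] [NormedSpace ℂ F] {k : ℕ}
  {M : Type*} [NormedAddCommGroup M] [NormedSpace ℝ M] {U : Set M} {n : WithTop ℕ∞}

lemma contDiffOn_contr {u : M → E [⋀^Fin (k + 1)]→L[ℝ] F} {a : M → E} (hu : ContDiffOn ℝ n u U)
    (ha : ContDiffOn ℝ n a U) : ContDiffOn ℝ n (fun z => contr (a z) (u z)) U :=
  ((curryLeftLI (𝕜 := ℝ) (E := E) (F := F) (n := k)).toContinuousLinearMap.contDiff.comp_contDiffOn
    hu).clm_apply ha

lemma contDiffOn_contrPart {s : ℝ} {u : M → E [⋀^Fin (k + 1)]→L[ℝ] F} {a : M → E}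
    (hu : ContDiffOn ℝ n u U) (ha : ContDiffOn ℝ n a U) :
    ContDiffOn ℝ n (fun z => contrPart s (a z) (u z)) U := by
  simp only [contrPart_eq]
  exact ((contDiffOn_contr hu ha).sub ((contDiffOn_contr hu
    ((cplxJ E).contDiff.comp_contDiffOn ha)).const_smul _)).const_smul _

lemma contDiffOn_formInner {S : M → (E →L[ℝ] ℝ) →L[ℝ] E} (hS : ContDiffOn ℝ n S U) :
    ∀ {k : ℕ} {u v : M → E [⋀^Fin k]→L[ℝ] ℂ}, ContDiffOn ℝ n u U → ContDiffOn ℝ n v U →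
      ContDiffOn ℝ n (fun z => formInner (S z) (u z) (v z)) U := by
  intro k
  induction k with
  | zero =>
    intro u v hu hv
    have happ : ∀ {u : M → E [⋀^Fin 0]→L[ℝ] ℂ}, ContDiffOn ℝ n u U →
        ContDiffOn ℝ n (fun z => u z 0) U := fun hu =>
      (ContinuousAlternatingMap.apply ℝ E ℂ (0 : Fin 0 → E)).contDiff.comp_contDiffOn hu
    exact (happ hv).inner ℂ (happ hu)
  | succ k ih =>
    intro u v hu hv
    refine contDiffOn_const.mul (ContDiffOn.sum fun i _ => ih ?_ ?_)
    · exact contDiffOn_contr hu contDiffOn_const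
    · exact contDiffOn_contr hv (hS.clm_apply contDiffOn_const)

lemma contDiffOn_lamSharp {S : M → (E →L[ℝ] ℝ) →L[ℝ] E} (hS : ContDiffOn ℝ n S U)
    {u : M → E [⋀^Fin (k + 2)]→L[ℝ] F} (hu : ContDiffOn ℝ n u U) :
    ContDiffOn ℝ n (fun z => lamSharp (S z) (u z)) U := by
  refine ContDiffOn.const_smul _ (ContDiffOn.sum fun i _ => ?_)
  exact contDiffOn_contr (contDiffOn_contr hu contDiffOn_const)
    ((cplxJ E).contDiff.comp_contDiffOn (hS.clm_apply contDiffOn_const))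

lemma contDiffOn_sharp {G : M → E →L[ℝ] E →L[ℝ] ℝ} (hG : ContDiffOn ℝ n G U)
    (hinv : ∀ y ∈ U, (G y).IsInvertible) : ContDiffOn ℝ n (fun z => sharp (G z)) U := fun y hy =>
  have : CompleteSpace E := FiniteDimensional.complete ℂ E
  ((hinv y hy).contDiffAt_map_inverse).comp_contDiffWithinAt y (hG y hy)

lemma contDiffOn_metricDensity {G : M → E →L[ℝ] E →L[ℝ] ℝ} (hG : ContDiffOn ℝ n G U)
    (hsymm : ∀ y ∈ U, ∀ v w, G y v w = G y w v) (hpos : ∀ y ∈ U, ∀ v, v ≠ 0 → 0 < G y v v) :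
    ContDiffOn ℝ n (fun z => metricDensity (G z)) U := by
  refine ContDiffOn.sqrt ?_ fun y hy => (det_gram_pos (hsymm y hy) (hpos y hy)).ne'
  refine (detRows _).contDiff.comp_contDiffOn (f := fun z => fun i j =>
    G z (realBasis E i) (realBasis E j)) ?_
  exact contDiffOn_pi.mpr fun i => contDiffOn_pi.mpr fun j =>
    (hG.clm_apply contDiffOn_const).clm_apply contDiffOn_const

/-- `typePart` as a continuous linear map. -/
def typePartCLM (E F : Type*) [NormedAddCommGroup E] [NormedSpace ℂ E] [NormedAddCommGroup F]
    [NormedSpace ℂ F] (s : ℝ) : (E →L[ℝ] F) →L[ℝ] E →L[ℝ] F :=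
  (1 / 2 : ℂ) • (ContinuousLinearMap.id ℝ _ -
    ((s : ℂ) * Complex.I) • (ContinuousLinearMap.compL ℝ E E F).flip (cplxJ E))

/-- The local expression `du + A ∧ u`, restricted to one type. -/
def localD (s : ℝ) (A : E → E →L[ℝ] ℂ) (u : E → E [⋀^Fin k]→L[ℝ] F) (y : E) :
    E [⋀^Fin (k + 1)]→L[ℝ] F :=
  alternatizeUncurryFin (typePart s (fderiv ℝ u y + (A y).smulRight (u y)))

variable {V : Set E}

lemma contDiffOn_smulRight {A : M → E →L[ℝ] ℂ} {u : M → F} (hA : ContDiffOn ℝ n A U)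
    (hu : ContDiffOn ℝ n u U) : ContDiffOn ℝ n (fun y => (A y).smulRight (u y)) U :=
  ((ContinuousLinearMap.lsmul ℝ ℂ (E := F)).flip.contDiff.comp_contDiffOn hu).clm_comp hA

lemma contDiffOn_localD {s : ℝ} {A : E → E →L[ℝ] ℂ} {u : E → E [⋀^Fin k]→L[ℝ] F} (hV : IsOpen V)
    (hA : ContDiffOn ℝ ∞ A V) (hu : ContDiffOn ℝ ∞ u V) : ContDiffOn ℝ ∞ (localD s A u) V := by
  have h1 : ContDiffOn ℝ ∞ (fderiv ℝ u) V := hu.fderiv_of_isOpen hV (by simp)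
  have h2 : ContDiffOn ℝ ∞ (fun y => (A y).smulRight (u y)) V :=
    contDiffOn_smulRight hA hu
  exact ((alternatizeUncurryFinCLM ℝ E F) ∘L (typePartCLM E _ s)).contDiff.comp_contDiffOn
    (h1.add h2)

lemma localD_congr {s : ℝ} {A : E → E →L[ℝ] ℂ} {u v : E → E [⋀^Fin k]→L[ℝ] F} {y : E}
    (h : u =ᶠ[nhds y] v) : localD s A u y = localD s A v y := by
  rw [localD, localD, h.fderiv_eq, h.eq_of_nhds]

/-- The local expression of the formal adjoint of `localD`, given by the Kähler identities. -/
def localCodiff (s : ℝ) (G : E → E →L[ℝ] E →L[ℝ] ℝ) (A : E → E →L[ℝ] ℂ) :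
    ∀ {k : ℕ}, (E → E [⋀^Fin (k + 1)]→L[ℝ] F) → E → E [⋀^Fin k]→L[ℝ] F
  | 0, v, y => ((s : ℂ) * Complex.I) • lamSharp (sharp (G y)) (localD (-s) A v y)
  | _ + 1, v, y => ((s : ℂ) * Complex.I) • (lamSharp (sharp (G y)) (localD (-s) A v y) -
      localD (-s) A (fun z => lamSharp (sharp (G z)) (v z)) y)

lemma contDiffOn_localCodiff {s : ℝ} {G : E → E →L[ℝ] E →L[ℝ] ℝ} {A : E → E →L[ℝ] ℂ}
    {v : E → E [⋀^Fin (k + 1)]→L[ℝ] F} (hV : IsOpen V) (hG : ContDiffOn ℝ ∞ G V)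
    (hinv : ∀ y ∈ V, (G y).IsInvertible) (hA : ContDiffOn ℝ ∞ A V) (hv : ContDiffOn ℝ ∞ v V) :
    ContDiffOn ℝ ∞ (localCodiff s G A v) V := by
  have hS := contDiffOn_sharp hG hinv
  have h1 := contDiffOn_lamSharp hS (contDiffOn_localD (s := -s) hV hA hv)
  cases k with
  | zero => exact h1.const_smul _
  | succ k =>
    exact (h1.sub (contDiffOn_localD (s := -s) hV hA (contDiffOn_lamSharp hS hv))).const_smul _

end LocalSmoothness

/-! ### Kähler identities and adjointness on an open subset of the model space. -/

noncomputable section LocalAdjoint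

open ContinuousAlternatingMap (alternatizeUncurryFin alternatizeUncurryFinCLM
  alternatizeUncurryFin_apply alternatizeUncurryFin_add alternatizeUncurryFin_smul curryLeftLI)

variable {E : Type*} [NormedAddCommGroup E] [NormedSpace ℂ E] [FiniteDimensional ℂ E]
  {F : Type*} [NormedAddCommGroup F] [NormedSpace ℂ F] {k : ℕ}

/-- A Kähler metric `G` on an open subset of the model space, together with the squared length `h`
of a frame of a Hermitian line bundle and the connection form `A` of a Hermitian connection. -/
structure IsLocalKaehler (U : Set E) (G : E → E →L[ℝ] E →L[ℝ] ℝ) (h : E → ℝ)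
    (A : E → E →L[ℝ] ℂ) : Prop where
  isOpen : IsOpen U
  contDiffOn_metric : ContDiffOn ℝ ∞ G U
  symm : ∀ y ∈ U, ∀ v w, G y v w = G y w v
  pos : ∀ y ∈ U, ∀ v, v ≠ 0 → 0 < G y v v
  hermitian : ∀ y ∈ U, ∀ v w, G y (cplxJ E v) (cplxJ E w) = G y v w
  closed : ∀ y ∈ U, ∀ a b c, fderiv ℝ G y a (cplxJ E b) c + fderiv ℝ G y b (cplxJ E c) a +
    fderiv ℝ G y c (cplxJ E a) b = 0
  contDiffOn_length : ContDiffOn ℝ ∞ h U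
  contDiffOn_connection : ContDiffOn ℝ ∞ A U
  fderiv_length : ∀ y ∈ U, ∀ w,
    ((fderiv ℝ h y w : ℝ) : ℂ) = h y * (A y w + (starRingEnd ℂ) (A y w))

variable {U : Set E} {G : E → E →L[ℝ] E →L[ℝ] ℝ} {h : E → ℝ} {A : E → E →L[ℝ] ℂ} {y : E}

lemma _root_.ContDiffOn.differentiableAt_of_isOpen {N : Type*} [NormedAddCommGroup N]
    [NormedSpace ℝ N] {f : E → N} {V : Set E} (hf : ContDiffOn ℝ ∞ f V) (hV : IsOpen V)
    (hy : y ∈ V) : DifferentiableAt ℝ f y :=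
  (hf.contDiffAt (hV.mem_nhds hy)).differentiableAt (by simp)

lemma lamFrame_smul {ι : Type*} [Fintype ι] (f : Module.Basis ι ℝ E) (c : ℂ)
    (u : E [⋀^Fin (k + 2)]→L[ℝ] F) : lamFrame f (c • u) = c • lamFrame f u := by
  simp [lamFrame, contr_smul, Finset.smul_sum, smul_comm c]

namespace IsLocalKaehler

lemma hasFDerivAt_metric (hK : IsLocalKaehler U G h A) (hy : y ∈ U) : HasFDerivAt G (fderiv ℝ G y) y :=
  (hK.contDiffOn_metric.differentiableAt_of_isOpen hK.isOpen hy).hasFDerivAt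

lemma isInvertible (hK : IsLocalKaehler U G h A) (hy : y ∈ U) : (G y).IsInvertible := by
  obtain ⟨f, hf⟩ := exists_isOrthonormalFrame (hK.symm y hy) (hK.pos y hy)
  exact hf.isInvertible (hK.symm y hy)

/-- Symmetry and invariance under `J` hold on the whole open set, so they can be differentiated and
pass to the derivative of the metric. -/
lemma exists_isChristoffel (hK : IsLocalKaehler U G h A) (hy : y ∈ U) : ∃ Gam, IsChristoffel (G y) (fderiv ℝ G y) Gam := by
  have hd : ∀ a b, HasFDerivAt (fun z => G z a b) (((fderiv ℝ G y).flip a).flip b) y :=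
    fun a b => by
      have h := ((hK.hasFDerivAt_metric hy).clm_apply (hasFDerivAt_const a y)).clm_apply
        (hasFDerivAt_const b y)
      convert! h using 1
      ext w
      simp
  have heq : ∀ a b a' b', (∀ z ∈ U, G z a b = G z a' b') →
      ∀ w, fderiv ℝ G y w a b = fderiv ℝ G y w a' b' := fun a b a' b' he w => by
    have h1 := (hd a b).congr_of_eventuallyEq (f₁ := fun z => G z a' b') <| by
      filter_upwards [hK.isOpen.mem_nhds hy] with z hz using (he z hz).symm
    exact congrArg (fun T : E →L[ℝ] ℝ => T w) (h1.unique (hd a' b'))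
  exact TwistedBKN.exists_isChristoffel (hK.isInvertible hy) (hK.symm y hy) (hK.hermitian y hy)
    (fun w a b => heq _ _ _ _ (fun z hz => hK.symm z hz a b) w)
    (fun w a b => heq _ _ _ _ (fun z hz => hK.hermitian z hz a b) w) (hK.closed y hy)

lemma isParallelAt (hK : IsLocalKaehler U G h A) (hy : y ∈ U) {Gam : E →L[ℝ] E →L[ℝ] E}
    (hGam : IsChristoffel (G y) (fderiv ℝ G y) Gam) :
    IsParallelAt (fun z => sharp (G z)) Gam y :=
  hasFDerivAt_sharp (hK.hasFDerivAt_metric hy) (hK.isInvertible hy) hGam.compat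

/-- The Kähler identities. -/
lemma localCodiff_eq (hK : IsLocalKaehler U G h A) (hy : y ∈ U) {Gam : E →L[ℝ] E →L[ℝ] E}
    (hGam : IsChristoffel (G y) (fderiv ℝ G y) Gam) {s : ℝ} (hs : s * s = 1)
    {v : E → E [⋀^Fin (k + 1)]→L[ℝ] F} (hv : DifferentiableAt ℝ v y) :
    localCodiff s G A v y = -∑ i, contrPart s (sharp (G y) (dualVec i))
      (nabla Gam (A y) (v y) (fderiv ℝ v y) (realBasis E i)) := by
  have hsymm := hK.symm y hy
  have hJ := hK.hermitian y hy
  obtain ⟨f, hf⟩ := exists_isOrthonormalFrame hsymm (hK.pos y hy)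
  set T := nabla Gam (A y) (v y) (fderiv ℝ v y) with hT
  have hsum : ∑ i, contrPart s (sharp (G y) (dualVec i)) (T (realBasis E i)) =
      ∑ a, contrPart s (f a) (T (f a)) := hf.sum_sharp hsymm (LinearMap.mk₂ ℝ (fun b x => contrPart s x (T b))
    (fun b b' x => by rw [map_add, contrPart_add_right])
    (fun c b x => by rw [map_smul, ← coe_smul_form, contrPart_smul_right, coe_smul_form])
    (fun b x x' => contrPart_add_left s x x' (T b))
    (fun c b x => map_smul (typePart s (T b).curryLeft) c x))
  rw [hsum]
  -- The connection `d + A` is replaced by the covariant derivative, whose Christoffel part is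
  -- invisible here.
  have hD : localD (-s) A v y = alternatizeUncurryFin (typePart (-s) T) :=
    (alternatize_typePart_nabla (-s) hGam.symm hGam.cplxJ _ _ _).symm
  have hss : ((s : ℂ) * Complex.I) * ((s : ℂ) * Complex.I) = -1 := by
    have : ((s : ℂ)) * s = 1 := by exact_mod_cast hs
    linear_combination (this * Complex.I ^ 2 + Complex.I_sq)
  cases k with
  | zero =>
    rw [localCodiff, hf.lamSharp_eq hsymm, hD, hf.lamFrame_alternatize_one hsymm hJ,
      hf.sum_contr_typePart hsymm hJ hs, smul_smul, hss, neg_one_smul]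
  | succ k =>
    obtain ⟨D, hD1, hD2⟩ := hasFDerivAt_lamSharp (hK.isParallelAt hy hGam) hGam.cplxJ
      hv.hasFDerivAt
    -- As `Λ` is parallel, the covariant derivative of `Λ v` is `Λ` of the covariant derivative of
    -- `v`. The commutator of differential operators thereby becomes the commutator of `Λ` with an
    -- alternatization at one point.
    have hL : nabla Gam (A y) (lamSharp (sharp (G y)) (v y)) D = lamFrame f ∘L T := by
      ext1 w
      rw [nabla_apply, hD2, ContinuousLinearMap.comp_apply, hT, nabla_apply]
      simp only [hf.lamSharp_eq hsymm, map_sub, map_add]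
      rw [lamFrame_smul]
      abel
    have hDL : localD (-s) A (fun z => lamSharp (sharp (G z)) (v z)) y =
        alternatizeUncurryFin (lamFrame f ∘L typePart (-s) T) := by
      rw [localD, hD1.fderiv, ← alternatize_typePart_nabla (-s) hGam.symm hGam.cplxJ, hL]
      congr 1
      ext1 w
      simp only [typePart_apply, ContinuousLinearMap.comp_apply]
      rw [lamFrame_smul, map_sub, lamFrame_smul]
    rw [localCodiff, hf.lamSharp_eq hsymm, hD, hDL, hf.lamFrame_alternatize hsymm hJ,
      hf.sum_contr_typePart hsymm hJ hs, smul_smul, hss, neg_one_smul]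

end IsLocalKaehler

/-! ### Integration by parts -/

section Integral

variable [MeasurableSpace E] [BorelSpace E] (μ : Measure E) [μ.IsAddHaarMeasure]

lemma exists_indicator_continuous {N : Type*} [NormedAddCommGroup N] {V K : Set E}
    (hV : IsOpen V) (hK : IsCompact K) (hKV : K ⊆ V) {f : E → N} (hf : ContinuousOn f V)
    (h0 : ∀ y ∈ V, y ∉ K → f y = 0) :
    Continuous (V.indicator f) ∧ HasCompactSupport (V.indicator f) := by
  have hz : ∀ y, y ∉ K → V.indicator f y = 0 := fun y hy => by
    by_cases hyV : y ∈ V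
    · rw [Set.indicator_of_mem hyV, h0 y hyV hy]
    · exact Set.indicator_of_notMem hyV f
  refine ⟨continuous_iff_continuousAt.mpr fun y => ?_, HasCompactSupport.intro hK hz⟩
  by_cases hy : y ∈ K
  · refine (hf.continuousAt (hV.mem_nhds (hKV hy))).congr ?_
    filter_upwards [hV.mem_nhds (hKV hy)] with z hz using (Set.indicator_of_mem hz f).symm
  · refine (continuousAt_const (y := (0 : N))).congr ?_
    filter_upwards [hK.isClosed.isOpen_compl.mem_nhds hy] with z hz' using (hz z hz').symm

lemma integrableOn_of_continuousOn {N : Type*} [NormedAddCommGroup N] {V K : Set E}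
    (hV : IsOpen V) (hK : IsCompact K) (hKV : K ⊆ V) {f : E → N} (hf : ContinuousOn f V)
    (h0 : ∀ y ∈ V, y ∉ K → f y = 0) : IntegrableOn f V μ := by
  have h := exists_indicator_continuous hV hK hKV hf h0
  exact (integrable_indicator_iff hV.measurableSet).mp (h.1.integrable_of_hasCompactSupport h.2)

/-- The integral of a derivative of a compactly supported function vanishes. -/
lemma setIntegral_fderiv_eq_zero {V K : Set E} (hV : IsOpen V) (hK : IsCompact K) (hKV : K ⊆ V)
    {f : E → ℂ} (hf : ContDiffOn ℝ ∞ f V) (h0 : ∀ y ∈ V, y ∉ K → f y = 0) (b : E) :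
    ∫ y in V, fderiv ℝ f y b ∂μ = 0 := by
  set φ := V.indicator f with hφ
  have hcs := exists_indicator_continuous hV hK hKV hf.continuousOn h0
  have hz : ∀ y, y ∉ K → φ =ᶠ[nhds y] 0 := fun y hy => by
    filter_upwards [hK.isClosed.isOpen_compl.mem_nhds hy] with z hz
    by_cases hzV : z ∈ V
    · rw [hφ, Set.indicator_of_mem hzV, h0 z hzV hz]; rfl
    · exact Set.indicator_of_notMem hzV f
  have hev : ∀ y ∈ V, φ =ᶠ[nhds y] f := fun y hy => by
    filter_upwards [hV.mem_nhds hy] with z hz using Set.indicator_of_mem hz f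
  have hsm : ContDiff ℝ ∞ φ := contDiff_iff_contDiffAt.mpr fun y => by
    by_cases hy : y ∈ K
    · exact (hf.contDiffAt (hV.mem_nhds (hKV hy))).congr_of_eventuallyEq (hev y (hKV hy))
    · exact contDiffAt_const.congr_of_eventuallyEq (hz y hy)
  have hcd : Continuous fun y => fderiv ℝ φ y b :=
    (hsm.continuous_fderiv (by simp)).clm_apply continuous_const
  have hcsd : HasCompactSupport fun y => fderiv ℝ φ y b := HasCompactSupport.intro hK fun y hy => by
    rw [(hz y hy).fderiv_eq]; simp
  have h1 : ∫ y in V, fderiv ℝ f y b ∂μ = ∫ y in V, fderiv ℝ φ y b ∂μ :=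
    setIntegral_congr_fun hV.measurableSet fun y hy => by rw [(hev y hy).fderiv_eq]
  have h2 : ∫ y in V, fderiv ℝ φ y b ∂μ = ∫ y, fderiv ℝ φ y b ∂μ :=
    setIntegral_eq_integral_of_forall_compl_eq_zero fun y hy => by
      rw [(hz y fun h => hy (hKV h)).fderiv_eq]; simp
  -- Integration by parts against the constant function `1`, applied to the extension of `f` by
  -- zero, which is smooth because `f` vanishes off a compact subset of `V`.
  have h3 := integral_mul_fderiv_eq_neg_fderiv_mul_of_integrable (μ := μ) (f := fun _ : E => (1 : ℂ))
    (g := φ) (v := b) (by simp) (by simpa using hcd.integrable_of_hasCompactSupport hcsd)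
    (by simpa using hcs.1.integrable_of_hasCompactSupport hcs.2)
    (fun x _ => by simp) (fun x _ => hsm.differentiable (by simp) x)
  rw [h1, h2]
  simpa using h3

namespace IsLocalKaehler

lemma contDiffOn_weight (hK : IsLocalKaehler U G h A) :
    ContDiffOn ℝ ∞ (fun y => (metricDensity (G y) : ℂ) * (h y : ℂ)) U :=
  (Complex.ofRealCLM.contDiff.comp_contDiffOn
    (contDiffOn_metricDensity hK.contDiffOn_metric hK.symm hK.pos)).mul
    (Complex.ofRealCLM.contDiff.comp_contDiffOn hK.contDiffOn_length)

lemma contDiffOn_sharp (hK : IsLocalKaehler U G h A) : ContDiffOn ℝ ∞ (fun y => sharp (G y)) U :=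
  TwistedBKN.contDiffOn_sharp hK.contDiffOn_metric fun _ hy => hK.isInvertible hy

/-- The difference of the two integrands in the adjointness relation is a coordinate divergence: in
the weighted divergence the derivative of `u` yields `localD` and that of `v` yields `localCodiff`.
-/
lemma sum_fderiv (hK : IsLocalKaehler U G h A) {s : ℝ} (hs : s * s = 1) {u : E → E [⋀^Fin k]→L[ℝ] ℂ}
    {v : E → E [⋀^Fin (k + 1)]→L[ℝ] ℂ} (hy : y ∈ U) (hu : DifferentiableAt ℝ u y)
    (hv : DifferentiableAt ℝ v y) :
    ∑ i, fderiv ℝ (fun z => ((metricDensity (G z) : ℂ) * (h z : ℂ)) * formInner (sharp (G z)) (u z)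
        (contrPart s (sharp (G z) (dualVec i)) (v z))) y (realBasis E i) =
      (metricDensity (G y) : ℂ) * (h y : ℂ) *
        (formInner (sharp (G y)) (localD s A u y) (v y) -
          formInner (sharp (G y)) (u y) (localCodiff s G A v y)) := by
  obtain ⟨Gam, hGam⟩ := hK.exists_isChristoffel hy
  have hsymm := hK.symm y hy
  have hJ := hK.hermitian y hy
  obtain ⟨f, hf⟩ := exists_isOrthonormalFrame hsymm (hK.pos y hy)
  obtain ⟨r', hr, hr'⟩ := hasFDerivAt_metricDensity (hK.hasFDerivAt_metric hy) hsymm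
    (hK.pos y hy) hGam.compat
  obtain ⟨D, hD, hDe⟩ := hasFDerivAt_divergence s (hK.isParallelAt hy hGam) hGam.symm hGam.cplxJ
    hr hr' (hK.contDiffOn_length.differentiableAt_of_isOpen hK.isOpen hy).hasFDerivAt
    (hK.fderiv_length y hy) hu.hasFDerivAt hv.hasFDerivAt
  simp only [fun i => (hD i).fderiv]
  rw [hDe, hK.localCodiff_eq hy hGam hs hv, formInner_neg_right, sub_neg_eq_add,
    formInner_sum_right, Finset.sum_add_distrib]
  congr 2
  set T := nabla Gam (A y) (u y) (fderiv ℝ u y)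
  have h1 : localD s A u y = alternatizeUncurryFin (typePart s T) :=
    (alternatize_typePart_nabla s hGam.symm hGam.cplxJ _ _ _).symm
  rw [h1, hf.formInner_alternatize_typePart hsymm hJ]
  have hsum := hf.sum_sharp hsymm (((formInnerBilin (sharp (G y))).compl₁₂
    (T : E →ₗ[ℝ] E [⋀^Fin k]→L[ℝ] ℂ) (contrPartLin s (v y))))
  simpa [formInnerBilin_apply, contrPartLin_apply] using hsum

/-- The operators `localD` and `localCodiff` are formally adjoint. -/
lemma integral_formInner_localD (hK : IsLocalKaehler U G h A) {s : ℝ} (hs : s * s = 1) {u : E → E [⋀^Fin k]→L[ℝ] ℂ}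
    {v : E → E [⋀^Fin (k + 1)]→L[ℝ] ℂ} (hu : ContDiffOn ℝ ∞ u U) (hv : ContDiffOn ℝ ∞ v U)
    {C : Set E} (hC : IsCompact C) (hCU : C ⊆ U) (h0 : ∀ y ∈ U, y ∉ C → u y = 0) :
    ∫ y in U, (metricDensity (G y) : ℂ) * (h y : ℂ) *
        formInner (sharp (G y)) (localD s A u y) (v y) ∂μ =
      ∫ y in U, (metricDensity (G y) : ℂ) * (h y : ℂ) *
        formInner (sharp (G y)) (u y) (localCodiff s G A v y) ∂μ := by
  have hS := hK.contDiffOn_sharp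
  have hW := hK.contDiffOn_weight
  have hDu := contDiffOn_localD (s := s) hK.isOpen hK.contDiffOn_connection hu
  have hDv := contDiffOn_localCodiff (s := s) hK.isOpen hK.contDiffOn_metric
    (fun _ hy => hK.isInvertible hy) hK.contDiffOn_connection hv
  have hzero : ∀ w : E [⋀^Fin k]→L[ℝ] ℂ, ∀ z, formInner (sharp (G z)) 0 w = 0 := fun w z => by
    simpa using formInner_smul_left (sharp (G z)) 0 0 w
  have hzero' : ∀ w : E [⋀^Fin (k + 1)]→L[ℝ] ℂ, ∀ z, formInner (sharp (G z)) 0 w = 0 :=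
    fun w z => by simpa using formInner_smul_left (sharp (G z)) 0 0 w
  have hDu0 : ∀ y ∈ U, y ∉ C → localD s A u y = 0 := fun y hy hyC => by
    have he : u =ᶠ[nhds y] 0 := by
      filter_upwards [hK.isOpen.mem_nhds hy, hC.isClosed.isOpen_compl.mem_nhds hyC] with z hz hz'
        using h0 z hz hz'
    have hT : fderiv ℝ u y + (A y).smulRight (u y) = 0 := by
      rw [he.fderiv_eq, he.eq_of_nhds]; ext w; simp
    rw [localD, hT]
    exact map_zero ((alternatizeUncurryFinCLM ℝ E ℂ) ∘L (typePartCLM E _ s))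
  have hψ : ∀ i, ContDiffOn ℝ ∞ (fun z => ((metricDensity (G z) : ℂ) * (h z : ℂ)) *
      formInner (sharp (G z)) (u z) (contrPart s (sharp (G z) (dualVec i)) (v z))) U := fun i =>
    hW.mul (contDiffOn_formInner hS hu (contDiffOn_contrPart hv (hS.clm_apply contDiffOn_const)))
  have hψ0 : ∀ i, ∀ y ∈ U, y ∉ C → ((metricDensity (G y) : ℂ) * (h y : ℂ)) *
      formInner (sharp (G y)) (u y) (contrPart s (sharp (G y) (dualVec i)) (v y)) = 0 :=
    fun i y hy hyC => by rw [h0 y hy hyC, hzero, mul_zero]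
  have hint : ∀ i, IntegrableOn (fun y => fderiv ℝ (fun z => ((metricDensity (G z) : ℂ) *
      (h z : ℂ)) * formInner (sharp (G z)) (u z) (contrPart s (sharp (G z) (dualVec i)) (v z))) y
        (realBasis E i)) U μ := fun i => by
    refine integrableOn_of_continuousOn μ hK.isOpen hC hCU
      (((hψ i).fderiv_of_isOpen (m := 0) hK.isOpen (by simp)).continuousOn.clm_apply
        continuousOn_const) fun y hy hyC => ?_
    have he : (fun z => ((metricDensity (G z) : ℂ) * (h z : ℂ)) * formInner (sharp (G z)) (u z)
        (contrPart s (sharp (G z) (dualVec i)) (v z))) =ᶠ[nhds y] 0 := by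
      filter_upwards [hK.isOpen.mem_nhds hy, hC.isClosed.isOpen_compl.mem_nhds hyC] with z hz hz'
        using hψ0 i z hz hz'
    rw [he.fderiv_eq]
    simp
  -- Each summand is a directional derivative of a smooth function that vanishes off the compact set
  -- `C`.
  have hsum : ∫ y in U, ∑ i, fderiv ℝ (fun z => ((metricDensity (G z) : ℂ) * (h z : ℂ)) *
      formInner (sharp (G z)) (u z) (contrPart s (sharp (G z) (dualVec i)) (v z))) y
        (realBasis E i) ∂μ = 0 := by
    rw [integral_finsetSum _ fun i _ => hint i]
    exact Finset.sum_eq_zero fun i _ =>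
      setIntegral_fderiv_eq_zero μ hK.isOpen hC hCU (hψ i) (hψ0 i) _
  have hI1 : IntegrableOn (fun y => (metricDensity (G y) : ℂ) * (h y : ℂ) *
      formInner (sharp (G y)) (localD s A u y) (v y)) U μ :=
    integrableOn_of_continuousOn μ hK.isOpen hC hCU
      (hW.mul (contDiffOn_formInner hS hDu hv)).continuousOn fun y hy hyC => by
        rw [hDu0 y hy hyC, hzero', mul_zero]
  have hI2 : IntegrableOn (fun y => (metricDensity (G y) : ℂ) * (h y : ℂ) *
      formInner (sharp (G y)) (u y) (localCodiff s G A v y)) U μ :=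
    integrableOn_of_continuousOn μ hK.isOpen hC hCU
      (hW.mul (contDiffOn_formInner hS hu hDv)).continuousOn fun y hy hyC => by
        rw [h0 y hy hyC, hzero, mul_zero]
  rw [← sub_eq_zero, ← integral_sub hI1 hI2, ← hsum]
  refine setIntegral_congr_fun hK.isOpen.measurableSet fun y hy => ?_
  rw [hK.sum_fderiv hs hy (hu.differentiableAt_of_isOpen hK.isOpen hy)
    (hv.differentiableAt_of_isOpen hK.isOpen hy)]
  ring

end IsLocalKaehler

end Integral

end LocalAdjoint

/-! ### Naturality under holomorphic coordinate changes and changes of frame. -/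

noncomputable section Pullback

open ContinuousAlternatingMap (alternatizeUncurryFin alternatizeUncurryFinCLM
  compContinuousLinearMapCLM
  alternatizeUncurryFin_apply alternatizeUncurryFin_add alternatizeUncurryFin_smul curryLeftLI)

variable {E : Type*} [NormedAddCommGroup E] [NormedSpace ℂ E]
  {F : Type*} [NormedAddCommGroup F] [NormedSpace ℂ F] {k : ℕ}

/-- The twisted exterior derivatives are natural under holomorphic coordinate changes and changes of
frame. -/
lemma localD_pullback (s : ℝ) {τ : E → E} {y : E} (hτ : ContDiffAt ℝ ∞ τ y)
    (hJ : ∀ᶠ z in nhds y, ∀ v, fderiv ℝ τ z (cplxJ E v) = cplxJ E (fderiv ℝ τ z v))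
    {B : E →L[ℝ] E} (hB : ∀ v, B (fderiv ℝ τ y v) = v) (hB' : ∀ v, fderiv ℝ τ y (B v) = v)
    {c : E → ℂ} (hc : DifferentiableAt ℝ c y) (hc0 : c y ≠ 0)
    {u₀ u₁ : E → E [⋀^Fin k]→L[ℝ] F} (hu₁ : DifferentiableAt ℝ u₁ (τ y))
    (hu : u₀ =ᶠ[nhds y] fun z => c z • (u₁ (τ z)).compContinuousLinearMap (fderiv ℝ τ z))
    {A₀ A₁ : E → E →L[ℝ] ℂ}
    (hA : A₁ (τ y) ∘L fderiv ℝ τ y = A₀ y + (c y)⁻¹ • fderiv ℝ c y) :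
    localD s A₀ u₀ y = c y • (localD s A₁ u₁ (τ y)).compContinuousLinearMap (fderiv ℝ τ y) := by
  set P := fderiv ℝ τ y with hP
  have hPJ : ∀ v, P (cplxJ E v) = cplxJ E (P v) := hJ.self_of_nhds
  have hτ1 : HasFDerivAt τ P y := (hτ.differentiableAt (by simp)).hasFDerivAt
  have hτ2 : HasFDerivAt (fderiv ℝ τ) (fderiv ℝ (fderiv ℝ τ) y) y :=
    ((hτ.fderiv_right (m := ∞) (by simp)).differentiableAt (by simp)).hasFDerivAt
  set Q := fderiv ℝ (fderiv ℝ τ) y with hQ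
  have hQs : ∀ v w, Q v w = Q w v :=
    hτ.isSymmSndFDerivAt (by
      rw [minSmoothness_of_isRCLikeNormedField]
      exact WithTop.coe_le_coe.2 (le_top : (2 : ℕ∞) ≤ ⊤))
  -- The relation `Dτ ∘ J = J ∘ Dτ` holds near `y`, so it can be differentiated once more.
  have hQJ : ∀ v w, Q v (cplxJ E w) = cplxJ E (Q v w) := fun v w => by
    have h1 := hτ2.clm_apply (hasFDerivAt_const (cplxJ E w) y)
    have h2 := (cplxJ E).hasFDerivAt.comp y (hτ2.clm_apply (hasFDerivAt_const w y))
    have h3 := h1.congr_of_eventuallyEq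
      (f₁ := (cplxJ E) ∘ fun z => fderiv ℝ τ z w) (by
        filter_upwards [hJ] with z hz using (hz w).symm)
    have h4 := congrArg (fun T : E →L[ℝ] E => T v) (h3.unique h2)
    simpa using h4
  have hBJ : ∀ v, B (cplxJ E v) = cplxJ E (B v) := fun v => by
    rw [← hB (cplxJ E (B v)), hPJ, hB']
  -- The second derivative of the coordinate change, brought back by `(Dτ)⁻¹`, is symmetric and
  -- complex bilinear. It acts on the form exactly like Christoffel symbols and is removed by
  -- alternation for the same reason.
  let Gam : E →L[ℝ] E →L[ℝ] E := ContinuousLinearMap.compL ℝ E E E B ∘L Q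
  have hGam : ∀ v w, Gam v w = B (Q v w) := fun v w => rfl
  have hd : HasFDerivAt (fun z => (u₁ (τ z)).compContinuousLinearMap (fderiv ℝ τ z))
      (compContinuousLinearMapCLM P ∘L fderiv ℝ u₁ (τ y) ∘L P +
        (u₁ (τ y)).fderivCompContinuousLinearMap P ∘L Q) y := ((hu₁.hasFDerivAt.comp y hτ1).continuousAlternatingMapCompContinuousLinearMap hτ2)
  have hd2 : HasFDerivAt (fun z => c z • (u₁ (τ z)).compContinuousLinearMap (fderiv ℝ τ z)) _ y :=
    hc.hasFDerivAt.smul hd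
  set U := (u₁ (τ y)).compContinuousLinearMap P with hU
  have hu0 : u₀ y = c y • U := hu.self_of_nhds
  have hact : ∀ v, (u₁ (τ y)).fderivCompContinuousLinearMap P (Q v) =
      U.fderivCompContinuousLinearMap (ContinuousLinearMap.id ℝ E) (Gam v) := fun v => by
    ext m
    simp only [ContinuousAlternatingMap.fderivCompContinuousLinearMap_apply, hU,
      ContinuousAlternatingMap.compContinuousLinearMap_apply]
    refine Finset.sum_congr rfl fun i _ => ?_
    congr 1
    funext j
    rcases eq_or_ne j i with rfl | h
    · simp [hGam, hB']
    · simp [h]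
  -- The term `dc` from the Leibniz rule is absorbed by the inhomogeneous term `c⁻¹ dc` in the
  -- change of the connection form.
  have hT : fderiv ℝ u₀ y + (A₀ y).smulRight (u₀ y) =
      c y • (compContinuousLinearMapCLM P ∘L (fderiv ℝ u₁ (τ y) + (A₁ (τ y)).smulRight (u₁ (τ y)))
        ∘L P + U.fderivCompContinuousLinearMap (ContinuousLinearMap.id ℝ E) ∘L Gam) := by
    rw [hu.fderiv_eq, HasFDerivAt.fderiv hd2, hu0]
    ext1 v
    have hAv : A₁ (τ y) (P v) = A₀ y v + (c y)⁻¹ * fderiv ℝ c y v :=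
      congrArg (fun T : E →L[ℝ] ℂ => T v) hA
    have hmap : ∀ (a : ℂ) (w : E [⋀^Fin k]→L[ℝ] F), compContinuousLinearMapCLM P (a • w) =
        a • compContinuousLinearMapCLM (𝕜 := ℝ) P w := fun a w => rfl
    have hUe : compContinuousLinearMapCLM (𝕜 := ℝ) P (u₁ (τ y)) = U := rfl
    simp only [add_apply, smul_apply, ContinuousLinearMap.smulRight_apply,
      ContinuousLinearMap.comp_apply, hact, map_add, hmap, hUe, hAv]
    have : c y • ((c y)⁻¹ * fderiv ℝ c y v) • U = fderiv ℝ c y v • U := by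
      rw [smul_smul]; congr 1; field_simp
    simp only [smul_add, add_smul, this]
    module
  rw [localD, hT, typePart_smul, typePart_add, alternatizeUncurryFin_smul,
    alternatizeUncurryFin_add,
    alternatize_typePart_act s U Gam (fun v w => by rw [hGam, hGam, hQs])
      (fun v w => by rw [hGam, hGam, hQJ, hBJ]), add_zero, localD,
    alternatize_compContinuousLinearMap]
  congr 2
  ext1 v
  simp only [ContinuousLinearMap.comp_apply, typePart_apply]
  rw [← cplxJ_apply, hPJ, ← cplxJ_apply]
  rfl

end Pullback

/-! ### Holomorphic coordinate changes and their tangent maps. -/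

noncomputable section Charts

variable {E : Type*} [NormedAddCommGroup E] [NormedSpace ℂ E] [FiniteDimensional ℂ E]
  {X : Type*} [TopologicalSpace X] [ChartedSpace E X] [IsManifold 𝓘(ℂ, E) ω X]

/-- The coordinate change between two preferred charts. -/
def transition (x₀ x₁ : X) : E → E := chartAt E x₁ ∘ (chartAt E x₀).symm

lemma contDiffAt_transition_complex {x₀ x₁ : X} {y : E} (hy : y ∈ (chartAt E x₀).target)
    (hy' : (chartAt E x₀).symm y ∈ (chartAt E x₁).source) :
    ContDiffAt ℂ ω (transition x₀ x₁) y := by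
  have h := contDiffOn_ext_coord_change (I := 𝓘(ℂ, E)) (n := ω) x₁ x₀
  have hm : y ∈ ((extChartAt 𝓘(ℂ, E) x₀).symm ≫ extChartAt 𝓘(ℂ, E) x₁).source := by
    simp [hy, hy']
  have h2 := h.contDiffAt (IsOpen.mem_nhds (by
    simpa [extChartAt] using ((chartAt E x₀).symm ≫ₕ (chartAt E x₁)).open_source) hm)
  simpa [transition, extChartAt, Function.comp_def] using h2

lemma contDiffAt_transition {x₀ x₁ : X} {y : E} (hy : y ∈ (chartAt E x₀).target)
    (hy' : (chartAt E x₀).symm y ∈ (chartAt E x₁).source) :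
    ContDiffAt ℝ ∞ (transition x₀ x₁) y :=
  ((contDiffAt_transition_complex hy hy').restrict_scalars ℝ).of_le le_top

lemma fderiv_transition_cplxJ {x₀ x₁ : X} {y : E} (hy : y ∈ (chartAt E x₀).target)
    (hy' : (chartAt E x₀).symm y ∈ (chartAt E x₁).source) (v : E) :
    fderiv ℝ (transition x₀ x₁) y (cplxJ E v) = cplxJ E (fderiv ℝ (transition x₀ x₁) y v) := by
  have h := (contDiffAt_transition_complex hy hy').differentiableAt (by simp)
  rw [h.fderiv_restrictScalars ℝ]
  simp [cplxJ_apply]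

/-- The tangent space at `x` is `E` by means of the chart at `x`. So the tangent map of the inverse
chart at `x₀` is the Jacobian of the change from the chart at `x₀` to the chart at `x`. -/
lemma fromChart_eq {x₀ x : X} (hx : x ∈ (chartAt E x₀).source) :
    fromChart x₀ x = fderiv ℝ (transition x₀ x) (chartAt E x₀ x) := by
  rw [fromChart, TangentBundle.symmL_trivializationAt_eq_core hx,
    tangentBundleCore_coordChange_achart]
  simp [transition, extChartAt]

lemma eventually_mem_target {x₀ x₁ : X} {y : E} (hy : y ∈ (chartAt E x₀).target)
    (hy' : (chartAt E x₀).symm y ∈ (chartAt E x₁).source) :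
    ∀ᶠ z in nhds y, z ∈ (chartAt E x₀).target ∧ (chartAt E x₀).symm z ∈ (chartAt E x₁).source :=
  Filter.Eventually.and ((chartAt E x₀).open_target.mem_nhds hy)
    (((chartAt E x₀).continuousAt_symm hy).preimage_mem_nhds
      ((chartAt E x₁).open_source.mem_nhds hy'))

lemma transition_comp {x₀ x₁ : X} (x₂ : X) {y : E} (hy : y ∈ (chartAt E x₀).target)
    (hy' : (chartAt E x₀).symm y ∈ (chartAt E x₁).source) :
    transition x₀ x₂ =ᶠ[nhds y] transition x₁ x₂ ∘ transition x₀ x₁ := by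
  filter_upwards [eventually_mem_target hy hy'] with z hz
  simp [transition, hz.2]

lemma fderiv_transition_comp {x₀ x₁ x₂ : X} {y : E} (hy : y ∈ (chartAt E x₀).target)
    (hy' : (chartAt E x₀).symm y ∈ (chartAt E x₁).source)
    (hy'' : (chartAt E x₀).symm y ∈ (chartAt E x₂).source) :
    fderiv ℝ (transition x₀ x₂) y =
      fderiv ℝ (transition x₁ x₂) (transition x₀ x₁ y) ∘L fderiv ℝ (transition x₀ x₁) y := by
  rw [(transition_comp x₂ hy hy').fderiv_eq, fderiv_comp]
  · refine (contDiffAt_transition ((chartAt E x₁).map_source hy') ?_).differentiableAt (by simp)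
    rwa [(chartAt E x₁).left_inv hy']
  · exact (contDiffAt_transition hy hy').differentiableAt (by simp)

lemma fderiv_transition_self {x₀ : X} {y : E} (hy : y ∈ (chartAt E x₀).target) :
    fderiv ℝ (transition x₀ x₀) y = ContinuousLinearMap.id ℝ E := by
  have : transition x₀ x₀ =ᶠ[nhds y] id := by
    filter_upwards [(chartAt E x₀).open_target.mem_nhds hy] with z hz
    simp [transition, hz]
  rw [this.fderiv_eq, fderiv_id]

/-- The cocycle property. -/
lemma fromChart_transition {x₀ x₁ : X} {y : E} (hy : y ∈ (chartAt E x₀).target)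
    (hy' : (chartAt E x₀).symm y ∈ (chartAt E x₁).source) :
    fromChart x₀ ((chartAt E x₀).symm y) =
      fromChart x₁ ((chartAt E x₀).symm y) ∘L fderiv ℝ (transition x₀ x₁) y := by
  rw [fromChart_eq ((chartAt E x₀).map_target hy), fromChart_eq hy', (chartAt E x₀).right_inv hy,
    fderiv_transition_comp hy hy' (mem_chart_source E _)]
  rfl

lemma fromChart_self (x : X) : fromChart x x = ContinuousLinearMap.id ℝ E := by
  rw [fromChart_eq (mem_chart_source E x), fderiv_transition_self (mem_chart_target E x)]

lemma fromChart_cplxJ {x₀ x : X} (hx : x ∈ (chartAt E x₀).source) (v : E) :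
    fromChart x₀ x (cplxJ E v) = cplxJ E (fromChart x₀ x v) := by
  rw [fromChart_eq hx]
  refine fderiv_transition_cplxJ ((chartAt E x₀).map_source hx) ?_ v
  rw [(chartAt E x₀).left_inv hx]
  exact mem_chart_source E x

/-- The inverse of `fromChart`. -/
def toChart (x₀ x : X) : E →L[ℝ] E := fderiv ℝ (transition x x₀) (chartAt E x x)

lemma toChart_fromChart {x₀ x : X} (hx : x ∈ (chartAt E x₀).source) (v : E) :
    toChart x₀ x (fromChart x₀ x v) = v := by
  have hx' : (chartAt E x₀).symm (chartAt E x₀ x) = x := (chartAt E x₀).left_inv hx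
  have h := fderiv_transition_comp (x₀ := x₀) (x₁ := x) (x₂ := x₀) ((chartAt E x₀).map_source hx)
    (by rw [hx']; exact mem_chart_source E x) (by rwa [hx'])
  rw [fderiv_transition_self ((chartAt E x₀).map_source hx)] at h
  have h2 := congrArg (fun T : E →L[ℝ] E => T v) h
  simp only [transition, Function.comp_apply, hx', ContinuousLinearMap.comp_apply] at h2
  rw [fromChart_eq hx]
  exact h2.symm

lemma fromChart_toChart {x₀ x : X} (hx : x ∈ (chartAt E x₀).source) (v : E) :
    fromChart x₀ x (toChart x₀ x v) = v := by
  have hx' : (chartAt E x).symm (chartAt E x x) = x :=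
    (chartAt E x).left_inv (mem_chart_source E x)
  have h := fderiv_transition_comp (x₀ := x) (x₁ := x₀) (x₂ := x) (mem_chart_target E x)
    (by rwa [hx']) (by rw [hx']; exact mem_chart_source E x)
  rw [fderiv_transition_self (mem_chart_target E x)] at h
  have h2 := congrArg (fun T : E →L[ℝ] E => T v) h
  simp only [transition, Function.comp_apply, hx', ContinuousLinearMap.comp_apply] at h2
  rw [fromChart_eq hx]
  exact h2.symm

end Charts

/-! ### Differentials of functions in charts. -/

noncomputable section ChartFunctions

variable {E : Type*} [NormedAddCommGroup E] [NormedSpace ℂ E] [FiniteDimensional ℂ E]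
  {X : Type*} [TopologicalSpace X] [ChartedSpace E X] [IsManifold 𝓘(ℂ, E) ω X]
  {W : Type*} [NormedAddCommGroup W] [NormedSpace ℝ W]

/-- The differential of a vector valued function, computed in the preferred chart. -/
def chartDeriv (f : X → W) (x : X) : E →L[ℝ] W :=
  fderiv ℝ (f ∘ (chartAt E x).symm) (chartAt E x x)

lemma mfderiv_eq_chartDeriv {f : X → W} {x : X} (hf : MDifferentiableAt 𝓘(ℝ, E) 𝓘(ℝ, W) f x) :
    (mfderiv 𝓘(ℝ, E) 𝓘(ℝ, W) f x : E →L[ℝ] W) = chartDeriv (E := E) f x := by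
  refine (if_pos hf).trans ?_
  simp [chartDeriv, writtenInExtChartAt, extChartAt]
  rfl

lemma differentiableAt_comp_chart_symm {f : X → W} {x₀ : X} {y : E}
    (hy : y ∈ (chartAt E x₀).target)
    (hf : MDifferentiableAt 𝓘(ℝ, E) 𝓘(ℝ, W) f ((chartAt E x₀).symm y)) :
    DifferentiableAt ℝ (f ∘ (chartAt E x₀).symm) y := by
  have h1 : MDifferentiableAt 𝓘(ℝ, E) 𝓘(ℝ, E) (chartAt E x₀).symm y :=
    ((contMDiffOn_chart_symm (I := 𝓘(ℝ, E)) (n := ∞) (x := x₀)).contMDiffAt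
      ((chartAt E x₀).open_target.mem_nhds hy)).mdifferentiableAt (by simp)
  exact mdifferentiableAt_iff_differentiableAt.mp (hf.comp y h1)

lemma contDiffAt_comp_chart_symm {f : X → W} {x₀ : X} {y : E} {n : ℕ∞}
    (hy : y ∈ (chartAt E x₀).target)
    (hf : ContMDiffAt 𝓘(ℝ, E) 𝓘(ℝ, W) n f ((chartAt E x₀).symm y)) :
    ContDiffAt ℝ n (f ∘ (chartAt E x₀).symm) y := by
  have h1 : ContMDiffAt 𝓘(ℝ, E) 𝓘(ℝ, E) n (chartAt E x₀).symm y :=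
    ((contMDiffOn_chart_symm (I := 𝓘(ℝ, E)) (n := ∞) (x := x₀)).contMDiffAt
      ((chartAt E x₀).open_target.mem_nhds hy)).of_le (WithTop.coe_le_coe.2 le_top)
  exact contMDiffAt_iff_contDiffAt.mp (hf.comp y h1)

lemma fderiv_comp_chart_symm {f : X → W} {x₀ : X} {y : E} (hy : y ∈ (chartAt E x₀).target)
    (hf : MDifferentiableAt 𝓘(ℝ, E) 𝓘(ℝ, W) f ((chartAt E x₀).symm y)) :
    fderiv ℝ (f ∘ (chartAt E x₀).symm) y =
      chartDeriv f ((chartAt E x₀).symm y) ∘L fromChart x₀ ((chartAt E x₀).symm y) := by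
  set x := (chartAt E x₀).symm y with hx
  have hx0 : x ∈ (chartAt E x₀).source := (chartAt E x₀).map_target hy
  have hyx : chartAt E x₀ x = y := (chartAt E x₀).right_inv hy
  have he : f ∘ (chartAt E x₀).symm =ᶠ[nhds y]
      (f ∘ (chartAt E x).symm) ∘ transition x₀ x := by
    filter_upwards [eventually_mem_target hy (mem_chart_source E x)] with z hz
    simp [transition, hz.2]
  have hτ : transition x₀ x y = chartAt E x x := by simp [transition, ← hx]
  rw [he.fderiv_eq, fderiv_comp, fromChart_eq hx0, hyx, hτ, chartDeriv]
  · rw [hτ]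
    refine differentiableAt_comp_chart_symm (mem_chart_target E x) ?_
    rwa [(chartAt E x).left_inv (mem_chart_source E x)]
  · exact (contDiffAt_transition hy (mem_chart_source E x)).differentiableAt (by simp)

end ChartFunctions

/-! ### Local frames of the line bundle and the complex Leibniz rule. -/

noncomputable section BundleCharts

open Bundle

variable {E : Type*} [NormedAddCommGroup E] [NormedSpace ℂ E] [FiniteDimensional ℂ E]
  {X : Type*} [TopologicalSpace X] [ChartedSpace E X] [IsManifold 𝓘(ℂ, E) ω X]
  {L : X → Type*} [∀ x, NormedAddCommGroup (L x)] [∀ x, InnerProductSpace ℂ (L x)]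
  [TopologicalSpace (Bundle.TotalSpace ℂ L)] [FiberBundle ℂ L] [VectorBundle ℂ ℂ L]

variable (E L) in
/-- The domain of the local expressions at `x₀`. -/
def localDomain (x₀ : X) : Set E :=
  (chartAt E x₀).target ∩ (chartAt E x₀).symm ⁻¹' (trivializationAt ℂ L x₀).baseSet

lemma isOpen_localDomain (x₀ : X) : IsOpen (localDomain E L x₀) :=
  (chartAt E x₀).isOpen_inter_preimage_symm (trivializationAt ℂ L x₀).open_baseSet

lemma mem_localDomain_self (x : X) : chartAt E x x ∈ localDomain E L x := by
  refine ⟨mem_chart_target E x, ?_⟩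
  rw [Set.mem_preimage, (chartAt E x).left_inv (mem_chart_source E x)]
  exact FiberBundle.mem_baseSet_trivializationAt' x

/-- The fibre coordinate at `x` of the preferred trivialization at `x₀`. -/
def fiberCoord (x₀ x : X) : L x →L[ℝ] ℂ := (trivializationAt ℂ L x₀).continuousLinearMapAt ℝ x

/-- The local frame given by the preferred trivialization at `x₀`. -/
def localFrame (x₀ x : X) : L x := (trivializationAt ℂ L x₀).symmL ℝ x 1

/-- The coordinate of the underlying real bundle coincides with that of the complex bundle, so it is
complex linear although it is only declared real linear. -/
lemma continuousLinearMapAt_smul (x₀ x : X) (c : ℂ) (l : L x) :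
    fiberCoord x₀ x (c • l) = c • fiberCoord x₀ x l := by
  have h : ∀ l : L x, fiberCoord x₀ x l =
      (trivializationAt ℂ L x₀).continuousLinearMapAt ℂ x l := fun l => by
    simp only [fiberCoord, Trivialization.continuousLinearMapAt_apply,
      Trivialization.coe_linearMapAt]
  rw [h, h, map_smul]

lemma symmL_eq_smul (x₀ x : X) (c : ℂ) :
    (trivializationAt ℂ L x₀).symmL ℝ x c = c • localFrame x₀ x := by
  by_cases hx : x ∈ (trivializationAt ℂ L x₀).baseSet
  · have h : ∀ c : ℂ, (trivializationAt ℂ L x₀).symmL ℝ x c =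
        (trivializationAt ℂ L x₀).symmL ℂ x c := fun c => by
      rw [Trivialization.symmL_apply _ hx, Trivialization.symmL_apply _ hx]
    rw [localFrame, h, h, ← map_smul, smul_eq_mul, mul_one]
  -- Outside the base set `symmL` takes the default value zero, so both sides vanish.
  · simp [localFrame, hx]

lemma fiberCoord_localFrame {x₀ x : X} (hx : x ∈ (trivializationAt ℂ L x₀).baseSet) :
    fiberCoord x₀ x (localFrame x₀ x : L x) = 1 :=
  (trivializationAt ℂ L x₀).continuousLinearMapAt_symmL hx 1

lemma fiberCoord_smul_localFrame {x₀ x : X} (hx : x ∈ (trivializationAt ℂ L x₀).baseSet)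
    (l : L x) : fiberCoord x₀ x l • (localFrame x₀ x : L x) = l := by
  rw [← symmL_eq_smul]
  exact (trivializationAt ℂ L x₀).symmL_continuousLinearMapAt hx l

/-- The transition function of the line bundle. -/
def frameChange (L : X → Type*) [∀ x, NormedAddCommGroup (L x)] [∀ x, InnerProductSpace ℂ (L x)]
    [TopologicalSpace (Bundle.TotalSpace ℂ L)] [FiberBundle ℂ L] [VectorBundle ℂ ℂ L]
    (x₀ x₁ x : X) : ℂ := fiberCoord x₀ x (localFrame x₁ x : L x)

lemma fiberCoord_change {x₀ x₁ x : X} (hx : x ∈ (trivializationAt ℂ L x₁).baseSet) (l : L x) :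
    fiberCoord x₀ x l = frameChange L x₀ x₁ x * fiberCoord x₁ x l := by
  conv_lhs => rw [← fiberCoord_smul_localFrame hx l]
  rw [continuousLinearMapAt_smul, smul_eq_mul, mul_comm, frameChange]

lemma localFrame_change {x₀ x₁ x : X} (hx : x ∈ (trivializationAt ℂ L x₀).baseSet) :
    (localFrame x₁ x : L x) = frameChange L x₀ x₁ x • localFrame x₀ x :=
  (fiberCoord_smul_localFrame hx _).symm

lemma frameChange_ne_zero {x₀ x₁ x : X} (hx : x ∈ (trivializationAt ℂ L x₀).baseSet)
    (hx' : x ∈ (trivializationAt ℂ L x₁).baseSet) : frameChange L x₀ x₁ x ≠ 0 := fun h => by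
  have h1 := fiberCoord_localFrame (L := L) hx'
  rw [localFrame_change hx, h, zero_smul, map_zero] at h1
  exact zero_ne_one h1

namespace Form

lemma inChart_apply (u : Form E L) (k : ℕ) (x₀ : X) (y : E) (m : Fin k → E) :
    u.inChart k x₀ y m = fiberCoord x₀ ((chartAt E x₀).symm y) (u k ((chartAt E x₀).symm y)
      fun i => fromChart x₀ ((chartAt E x₀).symm y) (m i)) := rfl

/-- The change of local expressions. -/
lemma inChart_transition (u : Form E L) (k : ℕ) {x₀ x₁ : X} {y : E}
    (hy : y ∈ (chartAt E x₀).target) (hy' : (chartAt E x₀).symm y ∈ (chartAt E x₁).source)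
    (hb : (chartAt E x₀).symm y ∈ (trivializationAt ℂ L x₁).baseSet) :
    u.inChart k x₀ y = frameChange L x₀ x₁ ((chartAt E x₀).symm y) •
      (u.inChart k x₁ (transition x₀ x₁ y)).compContinuousLinearMap
        (fderiv ℝ (transition x₀ x₁) y) := by
  ext m
  have h : (chartAt E x₁).symm (transition x₀ x₁ y) = (chartAt E x₀).symm y := by
    simp [transition, hy']
  simp only [ContinuousAlternatingMap.smul_apply,
    ContinuousAlternatingMap.compContinuousLinearMap_apply, inChart_apply, Function.comp_apply,
    fromChart_transition hy hy', ContinuousLinearMap.comp_apply, smul_eq_mul]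
  have haux : ∀ z, z = (chartAt E x₀).symm y → ∀ m' : Fin k → E,
      fiberCoord x₁ z (u k z fun i => fromChart x₁ z (m' i)) =
        fiberCoord x₁ ((chartAt E x₀).symm y) (u k ((chartAt E x₀).symm y)
          fun i => fromChart x₁ ((chartAt E x₀).symm y) (m' i)) := by
    rintro z rfl m'
    rfl
  rw [haux _ h]
  exact fiberCoord_change hb _

lemma inChart_toFiber {k : ℕ} {x₀ x : X} (hx : x ∈ (trivializationAt ℂ L x).baseSet)
    (w : E [⋀^Fin k]→L[ℝ] ℂ) (m : Fin k → E) :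
    fiberCoord x₀ x (toFiber (L := L) x w m) = frameChange L x₀ x x * w m := by
  rw [fiberCoord_change hx]
  congr 1
  exact (trivializationAt ℂ L x).continuousLinearMapAt_symmL hx _

end Form

section Smooth

variable [ContMDiffVectorBundle ∞ ℂ L 𝓘(ℝ, E)]

lemma contMDiffAt_section_iff {σ : ∀ x, L x} {x₀ x : X}
    (hx : x ∈ (trivializationAt ℂ L x₀).baseSet) :
    ContMDiffAt 𝓘(ℝ, E) (𝓘(ℝ, E).prod 𝓘(ℝ, ℂ)) ∞ (fun z => TotalSpace.mk' ℂ z (σ z)) x ↔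
      ContMDiffAt 𝓘(ℝ, E) 𝓘(ℝ, ℂ) ∞ (fun z => fiberCoord x₀ z (σ z)) x := by
  rw [(trivializationAt ℂ L x₀).contMDiffAt_section_iff hx]
  refine Filter.EventuallyEq.contMDiffAt_iff ?_
  filter_upwards [(trivializationAt ℂ L x₀).open_baseSet.mem_nhds hx] with z hz
  rw [fiberCoord, Trivialization.continuousLinearMapAt_apply_of_mem _ _ hz]

lemma isDiffSection_iff {σ : ∀ x, L x} {x₀ x : X}
    (hx : x ∈ (trivializationAt ℂ L x₀).baseSet) :
    IsDiffSection E σ x ↔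
      MDifferentiableAt 𝓘(ℝ, E) 𝓘(ℝ, ℂ) (fun z => fiberCoord x₀ z (σ z)) x := by
  have : ContMDiffVectorBundle 1 ℂ L 𝓘(ℝ, E) := .of_le (n := ∞) (WithTop.coe_le_coe.2 le_top)
  rw [IsDiffSection, (trivializationAt ℂ L x₀).mdifferentiableAt_section_iff 𝓘(ℝ, E) σ hx]
  refine Filter.EventuallyEq.mdifferentiableAt_iff ?_
  filter_upwards [(trivializationAt ℂ L x₀).open_baseSet.mem_nhds hx] with z hz
  rw [fiberCoord, Trivialization.continuousLinearMapAt_apply_of_mem _ _ hz]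

lemma contMDiffAt_localFrame {x₀ x : X} (hx : x ∈ (trivializationAt ℂ L x₀).baseSet) :
    ContMDiffAt 𝓘(ℝ, E) (𝓘(ℝ, E).prod 𝓘(ℝ, ℂ)) ∞
      (fun z => TotalSpace.mk' ℂ z (localFrame x₀ z : L z)) x := by
  rw [contMDiffAt_section_iff hx]
  refine (contMDiffAt_const (c := (1 : ℂ))).congr_of_eventuallyEq ?_
  filter_upwards [(trivializationAt ℂ L x₀).open_baseSet.mem_nhds hx] with z hz
    using fiberCoord_localFrame hz

lemma isDiffSection_localFrame {x₀ x : X} (hx : x ∈ (trivializationAt ℂ L x₀).baseSet) :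
    IsDiffSection E (fun z => (localFrame x₀ z : L z)) x :=
  (contMDiffAt_localFrame hx).mdifferentiableAt (by simp)

lemma contMDiffAt_frameChange {x₀ x₁ x : X} (hx : x ∈ (trivializationAt ℂ L x₀).baseSet)
    (hx' : x ∈ (trivializationAt ℂ L x₁).baseSet) :
    ContMDiffAt 𝓘(ℝ, E) 𝓘(ℝ, ℂ) ∞ (frameChange L x₀ x₁) x :=
  (contMDiffAt_section_iff hx).mp (contMDiffAt_localFrame hx')

lemma IsDiffSection.smul {f : X → ℂ} {σ : ∀ x, L x} {x : X} (hσ : IsDiffSection E σ x)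
    (hf : MDifferentiableAt 𝓘(ℝ, E) 𝓘(ℝ, ℂ) f x) : IsDiffSection E (fun z => f z • σ z) x := by
  have hb := FiberBundle.mem_baseSet_trivializationAt' (F := ℂ) (E := L) x
  rw [isDiffSection_iff hb] at hσ ⊢
  simp only [continuousLinearMapAt_smul]
  exact hf.mul hσ

variable {D : CovariantDerivative 𝓘(ℝ, E) ℂ L}

/-- The Leibniz rule for complex valued functions. -/
lemma IsHermitianConnection.leibniz (hD : IsHermitianConnection D) {f : X → ℂ} {σ : ∀ x, L x}
    {x : X} (hf : MDifferentiableAt 𝓘(ℝ, E) 𝓘(ℝ, ℂ) f x) (hσ : IsDiffSection E σ x) (v : E) :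
    (D (fun z => f z • σ z) x : E →L[ℝ] L x) v =
      f x • (D σ x : E →L[ℝ] L x) v + (chartDeriv f x : E →L[ℝ] ℂ) v • σ x := by
  have hre : MDifferentiableAt 𝓘(ℝ, E) 𝓘(ℝ, ℝ) (fun z => (f z).re) x :=
    Complex.reCLM.mdifferentiableAt.comp x hf
  have him : MDifferentiableAt 𝓘(ℝ, E) 𝓘(ℝ, ℝ) (fun z => (f z).im) x :=
    Complex.imCLM.mdifferentiableAt.comp x hf
  have hb := FiberBundle.mem_baseSet_trivializationAt' (F := ℂ) (E := L) x
  have hIσ : IsDiffSection E (Complex.I • σ) x := by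
    rw [isDiffSection_iff hb] at hσ ⊢
    have h2 := ((Complex.I • ContinuousLinearMap.id ℝ ℂ).mdifferentiableAt).comp x hσ
    refine h2.congr_of_eventuallyEq (Filter.Eventually.of_forall fun z => ?_)
    simp [continuousLinearMapAt_smul]
  -- A covariant derivative obeys the Leibniz rule for real functions only. Writing `f σ` as `Re f ·
  -- σ + Im f · (i σ)`, the rule is applied twice, and complex linearity of `D` evaluates the
  -- derivative of `i σ`.
  have e1 : (fun z => f z • σ z) =
      (fun z => (f z).re) • σ + (fun z => (f z).im) • (Complex.I • σ) := by
    funext z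
    simp only [Pi.add_apply, Pi.smul_apply', Pi.smul_apply, ← Complex.coe_smul, smul_smul,
      ← add_smul]
    congr 1
    exact (Complex.re_add_im _).symm
  have hsum := D.isCovariantDerivativeOnUniv.add (hre.smul_section hσ) (him.smul_section hIσ)
    (Set.mem_univ x)
  have l1 := D.isCovariantDerivativeOnUniv.leibniz hσ hre (Set.mem_univ x)
  have l2 := D.isCovariantDerivativeOnUniv.leibniz hIσ him (Set.mem_univ x)
  have hI := hD.map_smul Complex.I σ x hσ v
  have d1 : (mvfderiv 𝓘(ℝ, E) (fun z => (f z).re) x : E →L[ℝ] ℝ) v =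
      ((chartDeriv f x : E →L[ℝ] ℂ) v).re := by
    have h := mfderiv_eq_chartDeriv hre
    have h3 : (chartDeriv (fun z => (f z).re) x : E →L[ℝ] ℝ) =
        Complex.reCLM ∘L (chartDeriv f x : E →L[ℝ] ℂ) := by
      have hd : DifferentiableAt ℝ (f ∘ (chartAt E x).symm) (chartAt E x x) :=
        differentiableAt_comp_chart_symm (mem_chart_target E x)
          (by rwa [(chartAt E x).left_inv (mem_chart_source E x)])
      exact (Complex.reCLM.hasFDerivAt.comp _ hd.hasFDerivAt).fderiv
    exact (congrArg (fun T : E →L[ℝ] ℝ => T v) h).trans (by rw [h3]; rfl)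
  have d2 : (mvfderiv 𝓘(ℝ, E) (fun z => (f z).im) x : E →L[ℝ] ℝ) v =
      ((chartDeriv f x : E →L[ℝ] ℂ) v).im := by
    have h := mfderiv_eq_chartDeriv him
    have h3 : (chartDeriv (fun z => (f z).im) x : E →L[ℝ] ℝ) =
        Complex.imCLM ∘L (chartDeriv f x : E →L[ℝ] ℂ) := by
      have hd : DifferentiableAt ℝ (f ∘ (chartAt E x).symm) (chartAt E x x) :=
        differentiableAt_comp_chart_symm (mem_chart_target E x)
          (by rwa [(chartAt E x).left_inv (mem_chart_source E x)])
      exact (Complex.imCLM.hasFDerivAt.comp _ hd.hasFDerivAt).fderiv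
    exact (congrArg (fun T : E →L[ℝ] ℝ => T v) h).trans (by rw [h3]; rfl)
  rw [e1]
  have hv := congrArg (fun T : E →L[ℝ] L x => T v) hsum
  have l1v := congrArg (fun T : E →L[ℝ] L x => T v) l1
  have l2v := congrArg (fun T : E →L[ℝ] L x => T v) l2
  refine hv.trans ?_
  refine (congrArg₂ (· + ·) l1v l2v).trans ?_
  change ((f x).re • (D σ x : E →L[ℝ] L x) v +
      (mvfderiv 𝓘(ℝ, E) (fun z => (f z).re) x : E →L[ℝ] ℝ) v • σ x) +
    ((f x).im • (D (Complex.I • σ) x : E →L[ℝ] L x) v +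
      (mvfderiv 𝓘(ℝ, E) (fun z => (f z).im) x : E →L[ℝ] ℝ) v • (Complex.I • σ x)) = _
  have hI' : (D (Complex.I • σ) x : E →L[ℝ] L x) v = Complex.I • (D σ x : E →L[ℝ] L x) v := hI
  rw [hI', d1, d2]
  have hz : ∀ z : ℂ, ∀ l : L x, z.re • l + z.im • Complex.I • l = z • l := fun z l => by
    rw [← Complex.coe_smul, ← Complex.coe_smul, smul_smul, ← add_smul, Complex.re_add_im]
  rw [← hz (f x), ← hz ((chartDeriv f x : E →L[ℝ] ℂ) v)]
  abel

end Smooth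

end BundleCharts

noncomputable section LocalGeometry

open Bundle
open ContinuousAlternatingMap (alternatizeUncurryFin alternatizeUncurryFinCLM
  alternatizeUncurryFin_apply ofSubsingletonLIE)

variable {E : Type*} [NormedAddCommGroup E] [NormedSpace ℂ E] [FiniteDimensional ℂ E]
  {X : Type*} [TopologicalSpace X] [ChartedSpace E X] [IsManifold 𝓘(ℂ, E) ω X]

/-! ### The metric in a chart -/

/-- The metric in the preferred chart at `x₀`. -/
def metricChart (g : TangentMetric E X) (x₀ : X) (y : E) : E →L[ℝ] E →L[ℝ] ℝ :=
  (metricAt g ((chartAt E x₀).symm y)).bilinearComp (fromChart x₀ ((chartAt E x₀).symm y))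
    (fromChart x₀ ((chartAt E x₀).symm y))

lemma metricChart_apply (g : TangentMetric E X) (x₀ : X) (y v w : E) :
    metricChart g x₀ y v w = metricAt g ((chartAt E x₀).symm y)
      (fromChart x₀ ((chartAt E x₀).symm y) v) (fromChart x₀ ((chartAt E x₀).symm y) w) := rfl

lemma volumeDensity_eq (g : TangentMetric E X) (x₀ : X) (y : E) :
    volumeDensity g x₀ y = metricDensity (metricChart g x₀ y) := rfl

lemma metricAt_symm (g : TangentMetric E X) (x : X) (v w : E) :
    metricAt g x v w = metricAt g x w v := g.symm x v w

lemma metricAt_pos (g : TangentMetric E X) (x : X) {v : E} (hv : v ≠ 0) : 0 < metricAt g x v v :=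
  g.pos x v hv

lemma metricChart_symm (g : TangentMetric E X) (x₀ : X) (y v w : E) :
    metricChart g x₀ y v w = metricChart g x₀ y w v := by
  rw [metricChart_apply, metricChart_apply, metricAt_symm]

lemma metricChart_pos (g : TangentMetric E X) {x₀ : X} {y : E} (hy : y ∈ (chartAt E x₀).target)
    {v : E} (hv : v ≠ 0) : 0 < metricChart g x₀ y v v := by
  rw [metricChart_apply]
  refine metricAt_pos g _ fun h => hv ?_
  rw [← toChart_fromChart ((chartAt E x₀).map_target hy) v, h, map_zero]

lemma metricChart_hermitian {g : TangentMetric E X} (hg : IsHermitian g) {x₀ : X} {y : E}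
    (hy : y ∈ (chartAt E x₀).target) (v w : E) :
    metricChart g x₀ y (cplxJ E v) (cplxJ E w) = metricChart g x₀ y v w := by
  rw [metricChart_apply, fromChart_cplxJ ((chartAt E x₀).map_target hy),
    fromChart_cplxJ ((chartAt E x₀).map_target hy), hg]
  rfl

/-- Vector fields with constant components in the chart at `x₀` are smooth. Evaluating a smooth
tensor on them shows that its coefficients are smooth. -/
lemma contMDiffAt_fromChart_apply {x₀ x : X} (hx : x ∈ (chartAt E x₀).source) (a : E) :
    ContMDiffAt 𝓘(ℝ, E) (𝓘(ℝ, E).prod 𝓘(ℝ, E)) ∞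
      (fun z => TotalSpace.mk' E (E := fun z : X => TangentSpace 𝓘(ℝ, E) z) z
        ((fromChart x₀ z : E →L[ℝ] E) a)) x := by
  have hb : (trivializationAt E (TangentSpace 𝓘(ℝ, E) : X → Type _) x₀).baseSet =
    (chartAt E x₀).source := rfl
  refine (Trivialization.contMDiffAt_section_iff (n := ∞) (𝕜 := ℝ) (F := E)
    (E := fun z : X => TangentSpace 𝓘(ℝ, E) z) (IB := 𝓘(ℝ, E))
    (trivializationAt E (fun z : X => TangentSpace 𝓘(ℝ, E) z) x₀) (s := fun z => (fromChart x₀ z : E →L[ℝ] E) a) hx).mpr ?_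
  refine (contMDiffAt_const (c := a)).congr_of_eventuallyEq ?_
  filter_upwards [(chartAt E x₀).open_source.mem_nhds hx] with z hz
  have h := (trivializationAt E (TangentSpace 𝓘(ℝ, E) : X → Type _) x₀).continuousLinearMapAt_symmL
    (R := ℝ) hz a
  rw [Trivialization.continuousLinearMapAt_apply_of_mem _ _ hz] at h
  exact h

lemma contDiffOn_metricChart (g : TangentMetric E X) (x₀ : X) :
    ContDiffOn ℝ ∞ (metricChart g x₀) (chartAt E x₀).target := by
  refine contDiffOn_clm_apply.mpr fun a => contDiffOn_clm_apply.mpr fun b => fun y hy => ?_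
  refine ContDiffAt.contDiffWithinAt ?_
  have hx := (chartAt E x₀).map_target hy
  have h : ContMDiffAt 𝓘(ℝ, E) 𝓘(ℝ, ℝ) ∞
      (fun z => g.inner z ((fromChart x₀ z : E →L[ℝ] E) a) ((fromChart x₀ z : E →L[ℝ] E) b)) ((chartAt E x₀).symm y) := by
    have : ContMDiffAt 𝓘(ℝ, E) (𝓘(ℝ, E).prod 𝓘(ℝ)) ∞
      (fun z => TotalSpace.mk' ℝ (E := Bundle.Trivial X ℝ) z
        (g.inner z ((fromChart x₀ z : E →L[ℝ] E) a) ((fromChart x₀ z : E →L[ℝ] E) b))) ((chartAt E x₀).symm y) := by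
      apply ContMDiffAt.clm_bundle_apply₂ (F₁ := E) (F₂ := E)
      · exact g.contMDiff.contMDiffAt
      · exact contMDiffAt_fromChart_apply hx a
      · exact contMDiffAt_fromChart_apply hx b
    simp only [contMDiffAt_totalSpace] at this
    exact this.2
  exact contDiffAt_comp_chart_symm hy h

/-- The fundamental form of a metric on a vector space. -/
def metricForm (G : E →L[ℝ] E →L[ℝ] ℝ) : E [⋀^Fin 2]→L[ℝ] ℂ :=
  (1 / 2 : ℂ) • alternatizeUncurryFin
    ((ofSubsingletonLIE (𝕜 := ℝ) (E := E) (F := ℂ) (0 : Fin 1)).toContinuousLinearEquiv.toContinuousLinearMap ∘L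
      ContinuousLinearMap.compL ℝ E ℝ ℂ Complex.ofRealCLM ∘L G ∘L cplxJ E)

lemma metricForm_apply (G : E →L[ℝ] E →L[ℝ] ℝ) (m : Fin 2 → E) :
    metricForm G m = (1 / 2 : ℂ) * (G (cplxJ E (m 0)) (m 1) - G (cplxJ E (m 1)) (m 0)) := by
  have h : ∀ a b, (ofSubsingletonLIE (𝕜 := ℝ) (E := E) (F := ℂ) (0 : Fin 1)) (Complex.ofRealCLM ∘L G (cplxJ E a)) b =
    (G (cplxJ E a) (b 0) : ℂ) := fun a b => rfl
  have h2 : alternatizeUncurryFin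
    ((ofSubsingletonLIE (𝕜 := ℝ) (E := E) (F := ℂ) (0 : Fin 1)).toContinuousLinearEquiv.toContinuousLinearMap ∘L
      ContinuousLinearMap.compL ℝ E ℝ ℂ Complex.ofRealCLM ∘L G ∘L cplxJ E) m =
      (G (cplxJ E (m 0)) (m 1) : ℂ) - G (cplxJ E (m 1)) (m 0) := by
    rw [alternatizeUncurryFin_apply, Fin.sum_univ_two]
    change (-1 : ℤ) ^ 0 • (G (cplxJ E (m 0)) ((0 : Fin 2).removeNth m 0) : ℂ) +
      (-1 : ℤ) ^ 1 • (G (cplxJ E (m 1)) ((1 : Fin 2).removeNth m 0) : ℂ) = _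
    simp [Fin.removeNth, sub_eq_add_neg]
  rw [metricForm, ContinuousAlternatingMap.smul_apply, h2, smul_eq_mul]

lemma fundamentalForm_eq (g : TangentMetric E X) (x : X) :
    fundamentalForm g x = metricForm (metricAt g x) := rfl

lemma fundamentalForm_inChart (g : TangentMetric E X) {x₀ : X} {y : E}
    (hy : y ∈ (chartAt E x₀).target) :
    (fundamentalForm g).inChart x₀ y = metricForm (metricChart g x₀ y) := by
  ext m
  rw [ScalarForm.inChart, ContinuousAlternatingMap.compContinuousLinearMap_apply,
    fundamentalForm_eq, metricForm_apply, metricForm_apply]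
  simp only [Function.comp_apply, metricChart_apply,
    fromChart_cplxJ ((chartAt E x₀).map_target hy)]

lemma contDiffOn_metricForm {G : E → E →L[ℝ] E →L[ℝ] ℝ} {U : Set E} (hG : ContDiffOn ℝ ∞ G U) :
    ContDiffOn ℝ ∞ (fun y => metricForm (G y)) U :=
  ((alternatizeUncurryFinCLM ℝ E ℂ).contDiff.comp_contDiffOn (contDiffOn_const.clm_comp
    (contDiffOn_const.clm_comp (hG.clm_comp contDiffOn_const)))).const_smul _

/-- The derivative `ScalarForm.d` is computed at each point in the chart attached to that point.
Naturality of the exterior derivative carries closedness over to all points of one fixed chart. -/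
lemma extDeriv_fundamentalForm_inChart (g : TangentMetric E X) (hd : (fundamentalForm g).d = 0)
    {x₀ : X} {y : E} (hy : y ∈ (chartAt E x₀).target) :
    extDeriv ((fundamentalForm g).inChart x₀) y = 0 := by
  set x := (chartAt E x₀).symm y with hx
  have hτ : transition x₀ x y = chartAt E x x := by simp [transition, ← hx]
  have he : (fundamentalForm g).inChart x₀ =ᶠ[nhds y] fun z =>
      ((fundamentalForm g).inChart x (transition x₀ x z)).compContinuousLinearMap
        (fderiv ℝ (transition x₀ x) z) := by
    filter_upwards [eventually_mem_target hy (mem_chart_source E x)] with z hz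
    have h1 : (chartAt E x).symm (transition x₀ x z) = (chartAt E x₀).symm z := by
      simp [transition, hz.2]
    have h2 : ∀ p, p = (chartAt E x₀).symm z → ((fundamentalForm g) p).compContinuousLinearMap
        (fromChart x p) = ((fundamentalForm g) ((chartAt E x₀).symm z)).compContinuousLinearMap
        (fromChart x ((chartAt E x₀).symm z)) := by
      rintro p rfl; rfl
    rw [ScalarForm.inChart, ScalarForm.inChart, h2 _ h1, fromChart_transition hz.1 hz.2]
    rfl
  have hdiff : DifferentiableAt ℝ ((fundamentalForm g).inChart x) (chartAt E x x) := by
    have h1 := contDiffOn_metricForm (contDiffOn_metricChart g x)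
    refine (h1.differentiableAt_of_isOpen (chartAt E x).open_target
      (mem_chart_target E x)).congr_of_eventuallyEq ?_
    filter_upwards [(chartAt E x).open_target.mem_nhds (mem_chart_target E x)] with z hz
      using fundamentalForm_inChart g hz
  rw [he.extDeriv_eq, extDeriv_pullback (r := ∞) (by rwa [hτ])
    (contDiffAt_transition hy (mem_chart_source E x)) (by
      rw [minSmoothness_of_isRCLikeNormedField]
      exact WithTop.coe_le_coe.2 (le_top : (2 : ℕ∞) ≤ ⊤)), hτ]
  have h0 : extDeriv ((fundamentalForm g).inChart x) (chartAt E x x) = 0 := congrFun hd x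
  rw [h0]
  rfl

/-- Closedness evaluated on constant vectors. The exterior derivative is an alternating sum, and
skewness of the fundamental form changes the sign of its middle term, which gives the cyclic sum. -/
lemma metricChart_closed {g : TangentMetric E X} (hg : IsKaehler g) {x₀ : X} {y : E}
    (hy : y ∈ (chartAt E x₀).target) (a b c : E) :
    fderiv ℝ (metricChart g x₀) y a (cplxJ E b) c + fderiv ℝ (metricChart g x₀) y b (cplxJ E c) a +
      fderiv ℝ (metricChart g x₀) y c (cplxJ E a) b = 0 := by
  have hG := (contDiffOn_metricChart g x₀).differentiableAt_of_isOpen (chartAt E x₀).open_target hy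
  set G' := fderiv ℝ (metricChart g x₀) y with hG'
  have hd : ∀ p q, HasFDerivAt (fun z => metricChart g x₀ z p q) ((G'.flip p).flip q) y :=
    fun p q => by
      have h := (hG.hasFDerivAt.clm_apply (hasFDerivAt_const p y)).clm_apply
        (hasFDerivAt_const q y)
      convert! h using 1
      ext w
      simp [hG']
  -- Since `J` is skew throughout the chart, `(p, q) ↦ G (J p, q)` is antisymmetric, and so is its
  -- derivative. The antisymmetrization in `metricForm` can therefore be dropped.
  have hskew : ∀ w p q, G' w (cplxJ E p) q = -G' w (cplxJ E q) p := fun w p q => by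
    have h1 : HasFDerivAt (fun z => metricChart g x₀ z (cplxJ E p) q)
        (-((G'.flip (cplxJ E q)).flip p)) y := by
      refine (hd (cplxJ E q) p).neg.congr_of_eventuallyEq ?_
      filter_upwards [(chartAt E x₀).open_target.mem_nhds hy] with z hz
      have := metricChart_hermitian hg.1 hz (cplxJ E p) q
      rw [cplxJ_cplxJ] at this
      rw [← this, metricChart_symm]
      simp
    exact congrArg (fun T : E →L[ℝ] ℝ => T w) ((hd (cplxJ E p) q).unique h1)
  have hω := contDiffOn_metricForm (contDiffOn_metricChart g x₀)
  have hωd := hω.differentiableAt_of_isOpen (chartAt E x₀).open_target hy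
  have happ : ∀ w (m : Fin 2 → E), fderiv ℝ (fun z => metricForm (metricChart g x₀ z)) y w m =
      (G' w (cplxJ E (m 0)) (m 1) : ℂ) := fun w m => by
    have h1 := ((ContinuousAlternatingMap.apply ℝ E ℂ m).hasFDerivAt.comp y hωd.hasFDerivAt)
    have h2 : HasFDerivAt (fun z => metricForm (metricChart g x₀ z) m) _ y :=
      (((Complex.ofRealCLM.hasFDerivAt.comp y (hd (cplxJ E (m 0)) (m 1))).sub
        (Complex.ofRealCLM.hasFDerivAt.comp y (hd (cplxJ E (m 1)) (m 0)))).const_mul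
          (1 / 2 : ℂ)).congr_of_eventuallyEq
        (Filter.Eventually.of_forall fun z => metricForm_apply _ m)
    have h3 := congrArg (fun T : E →L[ℝ] ℂ => T w) (h1.unique h2)
    have h4 : fderiv ℝ (fun z => metricForm (metricChart g x₀ z)) y w m =
      (1 / 2 : ℂ) * ((G' w (cplxJ E (m 0)) (m 1) : ℂ) - (G' w (cplxJ E (m 1)) (m 0) : ℂ)) := h3
    rw [h4, hskew w (m 1) (m 0)]
    push_cast
    ring
  have he := extDeriv_fundamentalForm_inChart g hg.2 hy
  have heq : (fundamentalForm g).inChart x₀ =ᶠ[nhds y]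
      fun z => metricForm (metricChart g x₀ z) := by
    filter_upwards [(chartAt E x₀).open_target.mem_nhds hy] with z hz
      using fundamentalForm_inChart g hz
  rw [heq.extDeriv_eq] at he
  have hv := congrArg (fun u : E [⋀^Fin 3]→L[ℝ] ℂ => u ![a, b, c]) he
  have hsum : ∀ f : Fin (2 + 1) → ℂ, ∑ i, f i = f 0 + f 1 + f 2 := Fin.sum_univ_three
  rw [extDeriv, alternatizeUncurryFin_apply, hsum] at hv
  simp only [happ] at hv
  simp [Fin.removeNth, Fin.succAbove] at hv
  have hv' : G' a (cplxJ E b) c - G' b (cplxJ E a) c + G' c (cplxJ E a) b = 0 := by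
    exact_mod_cast (by rw [← hv]; ring :
      ((G' a (cplxJ E b) c : ℂ) - G' b (cplxJ E a) c + G' c (cplxJ E a) b = 0))
  rw [hskew b a c] at hv'
  linarith

/-! ### The connection in a chart -/

variable {L : X → Type*} [∀ x, NormedAddCommGroup (L x)] [∀ x, InnerProductSpace ℂ (L x)]
  [TopologicalSpace (Bundle.TotalSpace ℂ L)] [FiberBundle ℂ L] [VectorBundle ℂ ℂ L]

/-- The squared length of the local frame, in the preferred chart. -/
def frameLength (L : X → Type*) [∀ x, NormedAddCommGroup (L x)] [∀ x, InnerProductSpace ℂ (L x)]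
    [TopologicalSpace (Bundle.TotalSpace ℂ L)] [FiberBundle ℂ L] [VectorBundle ℂ ℂ L]
    (x₀ : X) (y : E) : ℝ := ‖(localFrame x₀ ((chartAt E x₀).symm y) : L _)‖ ^ 2

variable [ContMDiffVectorBundle ∞ ℂ L 𝓘(ℝ, E)] {D : CovariantDerivative 𝓘(ℝ, E) ℂ L}

lemma connectionForm_apply (x₀ : X) (y w : E) : connectionForm D x₀ y w =
    fiberCoord x₀ ((chartAt E x₀).symm y)
      ((D (fun z => localFrame x₀ z) ((chartAt E x₀).symm y) : E →L[ℝ] L _)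
        ((fromChart x₀ ((chartAt E x₀).symm y) : E →L[ℝ] E) w)) := rfl

/-- The change of the connection form. -/
lemma connectionForm_transition (hD : IsHermitianConnection D) {x₀ x₁ : X} {y : E}
    (hy : y ∈ localDomain E L x₀) (hy' : (chartAt E x₀).symm y ∈ (chartAt E x₁).source)
    (hb : (chartAt E x₀).symm y ∈ (trivializationAt ℂ L x₁).baseSet) :
    connectionForm D x₁ (transition x₀ x₁ y) ∘L fderiv ℝ (transition x₀ x₁) y =
      connectionForm D x₀ y + (frameChange L x₀ x₁ ((chartAt E x₀).symm y))⁻¹ •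
        fderiv ℝ (frameChange L x₀ x₁ ∘ (chartAt E x₀).symm) y := by
  set x := (chartAt E x₀).symm y with hx
  have h : (chartAt E x₁).symm (transition x₀ x₁ y) = x := by simp [transition, hy', ← hx]
  have hb0 : x ∈ (trivializationAt ℂ L x₀).baseSet := hy.2
  have hc := contMDiffAt_frameChange (E := E) hb0 hb
  have hcd := hc.mdifferentiableAt (by simp)
  have haux : ∀ p, p = x → ∀ w, fiberCoord x₁ p ((D (fun z => localFrame x₁ z) p : E →L[ℝ] L p)
      ((fromChart x₁ p : E →L[ℝ] E) w)) = fiberCoord x₁ x ((D (fun z => localFrame x₁ z) x : E →L[ℝ] L x)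
      ((fromChart x₁ x : E →L[ℝ] E) w)) := by rintro p rfl w; rfl
  have hc0 := frameChange_ne_zero (L := L) hb0 hb
  ext w
  rw [ContinuousLinearMap.comp_apply, connectionForm_apply, haux _ h, add_apply, smul_apply,
    connectionForm_apply, fderiv_comp_chart_symm hy.1 hcd, ← hx]
  have hf : fromChart x₁ x (fderiv ℝ (transition x₀ x₁) y w) = fromChart x₀ x w := by
    rw [hx, fromChart_transition hy.1 hy']
    rfl
  rw [hf]
  set v := fromChart x₀ x w
  have hfr := isDiffSection_localFrame (E := E) hb0
  -- Near `x` the two frames differ by the factor `frameChange`, and a covariant derivative only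
  -- depends on the germ of the section.
  have hDe : (D (fun z => localFrame x₁ z) x : E →L[ℝ] L x) v =
      (D (fun z => frameChange L x₀ x₁ z • localFrame x₀ z) x : E →L[ℝ] L x) v := by
    refine congrArg (fun T : E →L[ℝ] L x => T v) ?_
    refine D.isCovariantDerivativeOnUniv.congr_of_eventuallyEq (isDiffSection_localFrame (E := E) hb) ?_
      Filter.univ_mem ?_
    · exact hfr.smul hcd
    · filter_upwards [(trivializationAt ℂ L x₀).open_baseSet.mem_nhds hb0] with z hz
        using localFrame_change hz
  rw [hDe, hD.leibniz hcd hfr]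
  have hinv : ∀ l : L x, fiberCoord x₁ x l = (frameChange L x₀ x₁ x)⁻¹ * fiberCoord x₀ x l :=
    fun l => by rw [fiberCoord_change (x₀ := x₀) hb]; field_simp
  rw [hinv, map_add, continuousLinearMapAt_smul, continuousLinearMapAt_smul,
    fiberCoord_localFrame hb0]
  simp only [ContinuousLinearMap.comp_apply, smul_eq_mul]
  field_simp
  rfl

end LocalGeometry

/-! ### Regularity of the connection form, and the operators in an arbitrary chart. -/

noncomputable section LocalGeometry

open Bundle
open ContinuousAlternatingMap (alternatizeUncurryFin alternatizeUncurryFinCLM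
  alternatizeUncurryFin_apply alternatizeUncurryFin_smul)

variable {E : Type*} [NormedAddCommGroup E] [NormedSpace ℂ E] [FiniteDimensional ℂ E]
  {X : Type*} [TopologicalSpace X] [ChartedSpace E X] [IsManifold 𝓘(ℂ, E) ω X]
  {L : X → Type*} [∀ x, NormedAddCommGroup (L x)] [∀ x, InnerProductSpace ℂ (L x)]
  [TopologicalSpace (Bundle.TotalSpace ℂ L)] [FiberBundle ℂ L] [VectorBundle ℂ ℂ L]
  [ContMDiffVectorBundle ∞ ℂ L 𝓘(ℝ, E)] {D : CovariantDerivative 𝓘(ℝ, E) ℂ L}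

/-- The smoothness of `D` is applied to a globally smooth section, while the frame is smooth only
over its base set. The frame is cut off by a bump function, and locality of `D` removes the cutoff
near the point. -/
lemma contDiffOn_connectionForm [T2Space X] (hD : IsHermitianConnection D) (x₀ : X) :
    ContDiffOn ℝ ∞ (connectionForm D x₀) (localDomain E L x₀) := by
  refine contDiffOn_clm_apply.mpr fun b y hy => ContDiffAt.contDiffWithinAt ?_
  set x := (chartAt E x₀).symm y with hx
  have hb0 : x ∈ (trivializationAt ℂ L x₀).baseSet := hy.2
  have hopen := (trivializationAt ℂ L x₀).open_baseSet
  obtain ⟨ψ, hψ, -⟩ := (SmoothBumpFunction.nhds_basis_support (I := 𝓘(ℝ, E))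
    (hopen.mem_nhds hb0)).mem_iff.mp (Filter.univ_mem (f := nhds x))
  set σ : ∀ z, L z := fun z => ψ z • (localFrame x₀ z : L z) with hσ
  have hσs : ContMDiff 𝓘(ℝ, E) (𝓘(ℝ, E).prod 𝓘(ℝ, ℂ)) ∞ (fun z => TotalSpace.mk' ℂ z (σ z)) :=
    ContMDiffOn.smul_section_of_tsupport ψ.contMDiff.contMDiffOn hopen hψ fun z hz =>
      (contMDiffAt_localFrame hz).contMDiffWithinAt
  have hDσ : ContMDiffAt 𝓘(ℝ, E) (𝓘(ℝ, E).prod 𝓘(ℝ, E →L[ℝ] ℂ)) ∞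
      (fun z => TotalSpace.mk' (E →L[ℝ] ℂ)
        (E := fun z : X => TangentSpace 𝓘(ℝ, E) z →L[ℝ] L z) z (D σ z)) x :=
    (hD.smooth.contMDiff.contMDiff (σ := σ) hσs.contMDiffOn).contMDiffAt Filter.univ_mem
  have hsec := hDσ.clm_bundle_apply (contMDiffAt_fromChart_apply ((chartAt E x₀).map_target hy.1) b)
  have hcoord := (contMDiffAt_section_iff (σ := fun z => (D σ z : E →L[ℝ] L z)
    ((fromChart x₀ z : E →L[ℝ] E) b)) hb0).mp hsec
  refine (contDiffAt_comp_chart_symm hy.1 hcoord).congr_of_eventuallyEq ?_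
  have hev : ∀ᶠ z in nhds x, (ψ : X → ℝ) =ᶠ[nhds z] 1 ∧ z ∈ (trivializationAt ℂ L x₀).baseSet :=
    (ψ.eventuallyEq_one.eventuallyEq_nhds).and (hopen.mem_nhds hb0)
  filter_upwards [(chartAt E x₀).continuousAt_symm hy.1 |>.eventually hev] with z hz
  rw [connectionForm_apply]
  simp only [Function.comp_apply]
  have heq : D σ ((chartAt E x₀).symm z) =
      D (fun z => (localFrame x₀ z : L z)) ((chartAt E x₀).symm z) :=
    D.isCovariantDerivativeOnUniv.congr_of_eventuallyEq
      (hσs.contMDiffAt.mdifferentiableAt (by simp)) (isDiffSection_localFrame hz.2)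
      Filter.univ_mem (by
        filter_upwards [hz.1] with p hp
        simp [hσ, hp])
  rw [heq]

lemma inner_localFrame (x₀ x : X) (l : L x) (hx : x ∈ (trivializationAt ℂ L x₀).baseSet) :
    inner ℂ (localFrame x₀ x : L x) l =
      fiberCoord x₀ x l * (‖(localFrame x₀ x : L x)‖ ^ 2 : ℝ) := by
  conv_lhs => rw [← fiberCoord_smul_localFrame hx l]
  rw [inner_smul_right, inner_self_eq_norm_sq_to_K]
  simp

lemma contDiffOn_frameLength (hL : HasSmoothMetric E L) (x₀ : X) :
    ContDiffOn ℝ ∞ (frameLength L x₀) (localDomain E L x₀) := fun _ hy =>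
  (contDiffAt_comp_chart_symm hy.1 ((hL x₀).contMDiffAt
    ((trivializationAt ℂ L x₀).open_baseSet.mem_nhds hy.2))).contDiffWithinAt

/-- Compatibility with the Hermitian metric, applied to the frame paired with itself: `d |e|² = |e|²
(A + conj A)`. -/
lemma fderiv_frameLength (hL : HasSmoothMetric E L) (hD : IsHermitianConnection D) {x₀ : X} {y : E}
    (hy : y ∈ localDomain E L x₀) (w : E) : ((fderiv ℝ (frameLength L x₀) y w : ℝ) : ℂ) =
      frameLength L x₀ y * (connectionForm D x₀ y w +
        (starRingEnd ℂ) (connectionForm D x₀ y w)) := by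
  set x := (chartAt E x₀).symm y with hx
  have hb : x ∈ (trivializationAt ℂ L x₀).baseSet := hy.2
  set N : X → ℂ := fun z => inner ℂ (localFrame x₀ z : L z) (localFrame x₀ z : L z) with hN
  have hNe : ∀ z, N z = ((‖(localFrame x₀ z : L z)‖ ^ 2 : ℝ) : ℂ) := fun z => by
    rw [hN]; simp [inner_self_eq_norm_sq_to_K]
  have hr : MDifferentiableAt 𝓘(ℝ, E) 𝓘(ℝ, ℝ) (fun z => ‖(localFrame x₀ z : L z)‖ ^ 2) x :=
    ((hL x₀).contMDiffAt ((trivializationAt ℂ L x₀).open_baseSet.mem_nhds hb)).mdifferentiableAt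
      (by simp)
  have hNd : MDifferentiableAt 𝓘(ℝ, E) 𝓘(ℝ, ℂ) N x := by
    have h := (Complex.ofRealCLM.mdifferentiableAt).comp x hr
    exact h.congr_of_eventuallyEq (Filter.Eventually.of_forall hNe)
  have hfr := isDiffSection_localFrame (E := E) hb
  have hm := hD.metric _ _ x hfr hfr ((fromChart x₀ x : E →L[ℝ] E) w)
  have hfd : fderiv ℝ (N ∘ (chartAt E x₀).symm) y w =
      ((fderiv ℝ (frameLength L x₀) y w : ℝ) : ℂ) := by
    have h1 := Complex.ofRealCLM.hasFDerivAt.comp y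
      ((contDiffOn_frameLength hL x₀).differentiableAt_of_isOpen (isOpen_localDomain x₀)
        hy).hasFDerivAt
    have h2 : N ∘ (chartAt E x₀).symm = Complex.ofRealCLM ∘ frameLength L x₀ :=
      funext fun z => hNe _
    rw [h2, h1.fderiv]
    rfl
  rw [← hfd, fderiv_comp_chart_symm hy.1 hNd]
  have h3 := congrArg (fun T : E →L[ℝ] ℂ => T (fromChart x₀ x w)) (mfderiv_eq_chartDeriv hNd)
  refine h3.symm.trans (hm.trans ?_)
  have hA : connectionForm D x₀ y w = fiberCoord x₀ x
    ((D (fun z => localFrame x₀ z) x : E →L[ℝ] L x) ((fromChart x₀ x : E →L[ℝ] E) w)) := rfl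
  have hh : frameLength L x₀ y = ‖(localFrame x₀ x : L x)‖ ^ 2 := rfl
  rw [hA, hh]
  set l : L x := (D (fun z => localFrame x₀ z) x : E →L[ℝ] L x) ((fromChart x₀ x : E →L[ℝ] E) w)
  change inner ℂ (localFrame x₀ x) l + inner ℂ l (localFrame x₀ x) = _
  rw [← inner_conj_symm l, inner_localFrame x₀ x l hb, map_mul, Complex.conj_ofReal]
  ring

/-- The local data of a Hermitian line bundle with connection over a Kähler manifold. -/
lemma isLocalKaehler [T2Space X] {g : TangentMetric E X} (hg : IsKaehler g)
    (hL : HasSmoothMetric E L) (hD : IsHermitianConnection D) (x₀ : X) :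
    IsLocalKaehler (localDomain E L x₀) (metricChart g x₀) (frameLength L x₀)
      (connectionForm D x₀) where
  isOpen := isOpen_localDomain x₀
  contDiffOn_metric := (contDiffOn_metricChart g x₀).mono Set.inter_subset_left
  symm y _ := metricChart_symm g x₀ y
  pos _ hy _ hv := metricChart_pos g hy.1 hv
  hermitian _ hy := metricChart_hermitian hg.1 hy.1
  closed _ hy := metricChart_closed hg hy.1
  contDiffOn_length := contDiffOn_frameLength hL x₀
  contDiffOn_connection := contDiffOn_connectionForm hD x₀
  fderiv_length _ hy := fderiv_frameLength hL hD hy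

/-! ### Operators on forms in a chart -/

variable (D) in
/-- The operators `∂_D` (for `s = 1`) and `∂̄_D` (for `s = -1`). -/
def typedD (s : ℝ) (u : Form E L) : Form E L
  | 0, _ => 0
  | k + 1, x => toFiber x (alternatizeUncurryFin (typePart s (localDeriv D u k x)))

lemma typedD_one (u : Form E L) : typedD D 1 u = del D u := by
  funext k x
  cases k with
  | zero => rfl
  | succ k => rw [typedD, typePart_one]; rfl

lemma typedD_neg_one (u : Form E L) : typedD D (-1) u = dbar D u := by
  funext k x
  cases k with
  | zero => rfl
  | succ k => rw [typedD, typePart_neg_one]; rfl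

lemma Form.inChart_zero {u : Form E L} {k : ℕ} (hu : u k = 0) (x₀ : X) : u.inChart k x₀ = 0 := by
  funext y
  ext m
  rw [Form.inChart_apply, hu]
  simp

lemma Form.IsSmooth.differentiableAt {u : Form E L} (hu : u.IsSmooth) (k : ℕ) {x₀ : X} {y : E}
    (hy : y ∈ localDomain E L x₀) : DifferentiableAt ℝ (u.inChart k x₀) y :=
  (hu k x₀).differentiableAt_of_isOpen (isOpen_localDomain x₀) hy

/-- The local expression of `typedD`. -/
lemma typedD_inChart (hD : IsHermitianConnection D) (s : ℝ) {u : Form E L} (hu : u.IsSmooth) (k : ℕ)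
    {x₀ : X} {y : E} (hy : y ∈ localDomain E L x₀) :
    (typedD D s u).inChart (k + 1) x₀ y = localD s (connectionForm D x₀) (u.inChart k x₀) y := by
  set x := (chartAt E x₀).symm y with hx
  have hτ : transition x₀ x y = chartAt E x x := by simp [transition, ← hx]
  have hb : x ∈ (trivializationAt ℂ L x).baseSet := FiberBundle.mem_baseSet_trivializationAt' x
  have hb0 : x ∈ (trivializationAt ℂ L x₀).baseSet := hy.2
  have hxs := mem_chart_source E x
  have hsrc : x ∈ (chartAt E x₀).source := (chartAt E x₀).map_target hy.1
  have hP : fderiv ℝ (transition x₀ x) y = fromChart x₀ x := by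
    rw [fromChart_eq hsrc, hx, (chartAt E x₀).right_inv hy.1]
  have hc := contMDiffAt_frameChange (E := E) hb0 hb
  have hcd := differentiableAt_comp_chart_symm hy.1 (hc.mdifferentiableAt (by simp))
  have hev : u.inChart k x₀ =ᶠ[nhds y] fun z => frameChange L x₀ x ((chartAt E x₀).symm z) •
      (u.inChart k x (transition x₀ x z)).compContinuousLinearMap
        (fderiv ℝ (transition x₀ x) z) := by
    filter_upwards [eventually_mem_target hy.1 hxs, ((chartAt E x₀).continuousAt_symm
      hy.1).preimage_mem_nhds ((trivializationAt ℂ L x).open_baseSet.mem_nhds hb)] with z hz hz'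
    exact u.inChart_transition k hz.1 hz.2 hz'
  -- At the point `x` the operator is defined in the chart and frame attached to `x`. Naturality
  -- rewrites it in those attached to `x₀`, with the transition map and the frame change as data.
  rw [localD_pullback s (contDiffAt_transition hy.1 hxs)
    (by filter_upwards [eventually_mem_target hy.1 hxs] with z hz using
      fderiv_transition_cplxJ hz.1 hz.2)
    (B := toChart x₀ x) (by rw [hP]; exact toChart_fromChart hsrc)
    (by rw [hP]; exact fromChart_toChart hsrc) (c := frameChange L x₀ x ∘ (chartAt E x₀).symm) hcd
    (frameChange_ne_zero hb0 hb) (u₁ := u.inChart k x)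
    (by rw [hτ]; exact hu.differentiableAt k (mem_localDomain_self x)) hev
    (connectionForm_transition hD hy hxs hb), hτ, hP]
  ext m
  rw [Form.inChart_apply, ← hx, typedD, Form.inChart_toFiber hb]
  rfl

end LocalGeometry

/-! ### Translation of `Λ` and of the inner product into chart expressions. -/

noncomputable section PointwiseDictionary

open Bundle
open ContinuousAlternatingMap (alternatizeUncurryFin alternatizeUncurryFinCLM
  alternatizeUncurryFin_apply alternatizeUncurryFin_smul)

variable {E : Type*} [NormedAddCommGroup E] [NormedSpace ℂ E] [FiniteDimensional ℂ E]
  {X : Type*} [TopologicalSpace X] [ChartedSpace E X] [IsManifold 𝓘(ℂ, E) ω X]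

/-- The tangent map of the preferred chart at `x₀` as a linear equivalence. -/
def chartEquiv {x₀ x : X} (hx : x ∈ (chartAt E x₀).source) : E ≃ₗ[ℝ] E where
  toFun := toChart x₀ x
  invFun := (fromChart x₀ x : E →L[ℝ] E)
  map_add' := map_add _
  map_smul' := map_smul _
  left_inv := fromChart_toChart hx
  right_inv := toChart_fromChart hx

/-- The expression in the preferred chart at `x₀` of the orthonormal frame at `x`. -/
def chartFrame (g : TangentMetric E X) {x₀ x : X} (hx : x ∈ (chartAt E x₀).source) :
    Module.Basis (Fin (Module.finrank ℝ E)) ℝ E :=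
  (frame g x).map (chartEquiv hx)

lemma fromChart_chartFrame (g : TangentMetric E X) {x₀ x : X} (hx : x ∈ (chartAt E x₀).source)
    (a : Fin (Module.finrank ℝ E)) : (fromChart x₀ x : E →L[ℝ] E) (chartFrame g hx a) = frame g x a := by
  rw [chartFrame, Module.Basis.map_apply]
  exact fromChart_toChart hx _

lemma isOrthonormalFrame_frame (g : TangentMetric E X) (x : X) :
    IsOrthonormalFrame (metricAt g x) (frame g x) := fun a b => by
  rw [frame_orthonormal]
  congr

lemma isOrthonormalFrame_chartFrame (g : TangentMetric E X) {x₀ : X} {y : E}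
    (hx : (chartAt E x₀).symm y ∈ (chartAt E x₀).source) :
    IsOrthonormalFrame (metricChart g x₀ y) (chartFrame g hx) := fun a b => by
  rw [metricChart_apply, fromChart_chartFrame, fromChart_chartFrame]
  exact isOrthonormalFrame_frame g _ a b

section Lambda

variable {L : X → Type*} [∀ x, NormedAddCommGroup (L x)] [∀ x, InnerProductSpace ℂ (L x)]

lemma fundamentalForm_apply {g : TangentMetric E X} (hg : IsHermitian g) (x : X) (v w : E) :
    fundamentalForm g x ![v, w] = (metricAt g x (cplxJ E v) w : ℂ) := by
  rw [fundamentalForm_eq, metricForm_apply]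
  have h : metricAt g x (cplxJ E w) v = -metricAt g x (cplxJ E v) w := by
    rw [metric_cplxJ_left (hg x), metricAt_symm]
  simp [h]
  ring

/-- `Λ` in terms of a frame. -/
lemma Form.Lambda_apply {g : TangentMetric E X} (hg : IsHermitian g) (u : Form E L) (k : ℕ)
    (x : X) : Form.Lambda g u k x = lamFrame (frame g x) (u (k + 2) x) := by
  have h1 : ∀ (v : E) (w : E [⋀^Fin (k + 1)]→L[ℝ] L x),
      ∑ b, ((metricAt g x v (frame g x b) : ℝ) : ℂ) • w.curryLeft (frame g x b) = contr v w := by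
    intro v w
    conv_rhs => rw [← (isOrthonormalFrame_frame g x).sum_apply_smul v]
    rw [← contrLin_apply, map_sum]
    refine Finset.sum_congr rfl fun b _ => ?_
    rw [map_smul, coe_smul_form]
    rfl
  simp only [Form.Lambda, Form.wedge2Adjoint, fundamentalForm_apply hg, Complex.conj_ofReal, h1]
  rw [lamFrame, smul_apply, sum_apply, ← coe_smul_form]
  simp [contr_apply]

end Lambda

section ChartPull

variable {L : X → Type*} [∀ x, NormedAddCommGroup (L x)] [∀ x, InnerProductSpace ℂ (L x)]
  [TopologicalSpace (Bundle.TotalSpace ℂ L)] [FiberBundle ℂ L] [VectorBundle ℂ ℂ L] {k : ℕ}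

/-- The expression of an alternating form at `x` in the chart and trivialization at `x₀`. -/
def chartPull (x₀ x : X) (w : E [⋀^Fin k]→L[ℝ] L x) : E [⋀^Fin k]→L[ℝ] ℂ :=
  (fiberCoord x₀ x).compContinuousAlternatingMap (w.compContinuousLinearMap (fromChart x₀ x))

lemma chartPull_apply (x₀ x : X) (w : E [⋀^Fin k]→L[ℝ] L x) (m : Fin k → E) :
    chartPull x₀ x w m = fiberCoord x₀ x (w fun i => (fromChart x₀ x : E →L[ℝ] E) (m i)) := rfl

lemma inChart_eq_chartPull (u : Form E L) (k : ℕ) (x₀ : X) (y : E) : u.inChart k x₀ y =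
    chartPull x₀ ((chartAt E x₀).symm y) (u k ((chartAt E x₀).symm y)) := rfl

lemma chartPull_add (x₀ x : X) (w w' : E [⋀^Fin k]→L[ℝ] L x) :
    chartPull x₀ x (w + w') = chartPull x₀ x w + chartPull x₀ x w' := by
  ext m; simp [chartPull_apply]

lemma chartPull_sub (x₀ x : X) (w w' : E [⋀^Fin k]→L[ℝ] L x) :
    chartPull x₀ x (w - w') = chartPull x₀ x w - chartPull x₀ x w' := by
  ext m; simp [chartPull_apply]

lemma chartPull_smul (x₀ x : X) (c : ℂ) (w : E [⋀^Fin k]→L[ℝ] L x) :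
    chartPull x₀ x (c • w) = c • chartPull x₀ x w := by
  ext m; simp [chartPull_apply, continuousLinearMapAt_smul]

lemma chartPull_sum (x₀ x : X) {ι : Type*} (s : Finset ι) (w : ι → E [⋀^Fin k]→L[ℝ] L x) :
    chartPull x₀ x (∑ i ∈ s, w i) = ∑ i ∈ s, chartPull x₀ x (w i) := by
  ext m; simp [chartPull_apply, ContinuousAlternatingMap.sum_apply]

lemma chartPull_contr (x₀ x : X) (a : E) (w : E [⋀^Fin (k + 1)]→L[ℝ] L x) :
    chartPull x₀ x (contr ((fromChart x₀ x : E →L[ℝ] E) a) w) = contr a (chartPull x₀ x w) := by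
  ext m
  rw [contr_apply_apply, chartPull_apply, chartPull_apply, contr_apply_apply]
  congr 2
  funext i
  refine Fin.cases ?_ (fun j => ?_) i <;> rfl

lemma chartPull_injective {x₀ x : X} (hx : x ∈ (chartAt E x₀).source)
    (hb : x ∈ (trivializationAt ℂ L x₀).baseSet) :
    Function.Injective (chartPull (E := E) (L := L) (k := k) x₀ x) := fun w w' h => by
  ext m
  have h1 := congrArg (fun T : E [⋀^Fin k]→L[ℝ] ℂ => T fun i => toChart x₀ x (m i)) h
  simp only [chartPull_apply, fromChart_toChart hx] at h1
  rw [← fiberCoord_smul_localFrame hb (w m), ← fiberCoord_smul_localFrame hb (w' m)]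
  exact congrArg (· • _) h1

lemma chartPull_alternatize (x₀ x : X) (T : E →L[ℝ] E [⋀^Fin k]→L[ℝ] L x)
    (T' : E →L[ℝ] E [⋀^Fin k]→L[ℝ] ℂ)
    (h : ∀ a, T' a = chartPull x₀ x (T ((fromChart x₀ x : E →L[ℝ] E) a))) :
    chartPull x₀ x (alternatizeUncurryFin T) = alternatizeUncurryFin T' := by
  ext m
  rw [chartPull_apply, alternatizeUncurryFin_apply, alternatizeUncurryFin_apply, map_sum]
  refine Finset.sum_congr rfl fun i _ => ?_
  rw [map_zsmul, h, chartPull_apply]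
  rfl

lemma chartPull_wedge1 (x₀ x : X) (θ : E →L[ℝ] ℂ) (w : E [⋀^Fin k]→L[ℝ] L x) :
    chartPull x₀ x (wedge1 θ w) = wedge1 (θ ∘L fromChart x₀ x) (chartPull x₀ x w) := by
  refine chartPull_alternatize _ _ _ _ fun a => ?_
  simp [chartPull_smul]

lemma chartPull_lamFrame (g : TangentMetric E X) {x₀ x : X} (hx : x ∈ (chartAt E x₀).source)
    (w : E [⋀^Fin (k + 2)]→L[ℝ] L x) :
    chartPull x₀ x (lamFrame (frame g x) w) = lamFrame (chartFrame g hx) (chartPull x₀ x w) := by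
  simp only [lamFrame, smul_apply, sum_apply,
    ← coe_smul_form, chartPull_smul, chartPull_sum]
  congr 1
  refine Finset.sum_congr rfl fun a _ => ?_
  simp only [ContinuousLinearMap.comp_apply]
  rw [← chartPull_contr, fromChart_chartFrame, ← chartPull_contr, fromChart_cplxJ hx,
    fromChart_chartFrame]

lemma chartPull_Lambda {g : TangentMetric E X} (hg : IsHermitian g) (u : Form E L) (k : ℕ)
    {x₀ : X} {y : E} (hy : y ∈ (chartAt E x₀).target) :
    (Form.Lambda g u).inChart k x₀ y =
      lamSharp (sharp (metricChart g x₀ y)) (u.inChart (k + 2) x₀ y) := by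
  have hx := (chartAt E x₀).map_target hy
  rw [inChart_eq_chartPull, Form.Lambda_apply hg, chartPull_lamFrame g hx,
    (isOrthonormalFrame_chartFrame g hx).lamSharp_eq (metricChart_symm g x₀ y)]
  rfl

lemma inner_eq_frameLength {x₀ : X} {y : E} (hy : y ∈ localDomain E L x₀)
    (l l' : L ((chartAt E x₀).symm y)) : inner ℂ l l' =
      frameLength L x₀ y * inner ℂ (fiberCoord x₀ _ l) (fiberCoord x₀ _ l') := by
  conv_lhs => rw [← fiberCoord_smul_localFrame hy.2 l, inner_smul_left, inner_localFrame _ _ _ hy.2]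
  rw [show frameLength L x₀ y = ‖(localFrame x₀ ((chartAt E x₀).symm y) : L _)‖ ^ 2 from rfl]
  simp only [RCLike.inner_apply]
  ring

/-- The frame chosen at the point becomes an orthonormal frame for the chart metric, and each value
in `L` is its coordinate times the local frame. So the metric of `L` enters only through the factor
`frameLength`. -/
lemma pointwiseInner_eq_formInner (g : TangentMetric E X) {x₀ : X} {y : E}
    (hy : y ∈ localDomain E L x₀) (w w' : E [⋀^Fin k]→L[ℝ] L ((chartAt E x₀).symm y)) :
    Form.pointwiseInner g ((chartAt E x₀).symm y) w w' = frameLength L x₀ y *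
      formInner (sharp (metricChart g x₀ y)) (chartPull x₀ _ w) (chartPull x₀ _ w') := by
  have hx := (chartAt E x₀).map_target hy.1
  rw [(isOrthonormalFrame_chartFrame g hx).formInner_eq (metricChart_symm g x₀ y),
    Form.pointwiseInner]
  simp only [inner_eq_frameLength hy, chartPull_apply, fromChart_chartFrame, ← Finset.mul_sum]
  ring

end ChartPull

end PointwiseDictionary

/-! ### Smooth forms and the candidate for the formal adjoint. -/

noncomputable section SmoothForms

open Bundle
open ContinuousAlternatingMap (alternatizeUncurryFin alternatizeUncurryFinCLM
  alternatizeUncurryFin_apply alternatizeUncurryFin_smul)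

variable {E : Type*} [NormedAddCommGroup E] [NormedSpace ℂ E] [FiniteDimensional ℂ E]
  {X : Type*} [TopologicalSpace X] [ChartedSpace E X] [IsManifold 𝓘(ℂ, E) ω X]

/-- The part of type `(1, 0)` (for `s = 1`) or `(0, 1)` (for `s = -1`) of the differential. -/
def typedFun (s : ℝ) (f : X → ℝ) (x : X) : E →L[ℝ] ℂ := typePart s (dFun f x)

lemma typedFun_one (f : X → ℝ) : typedFun (E := E) 1 f = delFun f :=
  funext fun _ => typePart_one _

lemma typedFun_neg_one (f : X → ℝ) : typedFun (E := E) (-1) f = dbarFun f :=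
  funext fun _ => typePart_neg_one _

lemma contDiffOn_comp_chart_symm {f : X → ℝ} (hf : ContMDiff 𝓘(ℝ, E) 𝓘(ℝ, ℝ) ∞ f) (x₀ : X) :
    ContDiffOn ℝ ∞ (fun y => ((f ((chartAt E x₀).symm y) : ℝ) : ℂ)) (chartAt E x₀).target :=
  fun _ hy => (Complex.ofRealCLM.contDiff.contDiffAt.comp _
    (contDiffAt_comp_chart_symm hy (hf _))).contDiffWithinAt

lemma fderiv_comp_chart_symm_eq {f : X → ℝ} (hf : ContMDiff 𝓘(ℝ, E) 𝓘(ℝ, ℝ) ∞ f) {x₀ : X} {y : E}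
    (hy : y ∈ (chartAt E x₀).target) :
    fderiv ℝ (fun y => ((f ((chartAt E x₀).symm y) : ℝ) : ℂ)) y =
      dFun f ((chartAt E x₀).symm y) ∘L fromChart x₀ ((chartAt E x₀).symm y) := by
  have hm : MDifferentiableAt 𝓘(ℝ, E) 𝓘(ℝ, ℝ) f ((chartAt E x₀).symm y) :=
    (hf _).mdifferentiableAt (by simp)
  have h := (Complex.ofRealCLM.hasFDerivAt.comp y
    (differentiableAt_comp_chart_symm hy hm).hasFDerivAt).fderiv
  refine h.trans ?_
  rw [fderiv_comp_chart_symm hy hm, ← mfderiv_eq_chartDeriv hm]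
  rfl

lemma typedFun_comp_fromChart (s : ℝ) {f : X → ℝ} (hf : ContMDiff 𝓘(ℝ, E) 𝓘(ℝ, ℝ) ∞ f) {x₀ : X}
    {y : E} (hy : y ∈ (chartAt E x₀).target) :
    typedFun s f ((chartAt E x₀).symm y) ∘L fromChart x₀ ((chartAt E x₀).symm y) =
      typePart s (fderiv ℝ (fun y => ((f ((chartAt E x₀).symm y) : ℝ) : ℂ)) y) := by
  rw [fderiv_comp_chart_symm_eq hf hy]
  ext v
  simp only [typedFun, ContinuousLinearMap.comp_apply, typePart_apply, ← cplxJ_apply,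
    fromChart_cplxJ ((chartAt E x₀).map_target hy)]

variable {L : X → Type*} [∀ x, NormedAddCommGroup (L x)] [∀ x, InnerProductSpace ℂ (L x)]
  [TopologicalSpace (Bundle.TotalSpace ℂ L)] [FiberBundle ℂ L] [VectorBundle ℂ ℂ L]
  [ContMDiffVectorBundle ∞ ℂ L 𝓘(ℝ, E)]

namespace Form

lemma inChart_add (u v : Form E L) (k : ℕ) (x₀ : X) (y : E) :
    (u + v).inChart k x₀ y = u.inChart k x₀ y + v.inChart k x₀ y := chartPull_add _ _ _ _

lemma inChart_sub (u v : Form E L) (k : ℕ) (x₀ : X) (y : E) :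
    (u - v).inChart k x₀ y = u.inChart k x₀ y - v.inChart k x₀ y := chartPull_sub _ _ _ _

lemma inChart_smul (c : ℂ) (u : Form E L) (k : ℕ) (x₀ : X) (y : E) :
    (c • u).inChart k x₀ y = c • u.inChart k x₀ y := chartPull_smul _ _ _ _

lemma inChart_mulFun (f : X → ℝ) (u : Form E L) (k : ℕ) (x₀ : X) (y : E) :
    (u.mulFun f).inChart k x₀ y = (f ((chartAt E x₀).symm y) : ℂ) • u.inChart k x₀ y :=
  chartPull_smul _ _ _ _

lemma inChart_wedge1_typedFun (s : ℝ) {f : X → ℝ} (hf : ContMDiff 𝓘(ℝ, E) 𝓘(ℝ, ℝ) ∞ f)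
    (u : Form E L) (k : ℕ) {x₀ : X} {y : E} (hy : y ∈ (chartAt E x₀).target) :
    (wedge1 (typedFun s f) u).inChart (k + 1) x₀ y = TwistedBKN.wedge1
      (typePart s (fderiv ℝ (fun y => ((f ((chartAt E x₀).symm y) : ℝ) : ℂ)) y))
      (u.inChart k x₀ y) := by
  rw [← typedFun_comp_fromChart s hf hy]
  exact chartPull_wedge1 _ _ _ _

/-- Forms are determined by their local expressions at the centres of the charts. -/
lemma ext_inChart {u v : Form E L}
    (h : ∀ k x, u.inChart k x (chartAt E x x) = v.inChart k x (chartAt E x x)) : u = v := by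
  funext k x
  have h1 := h k x
  rw [inChart_eq_chartPull, inChart_eq_chartPull, (chartAt E x).left_inv (mem_chart_source E x)]
    at h1
  exact chartPull_injective (mem_chart_source E x)
    (FiberBundle.mem_baseSet_trivializationAt' x) h1

namespace IsSmooth

variable {u v : Form E L}

lemma add (hu : u.IsSmooth) (hv : v.IsSmooth) : (u + v).IsSmooth := fun k x₀ =>
  ((hu k x₀).add (hv k x₀)).congr fun y _ => inChart_add u v k x₀ y

lemma sub (hu : u.IsSmooth) (hv : v.IsSmooth) : (u - v).IsSmooth := fun k x₀ =>
  ((hu k x₀).sub (hv k x₀)).congr fun y _ => inChart_sub u v k x₀ y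

lemma smul (c : ℂ) (hu : u.IsSmooth) : (c • u).IsSmooth := fun k x₀ =>
  ((hu k x₀).const_smul c).congr fun y _ => inChart_smul c u k x₀ y

lemma mulFun {f : X → ℝ} (hf : ContMDiff 𝓘(ℝ, E) 𝓘(ℝ, ℝ) ∞ f) (hu : u.IsSmooth) :
    (u.mulFun f).IsSmooth := fun k x₀ =>
  (((contDiffOn_comp_chart_symm hf x₀).mono Set.inter_subset_left).smul (hu k x₀)).congr
    fun y _ => inChart_mulFun f u k x₀ y

lemma wedge1_typedFun (s : ℝ) {f : X → ℝ} (hf : ContMDiff 𝓘(ℝ, E) 𝓘(ℝ, ℝ) ∞ f)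
    (hu : u.IsSmooth) : (wedge1 (typedFun s f) u).IsSmooth := by
  intro k x₀
  cases k with
  | zero =>
    rw [inChart_zero rfl]
    exact contDiffOn_const
  | succ k =>
    refine ContDiffOn.congr ?_ fun y hy => inChart_wedge1_typedFun s hf u k hy.1
    have h1 : ContDiffOn ℝ ∞ (fun y => typePart s
        (fderiv ℝ (fun y => ((f ((chartAt E x₀).symm y) : ℝ) : ℂ)) y)) (localDomain E L x₀) :=
      (typePartCLM E ℂ s).contDiff.comp_contDiffOn
        (((contDiffOn_comp_chart_symm hf x₀).mono Set.inter_subset_left).fderiv_of_isOpen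
          (isOpen_localDomain x₀) (by simp))
    exact (alternatizeUncurryFinCLM ℝ E ℂ).contDiff.comp_contDiffOn
      (contDiffOn_smulRight h1 (hu k x₀))

lemma Lambda {g : TangentMetric E X} (hg : IsHermitian g) (hu : u.IsSmooth) :
    (Lambda g u).IsSmooth := fun k x₀ => by
  refine ContDiffOn.congr ?_ fun y hy => chartPull_Lambda hg u k hy.1
  have hG := (contDiffOn_metricChart g x₀).mono
    (Set.inter_subset_left (t := (chartAt E x₀).symm ⁻¹' (trivializationAt ℂ L x₀).baseSet))
  exact contDiffOn_lamSharp (contDiffOn_sharp hG fun y hy =>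
    (isOrthonormalFrame_chartFrame g ((chartAt E x₀).map_target hy.1)).isInvertible
      (metricChart_symm g x₀ y)) (hu (k + 2) x₀)

variable {D : CovariantDerivative 𝓘(ℝ, E) ℂ L}

lemma typedD [T2Space X] (hD : IsHermitianConnection D) (s : ℝ) (hu : u.IsSmooth) :
    (typedD D s u).IsSmooth := by
  intro k x₀
  cases k with
  | zero =>
    rw [inChart_zero rfl]
    exact contDiffOn_const
  | succ k =>
    exact (contDiffOn_localD (isOpen_localDomain x₀) (contDiffOn_connectionForm hD x₀)
      (hu k x₀)).congr fun y hy => typedD_inChart hD s hu k hy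

end IsSmooth

end Form

variable {D : CovariantDerivative 𝓘(ℝ, E) ℂ L}

variable (D) in
/-- The formal adjoint of `typedD`, given by the Kähler identities. -/
def codiff (g : TangentMetric E X) (s : ℝ) (v : Form E L) : Form E L :=
  ((s : ℂ) * Complex.I) • (Form.Lambda g (typedD D (-s) v) - typedD D (-s) (Form.Lambda g v))

lemma Form.IsSmooth.codiff [T2Space X] {g : TangentMetric E X} (hg : IsHermitian g)
    (hD : IsHermitianConnection D) (s : ℝ) {v : Form E L} (hv : v.IsSmooth) :
    (codiff D g s v).IsSmooth :=
  (((hv.typedD hD _).Lambda hg).sub ((hv.Lambda hg).typedD hD _)).smul _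

lemma codiff_inChart [T2Space X] {g : TangentMetric E X} (hg : IsHermitian g)
    (hD : IsHermitianConnection D) (s : ℝ) {v : Form E L} (hv : v.IsSmooth) (k : ℕ) {x₀ : X} {y : E}
    (hy : y ∈ localDomain E L x₀) : (codiff D g s v).inChart k x₀ y =
      localCodiff s (metricChart g x₀) (connectionForm D x₀) (v.inChart (k + 1) x₀) y := by
  rw [codiff, Form.inChart_smul, Form.inChart_sub, chartPull_Lambda hg _ _ hy.1,
    typedD_inChart hD _ hv _ hy]
  cases k with
  | zero =>
    -- A derivative has no component of degree zero, so only the term `Λ D` is left, in accordance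
    -- with the first clause of `localCodiff`.
    rw [Form.inChart_zero (k := 0) rfl, Pi.zero_apply, sub_zero]
    rfl
  | succ k =>
    rw [typedD_inChart hD _ (hv.Lambda hg) _ hy, localCodiff]
    congr 2
    refine localD_congr ?_
    filter_upwards [(isOpen_localDomain x₀).mem_nhds hy] with z hz
    exact chartPull_Lambda hg _ _ hz.1

end SmoothForms

/-! ### The volume measure in charts. -/

noncomputable section VolumeMeasure

variable {E : Type*} [NormedAddCommGroup E] [NormedSpace ℂ E] [FiniteDimensional ℂ E]

/-- The Gram matrix of the pulled back metric is `Pᵀ G P`, whose determinant carries the factor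
`(det P)²`. -/
lemma metricDensity_bilinearComp (G : E →L[ℝ] E →L[ℝ] ℝ) (P : E →L[ℝ] E) :
    metricDensity (G.bilinearComp P P) = |P.det| * metricDensity G := by
  have h : (Matrix.of fun i j => G.bilinearComp P P (realBasis E i) (realBasis E j)) =
      (LinearMap.toMatrix (realBasis E) (realBasis E) (P : E →ₗ[ℝ] E)).transpose *
        (Matrix.of fun i j => G (realBasis E i) (realBasis E j)) *
        LinearMap.toMatrix (realBasis E) (realBasis E) (P : E →ₗ[ℝ] E) := by
    have hP : ∀ i, P (realBasis E i) = ∑ l,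
        LinearMap.toMatrix (realBasis E) (realBasis E) (P : E →ₗ[ℝ] E) l i • realBasis E l :=
      fun i => by
        conv_lhs => rw [← (realBasis E).sum_repr (P (realBasis E i))]
        refine Finset.sum_congr rfl fun l _ => ?_
        rw [LinearMap.toMatrix_apply]
        rfl
    ext i j
    simp only [Matrix.of_apply, ContinuousLinearMap.bilinearComp_apply, Matrix.mul_apply,
      Matrix.transpose_apply, Finset.sum_mul]
    rw [hP i, hP j]
    simp only [map_sum, map_smul, sum_apply, smul_apply, smul_eq_mul, Finset.mul_sum]
    refine Finset.sum_congr rfl fun l _ => Finset.sum_congr rfl fun m _ => by ring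
  rw [metricDensity, h, Matrix.det_mul, Matrix.det_mul, Matrix.det_transpose,
    LinearMap.det_toMatrix, metricDensity, ContinuousLinearMap.det, mul_right_comm,
    Real.sqrt_mul (mul_self_nonneg _), Real.sqrt_mul_self_eq_abs]

variable [MeasurableSpace E] [BorelSpace E]
  {X : Type*} [TopologicalSpace X] [ChartedSpace E X] [IsManifold 𝓘(ℂ, E) ω X]
  [MeasurableSpace X] [BorelSpace X]

instance isAddHaarMeasure_finBasis : (Module.finBasis ℝ E).addHaar.IsAddHaarMeasure :=
  inferInstance

lemma metricChart_transition (g : TangentMetric E X) {x₀ x₁ : X} {y : E}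
    (hy : y ∈ (chartAt E x₀).target) (hy' : (chartAt E x₀).symm y ∈ (chartAt E x₁).source) :
    metricChart g x₀ y = (metricChart g x₁ (transition x₀ x₁ y)).bilinearComp
      (fderiv ℝ (transition x₀ x₁) y) (fderiv ℝ (transition x₀ x₁) y) := by
  ext v w
  have h : (chartAt E x₁).symm (transition x₀ x₁ y) = (chartAt E x₀).symm y := by
    simp [transition, hy']
  rw [ContinuousLinearMap.bilinearComp_apply, metricChart_apply, metricChart_apply, h,
    fromChart_transition hy hy']
  rfl

lemma continuousOn_volumeDensity (g : TangentMetric E X) (x₀ : X) :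
    ContinuousOn (volumeDensity g x₀) (chartAt E x₀).target := by
  have := contDiffOn_metricDensity (contDiffOn_metricChart g x₀)
    (fun y _ => metricChart_symm g x₀ y) (fun y hy v hv => metricChart_pos g hy hv)
  exact this.continuousOn

lemma volumeDensity_pos (g : TangentMetric E X) {x₀ : X} {y : E} (hy : y ∈ (chartAt E x₀).target) :
    0 < volumeDensity g x₀ y :=
  metricDensity_pos (metricChart_symm g x₀ y) fun _ hv => metricChart_pos g hy hv

lemma aemeasurable_chart_symm (g : TangentMetric E X) (x₀ : X) :
    AEMeasurable (chartAt E x₀).symm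
      (((Module.finBasis ℝ E).addHaar.restrict (chartAt E x₀).target).withDensity
        fun y => ENNReal.ofReal (volumeDensity g x₀ y)) :=
  (((chartAt E x₀).continuousOn_symm.aemeasurable
    (chartAt E x₀).open_target.measurableSet)).mono_ac (withDensity_absolutelyContinuous _ _)

lemma measurableSet_target_inter_preimage (x₀ : X) {A : Set X} (hA : MeasurableSet A) :
    MeasurableSet ((chartAt E x₀).symm ⁻¹' A ∩ (chartAt E x₀).target) := by
  have h := (continuousOn_iff_continuous_domRestrict.mp
    (chartAt E x₀).continuousOn_symm).measurable hA
  have h2 := (chartAt E x₀).open_target.measurableSet.subtype_image h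
  convert h2 using 1
  ext y
  simp [and_comm]

lemma chartVolume_apply (g : TangentMetric E X) (x₀ : X) {A : Set X} (hA : MeasurableSet A) :
    chartVolume g x₀ A = ∫⁻ y in (chartAt E x₀).symm ⁻¹' A ∩ (chartAt E x₀).target,
      ENNReal.ofReal (volumeDensity g x₀ y) ∂(Module.finBasis ℝ E).addHaar := by
  rw [chartVolume, Measure.map_apply_of_aemeasurable (aemeasurable_chart_symm g x₀) hA,
    withDensity_apply', Measure.restrict_restrict' (chartAt E x₀).open_target.measurableSet]

/-- The volumes given by two charts agree on the intersection of their domains. -/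
lemma chartVolume_eq (g : TangentMetric E X) (x₀ x₁ : X) {A : Set X} (hA : MeasurableSet A)
    (h₀ : A ⊆ (chartAt E x₀).source) (h₁ : A ⊆ (chartAt E x₁).source) :
    chartVolume g x₀ A = chartVolume g x₁ A := by
  rw [chartVolume_apply g x₀ hA, chartVolume_apply g x₁ hA]
  have himg : (chartAt E x₁).symm ⁻¹' A ∩ (chartAt E x₁).target =
      transition x₀ x₁ '' ((chartAt E x₀).symm ⁻¹' A ∩ (chartAt E x₀).target) := by
    ext y
    constructor
    · rintro ⟨hyA, hy⟩
      have h2 := h₀ hyA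
      refine ⟨chartAt E x₀ ((chartAt E x₁).symm y), ⟨?_, (chartAt E x₀).map_source h2⟩, ?_⟩
      · rwa [Set.mem_preimage, (chartAt E x₀).left_inv h2]
      · simp [transition, h2, hy]
    · rintro ⟨z, ⟨hzA, hz⟩, rfl⟩
      have h2 := h₁ hzA
      refine ⟨?_, (chartAt E x₁).map_source h2⟩
      rwa [Set.mem_preimage, transition, Function.comp_apply, (chartAt E x₁).left_inv h2]
  -- In the change of variables by the transition map, the Jacobian determinant is exactly the
  -- factor by which the two volume densities differ.
  rw [himg, lintegral_image_eq_lintegral_abs_det_fderiv_mul _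
    (measurableSet_target_inter_preimage x₀ hA) (f' := fun y => fderiv ℝ (transition x₀ x₁) y)
    (fun y hy => ((contDiffAt_transition hy.2 (h₁ hy.1)).differentiableAt
      (by simp)).hasFDerivAt.hasFDerivWithinAt)]
  · refine setLIntegral_congr_fun (measurableSet_target_inter_preimage x₀ hA) fun y hy => ?_
    rw [volumeDensity_eq, volumeDensity_eq, metricChart_transition g hy.2 (h₁ hy.1),
      metricDensity_bilinearComp, ENNReal.ofReal_mul (abs_nonneg _)]
  · intro y hy z hz hyz
    have h := congrArg (chartAt E x₁).symm hyz
    simp only [transition, Function.comp_apply] at h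
    rw [(chartAt E x₁).left_inv (h₁ hy.1), (chartAt E x₁).left_inv (h₁ hz.1)] at h
    exact (chartAt E x₀).symm.injOn hy.2 hz.2 h

variable [SecondCountableTopology X]

/-- The measure does not depend on the cover used to glue it: on each disjoint piece the volume of
the covering chart agrees with that of the chart at `x₀`, and countable additivity reassembles `A`.
-/
lemma volumeMeasure_apply (g : TangentMetric E X) (x₀ : X) {A : Set X} (hA : MeasurableSet A)
    (h₀ : A ⊆ (chartAt E x₀).source) : volumeMeasure g A = chartVolume g x₀ A := by
  -- Second countability gives a countable cover by chart domains, so the default value `0` in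
  -- `volumeMeasure` does not occur. The point `x₀` guarantees that the index set is nonempty, as an
  -- enumeration by `ℕ` requires.
  have hs : ∃ s : ℕ → X, ⋃ m, (chartAt E (s m)).source = Set.univ := by
    obtain ⟨s, hsc, hs⟩ := TopologicalSpace.countable_cover_nhds
      fun x : X => (chartAt E x).open_source.mem_nhds (mem_chart_source E x)
    have hne : s.Nonempty := by
      rw [Set.nonempty_iff_ne_empty]
      rintro rfl
      simpa using (hs ▸ Set.mem_univ x₀ : x₀ ∈ ⋃ x ∈ (∅ : Set X), (chartAt E x).source)
    obtain ⟨f, rfl⟩ := hsc.exists_eq_range hne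
    exact ⟨f, by rwa [Set.biUnion_range] at hs⟩
  rw [volumeMeasure, dif_pos hs, Measure.sum_apply _ hA]
  set S : ℕ → Set X := fun m => (chartAt E (hs.choose m)).source with hS
  have hSm : ∀ m, MeasurableSet (disjointed S m) := fun m =>
    MeasurableSet.disjointed (fun i => (chartAt E _).open_source.measurableSet) m
  have h1 : ∀ m, (chartVolume g (hs.choose m)).restrict (disjointed S m) A =
      chartVolume g x₀ (A ∩ disjointed S m) := fun m => by
    rw [Measure.restrict_apply hA]
    exact chartVolume_eq g _ _ (hA.inter (hSm m))
      (Set.inter_subset_right.trans (disjointed_subset S m)) (Set.inter_subset_left.trans h₀)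
  simp only [h1]
  rw [← measure_iUnion (fun i j hij => ((disjoint_disjointed S hij).mono Set.inter_subset_right
      Set.inter_subset_right)) fun m => hA.inter (hSm m), ← Set.inter_iUnion, iUnion_disjointed,
    hs.choose_spec, Set.inter_univ]

lemma volumeMeasure_restrict (g : TangentMetric E X) (x₀ : X) :
    (volumeMeasure g).restrict (chartAt E x₀).source = chartVolume g x₀ := by
  ext A hA
  rw [Measure.restrict_apply hA, volumeMeasure_apply g x₀
    (hA.inter (chartAt E x₀).open_source.measurableSet) Set.inter_subset_right,
    chartVolume_apply g x₀ (hA.inter (chartAt E x₀).open_source.measurableSet),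
    chartVolume_apply g x₀ hA]
  congr 2
  ext y
  simp only [Set.mem_inter_iff, Set.mem_preimage]
  constructor
  · rintro ⟨⟨h1, -⟩, h2⟩
    exact ⟨h1, h2⟩
  · rintro ⟨h1, h2⟩
    exact ⟨⟨h1, (chartAt E x₀).map_target h2⟩, h2⟩

/-- The density is positive in every chart. This is needed for the uniqueness of formal adjoints: a
continuous nonnegative function with zero integral must vanish. -/
instance isOpenPosMeasure_volumeMeasure (g : TangentMetric E X) :
    (volumeMeasure g).IsOpenPosMeasure where
  open_pos U hU hne h0 := by
    obtain ⟨x, hx⟩ := hne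
    have hm : MeasurableSet (U ∩ (chartAt E x).source) :=
      (hU.inter (chartAt E x).open_source).measurableSet
    have h1 := measure_mono_null (Set.inter_subset_left (t := (chartAt E x).source)) h0
    rw [volumeMeasure_apply g x hm Set.inter_subset_right, chartVolume_apply g x hm] at h1
    set V := (chartAt E x).symm ⁻¹' (U ∩ (chartAt E x).source) ∩ (chartAt E x).target with hV
    have hVm : MeasurableSet V := measurableSet_target_inter_preimage x hm
    have hVo : IsOpen V := by
      rw [hV, Set.inter_comm]
      exact (chartAt E x).isOpen_inter_preimage_symm (hU.inter (chartAt E x).open_source)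
    have hVne : V.Nonempty := by
      refine ⟨chartAt E x x, ?_, mem_chart_target E x⟩
      rw [Set.mem_preimage, (chartAt E x).left_inv (mem_chart_source E x)]
      exact ⟨hx, mem_chart_source E x⟩
    rw [lintegral_eq_zero_iff' (((continuousOn_volumeDensity g x).mono
      Set.inter_subset_right).aemeasurable hVm).ennreal_ofReal, Filter.EventuallyEq,
      ae_restrict_iff' hVm] at h1
    refine (hVo.measure_pos (Module.finBasis ℝ E).addHaar hVne).ne'
      (measure_mono_null (Set.subset_def.mpr fun y hyV => ?_) (ae_iff.mp h1))
    exact fun hy => (ENNReal.ofReal_pos.mpr (volumeDensity_pos g hyV.2)).ne' (hy hyV)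

/-- The density is continuous, hence integrable over compact subsets of a chart. Continuous
functions with compact support become integrable. -/
instance isLocallyFiniteMeasure_volumeMeasure (g : TangentMetric E X) :
    IsLocallyFiniteMeasure (volumeMeasure g) where
  finiteAtNhds x := by
    have : FiniteDimensional ℝ E := inferInstance
    have : ProperSpace E := FiniteDimensional.proper ℝ E
    obtain ⟨K, hK, hKx, hKt⟩ := exists_compact_subset (chartAt E x).open_target
      (mem_chart_target E x)
    refine ⟨(chartAt E x).source ∩ chartAt E x ⁻¹' (interior K),
      ((chartAt E x).isOpen_inter_preimage isOpen_interior).mem_nhds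
        ⟨mem_chart_source E x, hKx⟩, ?_⟩
    have hm := ((chartAt E x).isOpen_inter_preimage (s := interior K) isOpen_interior).measurableSet
    rw [volumeMeasure_apply g x hm Set.inter_subset_left, chartVolume_apply g x hm]
    refine (lintegral_mono_set (t := K) ?_).trans_lt (Integrable.lintegral_lt_top
      (((continuousOn_volumeDensity g x).mono hKt).integrableOn_compact hK))
    rintro y ⟨⟨-, h2⟩, h3⟩
    rw [Set.mem_preimage, (chartAt E x).right_inv h3] at h2
    exact interior_subset h2

/-- Integration in a chart. -/
lemma setIntegral_volumeMeasure (g : TangentMetric E X) (x₀ : X) {f : X → ℂ} (hf : Continuous f) :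
    ∫ x in (chartAt E x₀).source, f x ∂(volumeMeasure g) =
      ∫ y in (chartAt E x₀).target, (metricDensity (metricChart g x₀ y) : ℂ) *
        f ((chartAt E x₀).symm y) ∂(Module.finBasis ℝ E).addHaar := by
  rw [volumeMeasure_restrict, chartVolume, integral_map (aemeasurable_chart_symm g x₀)
    hf.aestronglyMeasurable, integral_withDensity_eq_integral_toReal_smul₀]
  · refine setIntegral_congr_fun (chartAt E x₀).open_target.measurableSet fun y hy => ?_
    rw [ENNReal.toReal_ofReal (volumeDensity_pos g hy).le, volumeDensity_eq, Complex.real_smul]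
  · exact ((continuousOn_volumeDensity g x₀).aemeasurable
      (chartAt E x₀).open_target.measurableSet).ennreal_ofReal
  · exact Filter.Eventually.of_forall fun y => ENNReal.ofReal_lt_top

end VolumeMeasure

/-! ### Linearity, Leibniz rule and locality of the operators. -/

noncomputable section LinearOperators

open Bundle
open ContinuousAlternatingMap (alternatizeUncurryFin alternatizeUncurryFinCLM
  alternatizeUncurryFin_apply alternatizeUncurryFin_smul alternatizeUncurryFin_add)

variable {E : Type*} [NormedAddCommGroup E] [NormedSpace ℂ E] [FiniteDimensional ℂ E]

section Local

variable {F : Type*} [NormedAddCommGroup F] [NormedSpace ℂ F] {k : ℕ} {s : ℝ} {A : E → E →L[ℝ] ℂ}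
  {u v : E → E [⋀^Fin k]→L[ℝ] F} {y : E}

lemma alternatize_smul_complex (c : ℂ) (T : E →L[ℝ] E [⋀^Fin k]→L[ℝ] F) :
    alternatizeUncurryFin (c • T) = c • alternatizeUncurryFin T := by
  ext m
  simp only [alternatizeUncurryFin_apply, smul_apply, ContinuousAlternatingMap.smul_apply,
    Finset.smul_sum]
  exact Finset.sum_congr rfl fun i _ => smul_comm _ _ _

lemma localD_add (hu : DifferentiableAt ℝ u y) (hv : DifferentiableAt ℝ v y) :
    localD s A (fun z => u z + v z) y = localD s A u y + localD s A v y := by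
  rw [localD, localD, localD, ← alternatizeUncurryFin_add, ← typePart_add, fderiv_fun_add hu hv]
  congr 2
  ext w m
  simp
  abel

/-- The Leibniz rule. -/
lemma localD_smul {f : E → ℂ} (hf : DifferentiableAt ℝ f y) (hu : DifferentiableAt ℝ u y) :
    localD s A (fun z => f z • u z) y =
      f y • localD s A u y + wedge1 (typePart s (fderiv ℝ f y)) (u y) := by
  have h : fderiv ℝ (fun z => f z • u z) y + (A y).smulRight (f y • u y) =
      f y • (fderiv ℝ u y + (A y).smulRight (u y)) + (fderiv ℝ f y).smulRight (u y) := by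
    rw [fderiv_fun_smul hf hu]
    ext w m
    simp [smul_comm (f y) (A y w)]
    abel
  rw [localD, localD, h, typePart_add, typePart_smul, alternatizeUncurryFin_add,
    alternatize_smul_complex, wedge1]
  congr 2
  ext w m
  simp [typePart_apply, sub_smul, mul_smul, smul_sub]

lemma localD_const_smul (c : ℂ) (hu : DifferentiableAt ℝ u y) :
    localD s A (fun z => c • u z) y = c • localD s A u y := by
  rw [localD_smul (differentiableAt_const c) hu]
  have h : wedge1 (typePart s (fderiv ℝ (fun _ : E => c) y)) (u y) = 0 := by
    rw [fderiv_fun_const]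
    ext m
    simp [wedge1, alternatizeUncurryFin_apply, typePart_apply]
  rw [h, add_zero]

end Local

variable {X : Type*} [TopologicalSpace X] [ChartedSpace E X] [IsManifold 𝓘(ℂ, E) ω X]
  {L : X → Type*} [∀ x, NormedAddCommGroup (L x)] [∀ x, InnerProductSpace ℂ (L x)]

namespace Form

lemma mulFun_add_fun (f f' : X → ℝ) (u : Form E L) :
    u.mulFun (fun x => f x + f' x) = u.mulFun f + u.mulFun f' := by
  funext k x
  simp [mulFun, add_smul]

lemma mulFun_add (f : X → ℝ) (u v : Form E L) : (u + v).mulFun f = u.mulFun f + v.mulFun f := by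
  funext k x
  simp [mulFun]

lemma mulFun_sub (f : X → ℝ) (u v : Form E L) : (u - v).mulFun f = u.mulFun f - v.mulFun f := by
  funext k x
  simp [mulFun, smul_sub]

lemma mulFun_smul (f : X → ℝ) (c : ℂ) (u : Form E L) : (c • u).mulFun f = c • u.mulFun f := by
  funext k x
  simp [mulFun, smul_comm c]

lemma mulFun_mulFun (f f' : X → ℝ) (u : Form E L) :
    (u.mulFun f').mulFun f = u.mulFun (fun x => f x * f' x) := by
  funext k x
  simp [mulFun, mul_smul]

lemma wedge1_add (θ : X → E →L[ℝ] ℂ) (u v : Form E L) :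
    wedge1 θ (u + v) = wedge1 θ u + wedge1 θ v := by
  funext k x
  cases k with
  | zero => simp [wedge1]
  | succ k =>
    ext m
    simp [wedge1, TwistedBKN.wedge1, alternatizeUncurryFin_apply, Finset.sum_add_distrib]

lemma wedge1_smul (θ : X → E →L[ℝ] ℂ) (c : ℂ) (u : Form E L) :
    wedge1 θ (c • u) = c • wedge1 θ u := by
  funext k x
  cases k with
  | zero => simp [wedge1]
  | succ k =>
    ext m
    simp only [wedge1, TwistedBKN.wedge1, Pi.smul_apply, alternatizeUncurryFin_apply,
      ContinuousLinearMap.smulRight_apply, ContinuousAlternatingMap.smul_apply, Finset.smul_sum]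
    exact Finset.sum_congr rfl fun i _ => by rw [smul_comm c, smul_comm c]

lemma wedge1_sub (θ : X → E →L[ℝ] ℂ) (u v : Form E L) :
    wedge1 θ (u - v) = wedge1 θ u - wedge1 θ v := by
  rw [sub_eq_add_neg, ← neg_one_smul ℂ v, wedge1_add, wedge1_smul, neg_one_smul, sub_eq_add_neg]

lemma wedge1_mulFun (θ : X → E →L[ℝ] ℂ) (f : X → ℝ) (u : Form E L) :
    wedge1 θ (u.mulFun f) = (wedge1 θ u).mulFun f := by
  funext k x
  cases k with
  | zero => simp [wedge1, mulFun]
  | succ k =>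
    ext m
    simp only [wedge1, TwistedBKN.wedge1, mulFun, alternatizeUncurryFin_apply,
      ContinuousLinearMap.smulRight_apply, ContinuousAlternatingMap.smul_apply, Finset.smul_sum]
    exact Finset.sum_congr rfl fun i _ => by rw [smul_comm (f x : ℂ), smul_comm (f x : ℂ)]

variable {g : TangentMetric E X}

lemma Lambda_add (hg : IsHermitian g) (u v : Form E L) :
    Lambda g (u + v) = Lambda g u + Lambda g v := by
  funext k x
  simp [Lambda_apply hg]

lemma Lambda_sub (hg : IsHermitian g) (u v : Form E L) :
    Lambda g (u - v) = Lambda g u - Lambda g v := by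
  funext k x
  simp [Lambda_apply hg]

lemma Lambda_smul (hg : IsHermitian g) (c : ℂ) (u : Form E L) :
    Lambda g (c • u) = c • Lambda g u := by
  funext k x
  simp [Lambda_apply hg, lamFrame_smul]

lemma Lambda_mulFun (hg : IsHermitian g) (f : X → ℝ) (u : Form E L) :
    Lambda g (u.mulFun f) = (Lambda g u).mulFun f := by
  funext k x
  simp [Lambda_apply hg, mulFun]

end Form

variable [TopologicalSpace (Bundle.TotalSpace ℂ L)] [FiberBundle ℂ L] [VectorBundle ℂ ℂ L]
  [ContMDiffVectorBundle ∞ ℂ L 𝓘(ℝ, E)] {D : CovariantDerivative 𝓘(ℝ, E) ℂ L} {s : ℝ}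
  {u v : Form E L}

lemma typedD_add (hD : IsHermitianConnection D) (hu : u.IsSmooth) (hv : v.IsSmooth) :
    typedD D s (u + v) = typedD D s u + typedD D s v := by
  refine Form.ext_inChart fun k x => ?_
  have hy := mem_localDomain_self (E := E) (L := L) x
  rw [Form.inChart_add]
  cases k with
  | zero => simp only [Form.inChart_zero (k := 0) (u := typedD D s _) rfl, Pi.zero_apply, add_zero]
  | succ k =>
    rw [typedD_inChart hD s hu k hy, typedD_inChart hD s hv k hy,
      typedD_inChart hD s (hu.add hv) k hy,
      ← localD_add (hu.differentiableAt k hy) (hv.differentiableAt k hy)]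
    exact localD_congr (Filter.Eventually.of_forall fun z => Form.inChart_add u v k x z)

lemma typedD_smul (hD : IsHermitianConnection D) (c : ℂ) (hu : u.IsSmooth) :
    typedD D s (c • u) = c • typedD D s u := by
  refine Form.ext_inChart fun k x => ?_
  have hy := mem_localDomain_self (E := E) (L := L) x
  rw [Form.inChart_smul]
  cases k with
  | zero => simp only [Form.inChart_zero (k := 0) (u := typedD D s _) rfl, Pi.zero_apply, smul_zero]
  | succ k =>
    rw [typedD_inChart hD s hu k hy, typedD_inChart hD s (hu.smul c) k hy,
      ← localD_const_smul c (hu.differentiableAt k hy)]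
    refine localD_congr (Filter.Eventually.of_forall fun z => ?_)
    exact Form.inChart_smul c u k x z

lemma typedD_sub (hD : IsHermitianConnection D) (hu : u.IsSmooth) (hv : v.IsSmooth) :
    typedD D s (u - v) = typedD D s u - typedD D s v := by
  rw [sub_eq_add_neg, ← neg_one_smul ℂ v, typedD_add hD hu (hv.smul _), typedD_smul hD _ hv,
    neg_one_smul, sub_eq_add_neg]

/-- The Leibniz rule. -/
lemma typedD_mulFun (hD : IsHermitianConnection D) {f : X → ℝ}
    (hf : ContMDiff 𝓘(ℝ, E) 𝓘(ℝ, ℝ) ∞ f) (hu : u.IsSmooth) :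
    typedD D s (u.mulFun f) = (typedD D s u).mulFun f + Form.wedge1 (typedFun s f) u := by
  refine Form.ext_inChart fun k x => ?_
  have hy := mem_localDomain_self (E := E) (L := L) x
  rw [Form.inChart_add, Form.inChart_mulFun]
  cases k with
  | zero =>
    simp only [Form.inChart_zero (k := 0) (u := typedD D s _) rfl,
      Form.inChart_zero (k := 0) (u := Form.wedge1 _ u) rfl, Pi.zero_apply, add_zero, smul_zero]
  | succ k =>
    rw [typedD_inChart hD s hu k hy, typedD_inChart hD s (hu.mulFun hf) k hy,
      Form.inChart_wedge1_typedFun s hf u k hy.1, ← localD_smul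
        (((contDiffOn_comp_chart_symm hf x).differentiableAt_of_isOpen (chartAt E x).open_target
          hy.1)) (hu.differentiableAt k hy)]
    refine localD_congr (Filter.Eventually.of_forall fun z => ?_)
    exact Form.inChart_mulFun f u k x z

/-- Differential operators do not increase supports. -/
lemma typedD_eq_zero_of_notMem {K : Set X} (hK : IsClosed K) (h : ∀ x ∉ K, ∀ k, u k x = 0)
    {x : X} (hx : x ∉ K) (k : ℕ) : typedD D s u k x = 0 := by
  cases k with
  | zero => rfl
  | succ k =>
    have hev : u.inChart k x =ᶠ[nhds (chartAt E x x)] fun _ => 0 := by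
      have hc := (chartAt E x).continuousAt_symm (mem_chart_target E x)
      have := hc.preimage_mem_nhds (t := Kᶜ) (by
        rw [(chartAt E x).left_inv (mem_chart_source E x)]
        exact hK.isOpen_compl.mem_nhds hx)
      filter_upwards [this] with z hz
      ext m
      rw [Form.inChart_apply, h _ hz]
      simp
    have hz : localDeriv D u k x = 0 := by
      rw [localDeriv, hev.fderiv_eq, hev.eq_of_nhds, fderiv_fun_const]
      ext
      simp
    ext m
    simp [typedD, hz, toFiber, typePart, alternatizeUncurryFin_apply]

end LinearOperators

/-! ### The `L²` product, and adjointness for forms supported in one chart. -/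

noncomputable section Integration

open Bundle

/-- Arguments of such a form are linearly dependent. Hence the finite sum over degrees in `innerAt`
misses nothing. -/
lemma form_eq_zero_of_finrank_lt {V F : Type*} [NormedAddCommGroup V] [NormedSpace ℝ V]
    [FiniteDimensional ℝ V] [NormedAddCommGroup F] [NormedSpace ℝ F] {k : ℕ}
    (hk : Module.finrank ℝ V < k) (u : V [⋀^Fin k]→L[ℝ] F) : u = 0 := by
  ext m
  refine u.toAlternatingMap.map_linearDependent m fun h => ?_
  have := h.fintype_card_le_finrank
  simp at this
  omega

variable {E : Type*} [NormedAddCommGroup E] [NormedSpace ℂ E] [FiniteDimensional ℂ E]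
  {X : Type*} [TopologicalSpace X] [ChartedSpace E X] [IsManifold 𝓘(ℂ, E) ω X]
  {L : X → Type*} [∀ x, NormedAddCommGroup (L x)] [∀ x, InnerProductSpace ℂ (L x)]

namespace Form

lemma pointwiseInner_add_left (g : TangentMetric E X) (x : X) {k : ℕ}
    (u u' v : E [⋀^Fin k]→L[ℝ] L x) :
    pointwiseInner g x (u + u') v = pointwiseInner g x u v + pointwiseInner g x u' v := by
  simp [pointwiseInner, Finset.sum_add_distrib, mul_add]

lemma pointwiseInner_conj (g : TangentMetric E X) (x : X) {k : ℕ} (u v : E [⋀^Fin k]→L[ℝ] L x) :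
    (starRingEnd ℂ) (pointwiseInner g x u v) = pointwiseInner g x v u := by
  simp [pointwiseInner, map_sum]

lemma pointwiseInner_self (g : TangentMetric E X) (x : X) {k : ℕ} (u : E [⋀^Fin k]→L[ℝ] L x) :
    pointwiseInner g x u u = (((k.factorial : ℝ)⁻¹ *
      ∑ a : Fin k → Fin (Module.finrank ℝ E), ‖u fun i => frame g x (a i)‖ ^ 2 : ℝ) : ℂ) := by
  simp [pointwiseInner, inner_self_eq_norm_sq_to_K]

lemma eq_zero_of_pointwiseInner_self {g : TangentMetric E X} {x : X} {k : ℕ}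
    {u : E [⋀^Fin k]→L[ℝ] L x} (h : pointwiseInner g x u u = 0) : u = 0 := by
  rw [pointwiseInner_self, Complex.ofReal_eq_zero, mul_eq_zero, or_iff_right (by positivity),
    Finset.sum_eq_zero_iff_of_nonneg fun _ _ => by positivity] at h
  have h1 : u.toMultilinearMap = 0 := by
    refine Module.Basis.ext_multilinear (fun _ => frame g x) fun a => ?_
    simpa using h a (Finset.mem_univ a)
  ext m
  exact congrArg (fun T : MultilinearMap ℝ (fun _ : Fin k => E) (L x) => T m) h1

lemma innerAt_add_left (g : TangentMetric E X) (u u' v : Form E L) (x : X) :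
    innerAt g (u + u') v x = innerAt g u v x + innerAt g u' v x := by
  simp [innerAt, pointwiseInner_add_left, Finset.sum_add_distrib]

lemma innerAt_smul_left (g : TangentMetric E X) (c : ℂ) (u v : Form E L) (x : X) :
    innerAt g (c • u) v x = c * innerAt g u v x := by
  simp [innerAt, pointwiseInner_smul_left, Finset.mul_sum]

lemma innerAt_conj (g : TangentMetric E X) (u v : Form E L) (x : X) :
    (starRingEnd ℂ) (innerAt g u v x) = innerAt g v u x := by
  simp [innerAt, map_sum, pointwiseInner_conj]

lemma innerAt_sub_left (g : TangentMetric E X) (u u' v : Form E L) (x : X) :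
    innerAt g (u - u') v x = innerAt g u v x - innerAt g u' v x := by
  rw [sub_eq_add_neg, ← neg_one_smul ℂ u', innerAt_add_left, innerAt_smul_left]
  ring

lemma innerAt_sub_right (g : TangentMetric E X) (u v v' : Form E L) (x : X) :
    innerAt g u (v - v') x = innerAt g u v x - innerAt g u v' x := by
  rw [← innerAt_conj, innerAt_sub_left, map_sub, innerAt_conj, innerAt_conj]

lemma innerAt_mulFun_left (g : TangentMetric E X) (f : X → ℝ) (u v : Form E L) (x : X) :
    innerAt g (u.mulFun f) v x = f x * innerAt g u v x := by
  simp only [innerAt, mulFun, pointwiseInner_smul_left, Finset.mul_sum]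

lemma innerAt_mulFun_right (g : TangentMetric E X) (f : X → ℝ) (u v : Form E L) (x : X) :
    innerAt g u (v.mulFun f) x = f x * innerAt g u v x := by
  simp only [innerAt, mulFun, pointwiseInner_smul_right, Complex.conj_ofReal, Finset.mul_sum]

lemma innerAt_self_im (g : TangentMetric E X) (u : Form E L) (x : X) : (innerAt g u u x).im = 0 :=
  Complex.conj_eq_iff_im.mp (innerAt_conj g u u x)

lemma innerAt_self_nonneg (g : TangentMetric E X) (u : Form E L) (x : X) :
    0 ≤ (innerAt g u u x).re := by
  rw [innerAt, Complex.re_sum]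
  refine Finset.sum_nonneg fun k _ => ?_
  rw [pointwiseInner_self, Complex.ofReal_re]
  positivity

lemma eq_zero_of_innerAt_self {g : TangentMetric E X} {u : Form E L} {x : X}
    (h : (innerAt g u u x).re = 0) (k : ℕ) : u k x = 0 := by
  by_cases hk : Module.finrank ℝ E < k
  · exact form_eq_zero_of_finrank_lt hk _
  rw [innerAt, Complex.re_sum, Finset.sum_eq_zero_iff_of_nonneg fun _ _ => by
    rw [pointwiseInner_self, Complex.ofReal_re]; positivity] at h
  refine eq_zero_of_pointwiseInner_self (g := g) (Complex.ext (h k ?_) ?_)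
  · rw [Finset.mem_range]
    omega
  · exact Complex.conj_eq_iff_im.mp (pointwiseInner_conj g x _ _)

lemma innerAt_eq_zero_left {g : TangentMetric E X} {u : Form E L} {x : X} (h : ∀ k, u k x = 0)
    (v : Form E L) : innerAt g u v x = 0 :=
  Finset.sum_eq_zero fun k _ => by simp [pointwiseInner, h k]

lemma innerAt_eq_zero_right {g : TangentMetric E X} {v : Form E L} {x : X} (h : ∀ k, v k x = 0)
    (u : Form E L) : innerAt g u v x = 0 := by
  rw [← innerAt_conj, innerAt_eq_zero_left h, map_zero]

lemma HasCompactSupport.of_forall [T2Space X] {u : Form E L} {K : Set X} (hK : IsCompact K)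
    (h : ∀ x ∉ K, ∀ k, u k x = 0) : u.HasCompactSupport := by
  refine hK.of_isClosed_subset isClosed_closure (closure_minimal ?_ hK.isClosed)
  rintro x ⟨k, hk⟩
  by_contra hx
  exact hk (h x hx k)

lemma HasCompactSupport.exists {u : Form E L} (hu : u.HasCompactSupport) :
    ∃ K, IsCompact K ∧ IsClosed K ∧ ∀ x ∉ K, ∀ k, u k x = 0 :=
  ⟨_, hu, isClosed_closure, fun x hx k => by
    by_contra h
    exact hx (subset_closure ⟨k, h⟩)⟩

variable [TopologicalSpace (Bundle.TotalSpace ℂ L)] [FiberBundle ℂ L] [VectorBundle ℂ ℂ L]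
  [ContMDiffVectorBundle ∞ ℂ L 𝓘(ℝ, E)]

lemma innerAt_comp_chart_symm (g : TangentMetric E X) (u v : Form E L) {x₀ : X} {y : E}
    (hy : y ∈ localDomain E L x₀) : innerAt g u v ((chartAt E x₀).symm y) =
      ∑ k ∈ Finset.range (Module.finrank ℝ E + 1), (frameLength L x₀ y : ℂ) *
        formInner (sharp (metricChart g x₀ y)) (u.inChart k x₀ y) (v.inChart k x₀ y) :=
  Finset.sum_congr rfl fun _ _ => pointwiseInner_eq_formInner g hy _ _

lemma contDiffOn_formInner_inChart (hL : HasSmoothMetric E L) (g : TangentMetric E X)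
    {u v : Form E L} (hu : u.IsSmooth) (hv : v.IsSmooth) (k : ℕ) (x₀ : X) :
    ContDiffOn ℝ ∞ (fun y => (frameLength L x₀ y : ℂ) *
      formInner (sharp (metricChart g x₀ y)) (u.inChart k x₀ y) (v.inChart k x₀ y))
      (localDomain E L x₀) := by
  have hG := (contDiffOn_metricChart g x₀).mono
    (Set.inter_subset_left (t := (chartAt E x₀).symm ⁻¹' (trivializationAt ℂ L x₀).baseSet))
  exact (Complex.ofRealCLM.contDiff.comp_contDiffOn (contDiffOn_frameLength hL x₀)).mul
    (contDiffOn_formInner (contDiffOn_sharp hG fun y hy =>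
      (isOrthonormalFrame_chartFrame g ((chartAt E x₀).map_target hy.1)).isInvertible
        (metricChart_symm g x₀ y)) (hu k x₀) (hv k x₀))

/-- The frames used to define the inner product may jump from point to point, so continuity is read
off from the chart expression with the inverse metric. -/
lemma continuous_innerAt (hL : HasSmoothMetric E L) (g : TangentMetric E X)
    {u v : Form E L} (hu : u.IsSmooth) (hv : v.IsSmooth) : Continuous (innerAt g u v) := by
  refine continuous_iff_continuousAt.mpr fun x => ?_
  have hc : ContinuousOn (fun y => ∑ k ∈ Finset.range (Module.finrank ℝ E + 1),
      (frameLength L x y : ℂ) * formInner (sharp (metricChart g x y)) (u.inChart k x y)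
        (v.inChart k x y)) (localDomain E L x) :=
    continuousOn_finsetSum _ fun k _ => (contDiffOn_formInner_inChart hL g hu hv k x).continuousOn
  have hy := (isOpen_localDomain (E := E) (L := L) x).mem_nhds (mem_localDomain_self x)
  have h2 := (hc.continuousAt hy).comp (f := chartAt E x) (x := x)
    ((chartAt E x).continuousAt (mem_chart_source E x))
  refine h2.congr ?_
  filter_upwards [((chartAt E x).continuousAt (mem_chart_source E x)).preimage_mem_nhds hy,
    (chartAt E x).open_source.mem_nhds (mem_chart_source E x)] with z hz hz'
  have h3 := innerAt_comp_chart_symm g u v hz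
  rw [(chartAt E x).left_inv hz'] at h3
  exact h3.symm

variable [MeasurableSpace E] [BorelSpace E] [MeasurableSpace X] [BorelSpace X]
  [SecondCountableTopology X] [T2Space X]

lemma integrable_innerAt (hL : HasSmoothMetric E L) (g : TangentMetric E X) {u v : Form E L}
    (hu : u.IsSmooth) (hv : v.IsSmooth) {K : Set X} (hK : IsCompact K)
    (h : ∀ x ∉ K, innerAt g u v x = 0) : Integrable (innerAt g u v) (volumeMeasure g) :=
  (continuous_innerAt hL g hu hv).integrable_of_hasCompactSupport
    (HasCompactSupport.intro hK h)

lemma l2Inner_add_left (hL : HasSmoothMetric E L) (g : TangentMetric E X) {u u' v : Form E L}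
    (hu : u.IsSmooth) (hu' : u'.IsSmooth) (hv : v.IsSmooth) {K : Set X} (hK : IsCompact K)
    (h : ∀ x ∉ K, innerAt g u v x = 0) (h' : ∀ x ∉ K, innerAt g u' v x = 0) :
    l2Inner g (u + u') v = l2Inner g u v + l2Inner g u' v := by
  rw [l2Inner, l2Inner, l2Inner, ← integral_add (integrable_innerAt hL g hu hv hK h)
    (integrable_innerAt hL g hu' hv hK h')]
  exact integral_congr_ae (Filter.Eventually.of_forall fun x => innerAt_add_left g u u' v x)

/-- The `L²` product of forms whose pointwise product is supported in a chart. -/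
lemma l2Inner_eq_sum (hL : HasSmoothMetric E L) (g : TangentMetric E X) {u v : Form E L}
    (hu : u.IsSmooth) (hv : v.IsSmooth) (x₀ : X) {K : Set X} (hK : IsCompact K)
    (hKs : K ⊆ (chartAt E x₀).source) (hKb : K ⊆ (trivializationAt ℂ L x₀).baseSet)
    (h : ∀ x ∉ K, (∀ k, u k x = 0) ∨ ∀ k, v k x = 0) :
    l2Inner g u v = ∑ k ∈ Finset.range (Module.finrank ℝ E + 1), ∫ y in localDomain E L x₀,
      (metricDensity (metricChart g x₀ y) : ℂ) * (frameLength L x₀ y : ℂ) *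
        formInner (sharp (metricChart g x₀ y)) (u.inChart k x₀ y) (v.inChart k x₀ y)
          ∂(Module.finBasis ℝ E).addHaar := by
  have h0 : ∀ x ∉ K, innerAt g u v x = 0 := fun x hx =>
    (h x hx).elim (fun h => innerAt_eq_zero_left h v) fun h => innerAt_eq_zero_right h u
  have hsub : localDomain E L x₀ ⊆ (chartAt E x₀).target := Set.inter_subset_left
  rw [l2Inner, ← setIntegral_eq_integral_of_forall_compl_eq_zero fun x hx =>
    h0 x fun hxK => hx (hKs hxK), setIntegral_volumeMeasure g x₀ (continuous_innerAt hL g hu hv),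
    setIntegral_eq_of_subset_of_forall_sdiff_eq_zero (chartAt E x₀).open_target.measurableSet hsub
      fun y hy => by
        rw [h0 _ fun hyK => hy.2 ⟨hy.1, hKb hyK⟩, mul_zero]]
  have hC : IsCompact (chartAt E x₀ '' K) := hK.image_of_continuousOn
    ((chartAt E x₀).continuousOn.mono hKs)
  have hCU : chartAt E x₀ '' K ⊆ localDomain E L x₀ := by
    rintro _ ⟨x, hx, rfl⟩
    refine ⟨(chartAt E x₀).map_source (hKs hx), ?_⟩
    rw [Set.mem_preimage, (chartAt E x₀).left_inv (hKs hx)]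
    exact hKb hx
  rw [← integral_finsetSum]
  · refine setIntegral_congr_fun (isOpen_localDomain x₀).measurableSet fun y hy => ?_
    rw [innerAt_comp_chart_symm g u v hy, Finset.mul_sum]
    exact Finset.sum_congr rfl fun k _ => by ring
  · intro k _
    refine integrableOn_of_continuousOn _ (isOpen_localDomain x₀) hC hCU ?_ ?_
    · simp only [mul_assoc]
      exact ((Complex.continuous_ofReal.comp_continuousOn
        ((continuousOn_volumeDensity g x₀).mono hsub)).mul
          (contDiffOn_formInner_inChart hL g hu hv k x₀).continuousOn)
    · intro y hy hyC
      have hyK : (chartAt E x₀).symm y ∉ K := fun hyK =>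
        hyC ⟨_, hyK, (chartAt E x₀).right_inv hy.1⟩
      rcases h _ hyK with h | h
      · rw [inChart_eq_chartPull u, h, ← zero_smul ℂ (0 : E [⋀^Fin k]→L[ℝ] L _), chartPull_smul,
          formInner_smul_left]
        ring
      · rw [inChart_eq_chartPull v, h, ← zero_smul ℂ (0 : E [⋀^Fin k]→L[ℝ] L _), chartPull_smul,
          formInner_smul_right]
        simp

end Form

variable [MeasurableSpace E] [BorelSpace E] [MeasurableSpace X] [BorelSpace X]
  [SecondCountableTopology X] [T2Space X]
  [TopologicalSpace (Bundle.TotalSpace ℂ L)] [FiberBundle ℂ L] [VectorBundle ℂ ℂ L]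
  [ContMDiffVectorBundle ∞ ℂ L 𝓘(ℝ, E)] {D : CovariantDerivative 𝓘(ℝ, E) ℂ L}

/-- Here the `L²` products are finite sums of integrals over one coordinate domain, and the local
adjointness relation applies degree by degree. -/
lemma l2Inner_typedD_of_subset {g : TangentMetric E X} (hg : IsKaehler g)
    (hL : HasSmoothMetric E L) (hD : IsHermitianConnection D) {s : ℝ} (hs : s * s = 1)
    {u v : Form E L} (hu : u.IsSmooth) (hv : v.IsSmooth) (x₀ : X) {K : Set X} (hK : IsCompact K)
    (hKs : K ⊆ (chartAt E x₀).source) (hKb : K ⊆ (trivializationAt ℂ L x₀).baseSet)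
    (h : ∀ x ∉ K, ∀ k, u k x = 0) :
    Form.l2Inner g (typedD D s u) v = Form.l2Inner g u (codiff D g s v) := by
  have hloc := isLocalKaehler hg hL hD x₀
  rw [Form.l2Inner_eq_sum hL g (hu.typedD hD s) hv x₀ hK hKs hKb fun x hx =>
      .inl fun k => typedD_eq_zero_of_notMem hK.isClosed h hx k,
    Form.l2Inner_eq_sum hL g hu (hv.codiff hg.1 hD s) x₀ hK hKs hKb fun x hx => .inl (h x hx)]
  set N := Module.finrank ℝ E
  set I : ℕ → ℂ := fun k => ∫ y in localDomain E L x₀,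
      (metricDensity (metricChart g x₀ y) : ℂ) * (frameLength L x₀ y : ℂ) *
        formInner (sharp (metricChart g x₀ y)) ((typedD D s u).inChart k x₀ y) (v.inChart k x₀ y)
          ∂(Module.finBasis ℝ E).addHaar with hI
  have hI0 : I 0 = 0 := by
    simp only [hI]
    refine (integral_congr_ae (Filter.Eventually.of_forall fun y => ?_)).trans (integral_zero _ _)
    rw [Form.inChart_zero (k := 0) rfl, Pi.zero_apply, ← zero_smul ℂ (0 : E [⋀^Fin 0]→L[ℝ] ℂ),
      formInner_smul_left]
    ring
  have hIN : I (N + 1) = 0 := by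
    simp only [hI]
    refine (integral_congr_ae (Filter.Eventually.of_forall fun y => ?_)).trans (integral_zero _ _)
    rw [form_eq_zero_of_finrank_lt (Nat.lt_succ_self N) (v.inChart (N + 1) x₀ y),
      ← zero_smul ℂ (0 : E [⋀^Fin (N + 1)]→L[ℝ] ℂ), formInner_smul_right]
    simp
  -- The derivative of the component of degree `k` sits in degree `k + 1`. The index can be shifted
  -- since `D u` has no component of degree `0` and there are no forms of degree `N + 1`.
  have h1 : ∑ k ∈ Finset.range (N + 1), I k = ∑ k ∈ Finset.range (N + 1), I (k + 1) := by
    rw [← add_zero (∑ k ∈ Finset.range (N + 1), I (k + 1)), ← hI0, ← Finset.sum_range_succ',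
      Finset.sum_range_succ _ (N + 1), hIN, add_zero]
  rw [h1]
  refine Finset.sum_congr rfl fun k _ => ?_
  have hC : IsCompact (chartAt E x₀ '' K) := hK.image_of_continuousOn
    ((chartAt E x₀).continuousOn.mono hKs)
  have hCU : chartAt E x₀ '' K ⊆ localDomain E L x₀ := by
    rintro _ ⟨x, hx, rfl⟩
    refine ⟨(chartAt E x₀).map_source (hKs hx), ?_⟩
    rw [Set.mem_preimage, (chartAt E x₀).left_inv (hKs hx)]
    exact hKb hx
  have hmain := hloc.integral_formInner_localD (Module.finBasis ℝ E).addHaar hs (hu k x₀)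
    (hv (k + 1) x₀) hC hCU fun y hy hyC => by
      rw [inChart_eq_chartPull, h _ fun hyK => hyC ⟨_, hyK, (chartAt E x₀).right_inv hy.1⟩,
        ← zero_smul ℂ (0 : E [⋀^Fin k]→L[ℝ] L _), chartPull_smul, zero_smul]
  refine Eq.trans ?_ (hmain.trans ?_)
  · refine setIntegral_congr_fun (isOpen_localDomain x₀).measurableSet fun y hy => ?_
    rw [typedD_inChart hD s hu k hy]
  · refine setIntegral_congr_fun (isOpen_localDomain x₀).measurableSet fun y hy => ?_
    rw [codiff_inChart hg.1 hD s hv k hy]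

end Integration

/-! ### Existence and uniqueness of formal adjoints. -/

noncomputable section FormalAdjoints

open Bundle

variable {E : Type*} [NormedAddCommGroup E] [NormedSpace ℂ E] [FiniteDimensional ℂ E]
  {X : Type*} [TopologicalSpace X] [ChartedSpace E X] [IsManifold 𝓘(ℂ, E) ω X]
  {L : X → Type*} [∀ x, NormedAddCommGroup (L x)] [∀ x, InnerProductSpace ℂ (L x)]
  [MeasurableSpace E] [BorelSpace E] [MeasurableSpace X] [BorelSpace X]
  [SecondCountableTopology X] [T2Space X]
  [TopologicalSpace (Bundle.TotalSpace ℂ L)] [FiberBundle ℂ L] [VectorBundle ℂ ℂ L]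
  [ContMDiffVectorBundle ∞ ℂ L 𝓘(ℝ, E)] {D : CovariantDerivative 𝓘(ℝ, E) ℂ L}
  {g : TangentMetric E X}

/-- `codiff` is the formal adjoint of `typedD`. -/
lemma l2Inner_typedD (hg : IsKaehler g) (hL : HasSmoothMetric E L) (hD : IsHermitianConnection D)
    {s : ℝ} (hs : s * s = 1) {u v : Form E L} (hu : u.IsSmooth) (hv : v.IsSmooth)
    (hc : u.HasCompactSupport) :
    Form.l2Inner g (typedD D s u) v = Form.l2Inner g u (codiff D g s v) := by
  have : ProperSpace E := FiniteDimensional.proper ℂ E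
  have : LocallyCompactSpace X := ChartedSpace.locallyCompactSpace E X
  obtain ⟨K, hK, hKc, hKu⟩ := hc.exists
  have hv' := hv.codiff hg.1 hD s
  -- The partition is subordinate to sets on which a chart and a trivialization with the same centre
  -- are both available; only finitely many of its members are nonzero somewhere on the compact set
  -- `K`.
  obtain ⟨f, hf⟩ := SmoothPartitionOfUnity.exists_isSubordinate 𝓘(ℝ, E) hKc
    (fun x : X => (chartAt E x).source ∩ (trivializationAt ℂ L x).baseSet)
    (fun x => (chartAt E x).open_source.inter (trivializationAt ℂ L x).open_baseSet)
    fun x _ => Set.mem_iUnion.mpr ⟨x, mem_chart_source E x,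
      FiberBundle.mem_baseSet_trivializationAt' x⟩
  have hfin := f.locallyFinite.finite_nonempty_inter_compact hK
  have hsm : ∀ F : Finset X, ContMDiff 𝓘(ℝ, E) 𝓘(ℝ, ℝ) ∞ (fun x => ∑ i ∈ F, f i x) := fun F =>
    contMDiff_finsetSum fun i _ => (f i).contMDiff
  have hmul : ∀ (φ : X → ℝ), ∀ x ∉ K, ∀ k, (u.mulFun φ) k x = 0 := fun φ x hx k => by
    rw [Form.mulFun, hKu x hx, smul_zero]
  -- By additivity the relation for finite sums `∑ f_i u` reduces to single terms, each supported in
  -- one chart.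
  have key : ∀ F : Finset X, Form.l2Inner g (typedD D s (u.mulFun fun x => ∑ i ∈ F, f i x)) v =
      Form.l2Inner g (u.mulFun fun x => ∑ i ∈ F, f i x) (codiff D g s v) := by
    classical
    intro F
    induction F using Finset.induction_on with
    | empty =>
      have h0 : ∀ x, x ∉ (∅ : Set X) → ∀ k, (u.mulFun fun x => ∑ i ∈ ∅, f i x) k x = 0 :=
        fun x _ k => by simp [Form.mulFun]
      refine integral_congr_ae (Filter.Eventually.of_forall fun x => ?_)
      rw [Form.innerAt_eq_zero_left (h0 x (Set.notMem_empty x)), Form.innerAt_eq_zero_left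
        (typedD_eq_zero_of_notMem isClosed_empty h0 (Set.notMem_empty x))]
    | insert i F hi ih =>
      have e : (u.mulFun fun x => ∑ j ∈ insert i F, f j x) =
          u.mulFun (f i) + u.mulFun (fun x => ∑ j ∈ F, f j x) := by
        rw [← Form.mulFun_add_fun]
        simp only [Finset.sum_insert hi]
      have h1 := hu.mulFun (f i).contMDiff
      have h2 := hu.mulFun (hsm F)
      have hloc : Form.l2Inner g (typedD D s (u.mulFun (f i))) v =
          Form.l2Inner g (u.mulFun (f i)) (codiff D g s v) := by
        refine l2Inner_typedD_of_subset hg hL hD hs h1 hv i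
          (hK.inter_right (isClosed_tsupport (f i))) (fun x hx => (hf i hx.2).1)
          (fun x hx => (hf i hx.2).2) fun x hx k => ?_
        by_cases hxK : x ∈ K
        · have : f i x = 0 := image_eq_zero_of_notMem_tsupport fun h => hx ⟨hxK, h⟩
          simp [Form.mulFun, this]
        · exact hmul _ x hxK k
      rw [e, typedD_add hD h1 h2, Form.l2Inner_add_left hL g (h1.typedD hD s) (h2.typedD hD s) hv hK,
        Form.l2Inner_add_left hL g h1 h2 hv' hK, hloc, ih]
      · exact fun x hx => Form.innerAt_eq_zero_left (hmul _ x hx) _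
      · exact fun x hx => Form.innerAt_eq_zero_left (hmul _ x hx) _
      · exact fun x hx => Form.innerAt_eq_zero_left
          (typedD_eq_zero_of_notMem hKc (hmul _) hx) _
      · exact fun x hx => Form.innerAt_eq_zero_left
          (typedD_eq_zero_of_notMem hKc (hmul _) hx) _
  have hu1 : (u.mulFun fun x => ∑ i ∈ hfin.toFinset, f i x) = u := by
    funext k x
    by_cases hx : x ∈ K
    · have h1 : ∑ i ∈ hfin.toFinset, f i x = 1 := by
        rw [← f.sum_eq_one hx, finsum_eq_sum_of_support_subset]
        intro i hi
        rw [Finset.mem_coe, Set.Finite.mem_toFinset]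
        exact ⟨x, hi, hx⟩
      simp only [Form.mulFun, h1, Complex.ofReal_one, one_smul]
    · rw [hmul _ x hx, hKu x hx]
  rw [← hu1]
  exact key _

lemma Form.l2Inner_mulFun (f : X → ℝ) (u v : Form E L) :
    Form.l2Inner g (u.mulFun f) v = Form.l2Inner g u (v.mulFun f) :=
  integral_congr_ae (Filter.Eventually.of_forall fun x => by
    simp only [innerAt_mulFun_left, innerAt_mulFun_right])

lemma Form.HasCompactSupport.mulFun {u : Form E L} (hu : u.HasCompactSupport) (f : X → ℝ) :
    (u.mulFun f).HasCompactSupport := by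
  obtain ⟨K, hK, -, hKu⟩ := hu.exists
  exact .of_forall hK fun x hx k => by rw [Form.mulFun, hKu x hx, smul_zero]

/-- The formal adjoint is unique on smooth forms. -/
lemma IsFormalAdjoint.unique (hL : HasSmoothMetric E L) {P Q Q' : Form E L → Form E L}
    (h : IsFormalAdjoint g P Q) (h' : IsFormalAdjoint g P Q') {v : Form E L} (hv : v.IsSmooth) :
    Q v = Q' v := by
  set w := Q v - Q' v with hw
  have hws : w.IsSmooth := (h.smooth_right v hv).sub (h'.smooth_right v hv)
  suffices hsuff : ∀ x, (Form.innerAt g w w x).re = 0 by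
    refine sub_eq_zero.mp ?_
    funext k x
    exact Form.eq_zero_of_innerAt_self (hsuff x) k
  intro x
  by_contra hx
  obtain ⟨χ⟩ : Nonempty (SmoothBumpFunction 𝓘(ℝ, E) x) := inferInstance
  -- Testing both adjoints against `χ w`, with `w` their difference, gives `∫ χ |w|² = 0`; but `χ
  -- |w|²` is continuous, nonnegative and positive at `x`.
  set u := w.mulFun χ
  have hus : u.IsSmooth := hws.mulFun χ.contMDiff
  have huK : ∀ z ∉ tsupport χ, ∀ k, u k z = 0 := fun z hz k => by
    simp [u, Form.mulFun, image_eq_zero_of_notMem_tsupport hz]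
  have huc : u.HasCompactSupport := .of_forall χ.hasCompactSupport huK
  have h0 : Form.l2Inner g u w = 0 := by
    have e1 := h.adjoint u v hus hv huc
    have e2 := h'.adjoint u v hus hv huc
    have hint : ∀ z : Form E L, z.IsSmooth → Integrable (Form.innerAt g u z) (volumeMeasure g) :=
      fun z hz => Form.integrable_innerAt hL g hus hz χ.hasCompactSupport fun p hp =>
        Form.innerAt_eq_zero_left (huK p hp) z
    have e3 : Form.l2Inner g u w = Form.l2Inner g u (Q v) - Form.l2Inner g u (Q' v) := by
      rw [Form.l2Inner, Form.l2Inner, Form.l2Inner, ← integral_sub (hint _ (h.smooth_right v hv))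
        (hint _ (h'.smooth_right v hv))]
      exact integral_congr_ae (Filter.Eventually.of_forall fun z =>
        Form.innerAt_sub_right g u _ _ z)
    rw [e3, ← e1, ← e2, sub_self]
  have h1 : Form.l2Inner g u w = ((∫ z, χ z * (Form.innerAt g w w z).re ∂(volumeMeasure g) : ℝ) : ℂ) := by
    rw [← integral_complex_ofReal, Form.l2Inner]
    refine integral_congr_ae (Filter.Eventually.of_forall fun z => ?_)
    simp only [u, Form.innerAt_mulFun_left]
    refine Complex.ext ?_ ?_ <;> simp [Form.innerAt_self_im]
  have h2 : 0 < ∫ z, χ z * (Form.innerAt g w w z).re ∂(volumeMeasure g) := by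
    refine Continuous.integral_pos_of_hasCompactSupport_nonneg_nonzero (x := x)
      (χ.continuous.mul (Complex.continuous_re.comp (Form.continuous_innerAt hL g hws hws)))
      χ.hasCompactSupport.mul_right
      (fun z => mul_nonneg χ.nonneg (Form.innerAt_self_nonneg g w z)) ?_
    rw [χ.eq_one, one_mul]
    exact hx
  rw [h1, Complex.ofReal_eq_zero] at h0
  exact h2.ne' h0

lemma IsFormalAdjoint.isFormalAdjoint_formalAdjoint {P Q : Form E L → Form E L}
    (h : IsFormalAdjoint g P Q) : IsFormalAdjoint g P (formalAdjoint g P) := by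
  have hex : ∃ Q, IsFormalAdjoint g P Q := ⟨Q, h⟩
  rw [formalAdjoint, dif_pos hex]
  exact hex.choose_spec

/-- `formalAdjoint` is a mere choice; uniqueness shows that on smooth forms it agrees with any
explicit adjoint. -/
lemma IsFormalAdjoint.formalAdjoint_eq (hL : HasSmoothMetric E L) {P Q : Form E L → Form E L}
    (h : IsFormalAdjoint g P Q) {v : Form E L} (hv : v.IsSmooth) : formalAdjoint g P v = Q v :=
  h.isFormalAdjoint_formalAdjoint.unique hL h hv

lemma isFormalAdjoint_typedD (hg : IsKaehler g) (hL : HasSmoothMetric E L)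
    (hD : IsHermitianConnection D) {s : ℝ} (hs : s * s = 1) :
    IsFormalAdjoint g (typedD D s) (codiff D g s) where
  smooth_left _ hu := hu.typedD hD s
  smooth_right _ hv := hv.codiff hg.1 hD s
  adjoint _ _ hu hv hc := l2Inner_typedD hg hL hD hs hu hv hc

/-- Multiplication by a real function is its own adjoint, so adjoints of composites are composites
in the opposite order. -/
lemma isFormalAdjoint_typedD_mulFun (hg : IsKaehler g) (hL : HasSmoothMetric E L)
    (hD : IsHermitianConnection D) {s : ℝ} (hs : s * s = 1) {f : X → ℝ}
    (hf : ContMDiff 𝓘(ℝ, E) 𝓘(ℝ, ℝ) ∞ f) :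
    IsFormalAdjoint g (fun u => typedD D s (u.mulFun f)) (fun v => (codiff D g s v).mulFun f) where
  smooth_left _ hu := (hu.mulFun hf).typedD hD s
  smooth_right _ hv := (hv.codiff hg.1 hD s).mulFun hf
  adjoint u v hu hv hc := by
    rw [l2Inner_typedD hg hL hD hs (hu.mulFun hf) hv (hc.mulFun f), Form.l2Inner_mulFun]

lemma isFormalAdjoint_mulFun_typedD (hg : IsKaehler g) (hL : HasSmoothMetric E L)
    (hD : IsHermitianConnection D) {s : ℝ} (hs : s * s = 1) {f : X → ℝ}
    (hf : ContMDiff 𝓘(ℝ, E) 𝓘(ℝ, ℝ) ∞ f) :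
    IsFormalAdjoint g (fun u => (typedD D s u).mulFun f) (fun v => codiff D g s (v.mulFun f)) where
  smooth_left _ hu := (hu.typedD hD s).mulFun hf
  smooth_right _ hv := (hv.mulFun hf).codiff hg.1 hD s
  adjoint u v hu hv hc := by
    rw [Form.l2Inner_mulFun, l2Inner_typedD hg hL hD hs hu (hv.mulFun hf) hc]

lemma contMDiff_sqrt {η : X → ℝ} (hη : ContMDiff 𝓘(ℝ, E) 𝓘(ℝ, ℝ) ∞ η) (hpos : ∀ x, 0 < η x) :
    ContMDiff 𝓘(ℝ, E) 𝓘(ℝ, ℝ) ∞ (fun x => √(η x)) := fun x =>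
  (Real.contDiffAt_sqrt (hpos x).ne').contMDiffAt.comp x (hη x)

/-- The Laplacian `(D_s √η) (D_s √η)^⋆ + (√η D_s)^⋆ (√η D_s)`, with explicit adjoints. -/
lemma twistedLaplacian_eq {s : ℝ} (hg : IsKaehler g) (hL : HasSmoothMetric E L)
    (hD : IsHermitianConnection D) (hs : s * s = 1) {η : X → ℝ}
    (hη : ContMDiff 𝓘(ℝ, E) 𝓘(ℝ, ℝ) ∞ η) (hpos : ∀ x, 0 < η x) {v : Form E L} (hv : v.IsSmooth) :
    typedD D s ((formalAdjoint g (fun u => typedD D s (u.mulFun fun x => √(η x))) v).mulFun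
        fun x => √(η x)) +
      formalAdjoint g (fun u => (typedD D s u).mulFun fun x => √(η x))
        ((typedD D s v).mulFun fun x => √(η x)) =
    typedD D s ((codiff D g s v).mulFun η) + codiff D g s ((typedD D s v).mulFun η) := by
  have hsq := contMDiff_sqrt hη hpos
  -- In both composites the two factors `√η` meet between an operator and its adjoint and merge into
  -- `η`.
  have hmul : (fun x => √(η x) * √(η x)) = η := funext fun x => Real.mul_self_sqrt (hpos x).le
  rw [(isFormalAdjoint_typedD_mulFun hg hL hD hs hsq).formalAdjoint_eq hL hv,
    (isFormalAdjoint_mulFun_typedD hg hL hD hs hsq).formalAdjoint_eq hL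
      ((hv.typedD hD s).mulFun hsq), Form.mulFun_mulFun, Form.mulFun_mulFun, hmul]

end FormalAdjoints

/-! ### The `(1, 1)`-part of the curvature as an anticommutator. -/

noncomputable section LocalCommutators

open ContinuousAlternatingMap (alternatizeUncurryFin alternatizeUncurryFinCLM
  alternatizeUncurryFin_apply alternatizeUncurryFin_smul alternatizeUncurryFin_add)

variable {E : Type*} [NormedAddCommGroup E] [NormedSpace ℂ E] [FiniteDimensional ℂ E]
  {F : Type*} [NormedAddCommGroup F] [NormedSpace ℂ F] {k : ℕ}

lemma wedge2_eq (β : E [⋀^Fin 2]→L[ℝ] ℂ) (u : E [⋀^Fin k]→L[ℝ] F)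
    {T : E →L[ℝ] E [⋀^Fin (k + 1)]→L[ℝ] F} (hT : ∀ v, T v = wedge1 (slot β v) u) :
    wedge2 β u = (1 / 2 : ℂ) • alternatizeUncurryFin T := by
  rw [wedge2]
  congr 2
  ext1 v
  exact (hT v).symm

/-- Double alternatization only sees the antisymmetric part of a bilinear form. -/
lemma alternatize_alternatize_eq_wedge2 (β : E [⋀^Fin 2]→L[ℝ] ℂ) (u : E [⋀^Fin k]→L[ℝ] F)
    (B : E →L[ℝ] E →L[ℝ] E [⋀^Fin k]→L[ℝ] F) (hB : ∀ v w, B v w - B w v = β ![v, w] • u) :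
    alternatizeUncurryFin (alternatizeUncurryFinCLM ℝ E F ∘L B) = wedge2 β u := by
  have h1 : ∀ v, (alternatizeUncurryFinCLM ℝ E F ∘L (B - B.flip)) v = wedge1 (slot β v) u := by
    intro v
    change alternatizeUncurryFin ((B - B.flip) v) = alternatizeUncurryFin _
    congr 1
    ext1 w
    rw [ContinuousLinearMap.smulRight_apply, slot_apply, ← hB]
    rfl
  -- Transposing `B` changes the sign of the double alternatization, so `B - B.flip` counts it
  -- twice; the normalization `1 / 2` of `wedge2` compensates.
  rw [wedge2_eq β u h1, ContinuousLinearMap.comp_sub, alternatize_sub, alternatize_flip,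
    sub_neg_eq_add, ← two_smul ℂ, smul_smul]
  norm_num

/-- The case of a bilinear form times `u`: with `C` the derivative of a `1`-form `θ`, it identifies
the corresponding term of the Leibniz rule with `dθ ∧ u`. -/
lemma wedge2_alternatize {β : E [⋀^Fin 2]→L[ℝ] ℂ} (u : E [⋀^Fin k]→L[ℝ] F) (C : E →L[ℝ] E →L[ℝ] ℂ)
    (hC : ∀ v w, C v w - C w v = β ![v, w]) {T : E →L[ℝ] E [⋀^Fin (k + 1)]→L[ℝ] F}
    (hT : ∀ v, T v = wedge1 (C v) u) : alternatizeUncurryFin T = wedge2 β u := by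
  rw [← alternatize_alternatize_eq_wedge2 β u
    ((ContinuousLinearMap.compL ℝ E ℂ (E [⋀^Fin k]→L[ℝ] F)
      ((ContinuousLinearMap.lsmul ℝ ℂ).flip u)) ∘L C) fun v w => ?_]
  · congr 1
    ext1 v
    rw [hT]
    rfl
  · rw [← hC, sub_smul]
    rfl

/-- `θ ∧ ·` anticommutes with an alternatization. -/
lemma alternatize_wedge1 (θ : E →L[ℝ] ℂ) (S : E →L[ℝ] E [⋀^Fin k]→L[ℝ] F)
    {T : E →L[ℝ] E [⋀^Fin (k + 1)]→L[ℝ] F} (hT : ∀ v, T v = wedge1 θ (S v)) :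
    alternatizeUncurryFin T = -wedge1 θ (alternatizeUncurryFin S) := by
  set B : E →L[ℝ] E →L[ℝ] E [⋀^Fin k]→L[ℝ] F :=
    (ContinuousLinearMap.compL ℝ E ℂ (E [⋀^Fin k]→L[ℝ] F)).flip θ ∘L
      (ContinuousLinearMap.lsmul ℝ ℂ).flip ∘L S with hB
  have hBT : alternatizeUncurryFinCLM ℝ E F ∘L B = T := by
    ext1 v
    rw [hT]
    rfl
  have hflip : alternatizeUncurryFinCLM ℝ E F ∘L B.flip = θ.smulRight (alternatizeUncurryFin S) := by
    ext1 v
    exact alternatize_smul_complex (θ v) S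
  rw [← hBT, wedge1, ← hflip, alternatize_flip, neg_neg]

lemma wedge2_apply (β : E [⋀^Fin 2]→L[ℝ] ℂ) (u : E [⋀^Fin k]→L[ℝ] F) (m : Fin (k + 2) → E) :
    wedge2 β u m = (1 / 2 : ℂ) • ∑ i : Fin (k + 2), (-1 : ℤ) ^ (i : ℕ) •
      ∑ j : Fin (k + 1), (-1 : ℤ) ^ (j : ℕ) •
      β ![m i, i.removeNth m j] • u (j.removeNth (i.removeNth m)) := by
  simp only [wedge2, wedge1, ContinuousAlternatingMap.smul_apply, alternatizeUncurryFin_apply,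
    LinearMap.coe_toContinuousLinearMap', LinearMap.coe_mk, AddHom.coe_mk,
    ContinuousLinearMap.smulRight_apply, slot_apply]

lemma wedge2_add_left (β β' : E [⋀^Fin 2]→L[ℝ] ℂ) (u : E [⋀^Fin k]→L[ℝ] F) :
    wedge2 (β + β') u = wedge2 β u + wedge2 β' u := by
  ext m
  simp only [wedge2_apply, ContinuousAlternatingMap.add_apply, add_smul, smul_add,
    Finset.sum_add_distrib]

lemma wedge2_smul_left (c : ℂ) (β : E [⋀^Fin 2]→L[ℝ] ℂ) (u : E [⋀^Fin k]→L[ℝ] F) :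
    wedge2 (c • β) u = c • wedge2 β u := by
  ext m
  simp only [wedge2_apply, ContinuousAlternatingMap.smul_apply, smul_assoc, Finset.smul_sum]
  refine Finset.sum_congr rfl fun i _ => Finset.sum_congr rfl fun j _ => ?_
  module

section Square

variable {A : E → E →L[ℝ] ℂ} {u : E → E [⋀^Fin k]→L[ℝ] F} {y : E}

/-- The local covariant derivative of a form. -/
def localNabla (A : E → E →L[ℝ] ℂ) (u : E → E [⋀^Fin k]→L[ℝ] F) (y : E) :
    E →L[ℝ] E [⋀^Fin k]→L[ℝ] F :=
  fderiv ℝ u y + (A y).smulRight (u y)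

/-- The second covariant derivative, antisymmetrized, is given by the curvature. -/
lemma localNabla_localNabla_sub {V : Set E} (hV : IsOpen V) (hA : ContDiffOn ℝ ∞ A V)
    (hu : ContDiffOn ℝ ∞ u V) (hy : y ∈ V) (v w : E) :
    (fderiv ℝ (localNabla A u) y + (A y).smulRight (localNabla A u y)) v w -
      (fderiv ℝ (localNabla A u) y + (A y).smulRight (localNabla A u y)) w v =
      (fderiv ℝ A y v w - fderiv ℝ A y w v) • u y := by
  have hu1 := hu.differentiableAt_of_isOpen hV hy
  have hA1 := hA.differentiableAt_of_isOpen hV hy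
  have hu2 : DifferentiableAt ℝ (fderiv ℝ u) y :=
    (hu.fderiv_of_isOpen (m := ∞) hV (by simp)).differentiableAt_of_isOpen hV hy
  have hsymm : fderiv ℝ (fderiv ℝ u) y v w = fderiv ℝ (fderiv ℝ u) y w v :=
    (((hu y hy).contDiffAt (hV.mem_nhds hy)).isSymmSndFDerivAt (by
      rw [minSmoothness_of_isRCLikeNormedField]
      exact WithTop.coe_le_coe.2 (le_top : (2 : ℕ∞) ≤ ⊤))) v w
  have hap : ∀ a b : E, fderiv ℝ (localNabla A u) y a b =
      fderiv ℝ (fderiv ℝ u) y a b + (fderiv ℝ A y a b • u y + A y b • fderiv ℝ u y a) := by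
    intro a b
    have h1 : HasFDerivAt (fun z => localNabla A u z b)
        (((ContinuousLinearMap.apply ℝ _ b) ∘L fderiv ℝ (fderiv ℝ u) y) +
          (A y b • fderiv ℝ u y + ((ContinuousLinearMap.apply ℝ ℂ b) ∘L fderiv ℝ A y).smulRight
            (u y))) y := by
      refine HasFDerivAt.add ?_ ?_
      · exact (ContinuousLinearMap.apply ℝ _ b).hasFDerivAt.comp y hu2.hasFDerivAt
      · exact ((ContinuousLinearMap.apply ℝ ℂ b).hasFDerivAt.comp y hA1.hasFDerivAt).smul
          hu1.hasFDerivAt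
    have hd : DifferentiableAt ℝ (localNabla A u) y :=
      hu2.add ((contDiffOn_smulRight hA hu).differentiableAt_of_isOpen hV hy)
    have h2 := ((ContinuousLinearMap.apply ℝ (E [⋀^Fin k]→L[ℝ] F) b).hasFDerivAt.comp y
      hd.hasFDerivAt).unique h1
    have h3 := congrArg (fun T : E →L[ℝ] E [⋀^Fin k]→L[ℝ] F => T a) h2
    refine h3.trans ?_
    change fderiv ℝ (fderiv ℝ u) y a b + (A y b • fderiv ℝ u y a + fderiv ℝ A y a b • u y) = _
    abel
  have hv : ∀ a b : E, (fderiv ℝ (localNabla A u) y + (A y).smulRight (localNabla A u y)) a b =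
      fderiv ℝ (localNabla A u) y a b + A y a • (fderiv ℝ u y b + A y b • u y) := fun _ _ => rfl
  -- Second derivatives cancel by symmetry, the mixed terms `A ⊗ du` and the products `A v · A w`
  -- cancel in pairs, and only the antisymmetrized derivative of `A` remains.
  rw [hv, hv, hap, hap, hsymm, sub_smul, smul_add, smul_add, smul_comm (A y v) (A y w)]
  abel

/-- The exterior covariant derivative in the directions `M v`. -/
def localTwist (M : E →L[ℝ] E) (A : E → E →L[ℝ] ℂ) (u : E → E [⋀^Fin k]→L[ℝ] F) (y : E) :
    E [⋀^Fin (k + 1)]→L[ℝ] F :=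
  alternatizeUncurryFin (localNabla A u y ∘L M)

/-- Let `d_M` denote `localTwist M`. Then `∂_D` and `∂̄_D` are `(d_1 ∓ i d_J) / 2`, so their
anticommutator is `(d_1² + d_J²) / 2`, the mixed products cancelling. Only the squares of `d_1` and
`d_J` have to be computed. -/
lemma localD_eq (s : ℝ) (A : E → E →L[ℝ] ℂ) (u : E → E [⋀^Fin k]→L[ℝ] F) (y : E) :
    localD s A u y = (1 / 2 : ℂ) • (localTwist (ContinuousLinearMap.id ℝ E) A u y -
      ((s : ℂ) * Complex.I) • localTwist (cplxJ E) A u y) := by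
  rw [localD, typePart, alternatize_smul_complex, alternatize_sub, alternatize_smul_complex]
  rfl

lemma contDiffOn_localTwist {V : Set E} (M : E →L[ℝ] E) (hV : IsOpen V) (hA : ContDiffOn ℝ ∞ A V)
    (hu : ContDiffOn ℝ ∞ u V) : ContDiffOn ℝ ∞ (localTwist M A u) V := by
  have h1 : ContDiffOn ℝ ∞ (fderiv ℝ u) V := hu.fderiv_of_isOpen hV (by simp)
  exact (alternatizeUncurryFinCLM ℝ E F).contDiff.comp_contDiffOn
    ((h1.add (contDiffOn_smulRight hA hu)).clm_comp contDiffOn_const)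

/-- As `M` is constant, it commutes with differentiation, and the usual computation `D² = Θ` goes
through with both arguments of the curvature composed with `M`. -/
lemma localTwist_localTwist {V : Set E} (M : E →L[ℝ] E) (hV : IsOpen V) (hA : ContDiffOn ℝ ∞ A V)
    (hu : ContDiffOn ℝ ∞ u V) (hy : y ∈ V) (β : E [⋀^Fin 2]→L[ℝ] ℂ)
    (hβ : ∀ v w, β ![v, w] = fderiv ℝ A y (M v) (M w) - fderiv ℝ A y (M w) (M v)) :
    localTwist M A (localTwist M A u) y = wedge2 β (u y) := by
  set B0 := fderiv ℝ (localNabla A u) y + (A y).smulRight (localNabla A u y) with hB0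
  rw [← alternatize_alternatize_eq_wedge2 β (u y) (B0.bilinearComp M M) fun v w => by
    rw [hβ, ← localNabla_localNabla_sub hV hA hu hy]; rfl]
  have hd : DifferentiableAt ℝ (localNabla A u) y :=
    ((hu.fderiv_of_isOpen (m := ∞) hV (by simp)).add
      (contDiffOn_smulRight hA hu)).differentiableAt_of_isOpen hV hy
  set C : (E →L[ℝ] E [⋀^Fin k]→L[ℝ] F) →L[ℝ] E [⋀^Fin (k + 1)]→L[ℝ] F :=
    alternatizeUncurryFinCLM ℝ E F ∘L
      (ContinuousLinearMap.compL ℝ E E (E [⋀^Fin k]→L[ℝ] F)).flip M with hC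
  have hf : fderiv ℝ (localTwist M A u) y = C ∘L fderiv ℝ (localNabla A u) y :=
    (C.hasFDerivAt.comp y hd.hasFDerivAt).fderiv
  conv_lhs => rw [localTwist, localNabla, hf]
  congr 1
  ext1 v
  change C (fderiv ℝ (localNabla A u) y (M v)) + A y (M v) • C (localNabla A u y) =
    alternatizeUncurryFin (B0 (M v) ∘L M)
  have h2 : B0 (M v) ∘L M = fderiv ℝ (localNabla A u) y (M v) ∘L M +
      A y (M v) • (localNabla A u y ∘L M) := rfl
  rw [h2, alternatizeUncurryFin_add, alternatize_smul_complex]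
  rfl

lemma localTwist_combination {a b : E → E [⋀^Fin k]→L[ℝ] F} (M : E →L[ℝ] E) (c c' : ℂ)
    (ha : DifferentiableAt ℝ a y) (hb : DifferentiableAt ℝ b y) :
    localTwist M A (fun z => c • (a z - c' • b z)) y =
      c • (localTwist M A a y - c' • localTwist M A b y) := by
  have h : localNabla A (fun z => c • (a z - c' • b z)) y =
      c • (localNabla A a y - c' • localNabla A b y) := by
    have hd : fderiv ℝ (fun z => c • (a z - c' • b z)) y =
        c • (fderiv ℝ a y - c' • fderiv ℝ b y) :=
      ((ha.hasFDerivAt.sub (hb.hasFDerivAt.const_smul c')).const_smul c).fderiv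
    rw [localNabla, hd]
    ext1 v
    change c • (fderiv ℝ a y v - c' • fderiv ℝ b y v) + A y v • c • (a y - c' • b y) =
      c • (fderiv ℝ a y v + A y v • a y - c' • (fderiv ℝ b y v + A y v • b y))
    module
  rw [localTwist, h, localTwist, localTwist, ← alternatize_smul_complex, ← alternatize_sub,
    ← alternatize_smul_complex]
  rfl

lemma extDeriv_oneForm {A : E → E →L[ℝ] ℂ} (hA : DifferentiableAt ℝ A y) (v w : E) :
    extDeriv (fun z => oneForm (A z)) y ![v, w] = fderiv ℝ A y v w - fderiv ℝ A y w v := by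
  set Φ : (E →L[ℝ] ℂ) →L[ℝ] E [⋀^Fin 1]→L[ℝ] ℂ :=
    ((ContinuousAlternatingMap.ofSubsingletonLIE (𝕜 := ℝ) (E := E) (F := ℂ)
      (0 : Fin 1)).toContinuousLinearEquiv : (E →L[ℝ] ℂ) →L[ℝ] E [⋀^Fin 1]→L[ℝ] ℂ) with hΦ
  have h : fderiv ℝ (fun z => oneForm (A z)) y = Φ ∘L fderiv ℝ A y :=
    (Φ.hasFDerivAt.comp y hA.hasFDerivAt).fderiv
  have hΦ' : ∀ (T : E →L[ℝ] ℂ) (m : Fin 1 → E), Φ T m = T (m 0) := fun _ _ => rfl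
  rw [extDeriv, h, alternatizeUncurryFin_apply, Fin.sum_univ_two]
  simp [hΦ', sub_eq_add_neg]
  rfl

/-- The `(1, 1)`-part of the curvature is the anticommutator of `∂` and `∂̄`. -/
lemma localD_anticommutator {V : Set E} (hV : IsOpen V) (hA : ContDiffOn ℝ ∞ A V)
    (hu : ContDiffOn ℝ ∞ u V) (hy : y ∈ V) :
    localD 1 A (localD (-1) A u) y + localD (-1) A (localD 1 A u) y =
      wedge2 (part11 (extDeriv (fun z => oneForm (A z)) y)) (u y) := by
  have hA1 := hA.differentiableAt_of_isOpen hV hy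
  have hd : ∀ M : E →L[ℝ] E, DifferentiableAt ℝ (localTwist M A u) y := fun M =>
    (contDiffOn_localTwist M hV hA hu).differentiableAt_of_isOpen hV hy
  have he : ∀ s : ℝ, localD s A u = fun z => (1 / 2 : ℂ) • (localTwist (ContinuousLinearMap.id ℝ E)
      A u z - ((s : ℂ) * Complex.I) • localTwist (cplxJ E) A u z) := fun s =>
    funext fun z => localD_eq s A u z
  set β := extDeriv (fun z => oneForm (A z)) y with hβ
  have h1 := localTwist_localTwist (ContinuousLinearMap.id ℝ E) hV hA hu hy β fun v w =>
    extDeriv_oneForm hA1 v w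
  have h2 := localTwist_localTwist (cplxJ E) hV hA hu hy (β.compContinuousLinearMap (cplxJ E))
    fun v w => by
      rw [← extDeriv_oneForm hA1, ContinuousAlternatingMap.compContinuousLinearMap_apply]
      congr 1
      funext i
      fin_cases i <;> rfl
  -- After expansion, `d_1²` gives the curvature `β` and `d_J²` its pullback by `J`; their mean is
  -- `part11 β`.
  rw [localD_eq, localD_eq, he, he, localTwist_combination _ _ _ (hd _) (hd _),
    localTwist_combination _ _ _ (hd _) (hd _), localTwist_combination _ _ _ (hd _) (hd _),
    localTwist_combination _ _ _ (hd _) (hd _), h1, h2, part11, wedge2_smul_left, wedge2_add_left]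
  push_cast
  match_scalars <;> first | ring1 | linear_combination (-1 / 2 : ℂ) * Complex.I_sq

end Square

end LocalCommutators

/-! ### The Leibniz rule for products with `1`-forms. -/

noncomputable section LeibnizWedge

open ContinuousAlternatingMap (alternatizeUncurryFin alternatizeUncurryFinCLM
  alternatizeUncurryFin_apply alternatizeUncurryFin_smul alternatizeUncurryFin_add)

variable {E : Type*} [NormedAddCommGroup E] [NormedSpace ℂ E] [FiniteDimensional ℂ E]
  {F : Type*} [NormedAddCommGroup F] [NormedSpace ℂ F] {k : ℕ}
  {A : E → E →L[ℝ] ℂ} {u : E → E [⋀^Fin k]→L[ℝ] F} {y : E}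

lemma wedge1_add_left (θ θ' : E →L[ℝ] ℂ) (w : E [⋀^Fin k]→L[ℝ] F) :
    wedge1 (θ + θ') w = wedge1 θ w + wedge1 θ' w := by
  rw [wedge1, wedge1, wedge1, ← alternatizeUncurryFin_add]
  exact congrArg _ (ContinuousLinearMap.ext fun v => add_smul (θ v) (θ' v) w)

lemma wedge1_smul_left (c : ℂ) (θ : E →L[ℝ] ℂ) (w : E [⋀^Fin k]→L[ℝ] F) :
    wedge1 (c • θ) w = c • wedge1 θ w := by
  rw [wedge1, wedge1, ← alternatize_smul_complex]
  exact congrArg _ (ContinuousLinearMap.ext fun v => mul_smul c (θ v) w)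

lemma wedge1_sub_left (θ θ' : E →L[ℝ] ℂ) (w : E [⋀^Fin k]→L[ℝ] F) :
    wedge1 (θ - θ') w = wedge1 θ w - wedge1 θ' w := by
  rw [sub_eq_add_neg, ← neg_one_smul ℂ θ', wedge1_add_left, wedge1_smul_left, neg_one_smul,
    sub_eq_add_neg]

lemma wedge1_add_right (θ : E →L[ℝ] ℂ) (w w' : E [⋀^Fin k]→L[ℝ] F) :
    wedge1 θ (w + w') = wedge1 θ w + wedge1 θ w' := by
  rw [wedge1, wedge1, wedge1, ← alternatizeUncurryFin_add]
  exact congrArg _ (ContinuousLinearMap.ext fun v => smul_add (θ v) w w')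

lemma wedge1_smul_right (θ : E →L[ℝ] ℂ) (c : ℂ) (w : E [⋀^Fin k]→L[ℝ] F) :
    wedge1 θ (c • w) = c • wedge1 θ w := by
  rw [wedge1, wedge1, ← alternatize_smul_complex]
  exact congrArg _ (ContinuousLinearMap.ext fun v => smul_comm (θ v) c w)

lemma wedge1_sub_right (θ : E →L[ℝ] ℂ) (w w' : E [⋀^Fin k]→L[ℝ] F) :
    wedge1 θ (w - w') = wedge1 θ w - wedge1 θ w' := by
  rw [sub_eq_add_neg, ← neg_one_smul ℂ w', wedge1_add_right, wedge1_smul_right, neg_one_smul,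
    sub_eq_add_neg]

/-- The Leibniz rule for the product with a `1`-form. -/
lemma localD_wedge1 (s : ℝ) {θ : E → E →L[ℝ] ℂ} (hθ : DifferentiableAt ℝ θ y)
    (hu : DifferentiableAt ℝ u y) (β : E [⋀^Fin 2]→L[ℝ] ℂ)
    (hβ : ∀ v w, typePart s (fderiv ℝ θ y) v w - typePart s (fderiv ℝ θ y) w v = β ![v, w]) :
    localD s A (fun z => wedge1 (θ z) (u z)) y =
      wedge2 β (u y) - wedge1 (θ y) (localD s A u y) := by
  set N1 : E →L[ℝ] E [⋀^Fin (k + 1)]→L[ℝ] F := alternatizeUncurryFinCLM ℝ E F ∘L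
    (ContinuousLinearMap.compL ℝ E ℂ (E [⋀^Fin k]→L[ℝ] F) ((ContinuousLinearMap.lsmul ℝ ℂ).flip (u y))) ∘L
      fderiv ℝ θ y with hN1
  set N2 : E →L[ℝ] E [⋀^Fin (k + 1)]→L[ℝ] F := alternatizeUncurryFinCLM ℝ E F ∘L
    (ContinuousLinearMap.compL ℝ E ℂ (E [⋀^Fin k]→L[ℝ] F)).flip (θ y) ∘L (ContinuousLinearMap.lsmul ℝ ℂ).flip ∘L
      (fderiv ℝ u y + (A y).smulRight (u y)) with hN2
  have h1 : ∀ v, N1 v = wedge1 (fderiv ℝ θ y v) (u y) := fun _ => rfl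
  have h2 : ∀ v, N2 v = wedge1 (θ y) ((fderiv ℝ u y + (A y).smulRight (u y)) v) := fun _ => rfl
  have hd : HasFDerivAt (fun z => wedge1 (θ z) (u z)) (alternatizeUncurryFinCLM ℝ E F ∘L
      ((ContinuousLinearMap.compL ℝ E ℂ (E [⋀^Fin k]→L[ℝ] F) ((ContinuousLinearMap.lsmul ℝ ℂ).flip (u y))) ∘L
        fderiv ℝ θ y + (ContinuousLinearMap.compL ℝ E ℂ (E [⋀^Fin k]→L[ℝ] F)).flip (θ y) ∘L
          (ContinuousLinearMap.lsmul ℝ ℂ).flip ∘L fderiv ℝ u y)) y := by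
    refine (alternatizeUncurryFinCLM ℝ E F).hasFDerivAt.comp y
      (((((ContinuousLinearMap.lsmul ℝ ℂ).flip : (E [⋀^Fin k]→L[ℝ] F) →L[ℝ] ℂ →L[ℝ] E [⋀^Fin k]→L[ℝ] F).hasFDerivAt.comp y
        hu.hasFDerivAt).clm_comp hθ.hasFDerivAt).congr_fderiv ?_)
    rfl
  have hN : fderiv ℝ (fun z => wedge1 (θ z) (u z)) y + (A y).smulRight (wedge1 (θ y) (u y)) =
      N1 + N2 := by
    rw [hd.fderiv]
    ext1 v
    rw [add_apply, add_apply, h1, h2, add_apply, wedge1_add_right,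
      ContinuousLinearMap.smulRight_apply, ContinuousLinearMap.smulRight_apply, wedge1_smul_right,
      ← add_assoc]
    rw [ContinuousLinearMap.comp_add, add_apply]
    rfl
  rw [localD, hN, typePart_add, alternatizeUncurryFin_add, sub_eq_add_neg]
  congr 1
  · refine wedge2_alternatize (u y) (typePart s (fderiv ℝ θ y)) hβ fun v => ?_
    rw [typePart_apply, typePart_apply, h1, h1, wedge1_smul_left, wedge1_sub_left,
      wedge1_smul_left]
  · refine alternatize_wedge1 (θ y) (typePart s (fderiv ℝ u y + (A y).smulRight (u y))) fun v => ?_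
    rw [typePart_apply, typePart_apply, h2, h2, wedge1_smul_right, wedge1_sub_right,
      wedge1_smul_right]

/-- The two mixed second derivatives of a function agree. -/
lemma typePart_fderiv_typePart_comm {f : E → ℂ} (hf : ContDiffAt ℝ ∞ f y) (s t : ℝ) (v w : E) :
    typePart s (fderiv ℝ (fun z => typePart t (fderiv ℝ f z)) y) v w =
      typePart t (fderiv ℝ (fun z => typePart s (fderiv ℝ f z)) y) w v := by
  have hf2 : DifferentiableAt ℝ (fderiv ℝ f) y :=
    (hf.fderiv_right (m := 1) (by exact WithTop.coe_le_coe.2 le_top)).differentiableAt (by simp)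
  have hsymm : ∀ a b, fderiv ℝ (fderiv ℝ f) y a b = fderiv ℝ (fderiv ℝ f) y b a := fun a b =>
    (hf.isSymmSndFDerivAt (by
      rw [minSmoothness_of_isRCLikeNormedField]
      exact WithTop.coe_le_coe.2 (le_top : (2 : ℕ∞) ≤ ⊤))) a b
  have h1 : ∀ t a, fderiv ℝ (fun z => typePart t (fderiv ℝ f z)) y a =
      typePart t (fderiv ℝ (fderiv ℝ f) y a) := fun t a =>
    congrArg (fun T : E →L[ℝ] E →L[ℝ] ℂ => T a)
      ((typePartCLM E ℂ t).hasFDerivAt.comp y hf2.hasFDerivAt).fderiv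
  simp only [typePart_apply, h1, sub_apply, smul_apply]
  rw [hsymm w v, hsymm (Complex.I • w) v, hsymm w (Complex.I • v),
    hsymm (Complex.I • w) (Complex.I • v)]
  simp only [smul_eq_mul]
  ring

end LeibnizWedge

/-! ### Global commutation formulas, and vanishing in type `(n, q)`. -/

noncomputable section GlobalCommutators

open Bundle
open ContinuousAlternatingMap (alternatizeUncurryFin alternatizeUncurryFinCLM
  alternatizeUncurryFin_apply alternatizeUncurryFin_smul alternatizeUncurryFin_add)

variable {E : Type*} [NormedAddCommGroup E] [NormedSpace ℂ E] [FiniteDimensional ℂ E]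

lemma IsOfType.smul {F : Type*} [NormedAddCommGroup F] [NormedSpace ℂ F] {k p q : ℕ}
    {u : E [⋀^Fin k]→L[ℝ] F} (hu : IsOfType p q u) (a : ℂ) : IsOfType p q (a • u) :=
  ⟨hu.1, fun c v => by
    rw [ContinuousAlternatingMap.smul_apply, ContinuousAlternatingMap.smul_apply, hu.2,
      smul_comm]⟩

lemma IsOfType.add {F : Type*} [NormedAddCommGroup F] [NormedSpace ℂ F] {k p q : ℕ}
    {u v : E [⋀^Fin k]→L[ℝ] F} (hu : IsOfType p q u) (hv : IsOfType p q v) :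
    IsOfType p q (u + v) :=
  ⟨hu.1, fun c m => by
    rw [ContinuousAlternatingMap.add_apply, ContinuousAlternatingMap.add_apply, hu.2, hv.2,
      smul_add]⟩

/-- Derivatives of forms of type `(p, q)` are of type `(p, q)`. -/
lemma isOfType_fderiv {k p q : ℕ} {u : E → E [⋀^Fin k]→L[ℝ] ℂ} {y : E}
    (hd : DifferentiableAt ℝ u y) (hu : ∀ᶠ z in nhds y, IsOfType p q (u z)) (a : E) :
    IsOfType p q (fderiv ℝ u y a) := by
  refine ⟨hu.self_of_nhds.1, fun c m => ?_⟩
  have h : ∀ m : Fin k → E, HasFDerivAt (fun z => u z m)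
      (ContinuousAlternatingMap.apply ℝ E ℂ m ∘L fderiv ℝ u y) y := fun m =>
    (ContinuousAlternatingMap.apply ℝ E ℂ m).hasFDerivAt.comp y hd.hasFDerivAt
  have h1 := (h fun i => c • m i).congr_of_eventuallyEq
    (f₁ := fun z => (c ^ p * (starRingEnd ℂ c) ^ q) • u z m)
    (hu.mono fun z hz => (hz.2 c m).symm)
  exact congrArg (fun T : E →L[ℝ] ℂ => T a) (h1.unique ((h m).fun_const_smul _))

lemma localD_zero {F : Type*} [NormedAddCommGroup F] [NormedSpace ℂ F] {k : ℕ} (s : ℝ)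
    (A : E → E →L[ℝ] ℂ) (y : E) : localD s A (0 : E → E [⋀^Fin k]→L[ℝ] F) y = 0 := by
  have h := localD_const_smul (s := s) (A := A) (y := y) (u := (0 : E → E [⋀^Fin k]→L[ℝ] F)) 0
    (differentiableAt_const 0)
  rw [zero_smul] at h
  have h0 : (fun z : E => (0 : ℂ) • (0 : E → E [⋀^Fin k]→L[ℝ] F) z) = 0 :=
    funext fun z => smul_zero _
  exact h0 ▸ h

variable {X : Type*} [TopologicalSpace X] [ChartedSpace E X] [IsManifold 𝓘(ℂ, E) ω X]
  {L : X → Type*} [∀ x, NormedAddCommGroup (L x)] [∀ x, InnerProductSpace ℂ (L x)]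

/-- The adjoint of `∂̄f ∧ ·` is `i [Λ, ∂f ∧ ·]`. -/
lemma Form.wedge1Adjoint_dbarFun {g : TangentMetric E X} (hg : IsHermitian g) (f : X → ℝ)
    (w : Form E L) : wedge1Adjoint g (typedFun (-1) f) w =
      Complex.I • (Lambda g (wedge1 (typedFun 1 f) w) - wedge1 (typedFun 1 f) (Lambda g w)) := by
  funext k x
  have hf := isOrthonormalFrame_frame g x
  have hr : ∀ a, (starRingEnd ℂ) ((dFun f x : E →L[ℝ] ℂ) a) =
      (dFun f x : E →L[ℝ] ℂ) a := fun a => Complex.conj_ofReal _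
  -- Since `f` is real, the conjugate of `∂̄f` is `∂f`.
  have hθ : ∀ a, (starRingEnd ℂ) ((typedFun (-1) f x : E →L[ℝ] ℂ) a) =
      (typedFun 1 f x : E →L[ℝ] ℂ) a := fun a => by
    rw [typedFun, typedFun, typePart_apply, typePart_apply]
    simp only [smul_eq_mul, map_mul, map_sub, hr, Complex.conj_I, Complex.conj_ofReal, map_div₀,
      map_one, Complex.conj_ofNat]
    push_cast
    ring
  have hJ : ∀ a, (typedFun 1 f x : E →L[ℝ] ℂ) (cplxJ E a) =
      Complex.I * (typedFun 1 f x : E →L[ℝ] ℂ) a := fun a => by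
    rw [typedFun, typePart_one, cplxJ_apply, part10_apply_smul, smul_eq_mul]
  set θ : E →L[ℝ] ℂ := typedFun 1 f x with hθd
  -- The commutator of `Λ` with `∂f ∧ ·` is this trace. Moving `J` onto `∂f`, which is complex
  -- linear, turns it into the factor `-i`.
  have hsum : ∑ a, contr (cplxJ E (frame g x a)) ((θ.smulRight (w (k + 1) x)) (frame g x a)) =
      -(Complex.I • wedge1Adjoint g (typedFun (-1) f) w k x) := by
    have h1 := hf.sum_cplxJ_left (metricAt_symm g x) (hg x)
      ((contrBilin (θ.smulRight (w (k + 1) x))))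
    simp only [contrBilin, LinearMap.mk₂_apply] at h1
    rw [← neg_eq_iff_eq_neg, ← h1, wedge1Adjoint, Finset.smul_sum]
    refine Finset.sum_congr rfl fun a _ => ?_
    rw [ContinuousLinearMap.smulRight_apply, hJ, contr_smul, hθ, smul_smul, contr_apply]
  have hmain : Lambda g (wedge1 (typedFun 1 f) w) k x - wedge1 (typedFun 1 f) (Lambda g w) k x =
      -(Complex.I • wedge1Adjoint g (typedFun (-1) f) w k x) := by
    rw [← hsum, Lambda_apply hg]
    cases k with
    | zero =>
      rw [← hf.lamFrame_alternatize_one (metricAt_symm g x) (hg x)]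
      exact sub_zero _
    | succ k =>
      rw [← hf.lamFrame_alternatize (metricAt_symm g x) (hg x)]
      congr 1
      change alternatizeUncurryFin (θ.smulRight (Lambda g w k x)) = _
      rw [Lambda_apply hg]
      congr 1
      refine ContinuousLinearMap.ext fun a => ?_
      exact (lamFrame_smul _ (θ a) (w (k + 2) x)).symm
  rw [Pi.smul_apply, Pi.smul_apply, Pi.sub_apply, Pi.sub_apply, hmain, smul_neg, smul_smul,
    Complex.I_mul_I, neg_one_smul, neg_neg]

section Bidegree

/-- `∂f ∧ ·` vanishes on forms of type `(n, q)`. -/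
lemma Form.IsBidegree.wedge1_eq_zero {q : ℕ} {v : Form E L}
    (hv : v.IsBidegree (Module.finrank ℂ E) q) (f : X → ℝ) :
    wedge1 (typedFun (E := E) 1 f) v = 0 := by
  funext k x
  cases k with
  | zero => rfl
  | succ k =>
    by_cases hk : k = Module.finrank ℂ E + q
    · subst hk
      have h := isOfType_alternatize_part10 ((dFun f x : E →L[ℝ] ℂ).smulRight (v _ x))
        fun a => (hv.2 x).smul ((dFun f x : E →L[ℝ] ℂ) a)
      have h2 : (typedFun 1 f x : E →L[ℝ] ℂ) = part10 (dFun f x) := typePart_one _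
      have h3 : (part10 (dFun f x : E →L[ℝ] ℂ)).smulRight (v (Module.finrank ℂ E + q) x) =
          part10 ((dFun f x : E →L[ℝ] ℂ).smulRight (v (Module.finrank ℂ E + q) x)) := by
        refine ContinuousLinearMap.ext fun a => ?_
        rw [← typePart_one, ← typePart_one, ContinuousLinearMap.smulRight_apply, typePart_apply,
          typePart_apply, ContinuousLinearMap.smulRight_apply, ContinuousLinearMap.smulRight_apply]
        module
      rw [wedge1, TwistedBKN.wedge1, h2, h3]
      -- The product would have type `(n + 1, q)`.
      exact h.eq_zero (Nat.lt_succ_self _)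
    · rw [wedge1, hv.1 k hk]
      rw [Pi.zero_apply, ← zero_smul ℂ (0 : E [⋀^Fin k]→L[ℝ] L x), wedge1_smul_right, zero_smul]
      rfl

end Bidegree

variable [TopologicalSpace (Bundle.TotalSpace ℂ L)] [FiberBundle ℂ L] [VectorBundle ℂ ℂ L]

lemma chartPull_self_apply {k : ℕ} (x : X) (w : E [⋀^Fin k]→L[ℝ] L x) (m : Fin k → E) :
    chartPull x x w m = fiberCoord x x (w m) := by
  rw [chartPull_apply, fromChart_self]
  rfl

lemma chartPull_wedge2 {k : ℕ} (x : X) (β : E [⋀^Fin 2]→L[ℝ] ℂ) (w : E [⋀^Fin k]→L[ℝ] L x) :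
    chartPull x x (wedge2 β w) = wedge2 β (chartPull x x w) := by
  ext m
  simp only [chartPull_self_apply, wedge2_apply, continuousLinearMapAt_smul, map_sum, map_zsmul]

lemma Form.inChart_self (u : Form E L) (k : ℕ) (x : X) :
    u.inChart k x (chartAt E x x) = chartPull x x (u k x) := by
  rw [inChart_eq_chartPull, (chartAt E x).left_inv (mem_chart_source E x)]

lemma Form.inChart_wedge2 (β : ScalarForm E X 2) (w : Form E L) (k : ℕ) (x : X) :
    (wedge2 β w).inChart (k + 2) x (chartAt E x x) =
      TwistedBKN.wedge2 (β x) (w.inChart k x (chartAt E x x)) := by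
  rw [inChart_self, inChart_self]
  exact chartPull_wedge2 x (β x) (w k x)

variable [ContMDiffVectorBundle ∞ ℂ L 𝓘(ℝ, E)] {D : CovariantDerivative 𝓘(ℝ, E) ℂ L}

/-- `∂_D ∂̄_D + ∂̄_D ∂_D` is the product with the `(1, 1)`-part of the curvature. -/
lemma typedD_anticommutator [T2Space X] (hD : IsHermitianConnection D) {w : Form E L}
    (hw : w.IsSmooth) : typedD D 1 (typedD D (-1) w) + typedD D (-1) (typedD D 1 w) =
      Form.wedge2 (fun x => part11 (curvature D x)) w := by
  refine Form.ext_inChart fun k x => ?_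
  have hy := mem_localDomain_self (E := E) (L := L) x
  rw [Form.inChart_add]
  match k with
  | 0 =>
    simp only [Form.inChart_zero (k := 0) (u := typedD D _ _) rfl,
      Form.inChart_zero (k := 0) (u := Form.wedge2 _ w) rfl, Pi.zero_apply, add_zero]
  -- The inner derivatives have no component of degree zero, and the product with a `2`-form has
  -- none of degree one.
  | 1 =>
    rw [typedD_inChart hD 1 (hw.typedD hD _) 0 hy, typedD_inChart hD (-1) (hw.typedD hD _) 0 hy,
      Form.inChart_zero (k := 0) rfl, Form.inChart_zero (k := 0) rfl,
      Form.inChart_zero (k := 1) (u := Form.wedge2 _ w) rfl, localD_zero, localD_zero, add_zero]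
    rfl
  | k + 2 =>
    have hev : ∀ s, (typedD D s w).inChart (k + 1) x =ᶠ[nhds (chartAt E x x)]
        localD s (connectionForm D x) (w.inChart k x) := fun s => by
      filter_upwards [(isOpen_localDomain x).mem_nhds hy] with z hz using
        typedD_inChart hD s hw k hz
    rw [typedD_inChart hD 1 (hw.typedD hD _) _ hy, typedD_inChart hD (-1) (hw.typedD hD _) _ hy,
      localD_congr (hev _), localD_congr (hev _), localD_anticommutator (isOpen_localDomain x)
        (contDiffOn_connectionForm hD x) (hw k x) hy, Form.inChart_wedge2]
    rfl

/-- Written as an antisymmetrized second derivative, `∂∂̄f` has the shape that the Leibniz rule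
`localD_wedge1` asks for. -/
lemma delDbar_apply {f : X → ℝ} (hf : ContMDiff 𝓘(ℝ, E) 𝓘(ℝ, ℝ) ∞ f) (x : X) (v w : E) :
    delDbar f x ![v, w] =
      typePart 1 (fderiv ℝ (fun z => typePart (-1)
        (fderiv ℝ (fun y => ((f ((chartAt E x).symm y) : ℝ) : ℂ)) z)) (chartAt E x x)) v w -
      typePart 1 (fderiv ℝ (fun z => typePart (-1)
        (fderiv ℝ (fun y => ((f ((chartAt E x).symm y) : ℝ) : ℂ)) z)) (chartAt E x x)) w v := by
  set F : E → ℂ := fun y => ((f ((chartAt E x).symm y) : ℝ) : ℂ) with hF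
  have hev : ScalarForm.inChart (fun x => oneForm (dbarFun f x)) x =ᶠ[nhds (chartAt E x x)]
      fun z => oneForm (typePart (-1) (fderiv ℝ F z)) := by
    filter_upwards [(chartAt E x).open_target.mem_nhds (mem_chart_target E x)] with z hz
    rw [← typedFun_comp_fromChart (-1) hf hz, typedFun_neg_one]
    rfl
  have hFs := contDiffOn_comp_chart_symm hf x
  have hd : DifferentiableAt ℝ (fun z => typePart (-1) (fderiv ℝ F z)) (chartAt E x x) :=
    ((typePartCLM E ℂ (-1)).contDiff.comp_contDiffOn (hFs.fderiv_of_isOpen (m := ∞)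
      (chartAt E x).open_target (by simp))).differentiableAt_of_isOpen (chartAt E x).open_target
        (mem_chart_target E x)
  set Φ : (E →L[ℝ] ℂ) →L[ℝ] E [⋀^Fin 1]→L[ℝ] ℂ :=
    ((ContinuousAlternatingMap.ofSubsingletonLIE (𝕜 := ℝ) (E := E) (F := ℂ)
      (0 : Fin 1)).toContinuousLinearEquiv : (E →L[ℝ] ℂ) →L[ℝ] E [⋀^Fin 1]→L[ℝ] ℂ) with hΦ
  have h : fderiv ℝ (fun z => oneForm (typePart (-1) (fderiv ℝ F z))) (chartAt E x x) =
      Φ ∘L fderiv ℝ (fun z => typePart (-1) (fderiv ℝ F z)) (chartAt E x x) :=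
    (Φ.hasFDerivAt.comp _ hd.hasFDerivAt).fderiv
  rw [delDbar, ScalarForm.del, hev.fderiv_eq, h, ← typePart_one, alternatizeUncurryFin_apply,
    Fin.sum_univ_two]
  set T := fderiv ℝ (fun z => typePart (-1) (fderiv ℝ F z)) (chartAt E x x)
  have hT : ∀ (a : E) (m : Fin 1 → E), typePart 1 (Φ ∘L T) a m = typePart 1 T a (m 0) :=
    fun _ _ => rfl
  simp [hT, sub_eq_add_neg]
  rfl

/-- The Leibniz rule for `∂̄_D (∂f ∧ ·)`. -/
lemma typedD_wedge1 [T2Space X] (hD : IsHermitianConnection D) {f : X → ℝ}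
    (hf : ContMDiff 𝓘(ℝ, E) 𝓘(ℝ, ℝ) ∞ f) {w : Form E L} (hw : w.IsSmooth) :
    typedD D (-1) (Form.wedge1 (typedFun 1 f) w) =
      -Form.wedge2 (delDbar f) w - Form.wedge1 (typedFun 1 f) (typedD D (-1) w) := by
  refine Form.ext_inChart fun k x => ?_
  have hy := mem_localDomain_self (E := E) (L := L) x
  rw [Form.inChart_sub, ← neg_one_smul ℂ (Form.wedge2 _ w), Form.inChart_smul]
  match k with
  | 0 =>
    simp only [Form.inChart_zero (k := 0) (u := typedD D _ _) rfl,
      Form.inChart_zero (k := 0) (u := Form.wedge1 _ (typedD D _ _)) rfl,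
      Form.inChart_zero (k := 0) (u := Form.wedge2 _ w) rfl, Pi.zero_apply, smul_zero, sub_zero]
  | 1 =>
    rw [typedD_inChart hD (-1) (hw.wedge1_typedFun 1 hf) 0 hy,
      Form.inChart_wedge1_typedFun 1 hf _ _ hy.1,
      Form.inChart_zero (k := 0) (u := typedD D _ _) rfl,
      Form.inChart_zero (k := 0) (u := Form.wedge1 _ _) rfl,
      Form.inChart_zero (k := 1) (u := Form.wedge2 _ w) rfl, localD_zero, Pi.zero_apply,
      smul_zero, zero_sub, Pi.zero_apply, ← zero_smul ℂ (0 : E [⋀^Fin 0]→L[ℝ] ℂ),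
      wedge1_smul_right, zero_smul, neg_zero]
  | k + 2 =>
    have hFs := contDiffOn_comp_chart_symm hf x
    set F : E → ℂ := fun y => ((f ((chartAt E x).symm y) : ℝ) : ℂ) with hF
    have hev : (Form.wedge1 (typedFun 1 f) w).inChart (k + 1) x =ᶠ[nhds (chartAt E x x)]
        fun z => wedge1 (typePart 1 (fderiv ℝ F z)) (w.inChart k x z) := by
      filter_upwards [(chartAt E x).open_target.mem_nhds hy.1] with z hz using
        Form.inChart_wedge1_typedFun 1 hf w k hz
    have hd : DifferentiableAt ℝ (fun z => typePart 1 (fderiv ℝ F z)) (chartAt E x x) :=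
      ((typePartCLM E ℂ 1).contDiff.comp_contDiffOn (hFs.fderiv_of_isOpen (m := ∞)
        (chartAt E x).open_target (by simp))).differentiableAt_of_isOpen (chartAt E x).open_target
          hy.1
    have hFa : ContDiffAt ℝ ∞ F (chartAt E x x) :=
      (hFs _ hy.1).contDiffAt ((chartAt E x).open_target.mem_nhds hy.1)
    -- The `2`-form of the Leibniz rule is `∂̄∂f`, which equals `-∂∂̄f` because the mixed second
    -- derivatives of `f` agree.
    rw [typedD_inChart hD (-1) (hw.wedge1_typedFun 1 hf) _ hy, localD_congr hev,
      localD_wedge1 (-1) hd (hw.differentiableAt k hy) ((-1 : ℂ) • delDbar f x) fun v' w' => by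
        rw [ContinuousAlternatingMap.smul_apply, delDbar_apply hf,
          typePart_fderiv_typePart_comm hFa (-1) 1 v' w',
          typePart_fderiv_typePart_comm hFa (-1) 1 w' v', neg_one_smul]
        ring,
      Form.inChart_wedge1_typedFun 1 hf _ _ hy.1, typedD_inChart hD (-1) hw k hy,
      Form.inChart_wedge2, wedge2_smul_left]

/-- `∂_D` vanishes on forms of type `(n, q)`. -/
lemma Form.IsBidegree.typedD_eq_zero {q : ℕ} {v : Form E L}
    (hv : v.IsBidegree (Module.finrank ℂ E) q) (hvs : v.IsSmooth) : typedD D 1 v = 0 := by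
  funext k x
  cases k with
  | zero => rfl
  | succ k =>
    suffices h : alternatizeUncurryFin (part10 (localDeriv D v k x)) = 0 by
      rw [typedD, typePart_one, h]
      ext m
      simp [toFiber]
    by_cases hk : k = Module.finrank ℂ E + q
    · subst hk
      refine (isOfType_alternatize_part10 (localDeriv D v _ x) (q := q) fun a => ?_).eq_zero
        (Nat.lt_succ_self _)
      -- Tangent maps of holomorphic charts are complex linear, so local expressions keep the type
      -- at all nearby points, and their derivatives inherit it.
      have hev : ∀ z ∈ localDomain E L x,
          IsOfType (Module.finrank ℂ E) q (v.inChart (Module.finrank ℂ E + q) x z) :=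
        fun z hz => ⟨rfl, fun c m => by
          have hx := (chartAt E x).map_target hz.1
          have hc : ∀ a : E, (fromChart x ((chartAt E x).symm z) : E →L[ℝ] E) (c • a) =
              c • (fromChart x ((chartAt E x).symm z) : E →L[ℝ] E) a := fun a => by
            have h1 := fromChart_cplxJ hx a
            rw [cplxJ_apply, cplxJ_apply] at h1
            conv_lhs => rw [← Complex.re_add_im c]
            conv_rhs => rw [← Complex.re_add_im c]
            rw [add_smul, map_add, add_smul, mul_smul, mul_smul, Complex.coe_smul, Complex.coe_smul,
              map_smul, map_smul, h1, Complex.coe_smul, Complex.coe_smul]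
          rw [inChart_apply, inChart_apply]
          simp only [hc]
          rw [(hv.2 _).2, continuousLinearMapAt_smul]⟩
      exact (isOfType_fderiv (hvs.differentiableAt _ (mem_localDomain_self x))
        (Filter.eventually_of_mem ((isOpen_localDomain x).mem_nhds (mem_localDomain_self x)) hev)
          a).add ((hev _ (mem_localDomain_self x)).smul _)
    · have hz : localDeriv D v k x = 0 := by
        rw [localDeriv, Form.inChart_zero (hv.1 k hk)]
        ext
        simp
      rw [hz, ← typePart_one]
      ext m
      simp [typePart, alternatizeUncurryFin_apply]

end GlobalCommutators

/-! ### The commutators with `Λ` and the twisted identity. -/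

noncomputable section CommutatorIdentities

open ContinuousAlternatingMap (alternatizeUncurryFin)

variable {E : Type*} [NormedAddCommGroup E] [NormedSpace ℂ E] [FiniteDimensional ℂ E]
  {X : Type*} [TopologicalSpace X] [ChartedSpace E X] [IsManifold 𝓘(ℂ, E) ω X]
  {L : X → Type*} [∀ x, NormedAddCommGroup (L x)] [∀ x, InnerProductSpace ℂ (L x)]

lemma Form.wedge2_sub_fun (β β' : ScalarForm E X 2) (w : Form E L) :
    wedge2 (fun x => β x - β' x) w = wedge2 β w - wedge2 β' w := by
  funext k x
  match k with
  | 0 => exact (sub_zero _).symm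
  | 1 => exact (sub_zero _).symm
  | k + 2 =>
    change TwistedBKN.wedge2 (β x - β' x) (w k x) =
      TwistedBKN.wedge2 (β x) (w k x) - TwistedBKN.wedge2 (β' x) (w k x)
    rw [sub_eq_add_neg, ← neg_one_smul ℂ (β' x), wedge2_add_left, wedge2_smul_left, neg_one_smul,
      sub_eq_add_neg]

lemma Form.wedge2_smul_fun (c : ℂ) (β : ScalarForm E X 2) (w : Form E L) :
    wedge2 (fun x => c • β x) w = c • wedge2 β w := by
  funext k x
  match k with
  | 0 => exact (smul_zero c).symm
  | 1 => exact (smul_zero c).symm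
  | k + 2 => exact wedge2_smul_left c (β x) (w k x)

lemma Form.wedge2_mulFun_fun (f : X → ℝ) (β : ScalarForm E X 2) (w : Form E L) :
    wedge2 (fun x => (f x : ℂ) • β x) w = (wedge2 β w).mulFun f := by
  funext k x
  match k with
  | 0 => exact (smul_zero (f x : ℂ)).symm
  | 1 => exact (smul_zero (f x : ℂ)).symm
  | k + 2 => exact wedge2_smul_left (f x : ℂ) (β x) (w k x)

lemma oneForm_apply (θ : E →L[ℝ] ℂ) (m : Fin 1 → E) : oneForm θ m = θ (m 0) := rfl

lemma Form.wedge2_delWedgeDbar (f : X → ℝ) (w : Form E L) :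
    wedge2 (delWedgeDbar f) w = wedge1 (typedFun 1 f) (wedge1 (typedFun (-1) f) w) := by
  funext k x
  match k with
  | 0 => rfl
  | 1 =>
    change (0 : E [⋀^Fin 1]→L[ℝ] L x) = TwistedBKN.wedge1 _ (0 : E [⋀^Fin 0]→L[ℝ] L x)
    rw [← zero_smul ℂ (0 : E [⋀^Fin 0]→L[ℝ] L x), wedge1_smul_right, zero_smul]
  | k + 2 =>
    rw [typedFun_one, typedFun_neg_one]
    symm
    change alternatizeUncurryFin _ = TwistedBKN.wedge2 _ _
    refine wedge2_alternatize (w k x)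
      ((delFun f x : E →L[ℝ] ℂ).smulRight (dbarFun f x : E →L[ℝ] ℂ)) (fun a b => ?_) fun a => ?_
    · rw [delWedgeDbar, TwistedBKN.wedge1,
        ContinuousAlternatingMap.alternatizeUncurryFin_apply, Fin.sum_univ_two]
      simp [oneForm_apply, Fin.removeNth, sub_eq_add_neg]
    · rw [ContinuousLinearMap.smulRight_apply, ContinuousLinearMap.smulRight_apply,
        wedge1_smul_left]
      rfl

/-- Products with `1`-forms anticommute. -/
lemma Form.wedge1_wedge1 (θ θ' : X → E →L[ℝ] ℂ) (w : Form E L) :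
    wedge1 θ (wedge1 θ' w) = -wedge1 θ' (wedge1 θ w) := by
  funext k x
  match k with
  | 0 => exact neg_zero.symm
  | 1 =>
    change TwistedBKN.wedge1 _ (0 : E [⋀^Fin 0]→L[ℝ] L x) =
      -TwistedBKN.wedge1 _ (0 : E [⋀^Fin 0]→L[ℝ] L x)
    rw [← zero_smul ℂ (0 : E [⋀^Fin 0]→L[ℝ] L x), wedge1_smul_right, wedge1_smul_right, zero_smul,
      zero_smul, neg_zero]
  | k + 2 =>
    refine alternatize_wedge1 (θ' x) ((θ x).smulRight (w k x)) fun a => ?_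
    rw [ContinuousLinearMap.smulRight_apply, ContinuousLinearMap.smulRight_apply,
      wedge1_smul_right]
    rfl

lemma Form.wedge1_zero (θ : X → E →L[ℝ] ℂ) : wedge1 θ (0 : Form E L) = 0 := by
  simpa only [zero_smul] using wedge1_smul θ 0 (0 : Form E L)

lemma Form.Lambda_zero {g : TangentMetric E X} (hg : IsHermitian g) :
    Lambda g (0 : Form E L) = 0 := by
  simpa only [zero_smul] using Lambda_smul hg 0 (0 : Form E L)

lemma Form.mulFun_zero (f : X → ℝ) : mulFun f (0 : Form E L) = 0 := by
  simpa only [zero_smul] using mulFun_smul f 0 (0 : Form E L)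

/-- The commutator of `i ∂f ∧ ∂̄f` with `Λ`, on forms killed by `∂f`. -/
lemma Form.commLambda_delWedgeDbar {g : TangentMetric E X} (hg : IsHermitian g) (f : X → ℝ)
    {v : Form E L} (hv : wedge1 (typedFun (E := E) 1 f) v = 0) :
    Complex.I • commLambda g (delWedgeDbar f) v =
      wedge1 (typedFun (-1) f) (wedge1Adjoint g (typedFun (-1) f) v) := by
  -- The term with `Λ` outermost dies after `∂f` is moved next to `v`. In the other one, moving
  -- `∂̄f` to the front leaves `-i ∂f ∧ Λ v`, which is the adjoint of `∂̄f ∧ ·` on `v`, as `∂f ∧ v =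
  -- 0`.
  rw [commLambda, wedge2_delWedgeDbar, wedge2_delWedgeDbar, wedge1_wedge1 _ _ v, hv, wedge1_zero,
    neg_zero, Lambda_zero hg, sub_zero, wedge1Adjoint_dbarFun hg, hv, Lambda_zero hg,
    wedge1_wedge1, wedge1_smul, Form.wedge1_sub, wedge1_zero, zero_sub]

variable [TopologicalSpace (Bundle.TotalSpace ℂ L)] [FiberBundle ℂ L] [VectorBundle ℂ ℂ L]

lemma Form.wedge2_twistedCurvature (D : CovariantDerivative 𝓘(ℝ, E) ℂ L) (η : X → ℝ)
    (w : Form E L) : wedge2 (twistedCurvature D η) w =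
      Complex.I • (wedge2 (fun x => part11 (curvature D x)) w).mulFun η -
        Complex.I • wedge2 (delDbar η) w := by
  rw [← wedge2_mulFun_fun, ← wedge2_smul_fun, ← wedge2_smul_fun, ← wedge2_sub_fun]
  congr 1
  funext x
  rw [twistedCurvature, smul_comm]

lemma Form.commLambda_twistedCurvature₂ {g : TangentMetric E X} (hg : IsHermitian g)
    (D : CovariantDerivative 𝓘(ℝ, E) ℂ L) (η lam : X → ℝ) (w : Form E L) :
    commLambda g (twistedCurvature₂ D η lam) w = commLambda g (twistedCurvature D η) w -
      (Complex.I • commLambda g (delWedgeDbar η) w).mulFun fun x => (lam x)⁻¹ := by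
  have h : ∀ u : Form E L, wedge2 (twistedCurvature₂ D η lam) u = wedge2 (twistedCurvature D η) u -
      (Complex.I • wedge2 (delWedgeDbar η) u).mulFun fun x => (lam x)⁻¹ := fun u => by
    rw [← wedge2_smul_fun, ← wedge2_mulFun_fun, ← wedge2_sub_fun]
    congr 1
    funext x
    rw [twistedCurvature₂, Complex.ofReal_inv]
  rw [commLambda, commLambda, commLambda, h, h, Lambda_sub hg, Lambda_mulFun hg, Lambda_smul hg,
    smul_sub, Form.mulFun_sub]
  abel

variable [ContMDiffVectorBundle ∞ ℂ L 𝓘(ℝ, E)] {D : CovariantDerivative 𝓘(ℝ, E) ℂ L} [T2Space X]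
  {g : TangentMetric E X}

/-- The twisted Bochner–Kodaira–Nakano identity for forms killed by `∂_D` and by `∂η`. -/
lemma twistedBochnerKodairaNakano (hg : IsHermitian g) (hD : IsHermitianConnection D) {η : X → ℝ}
    (hη : ContMDiff 𝓘(ℝ, E) 𝓘(ℝ, ℝ) ∞ η) {v : Form E L} (hv : v.IsSmooth)
    (hdv : typedD D 1 v = 0) (hηv : Form.wedge1 (typedFun (E := E) 1 η) v = 0) :
    typedD D (-1) ((codiff D g (-1) v).mulFun η) + codiff D g (-1) ((typedD D (-1) v).mulFun η) =
      typedD D 1 ((codiff D g 1 v).mulFun η) + codiff D g 1 ((typedD D 1 v).mulFun η) +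
        Form.commLambda g (twistedCurvature D η) v +
        Form.wedge1 (typedFun (-1) η) (codiff D g (-1) v) +
        typedD D (-1) (Form.wedge1Adjoint g (typedFun (-1) η) v) := by
  have hΛ := hv.Lambda hg
  have hdb := hv.typedD hD (-1)
  have hz : ∀ s, typedD D s (0 : Form E L) = 0 := fun s => by
    have h := typedD_smul (s := s) hD 0 hv
    rwa [zero_smul, zero_smul] at h
  -- As `∂_D v = 0`, one half of the commutator disappears and `∂̄_D^⋆ v = i ∂_D Λ v`.
  have hδ'' : codiff D g (-1) v = Complex.I • typedD D 1 (Form.Lambda g v) := by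
    rw [codiff, neg_neg, hdv, Form.Lambda_zero hg, zero_sub]
    push_cast
    module
  have hδ' : codiff D g 1 v = Complex.I • (Form.Lambda g (typedD D (-1) v) -
      typedD D (-1) (Form.Lambda g v)) := by
    rw [codiff]
    push_cast
    module
  have hcurv := typedD_anticommutator hD hΛ
  have hcurv' := typedD_anticommutator hD hv
  rw [hdv, hz, add_zero] at hcurv'
  have hlb := typedD_wedge1 hD hη hΛ
  have hlb' := typedD_wedge1 hD hη hv
  rw [hηv, hz] at hlb'
  -- Applying `∂̄_D` to `∂η ∧ v = 0` converts `∂∂̄η ∧ v` into a first order term, which can be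
  -- compared with those of the Laplacians.
  have hw2 : Form.wedge2 (delDbar η) v = -Form.wedge1 (typedFun 1 η) (typedD D (-1) v) := by
    rw [eq_comm, sub_eq_zero] at hlb'
    rw [← hlb', neg_neg]
  have e1 : typedD D (-1) ((codiff D g (-1) v).mulFun η) =
      Complex.I • ((typedD D (-1) (typedD D 1 (Form.Lambda g v))).mulFun η +
        Form.wedge1 (typedFun (-1) η) (typedD D 1 (Form.Lambda g v))) := by
    rw [hδ'', Form.mulFun_smul, typedD_smul hD _ ((hΛ.typedD hD 1).mulFun hη),
      typedD_mulFun hD hη (hΛ.typedD hD 1)]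
  have e2 : codiff D g (-1) ((typedD D (-1) v).mulFun η) =
      (-Complex.I) • ((Form.Lambda g (typedD D 1 (typedD D (-1) v))).mulFun η +
        Form.Lambda g (Form.wedge1 (typedFun 1 η) (typedD D (-1) v)) -
        ((typedD D 1 (Form.Lambda g (typedD D (-1) v))).mulFun η +
          Form.wedge1 (typedFun 1 η) (Form.Lambda g (typedD D (-1) v)))) := by
    rw [codiff, neg_neg, typedD_mulFun hD hη hdb, Form.Lambda_add hg, Form.Lambda_mulFun hg,
      Form.Lambda_mulFun hg, typedD_mulFun hD hη (hdb.Lambda hg)]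
    push_cast
    module
  have e3 : typedD D 1 ((codiff D g 1 v).mulFun η) =
      Complex.I • ((typedD D 1 (Form.Lambda g (typedD D (-1) v))).mulFun η +
          Form.wedge1 (typedFun 1 η) (Form.Lambda g (typedD D (-1) v)) -
        ((typedD D 1 (typedD D (-1) (Form.Lambda g v))).mulFun η +
          Form.wedge1 (typedFun 1 η) (typedD D (-1) (Form.Lambda g v)))) := by
    rw [hδ', Form.mulFun_smul, Form.mulFun_sub,
      typedD_smul hD _ (((hdb.Lambda hg).mulFun hη).sub ((hΛ.typedD hD (-1)).mulFun hη)),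
      typedD_sub hD ((hdb.Lambda hg).mulFun hη) ((hΛ.typedD hD (-1)).mulFun hη),
      typedD_mulFun hD hη (hdb.Lambda hg), typedD_mulFun hD hη (hΛ.typedD hD (-1))]
  have e4 : codiff D g 1 ((typedD D 1 v).mulFun η) = 0 := by
    rw [hdv, Form.mulFun_zero, codiff, hz, Form.Lambda_zero hg, hz, sub_zero, smul_zero]
  have e5 : typedD D (-1) (Form.wedge1Adjoint g (typedFun (-1) η) v) =
      Complex.I • (Form.wedge2 (delDbar η) (Form.Lambda g v) +
        Form.wedge1 (typedFun 1 η) (typedD D (-1) (Form.Lambda g v))) := by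
    rw [Form.wedge1Adjoint_dbarFun hg, hηv, Form.Lambda_zero hg, zero_sub,
      ← neg_one_smul ℂ (Form.wedge1 _ _), smul_smul,
      typedD_smul hD _ (hΛ.wedge1_typedFun 1 hη), hlb]
    module
  have e6 : Form.commLambda g (twistedCurvature D η) v =
      Complex.I • ((typedD D 1 (typedD D (-1) (Form.Lambda g v))).mulFun η +
          (typedD D (-1) (typedD D 1 (Form.Lambda g v))).mulFun η) -
        Complex.I • Form.wedge2 (delDbar η) (Form.Lambda g v) -
        (Complex.I • (Form.Lambda g (typedD D 1 (typedD D (-1) v))).mulFun η +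
          Complex.I • Form.Lambda g (Form.wedge1 (typedFun 1 η) (typedD D (-1) v))) := by
    rw [Form.commLambda, Form.wedge2_twistedCurvature, Form.wedge2_twistedCurvature, ← hcurv,
      ← hcurv', hw2, Form.mulFun_add, Form.Lambda_sub hg, Form.Lambda_smul hg, Form.Lambda_smul hg,
      Form.Lambda_mulFun hg, ← neg_one_smul ℂ (Form.wedge1 _ _), Form.Lambda_smul hg]
    module
  -- All terms are now expressed through `∂_D`, `∂̄_D`, `Λ` and products with `∂η`, `∂̄η`, `∂∂̄η`,
  -- with `Θ(D)^{1,1}` eliminated, and the two sides agree term by term.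
  rw [e1, e2, e3, e4, e5, e6, hδ'', Form.wedge1_smul]
  module

end CommutatorIdentities

/-! ### Energies and the completion of a square. -/

noncomputable section EnergyEstimate

variable {E : Type*} [NormedAddCommGroup E] [NormedSpace ℂ E] [FiniteDimensional ℂ E]
  {X : Type*} [TopologicalSpace X] [ChartedSpace E X] [IsManifold 𝓘(ℂ, E) ω X]
  {L : X → Type*} [∀ x, NormedAddCommGroup (L x)] [∀ x, InnerProductSpace ℂ (L x)]
  {g : TangentMetric E X}

/-- The pointwise adjointness shifts the degree by one. The two sums match since the product has no
component of degree zero and the adjoint has none of top degree. -/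
lemma Form.innerAt_wedge1 (θ : X → E →L[ℝ] ℂ) (u v : Form E L) (x : X) :
    innerAt g (wedge1 θ u) v x = innerAt g u (wedge1Adjoint g θ v) x := by
  have htop : wedge1Adjoint g θ v (Module.finrank ℝ E) x = 0 := by
    rw [wedge1Adjoint, form_eq_zero_of_finrank_lt (Nat.lt_succ_self _) (v _ x)]
    exact Finset.sum_eq_zero fun a _ => smul_zero _
  rw [innerAt, innerAt, Finset.sum_range_succ', Finset.sum_range_succ, htop]
  congr 1
  · exact Finset.sum_congr rfl fun k _ => pointwiseInner_wedge1 g θ u v k x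
  · rw [← zero_smul ℂ (0 : E [⋀^Fin (Module.finrank ℝ E)]→L[ℝ] L x), pointwiseInner_smul_right,
      map_zero, zero_mul]
    change pointwiseInner g x (0 : E [⋀^Fin 0]→L[ℝ] L x) _ = 0
    rw [← zero_smul ℂ (0 : E [⋀^Fin 0]→L[ℝ] L x), pointwiseInner_smul_left, zero_mul]

lemma Form.wedge1Adjoint_eq_zero (θ : X → E →L[ℝ] ℂ) {v : Form E L} {x : X}
    (h : ∀ k, v k x = 0) (k : ℕ) : wedge1Adjoint g θ v k x = 0 := by
  rw [wedge1Adjoint, h]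
  exact Finset.sum_eq_zero fun a _ => smul_zero _

variable [MeasurableSpace E] [BorelSpace E] [MeasurableSpace X] [BorelSpace X]

lemma Form.l2Inner_wedge1 (θ : X → E →L[ℝ] ℂ) (u v : Form E L) :
    l2Inner g (wedge1 θ u) v = l2Inner g u (wedge1Adjoint g θ v) :=
  integral_congr_ae (.of_forall fun x => innerAt_wedge1 θ u v x)

lemma Form.l2Inner_conj (u v : Form E L) :
    (starRingEnd ℂ) (l2Inner g u v) = l2Inner g v u := by
  rw [l2Inner, l2Inner, ← integral_conj]
  exact integral_congr_ae (.of_forall fun x => innerAt_conj g u v x)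

lemma Form.l2Inner_mulFun_self_eq (f : X → ℝ) (u : Form E L) :
    l2Inner g (u.mulFun f) u =
      ((∫ x, f x * (innerAt g u u x).re ∂(volumeMeasure g) : ℝ) : ℂ) := by
  rw [l2Inner, ← integral_complex_ofReal]
  refine integral_congr_ae (.of_forall fun x => ?_)
  refine (innerAt_mulFun_left g f u u x).trans
    (Eq.trans ?_ (Complex.ofReal_mul (f x) (innerAt g u u x).re).symm)
  congr 1
  exact Complex.ext rfl (innerAt_self_im g u x)

lemma Form.l2Inner_mulFun_self_im (f : X → ℝ) (u : Form E L) :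
    (l2Inner g (u.mulFun f) u).im = 0 := by
  rw [l2Inner_mulFun_self_eq, Complex.ofReal_im]

lemma Form.l2Inner_mulFun_self_nonneg {f : X → ℝ} (hf : ∀ x, 0 ≤ f x) (u : Form E L) :
    0 ≤ (l2Inner g (u.mulFun f) u).re := by
  rw [l2Inner_mulFun_self_eq, Complex.ofReal_re]
  exact integral_nonneg fun x => mul_nonneg (hf x) (innerAt_self_nonneg g u x)

variable [SecondCountableTopology X] [T2Space X]
  [TopologicalSpace (Bundle.TotalSpace ℂ L)] [FiberBundle ℂ L] [VectorBundle ℂ ℂ L]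
  [ContMDiffVectorBundle ∞ ℂ L 𝓘(ℝ, E)] {D : CovariantDerivative 𝓘(ℝ, E) ℂ L}

lemma Form.integrable_innerAt_of_hasCompactSupport (hL : HasSmoothMetric E L) {u v : Form E L}
    (hu : u.IsSmooth) (hv : v.IsSmooth) (hc : v.HasCompactSupport) :
    Integrable (innerAt g u v) (volumeMeasure g) := by
  obtain ⟨K, hK, -, h⟩ := hc.exists
  exact integrable_innerAt hL g hu hv hK fun x hx => innerAt_eq_zero_right (h x hx) u

lemma Form.l2Inner_add_left_of_hasCompactSupport (hL : HasSmoothMetric E L) {u u' v : Form E L}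
    (hu : u.IsSmooth) (hu' : u'.IsSmooth) (hv : v.IsSmooth) (hc : v.HasCompactSupport) :
    l2Inner g (u + u') v = l2Inner g u v + l2Inner g u' v := by
  obtain ⟨K, hK, -, h⟩ := hc.exists
  exact l2Inner_add_left hL g hu hu' hv hK (fun x hx => innerAt_eq_zero_right (h x hx) u)
    fun x hx => innerAt_eq_zero_right (h x hx) u'

lemma codiff_eq_zero_of_notMem (hg : IsHermitian g) {s : ℝ} {u : Form E L} {K : Set X}
    (hK : IsClosed K) (h : ∀ x ∉ K, ∀ k, u k x = 0) {x : X} (hx : x ∉ K) (k : ℕ) :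
    codiff D g s u k x = 0 := by
  have hΛ : ∀ {w : Form E L}, (∀ x ∉ K, ∀ k, w k x = 0) → ∀ x ∉ K, ∀ k,
      Form.Lambda g w k x = 0 := fun {w} hw x hx k => by
    rw [Form.Lambda_apply hg, hw x hx, map_zero]
  change ((s : ℂ) * Complex.I) • (Form.Lambda g (typedD D (-s) u) k x -
    typedD D (-s) (Form.Lambda g u) k x) = 0
  rw [hΛ (fun x hx k => typedD_eq_zero_of_notMem hK h hx k) x hx,
    typedD_eq_zero_of_notMem hK (hΛ h) hx, sub_zero, smul_zero]

lemma Form.HasCompactSupport.typedD {u : Form E L} (h : u.HasCompactSupport) (s : ℝ) :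
    (typedD D s u).HasCompactSupport := by
  obtain ⟨K, hK, hKc, h⟩ := h.exists
  exact .of_forall hK fun x hx k => typedD_eq_zero_of_notMem hKc h hx k

lemma Form.HasCompactSupport.codiff (hg : IsHermitian g) {u : Form E L} (h : u.HasCompactSupport)
    (s : ℝ) : (codiff D g s u).HasCompactSupport := by
  obtain ⟨K, hK, hKc, h⟩ := h.exists
  exact .of_forall hK fun x hx k => codiff_eq_zero_of_notMem hg hKc h hx k

lemma Form.HasCompactSupport.wedge1Adjoint {u : Form E L} (h : u.HasCompactSupport)
    (θ : X → E →L[ℝ] ℂ) : (wedge1Adjoint g θ u).HasCompactSupport := by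
  obtain ⟨K, hK, -, h⟩ := h.exists
  exact .of_forall hK fun x hx k => wedge1Adjoint_eq_zero θ (h x hx) k

lemma Form.IsSmooth.wedge1Adjoint_typedFun (hg : IsHermitian g) {f : X → ℝ}
    (hf : ContMDiff 𝓘(ℝ, E) 𝓘(ℝ, ℝ) ∞ f) {u : Form E L} (hu : u.IsSmooth) :
    (wedge1Adjoint g (typedFun (-1) f) u).IsSmooth := by
  rw [wedge1Adjoint_dbarFun hg]
  exact (((hu.wedge1_typedFun 1 hf).Lambda hg).sub ((hu.Lambda hg).wedge1_typedFun 1 hf)).smul _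

/-- The energy of a twisted Laplacian. -/
lemma l2Inner_twistedLaplacian (hg : IsKaehler g) (hL : HasSmoothMetric E L)
    (hD : IsHermitianConnection D) {s : ℝ} (hs : s * s = 1) {f : X → ℝ}
    (hf : ContMDiff 𝓘(ℝ, E) 𝓘(ℝ, ℝ) ∞ f) {v : Form E L} (hv : v.IsSmooth)
    (hc : v.HasCompactSupport) :
    Form.l2Inner g (typedD D s ((codiff D g s v).mulFun f) + codiff D g s ((typedD D s v).mulFun f))
        v =
      Form.l2Inner g ((codiff D g s v).mulFun f) (codiff D g s v) +
        Form.l2Inner g ((typedD D s v).mulFun f) (typedD D s v) := by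
  have h1 := (hv.codiff hg.1 hD s).mulFun hf
  have h2 := (hv.typedD hD s).mulFun hf
  -- In the first summand the adjointness is used for the compactly supported form `D^⋆ v` times
  -- `f`; in the second it is read backwards, after conjugation, with `v` as the compactly supported
  -- form.
  rw [Form.l2Inner_add_left_of_hasCompactSupport hL (h1.typedD hD s) (h2.codiff hg.1 hD s) hv hc,
    l2Inner_typedD hg hL hD hs h1 hv ((hc.codiff hg.1 s).mulFun f),
    ← Form.l2Inner_conj v, ← l2Inner_typedD hg hL hD hs hv h2 hc, Form.l2Inner_conj]

/-- Completing the square: `‖√λ u + w / √λ‖² ≥ 0`. -/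
lemma Form.l2Inner_complete_square (hL : HasSmoothMetric E L) {lam : X → ℝ}
    (hlam : ContMDiff 𝓘(ℝ, E) 𝓘(ℝ, ℝ) ∞ lam) (hpos : ∀ x, 0 < lam x) {u w : Form E L}
    (hu : u.IsSmooth) (hw : w.IsSmooth) (huc : u.HasCompactSupport) (hwc : w.HasCompactSupport) :
    l2Inner g ((u.mulFun lam + w).mulFun fun x => (lam x)⁻¹) (u.mulFun lam + w) =
      l2Inner g (u.mulFun lam) u + l2Inner g u w + l2Inner g w u +
        l2Inner g (w.mulFun fun x => (lam x)⁻¹) w := by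
  have hinv : ContMDiff 𝓘(ℝ, E) 𝓘(ℝ, ℝ) ∞ fun x => (lam x)⁻¹ :=
    hlam.inv₀ fun x => (hpos x).ne'
  have hmul : ((u.mulFun lam).mulFun fun x => (lam x)⁻¹) = u := by
    funext k x
    change (((lam x)⁻¹ : ℝ) : ℂ) • ((lam x : ℝ) : ℂ) • u k x = u k x
    rw [smul_smul, ← Complex.ofReal_mul, inv_mul_cancel₀ (hpos x).ne', Complex.ofReal_one, one_smul]
  have hu' := hu.mulFun hlam
  have hw' := hw.mulFun hinv
  have hz := hu'.add hw
  have hright : ∀ a : Form E L, a.IsSmooth → a.HasCompactSupport →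
      l2Inner g a (u.mulFun lam + w) = l2Inner g (a.mulFun lam) u + l2Inner g a w := fun a ha hac => by
    rw [← l2Inner_conj, l2Inner_add_left_of_hasCompactSupport hL hu' hw ha hac, map_add,
      l2Inner_conj, l2Inner_conj, ← l2Inner_mulFun]
  have hmul' : ((w.mulFun fun x => (lam x)⁻¹).mulFun lam) = w := by
    funext k x
    change ((lam x : ℝ) : ℂ) • (((lam x)⁻¹ : ℝ) : ℂ) • w k x = w k x
    rw [smul_smul, ← Complex.ofReal_mul, mul_inv_cancel₀ (hpos x).ne', Complex.ofReal_one, one_smul]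
  have hsplit : l2Inner g (u + w.mulFun fun x => (lam x)⁻¹) (u.mulFun lam + w) =
      l2Inner g u (u.mulFun lam + w) +
        l2Inner g (w.mulFun fun x => (lam x)⁻¹) (u.mulFun lam + w) := by
    obtain ⟨K, hK, -, h⟩ := huc.exists
    obtain ⟨K', hK', -, h'⟩ := (hwc.mulFun fun x => (lam x)⁻¹).exists
    exact l2Inner_add_left hL g hu hw' hz (hK.union hK')
      (fun x hx => innerAt_eq_zero_left (h x fun hx' => hx (.inl hx')) _)
      fun x hx => innerAt_eq_zero_left (h' x fun hx' => hx (.inr hx')) _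
  rw [mulFun_add, hmul, hsplit, hright u hu huc,
    hright _ hw' (hwc.mulFun _), hmul']
  ring

end EnergyEstimate

/-! ### The twisted Laplacians, the identity and the inequality. -/

noncomputable section TwistedLaplacians

variable {E : Type*} [NormedAddCommGroup E] [NormedSpace ℂ E] [FiniteDimensional ℂ E]
  [MeasurableSpace E] [BorelSpace E]
  {X : Type*} [TopologicalSpace X] [T2Space X] [SecondCountableTopology X]
  [ChartedSpace E X] [IsManifold 𝓘(ℂ, E) ω X] [MeasurableSpace X] [BorelSpace X]
  {L : X → Type*} [∀ x, NormedAddCommGroup (L x)] [∀ x, InnerProductSpace ℂ (L x)]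
  [TopologicalSpace (Bundle.TotalSpace ℂ L)] [FiberBundle ℂ L] [VectorBundle ℂ ℂ L]
  [ContMDiffVectorBundle ∞ ℂ L 𝓘(ℝ, E)] {D : CovariantDerivative 𝓘(ℝ, E) ℂ L}
  {g : TangentMetric E X}

lemma dbar_eq_typedD : dbar D = typedD D (-1) := funext fun u => (typedD_neg_one u).symm

lemma dbarRight_eq_typedD (η : X → ℝ) :
    dbarRight D η = fun u => typedD D (-1) (u.mulFun fun x => √(η x)) :=
  funext fun u => (typedD_neg_one (u.mulFun _)).symm

lemma dbarLeft_eq_typedD (η : X → ℝ) :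
    dbarLeft D η = fun u => (typedD D (-1) u).mulFun fun x => √(η x) :=
  funext fun u => by rw [dbarLeft, typedD_neg_one]

lemma delRight_eq_typedD (η : X → ℝ) :
    delRight D η = fun u => typedD D 1 (u.mulFun fun x => √(η x)) :=
  funext fun u => (typedD_one (u.mulFun _)).symm

lemma delLeft_eq_typedD (η : X → ℝ) :
    delLeft D η = fun u => (typedD D 1 u).mulFun fun x => √(η x) :=
  funext fun u => by rw [delLeft, typedD_one]

lemma neg_one_mul_neg_one_real : (-1 : ℝ) * (-1) = 1 := by norm_num

lemma laplaceDbar_eq (hg : IsKaehler g) (hL : HasSmoothMetric E L) (hD : IsHermitianConnection D)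
    {η : X → ℝ} (hη : ContMDiff 𝓘(ℝ, E) 𝓘(ℝ, ℝ) ∞ η) (hpos : ∀ x, 0 < η x) {v : Form E L}
    (hv : v.IsSmooth) : laplaceDbar D g η v =
      typedD D (-1) ((codiff D g (-1) v).mulFun η) +
        codiff D g (-1) ((typedD D (-1) v).mulFun η) := by
  rw [laplaceDbar, dbarRight_eq_typedD, dbarLeft_eq_typedD]
  exact twistedLaplacian_eq hg hL hD neg_one_mul_neg_one_real hη hpos hv

lemma laplaceDel_eq (hg : IsKaehler g) (hL : HasSmoothMetric E L) (hD : IsHermitianConnection D)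
    {η : X → ℝ} (hη : ContMDiff 𝓘(ℝ, E) 𝓘(ℝ, ℝ) ∞ η) (hpos : ∀ x, 0 < η x) {v : Form E L}
    (hv : v.IsSmooth) : laplaceDel D g η v =
      typedD D 1 ((codiff D g 1 v).mulFun η) + codiff D g 1 ((typedD D 1 v).mulFun η) := by
  rw [laplaceDel, delRight_eq_typedD, delLeft_eq_typedD]
  exact twistedLaplacian_eq hg hL hD (one_mul 1) hη hpos hv

lemma isFormalAdjoint_dbar (hg : IsKaehler g) (hL : HasSmoothMetric E L)
    (hD : IsHermitianConnection D) : IsFormalAdjoint g (dbar D) (codiff D g (-1)) := by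
  rw [dbar_eq_typedD]
  exact isFormalAdjoint_typedD hg hL hD neg_one_mul_neg_one_real

/-- The twisted Bochner–Kodaira–Nakano identity. -/
lemma laplaceDbar_eq_laplaceDel_add (hg : IsKaehler g) (hL : HasSmoothMetric E L)
    (hD : IsHermitianConnection D) {η : X → ℝ} (hη : ContMDiff 𝓘(ℝ, E) 𝓘(ℝ, ℝ) ∞ η)
    (hpos : ∀ x, 0 < η x) {q : ℕ} {v : Form E L} (hv : v.IsSmooth)
    (hvq : v.IsBidegree (Module.finrank ℂ E) q) :
    laplaceDbar D g η v =
      laplaceDel D g η v + Form.commLambda g (twistedCurvature D η) v +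
        Form.wedge1 (dbarFun η) (formalAdjoint g (dbar D) v) +
        dbar D (Form.wedge1Adjoint g (dbarFun η) v) := by
  rw [(isFormalAdjoint_dbar hg hL hD).formalAdjoint_eq hL hv, laplaceDbar_eq hg hL hD hη hpos hv,
    laplaceDel_eq hg hL hD hη hpos hv, dbar_eq_typedD, ← typedFun_neg_one]
  exact twistedBochnerKodairaNakano hg.1 hD hη hv (hvq.typedD_eq_zero hv) (hvq.wedge1_eq_zero η)

/-- The twisted Bochner–Kodaira–Nakano inequality, with its two sides real and integrable. -/
lemma twistedBochnerKodairaNakano_inequality (hg : IsKaehler g) (hL : HasSmoothMetric E L)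
    (hD : IsHermitianConnection D) {η lam : X → ℝ} (hη : ContMDiff 𝓘(ℝ, E) 𝓘(ℝ, ℝ) ∞ η)
    (hηpos : ∀ x, 0 < η x) (hlam : ContMDiff 𝓘(ℝ, E) 𝓘(ℝ, ℝ) ∞ lam) (hlampos : ∀ x, 0 < lam x)
    {q : ℕ} {v : Form E L} (hv : v.IsSmooth) (hvq : v.IsBidegree (Module.finrank ℂ E) q)
    (hc : v.HasCompactSupport) :
    Integrable (Form.innerAt g (laplaceDbar D g (η + lam) v) v) (volumeMeasure g) ∧
      Integrable (Form.innerAt g (Form.commLambda g (twistedCurvature₂ D η lam) v) v)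
        (volumeMeasure g) ∧
      (Form.l2Inner g (laplaceDbar D g (η + lam) v) v).im = 0 ∧
      (Form.l2Inner g (Form.commLambda g (twistedCurvature₂ D η lam) v) v).im = 0 ∧
      (Form.l2Inner g (Form.commLambda g (twistedCurvature₂ D η lam) v) v).re ≤
        (Form.l2Inner g (laplaceDbar D g (η + lam) v) v).re := by
  have hs : (-1 : ℝ) * (-1) = 1 := neg_one_mul_neg_one_real
  have hsum : ContMDiff 𝓘(ℝ, E) 𝓘(ℝ, ℝ) ∞ (η + lam) := hη.add hlam
  have hinv : ContMDiff 𝓘(ℝ, E) 𝓘(ℝ, ℝ) ∞ fun x => (lam x)⁻¹ :=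
    hlam.inv₀ fun x => (hlampos x).ne'
  have hdv := hvq.typedD_eq_zero (D := D) hv
  have hηv : Form.wedge1 (typedFun (E := E) 1 η) v = 0 := hvq.wedge1_eq_zero η
  have hP := hv.codiff hg.1 hD (-1)
  have hPc := hc.codiff (D := D) hg.1 (-1)
  have hb := hv.typedD hD (-1)
  have ha := hv.wedge1Adjoint_typedFun hg.1 hη
  have hac := hc.wedge1Adjoint (g := g) (typedFun (-1) η)
  have hδ' := hv.codiff hg.1 hD 1
  have hd' := hv.typedD hD 1
  have hbkn := twistedBochnerKodairaNakano hg.1 hD hη hv hdv hηv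
  have hE'' := l2Inner_twistedLaplacian hg hL hD hs hη hv hc
  have hE' := l2Inner_twistedLaplacian hg hL hD (one_mul 1) hη hv hc
  have hEs := l2Inner_twistedLaplacian hg hL hD hs hsum hv hc
  have hsq := Form.l2Inner_complete_square (g := g) hL hlam hlampos hP ha hPc hac
  have hnn := Form.l2Inner_mulFun_self_nonneg (g := g) (f := fun x => (lam x)⁻¹)
    (fun x => (inv_pos.2 (hlampos x)).le)
    ((codiff D g (-1) v).mulFun lam + Form.wedge1Adjoint g (typedFun (-1) η) v)
  have hri := Form.l2Inner_mulFun_self_im (g := g) (fun x => (lam x)⁻¹)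
    ((codiff D g (-1) v).mulFun lam + Form.wedge1Adjoint g (typedFun (-1) η) v)
  have hw := Form.commLambda_delWedgeDbar hg.1 η hηv
  have htw := Form.commLambda_twistedCurvature₂ hg.1 D η lam v
  rw [hw, ← Form.wedge1_mulFun] at htw
  rw [laplaceDbar_eq hg hL hD hsum (fun x => add_pos (hηpos x) (hlampos x)) hv]
  set Δ'' := typedD D (-1) ((codiff D g (-1) v).mulFun η) +
    codiff D g (-1) ((typedD D (-1) v).mulFun η)
  set Δ' := typedD D 1 ((codiff D g 1 v).mulFun η) + codiff D g 1 ((typedD D 1 v).mulFun η)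
  set Δs := typedD D (-1) ((codiff D g (-1) v).mulFun (η + lam)) +
    codiff D g (-1) ((typedD D (-1) v).mulFun (η + lam))
  set C := Form.commLambda g (twistedCurvature D η) v
  set C₂ := Form.commLambda g (twistedCurvature₂ D η lam) v
  set P := codiff D g (-1) v
  set a := Form.wedge1Adjoint g (typedFun (-1) η) v
  have sΔ'' : Δ''.IsSmooth :=
    ((hP.mulFun hη).typedD hD _).add ((hb.mulFun hη).codiff hg.1 hD _)
  have sΔs : Δs.IsSmooth :=
    ((hP.mulFun hsum).typedD hD _).add ((hb.mulFun hsum).codiff hg.1 hD _)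
  have sΔ' : Δ'.IsSmooth :=
    ((hδ'.mulFun hη).typedD hD _).add ((hd'.mulFun hη).codiff hg.1 hD _)
  have sθP := hP.wedge1_typedFun (-1) hη
  have sda := ha.typedD hD (-1)
  -- The identity exhibits the curvature term as a difference of smooth forms, so its regularity
  -- need not be examined directly.
  have sC : C.IsSmooth := by
    have h : C = Δ'' - Δ' - Form.wedge1 (typedFun (-1) η) P - typedD D (-1) a := by
      rw [hbkn]; abel
    rw [h]
    exact ((sΔ''.sub sΔ').sub sθP).sub sda
  have sθa := (ha.mulFun hinv).wedge1_typedFun (-1) hη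
  have sC₂ : C₂.IsSmooth := by
    rw [htw]
    exact sC.sub sθa
  have hC : C = C₂ + Form.wedge1 (typedFun (-1) η) (a.mulFun fun x => (lam x)⁻¹) := by
    rw [htw, sub_add_cancel]
  -- On `v` the term with `i ∂η ∧ ∂̄η` is `∂̄η ∧ a`, and the pointwise adjoint turns its product
  -- with `v` into the norm of `a` with weight `1 / λ`.
  have hlC : Form.l2Inner g C v = Form.l2Inner g C₂ v +
      Form.l2Inner g (a.mulFun fun x => (lam x)⁻¹) a := by
    rw [hC, Form.l2Inner_add_left_of_hasCompactSupport hL sC₂ sθa hv hc, Form.l2Inner_wedge1]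
  -- The last two terms of the identity become the mutually conjugate cross terms `⟪P, a⟫` and `⟪a,
  -- P⟫`.
  have hlΔ : Form.l2Inner g Δ'' v = Form.l2Inner g Δ' v + Form.l2Inner g C v +
      Form.l2Inner g P a + Form.l2Inner g a P := by
    rw [hbkn, Form.l2Inner_add_left_of_hasCompactSupport hL ((sΔ'.add sC).add sθP) sda hv hc,
      Form.l2Inner_add_left_of_hasCompactSupport hL (sΔ'.add sC) sθP hv hc,
      Form.l2Inner_add_left_of_hasCompactSupport hL sΔ' sC hv hc, Form.l2Inner_wedge1,
      l2Inner_typedD hg hL hD hs ha hv hac]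
  have hadd : ∀ u : Form E L, u.IsSmooth → u.HasCompactSupport →
      Form.l2Inner g (u.mulFun (η + lam)) u =
        Form.l2Inner g (u.mulFun η) u + Form.l2Inner g (u.mulFun lam) u := fun u hu huc => by
    rw [← Form.l2Inner_add_left_of_hasCompactSupport hL (hu.mulFun hη) (hu.mulFun hlam) hu huc,
      ← Form.mulFun_add_fun]
    rfl
  -- Replacing `η` by `η + λ` on the left adds the energy of weight `λ`. Its part `⟪λ P, P⟫`, the
  -- two cross terms and `⟪a / λ, a⟫` form the completed square. All terms besides that of `C₂` are
  -- real, whence the reality of the latter, and those dropped for the inequality are nonnegative.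
  have hkey : Form.l2Inner g Δs v = Form.l2Inner g C₂ v + Form.l2Inner g Δ' v +
      Form.l2Inner g ((typedD D (-1) v).mulFun lam) (typedD D (-1) v) +
      Form.l2Inner g ((P.mulFun lam + a).mulFun fun x => (lam x)⁻¹) (P.mulFun lam + a) := by
    rw [hsq]
    rw [hadd P hP hPc, hadd _ hb (hc.typedD _)] at hEs
    linear_combination hEs - hE'' + hlΔ + hlC
  have him : (Form.l2Inner g Δs v).im = 0 := by
    rw [hEs, Complex.add_im, Form.l2Inner_mulFun_self_im, Form.l2Inner_mulFun_self_im, add_zero]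
  have him' : (Form.l2Inner g Δ' v).im = 0 := by
    rw [hE', Complex.add_im, Form.l2Inner_mulFun_self_im, Form.l2Inner_mulFun_self_im, add_zero]
  have hre' : 0 ≤ (Form.l2Inner g Δ' v).re := by
    rw [hE', Complex.add_re]
    exact add_nonneg (Form.l2Inner_mulFun_self_nonneg (fun x => (hηpos x).le) _)
      (Form.l2Inner_mulFun_self_nonneg (fun x => (hηpos x).le) _)
  have hreb := Form.l2Inner_mulFun_self_nonneg (g := g) (fun x => (hlampos x).le)
    (typedD D (-1) v)
  have himb := Form.l2Inner_mulFun_self_im (g := g) lam (typedD D (-1) v)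
  have hkre := congrArg Complex.re hkey
  have hkim := congrArg Complex.im hkey
  simp only [Complex.add_re, Complex.add_im] at hkre hkim
  refine ⟨Form.integrable_innerAt_of_hasCompactSupport hL sΔs hv hc,
    Form.integrable_innerAt_of_hasCompactSupport hL sC₂ hv hc, him, ?_, ?_⟩
  · linarith
  · linarith

end TwistedLaplacians

end TwistedBKN

open TwistedBKN in
theorem proposition3p8
    {n : ℕ} {E : Type*} [NormedAddCommGroup E] [NormedSpace ℂ E] [FiniteDimensional ℂ E]
    (hn : Module.finrank ℂ E = n) [MeasurableSpace E] [BorelSpace E]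
    {X : Type*} [TopologicalSpace X] [T2Space X] [SecondCountableTopology X]
    [ChartedSpace E X] [IsManifold 𝓘(ℂ, E) ω X] [MeasurableSpace X] [BorelSpace X]
    (g : TangentMetric E X) (hg : IsKaehler g)
    {L : X → Type*} [∀ x, NormedAddCommGroup (L x)] [∀ x, InnerProductSpace ℂ (L x)]
    [TopologicalSpace (Bundle.TotalSpace ℂ L)] [FiberBundle ℂ L] [VectorBundle ℂ ℂ L]
    [ContMDiffVectorBundle ∞ ℂ L 𝓘(ℝ, E)] (hL : HasSmoothMetric E L)
    (D : CovariantDerivative 𝓘(ℝ, E) ℂ L) (hD : IsHermitianConnection D) :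
    (∀ η : X → ℝ, ContMDiff 𝓘(ℝ, E) 𝓘(ℝ, ℝ) ∞ η → (∀ x, 0 < η x) →
      (IsFormalAdjoint g (dbar D) (formalAdjoint g (dbar D)) ∧
        IsFormalAdjoint g (dbarRight D η) (formalAdjoint g (dbarRight D η)) ∧
        IsFormalAdjoint g (dbarLeft D η) (formalAdjoint g (dbarLeft D η)) ∧
        IsFormalAdjoint g (delRight D η) (formalAdjoint g (delRight D η)) ∧
        IsFormalAdjoint g (delLeft D η) (formalAdjoint g (delLeft D η))) ∧
      ∀ (q : ℕ) (v : Form E L), v.IsSmooth → v.IsBidegree n q →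
        laplaceDbar D g η v =
          laplaceDel D g η v + Form.commLambda g (twistedCurvature D η) v +
            Form.wedge1 (dbarFun η) (formalAdjoint g (dbar D) v) +
            dbar D (Form.wedge1Adjoint g (dbarFun η) v)) ∧
    (∀ η lam : X → ℝ, ContMDiff 𝓘(ℝ, E) 𝓘(ℝ, ℝ) ∞ η → (∀ x, 0 < η x) →
      ContMDiff 𝓘(ℝ, E) 𝓘(ℝ, ℝ) ∞ lam → (∀ x, 0 < lam x) →
      ∀ (q : ℕ) (v : Form E L), v.IsSmooth → v.IsBidegree n q → v.HasCompactSupport →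
        MeasureTheory.Integrable (Form.innerAt g (laplaceDbar D g (η + lam) v) v)
            (volumeMeasure g) ∧
          MeasureTheory.Integrable (Form.innerAt g (Form.commLambda g (twistedCurvature₂ D η lam) v) v)
            (volumeMeasure g) ∧
          (Form.l2Inner g (laplaceDbar D g (η + lam) v) v).im = 0 ∧
          (Form.l2Inner g (Form.commLambda g (twistedCurvature₂ D η lam) v) v).im = 0 ∧
          (Form.l2Inner g (Form.commLambda g (twistedCurvature₂ D η lam) v) v).re ≤
            (Form.l2Inner g (laplaceDbar D g (η + lam) v) v).re) := by
  subst hn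
  refine ⟨fun η hη hpos => ⟨?_, fun q v hv hvq =>
    laplaceDbar_eq_laplaceDel_add hg hL hD hη hpos hv hvq⟩,
    fun η lam hη hηpos hlam hlampos q v hv hvq hc =>
      twistedBochnerKodairaNakano_inequality hg hL hD hη hηpos hlam hlampos hv hvq hc⟩
  have hsq := contMDiff_sqrt hη hpos
  have hs := neg_one_mul_neg_one_real
  rw [dbarRight_eq_typedD, dbarLeft_eq_typedD, delRight_eq_typedD, delLeft_eq_typedD]
  exact ⟨(isFormalAdjoint_dbar hg hL hD).isFormalAdjoint_formalAdjoint,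
    (isFormalAdjoint_typedD_mulFun hg hL hD hs hsq).isFormalAdjoint_formalAdjoint,
    (isFormalAdjoint_mulFun_typedD hg hL hD hs hsq).isFormalAdjoint_formalAdjoint,
    (isFormalAdjoint_typedD_mulFun hg hL hD (one_mul 1) hsq).isFormalAdjoint_formalAdjoint,
    (isFormalAdjoint_mulFun_typedD hg hL hD (one_mul 1) hsq).isFormalAdjoint_formalAdjoint⟩
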